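/- Let $M$ be a smooth compact manifold of dimension $m$ with two commuting smooth vector fields $v=\operatorname{grad} f_v$, $w=\operatorname{grad} f_w$ (gradients of smooth functions for one Riemannian metric). Assume: (i) the critical points (common zeros of $v,w$) are isolated, and near each of them there is a chart in which both fields are linear and diagonal, with joint eigenvalues (characters) $\lambda_1,\dots,\lambda_m\in\mathbb R^2$; (ii) the critical edges (the $1$-dimensional orbits of the pair $(v,w)$) are isolated; (iii) the set $A=\{(f_v(p),f_w(p)) : p \text{ critical}\}\subset\mathbb R^2$ is in general position, i.e. its coordinates do not satisfy $P=0$ for a certain nonzero integer polynomial $P$ that depends only on the number $n$ of critical points. The direction of an oriented critical edge is the vector $(a,b)$ (up to positive scaling) such that $bv-aw$ vanishes on the edge and $av+bw$ goes along its orientation. A frame is a cyclic sequence of critical points connected by oriented critical edges, at least three, whose directions are in counterclockwise cyclic order (going around once); it projects to a convex polygon with vertices in $A$. Let $F$ be the free module on the set of frames over a commutative ring $R$ (the vector space spanned by the frames, if $R$ is a field), graded by the expected dimension of the space of leaves ($2$-dimensional orbits) with boundary $f$, i.e. by the invariant Euler characteristic of the normal bundle of a leaf: $$\dim f=(m-2)+\sum_{p}\Bigl(\#\{\lambda\in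 N_p : \lambda\in C_p\}-\#\{\lambda\in N_p:\lambda \text{ is not to the right of } d_p\}\Bigr),$$ where $p$ runs over the corners of $f$, $d_p$ and $d_p'$ are the directions of the edges of $f$ leaving and arriving at $p$, $N_p$ is the family of the characters at $p$ other than the two on the rays spanned by $d_p$ and $-d_p'$, and $C_p$ is the closed cone spanned by $d_p$ and $-d_p'$. A decomposition of a frame $f$ into frames $f_1,\dots,f_k$ is a subdivision of the polygon of $f$ into the polygons of the $f_i$ such that the edges of $f$ are exactly the oriented edges of the $f_i$ whose reversal is not an edge of any $f_j$; the other edges are internal, and each internal (unoriented) critical edge is shared by two pieces. Let $s$ be the number of internal edges. A dual web is a choice of points $x_1,\dots,x_k\in\mathbb R^2$ such that for every internal edge between $f_i$ and $f_j$ the vector $x_j-x_i$ is a positive multiple of the normal to that edge pointing from the polygon of $f_i$ to that of $f_j$. The expected codimension of the decomposition is $2k-s-2$. Then there are signs $\varepsilon(f_1,\dots,f_k)\in\{\pm1\}$, which do not depend on $R$, such that the multilinear operations $l_k: F\otimes\cdots\otimes F\to F$, $$l_k(f_1,\dots,f_k)=\sum_f \varepsilon(f_1,\dots,f_k)\, f,$$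 where the sum is over the frames $f$ of which $f_1,\dots,f_k$ is a decomposition that has a dual web and has expected codimension $1$, make $F$ an $L_\infty$-algebra (in the symmetric convention): $l_0=0$, every $l_k$ is graded symmetric of degree $+1$, and for all homogeneous $x_1,\dots,x_n$ $$\sum_{\emptyset\ne S\subseteq\{1,\dots,n\}}\pm\, l_{n-|S|+1}\bigl(l_{|S|}(x_S),x_{S^c}\bigr)=0,$$ where $x_S$ and $x_{S^c}$ are in increasing order and $\pm$ is the Koszul sign of the rearrangement $(x_1,\dots,x_n)\mapsto(x_S,x_{S^c})$. If $2=0$ in $R$ this is the plain sum without signs. -/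

import Mathlib

open scoped Manifold ContDiff Topology

noncomputable section

/-! ### L-infinity algebras -/

section LInfinity

/-- Sign of moving the entries with index in `S` (of degrees `d`) in front of the others,
all relative orders being kept. -/
def unshuffleSign {n : ℕ} (d : Fin n → ℤ) (S : Finset (Fin n)) : ℤˣ :=
  ∏ i ∈ S, ∏ j ∈ Sᶜ, if j < i then (d i * d j).negOnePow else 1

/-- Koszul sign of the rearrangement `x ↦ x ∘ σ` of entries of degrees `d`. -/
def koszulSign {n : ℕ} (d : Fin n → ℤ) (σ : Equiv.Perm (Fin n)) : ℤˣ :=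
  ∏ i : Fin n, ∏ j : Fin n,
    if i < j ∧ σ j < σ i then (d (σ i) * d (σ j)).negOnePow else 1

/-- `l_{n - |S| + 1} (l_{|S|} (x_S), x_{Sᶜ})`, both subfamilies in increasing order. -/
def nestedBracket {R V : Type*} [CommRing R] [AddCommGroup V] [Module R V]
    (l : ∀ k : ℕ, MultilinearMap R (fun _ : Fin k => V) V)
    {n : ℕ} (x : Fin n → V) (S : Finset (Fin n)) : V :=
  l (Sᶜ.card + 1)
    (Fin.cons (l S.card (fun a => x (S.orderEmbOfFin rfl a)))
      (fun b => x (Sᶜ.orderEmbOfFin rfl b)))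

/-- The graded module `V = ⨁ 𝒢 d`, with the operations `l k`, is an L-infinity algebra.
The symmetric (degree shifted) convention is used: every `l k` is graded symmetric of degree
`1`, so that the Maurer-Cartan elements are of degree `0`. -/
structure IsLInfinityAlgebra {R V : Type*} [CommRing R] [AddCommGroup V] [Module R V]
    (𝒢 : ℤ → Submodule R V) (l : ∀ k : ℕ, MultilinearMap R (fun _ : Fin k => V) V) : Prop where
  internal : DirectSum.IsInternal 𝒢
  /-- there is no curvature term -/
  flat : l 0 = 0
  degree : ∀ (k : ℕ) (x : Fin k → V) (d : Fin k → ℤ), (∀ i, x i ∈ 𝒢 (d i)) →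
    l k x ∈ 𝒢 (∑ i, d i + 1)
  symmetric : ∀ (k : ℕ) (σ : Equiv.Perm (Fin k)) (x : Fin k → V) (d : Fin k → ℤ),
    (∀ i, x i ∈ 𝒢 (d i)) → l k (x ∘ σ) = koszulSign d σ • l k x
  relation : ∀ (n : ℕ) (x : Fin n → V) (d : Fin n → ℤ), (∀ i, x i ∈ 𝒢 (d i)) →
    ∑ S : Finset (Fin n) with S.Nonempty, unshuffleSign d S • nestedBracket l x S = 0

/-- The multilinear operation on the free module on `ι` with prescribed values on the basis. -/
def multilinearOfBasis (R : Type*) [CommRing R] {ι N : Type*} [AddCommGroup N] [Module R N]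
    {k : ℕ} (val : (Fin k → ι) → N) : MultilinearMap R (fun _ : Fin k => ι →₀ R) N :=
  letI := Classical.decEq ι
  letI := Classical.decEq R
  (MultilinearMap.fromDFinsuppEquiv (fun _ : Fin k => ι) R
    (fun fs => MultilinearMap.mkPiRing R (Fin k) (val fs))).compLinearMap
      (fun _ => (finsuppLequivDFinsupp R).toLinearMap)

theorem multilinearOfBasis_single (R : Type*) [CommRing R] {ι N : Type*} [AddCommGroup N]
    [Module R N] {k : ℕ} (val : (Fin k → ι) → N) (fs : Fin k → ι) :
    multilinearOfBasis R val (fun i => Finsupp.single (fs i) 1) = val fs := by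
  classical
  simp only [multilinearOfBasis, MultilinearMap.compLinearMap_apply, LinearEquiv.coe_coe,
    finsuppLequivDFinsupp_apply_apply, Finsupp.toDFinsupp_single]
  rw [MultilinearMap.fromDFinsuppEquiv_single]
  simp

end LInfinity

/-! ### Plane geometry -/

/-- The determinant of two plane vectors; positive iff `y` is to the left of `x`. -/
def planeDet (x y : ℝ × ℝ) : ℝ := x.1 * y.2 - x.2 * y.1

/-- `y` lies on the open ray spanned by `x`. -/
def OnRay (x y : ℝ × ℝ) : Prop := ∃ t : ℝ, 0 < t ∧ y = t • x

/-- `z` lies in the closed convex cone spanned by `x` and `y`. -/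
def InCone (x y z : ℝ × ℝ) : Prop := ∃ s t : ℝ, 0 ≤ s ∧ 0 ≤ t ∧ z = s • x + t • y

/-! ### Pairs of vector fields -/

section Fields

variable {m : ℕ} {M : Type*} [TopologicalSpace M] [ChartedSpace (EuclideanSpace ℝ (Fin m)) M]

/-- The vector field `a v + b w`. -/
def combField (v w : ∀ x : M, TangentSpace (𝓡 m) x) (d : ℝ × ℝ) (x : M) :
    TangentSpace (𝓡 m) x := d.1 • v x + d.2 • w x

/-- The orbit of `x` under the pair: all `exp (a v + b w) x`.  For commuting complete vector
fields this is the orbit of the `ℝ²`-action. -/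
def pairOrbit (v w : ∀ x : M, TangentSpace (𝓡 m) x) (x : M) : Set M :=
  {y | ∃ (d : ℝ × ℝ) (γ : ℝ → M), IsMIntegralCurve (I := 𝓡 m) γ (combField v w d) ∧
    γ 0 = x ∧ γ 1 = y}

/-- The orbit through `x` is `1`-dimensional. -/
def OneDimAt (v w : ∀ x : M, TangentSpace (𝓡 m) x) (x : M) : Prop :=
  Module.finrank ℝ (Submodule.span ℝ {v x, w x}) = 1

/-- In a smooth chart centred at `p`, both fields are linear and diagonal; the `i`-th coordinate
has the eigenvalues `(wt i).1` (for `v`) and `(wt i).2` (for `w`). -/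
def LinearizedBy (v w : ∀ x : M, TangentSpace (𝓡 m) x) (p : M) (wt : Fin m → ℝ × ℝ) : Prop :=
  ∃ φ ∈ IsManifold.maximalAtlas (𝓡 m) ∞ M, p ∈ φ.source ∧ φ p = 0 ∧
    ∀ x ∈ φ.source,
      (mfderiv (𝓡 m) (𝓡 m) φ x (v x) : EuclideanSpace ℝ (Fin m)) =
        WithLp.toLp 2 (fun i => (wt i).1 * φ x i) ∧
      (mfderiv (𝓡 m) (𝓡 m) φ x (w x) : EuclideanSpace ℝ (Fin m)) =
        WithLp.toLp 2 (fun i => (wt i).2 * φ x i)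

end Fields

/-- A `2`-Morse system on `M`: a pair of commuting vector fields which are the gradients of two
functions for one Riemannian metric, such that the critical points are isolated and linearizable,
and the critical edges are isolated. -/
structure TwoMorse (m : ℕ) (M : Type*) [TopologicalSpace M]
    [ChartedSpace (EuclideanSpace ℝ (Fin m)) M] [IsManifold (𝓡 m) ∞ M] where
  v : ∀ x : M, TangentSpace (𝓡 m) x
  w : ∀ x : M, TangentSpace (𝓡 m) x
  fv : M → ℝ
  fw : M → ℝ
  metric : Bundle.ContMDiffRiemannianMetric (𝓡 m) ∞ (EuclideanSpace ℝ (Fin m))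
    (fun x : M => TangentSpace (𝓡 m) x)
  smooth_v : ContMDiff (𝓡 m) (𝓡 m).tangent ∞ (fun x => (⟨x, v x⟩ : TangentBundle (𝓡 m) M))
  smooth_w : ContMDiff (𝓡 m) (𝓡 m).tangent ∞ (fun x => (⟨x, w x⟩ : TangentBundle (𝓡 m) M))
  smooth_fv : ContMDiff (𝓡 m) 𝓘(ℝ, ℝ) ∞ fv
  smooth_fw : ContMDiff (𝓡 m) 𝓘(ℝ, ℝ) ∞ fw
  commute : ∀ x, VectorField.mlieBracket (𝓡 m) v w x = 0
  grad_v : ∀ (x : M) (u : TangentSpace (𝓡 m) x),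
    metric.inner x (v x) u = (mfderiv (𝓡 m) 𝓘(ℝ, ℝ) fv x u : ℝ)
  grad_w : ∀ (x : M) (u : TangentSpace (𝓡 m) x),
    metric.inner x (w x) u = (mfderiv (𝓡 m) 𝓘(ℝ, ℝ) fw x u : ℝ)
  isolated_points : ∀ p, v p = 0 → w p = 0 → ∀ᶠ q in 𝓝 p, v q = 0 → w q = 0 → q = p
  linearizable : ∀ p, v p = 0 → w p = 0 → ∃ wt, LinearizedBy v w p wt
  isolated_edges : ∀ x, OneDimAt v w x → ∀ᶠ y in 𝓝 x, OneDimAt v w y → y ∈ pairOrbit v w x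

namespace TwoMorse

variable {m : ℕ} {M : Type*} [TopologicalSpace M] [ChartedSpace (EuclideanSpace ℝ (Fin m)) M]
  [IsManifold (𝓡 m) ∞ M] (T : TwoMorse m M)

/-- Critical points: the common zeros of the two fields. -/
def CriticalPoint : Type _ := {p : M // T.v p = 0 ∧ T.w p = 0}

/-- The point of the plane set `A` given by a critical point. -/
def pos (p : T.CriticalPoint) : ℝ × ℝ := (T.fv p.1, T.fw p.1)

/-- The characters of the `ℝ²`-action on the tangent space at a critical point (as a family,
canonical up to the order). -/
def weight (p : T.CriticalPoint) : Fin m → ℝ × ℝ :=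
  Classical.choose (T.linearizable p.1 p.2.1 p.2.2)

/-- An oriented critical edge: a `1`-dimensional orbit `carrier` with one of its orientations.
Its direction, normalized to length one, is the vector `dir = (a, b)` such that `b v - a w`
vanishes on the edge and `a v + b w` goes along the orientation.  On a compact `M` every
`1`-dimensional orbit has such end points, and `src` and `tgt` are determined by `carrier`
and `dir`. -/
structure OrientedEdge where
  carrier : Set M
  dir : ℝ × ℝ
  src : T.CriticalPoint
  tgt : T.CriticalPoint
  norm_dir : dir.1 ^ 2 + dir.2 ^ 2 = 1
  exists_curve : ∃ γ : ℝ → M,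
    IsMIntegralCurve (I := 𝓡 m) γ (combField T.v T.w dir) ∧ Set.range γ = carrier ∧
    (∀ t, combField T.v T.w (dir.2, -dir.1) (γ t) = 0) ∧
    (∀ t, combField T.v T.w dir (γ t) ≠ 0) ∧
    Filter.Tendsto γ Filter.atBot (𝓝 src.1) ∧ Filter.Tendsto γ Filter.atTop (𝓝 tgt.1)

variable {T}

theorem combField_neg (d : ℝ × ℝ) :
    combField T.v T.w (-d) = (-1 : ℝ) • combField T.v T.w d := by
  funext x
  simp only [combField, Prod.fst_neg, Prod.snd_neg, Pi.smul_apply]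
  module

/-- The same critical edge with the opposite orientation. -/
def OrientedEdge.rev (e : T.OrientedEdge) : T.OrientedEdge where
  carrier := e.carrier
  dir := -e.dir
  src := e.tgt
  tgt := e.src
  norm_dir := by simpa using e.norm_dir
  exists_curve := by
    obtain ⟨γ, h1, h2, h3, h4, h5, h6⟩ := e.exists_curve
    refine ⟨γ ∘ (· * (-1)), ?_, ?_, ?_, ?_, ?_, ?_⟩
    · rw [combField_neg]
      exact h1.comp_mul (-1)
    · rw [Set.range_comp, ← h2]
      have : Set.range (fun t : ℝ => t * (-1)) = Set.univ :=
        Set.range_eq_univ.2 fun y => ⟨-y, by ring⟩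
      rw [this, Set.image_univ]
    · intro t
      have h := combField_neg (T := T) (e.dir.2, -e.dir.1)
      have h' := congrFun h (γ (t * (-1)))
      simp only [Pi.smul_apply, h3, smul_zero] at h'
      exact h'
    · intro t h
      refine h4 (t * (-1)) ?_
      rw [combField_neg] at h
      simpa using h
    · refine h6.comp ?_
      simpa using Filter.tendsto_neg_atBot_atTop
    · refine h5.comp ?_
      simpa using Filter.tendsto_neg_atTop_atBot

variable (T)

/-- A frame: a cyclic sequence of critical points connected by critical edges whose directions
are cyclically (counterclockwise) ordered; as consecutive directions span angles less than `π`,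
there are at least three edges.  The cyclic sequence is recovered from the set of its oriented
edges, so a frame is recorded as this set. -/
@[ext] structure Frame where
  edges : Finset T.OrientedEdge
  cyclic : ∃ (N : ℕ) (e : Fin (N + 3) → T.OrientedEdge) (θ : Fin (N + 3) → ℝ),
    StrictMono θ ∧ θ (Fin.last _) < θ 0 + 2 * Real.pi ∧
    (∀ i, (e i).dir = (Real.cos (θ i), Real.sin (θ i))) ∧
    (∀ i, (e i).tgt = (e (i + 1)).src) ∧
    (∀ a, a ∈ edges ↔ a ∈ Set.range e)

variable {T}

/-- The convex polygon with vertices in `A` onto which the frame projects. -/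
def Frame.polygon (f : T.Frame) : Set (ℝ × ℝ) :=
  convexHull ℝ ((fun e : T.OrientedEdge => T.pos e.src) '' (f.edges : Set T.OrientedEdge))

open Classical in
/-- The characters, at the corner of a frame where `e` arrives and `e'` leaves, of the normal
bundle of a leaf: all characters of the tangent space of `M` but those of the two edges. -/
def normalWeights (e e' : T.OrientedEdge) : Finset (Fin m) :=
  {i | ¬ OnRay (-e.dir) (T.weight e'.src i) ∧ ¬ OnRay e'.dir (T.weight e'.src i)}

open Classical in
/-- The expected dimension of the space of leaves with boundary `f`: the invariant Euler
characteristic of the normal bundle of a leaf, of rank `m - 2`.  By the Čech covering of the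
leaf by the charts of its corners, this is the number of normal characters over the open leaf,
minus those in the half-plane to the left of each edge, plus those in the cone of each corner. -/
def Frame.expectedDim (f : T.Frame) : ℤ :=
  ((m : ℤ) - 2) + ∑ e ∈ f.edges, ∑ e' ∈ f.edges with e.tgt = e'.src,
    ((((normalWeights e e').filter
        fun i => InCone e'.dir (-e.dir) (T.weight e'.src i)).card : ℤ) -
      (((normalWeights e e').filter
        fun i => 0 ≤ planeDet e'.dir (T.weight e'.src i)).card : ℤ))

/-- The frames `fs` form a subdivision of `f`: the polygons subdivide the polygon of `f`, and
adjacent pieces are glued along common critical edges, the unglued edges being those of `f`. -/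
structure IsSubdivision {k : ℕ} (f : T.Frame) (fs : Fin k → T.Frame) : Prop where
  union : f.polygon = ⋃ i, (fs i).polygon
  disjoint : ∀ i j, i ≠ j → Disjoint (interior (fs i).polygon) (interior (fs j).polygon)
  edges : ∀ e, e ∈ f.edges ↔ (∃ i, e ∈ (fs i).edges) ∧ ∀ j, e.rev ∉ (fs j).edges

/-- The number of internal edges of a subdivision (unoriented critical edges shared by two
pieces); equivalently, of internal edges of the dual graph. -/
def internalEdgeCount {k : ℕ} (fs : Fin k → T.Frame) : ℕ :=
  {c : Set M | ∃ i j, ∃ e, e ∈ (fs i).edges ∧ e.rev ∈ (fs j).edges ∧ e.carrier = c}.ncard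

/-- A web realizing the dual graph of a subdivision: a point `x i` of the plane for each piece,
such that for every internal edge the vector between the two points is positively proportional
to the normal of the edge that points from the first piece to the second. -/
def IsDualWeb {k : ℕ} (fs : Fin k → T.Frame) (x : Fin k → ℝ × ℝ) : Prop :=
  ∀ i j, ∀ e, e ∈ (fs i).edges → e.rev ∈ (fs j).edges →
    OnRay (e.dir.2, -e.dir.1) (x j - x i)

/-- The expected codimension `2 k - s - 2` of a subdivision into `k` pieces with `s` internal
edges, which is the expected dimension of the space of dual webs up to translations. -/
def expectedCodim {k : ℕ} (fs : Fin k → T.Frame) : ℤ :=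
  2 * (k : ℤ) - (internalEdgeCount fs : ℤ) - 2

/-- The decompositions over which the operations sum. -/
def IsWebDecomposition {k : ℕ} (f : T.Frame) (fs : Fin k → T.Frame) : Prop :=
  IsSubdivision f fs ∧ (∃ x, IsDualWeb fs x) ∧ expectedCodim fs = 1

/-- The frame decomposed by given pieces is unique, so that the sums below are finite. -/
theorem IsWebDecomposition.unique {k : ℕ} {f g : T.Frame} {fs : Fin k → T.Frame}
    (hf : IsWebDecomposition f fs) (hg : IsWebDecomposition g fs) : f = g := by
  ext e
  rw [hf.1.edges, hg.1.edges]

variable (T)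

/-- The space `F` spanned by the frames. -/
abbrev FrameSpace (R : Type*) [CommRing R] : Type _ := T.Frame →₀ R

/-- The grading of `F` by the expected dimension. -/
def grading (R : Type*) [CommRing R] (d : ℤ) : Submodule R (T.FrameSpace R) :=
  Finsupp.supported R R {f : T.Frame | f.expectedDim = d}

open Classical in
/-- The operation `l k` on `F`, for given signs `ε` of the decompositions: the coefficient of a
frame `f` in `l k (f₁, …, f_k)` is the sign if `f₁, …, f_k` is a decomposition of `f` whose dual
web exists and whose expected codimension is `1`, and zero otherwise. -/
def bracket (R : Type*) [CommRing R] (ε : ∀ k : ℕ, (Fin k → T.Frame) → ℤˣ) (k : ℕ) :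
    MultilinearMap R (fun _ : Fin k => T.FrameSpace R) (T.FrameSpace R) :=
  multilinearOfBasis R fun fs =>
    ∑ᶠ f : T.Frame, if IsWebDecomposition f fs then ε k fs • Finsupp.single f (1 : R) else 0

variable {T}

/-- The coordinates of the plane set `A`, for a labelling of the critical points. -/
def coords {n : ℕ} (label : Fin n ≃ T.CriticalPoint) (ij : Fin n × Fin 2) : ℝ :=
  ![(T.pos (label ij.1)).1, (T.pos (label ij.1)).2] ij.2

end TwoMorse

end

/-! A nonzero term of the relation on basis frames is a pair of composable gluings: a subfamily `S`
of the pieces is glued to a frame `f`, and `f` together with the other pieces is glued to a frame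
`g`, both with a dual web and expected codimension one. Erasing `f` leaves a tiling `𝒟` of `g` by
all pieces, of codimension two. The relation holds because such a `𝒟` arises from exactly two
subfamilies `S`, whose contributions are opposite.

Webs of `𝒟` with possibly contracted edges are the solutions of `s` linear equations in `2k`
coordinates, one equation for each internal edge, with nonnegative edge lengths. If the equations
are independent, codimension two makes the solutions two-dimensional modulo translations, and the
nonnegative ones form a plane cone with two boundary rays. On such a ray some edges have contracted;
merging the pieces with the same web point gives a coarser tiling with a dual web, and a dimension
count leaves room for only one merged group, so that the ray is a composable pair. Conversely the
coarse web of a composable pair spans a boundary ray, and a small perturbation of it by the fine web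
is a genuine dual web (`IsGood.exists_web`, `exists_isGood_of_weakWeb`, `IsGood.exists_partner`).

That merging produces convex polygons is a monotonicity: up to a quarter turn the web behaves like
the gradient of a convex piecewise linear function on the tiling (`IsTiling.mono`). It is proved by
summation by parts over glued edges, applied to signed crossing numbers, which also show that a
combinatorial gluing of convex cycles is a geometric subdivision (`IsFrame.sum_cross`,
`IsTiling.sum_inner`).

Independence of the equations means that there is no nonzero self-stress, and is where general
position enters. If the stress cannot be avoided by a polynomial condition on the vertices, it
depends polynomially on them and can be differentiated. Pairing its derivatives with the web gives
affine relations between the web points around each vertex, while equilibrium gives affine relations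
between the vertices of each piece. Both families are in convex position, so each nonzero row and
column of the matrix of coefficients has at least four entries. This is more than a plane bipartite
incidence graph of corners allows, so the stress vanishes (`IsTiling.eq_zero_of_relations`,
`IsTiling.stress_eq_zero_of_generic`).

The expected dimension of a frame is the sum of the indices of its oriented edges minus two, and the
indices of the two orientations of an edge add up to one. The last fact rests on dynamics: the
numbers of characters with a given pairing with the normal agree at both ends of an edge (a Lax
equation along the edge), exactly one character at the source points along the edge (isolated
edges), and none at the target continues it (no three critical points are collinear). Hence the
operations have degree one, and exactly one orientation of each edge is odd.

The sign of a decomposition compares two orientations of the linear forms on the configurations of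
web points. One is the standard volume element; the other is the product of the coordinates of one
point, a length, and the equations of the odd internal edges in the order of the pieces, with odd
boundary edges kept as formal letters. The degree of a frame has the parity of its number of odd
edges, so reordering the pieces produces Koszul signs. For the two composable pairs the same product
appears with its two length factors interchanged, whence the minus sign (`IsGood.exists_wedge_eq`,
`tilingSign_cancel`). -/

noncomputable section

/-! ### Commuting vector fields read in a chart -/

section ChartField

open VectorField

variable {m : ℕ} {M : Type*} [TopologicalSpace M] [ChartedSpace (EuclideanSpace ℝ (Fin m)) M]

/-- The expression of a vector field in a chart. -/
def chartField (φ : OpenPartialHomeomorph M (EuclideanSpace ℝ (Fin m)))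
    (V : ∀ x : M, TangentSpace (𝓡 m) x) : EuclideanSpace ℝ (Fin m) → EuclideanSpace ℝ (Fin m) :=
  mpullback (𝓡 m) (𝓡 m) φ.symm V

variable {φ : OpenPartialHomeomorph M (EuclideanSpace ℝ (Fin m))}

theorem mdifferentiable_of_mem_maximalAtlas_infty
    (hφ : φ ∈ IsManifold.maximalAtlas (𝓡 m) ∞ M) : φ.MDifferentiable (𝓡 m) (𝓡 m) :=
  ⟨(contMDiffOn_of_mem_maximalAtlas hφ).mdifferentiableOn (by simp),
    (contMDiffOn_symm_of_mem_maximalAtlas hφ).mdifferentiableOn (by simp)⟩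

variable [IsManifold (𝓡 m) ∞ M]

theorem chartField_apply (hφ : φ ∈ IsManifold.maximalAtlas (𝓡 m) ∞ M)
    (V : ∀ x : M, TangentSpace (𝓡 m) x) {x : M} (hx : x ∈ φ.source) :
    chartField φ V (φ x) = mfderiv (𝓡 m) (𝓡 m) φ x (V x) := by
  have hd := mdifferentiable_of_mem_maximalAtlas_infty hφ
  have h1 := hd.symm_comp_deriv hx
  have h2 := hd.comp_symm_deriv (φ.map_source hx)
  rw [φ.left_inv hx] at h2
  rw [chartField, mpullback_apply]
  have : (mfderiv (𝓡 m) (𝓡 m) φ.symm (φ x)).inverse = mfderiv (𝓡 m) (𝓡 m) φ (φ.symm (φ x)) := by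
    refine ContinuousLinearMap.inverse_eq ?_ ?_
    · rw [φ.left_inv hx]; exact h1
    · rw [φ.left_inv hx]; exact h2
  rw [this]
  exact congrArg (fun z => (mfderiv (𝓡 m) (𝓡 m) φ z (V z) : EuclideanSpace ℝ (Fin m)))
    (φ.left_inv hx)

theorem chartField_eq_zero_iff (hφ : φ ∈ IsManifold.maximalAtlas (𝓡 m) ∞ M)
    (V : ∀ x : M, TangentSpace (𝓡 m) x) {x : M} (hx : x ∈ φ.source) :
    chartField φ V (φ x) = 0 ↔ V x = 0 := by
  rw [chartField_apply hφ V hx]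
  have hd := mdifferentiable_of_mem_maximalAtlas_infty hφ
  constructor
  · intro h
    exact hd.mfderiv_injective hx (by rw [map_zero]; exact h)
  · intro h
    rw [h, map_zero]; rfl

theorem isInvertible_mfderiv_symm (hφ : φ ∈ IsManifold.maximalAtlas (𝓡 m) ∞ M)
    {y : EuclideanSpace ℝ (Fin m)} (hy : y ∈ φ.target) :
    (mfderiv (𝓡 m) (𝓡 m) φ.symm y).IsInvertible :=
  ⟨(mdifferentiable_of_mem_maximalAtlas_infty hφ).symm.mfderiv hy, rfl⟩

theorem contDiffAt_chartField (hφ : φ ∈ IsManifold.maximalAtlas (𝓡 m) ∞ M)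
    {V : ∀ x : M, TangentSpace (𝓡 m) x}
    (hV : ContMDiff (𝓡 m) (𝓡 m).tangent ∞ (fun x => (⟨x, V x⟩ : TangentBundle (𝓡 m) M)))
    {y : EuclideanSpace ℝ (Fin m)} (hy : y ∈ φ.target) :
    ContDiffAt ℝ ∞ (chartField φ V) y := by
  refine (contMDiffAt_vectorSpace_iff_contDiffAt (V := chartField φ V)).1 ?_
  exact ContMDiffAt.mpullback_vectorField_preimage (n := ∞) (hV _)
    (contMDiffAt_symm_of_mem_maximalAtlas hφ hy) (isInvertible_mfderiv_symm hφ hy) (by simp)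

/-- The Lie bracket is natural under pullback, and in a vector space it is the difference of the two
sides. -/
theorem chartField_commute (hφ : φ ∈ IsManifold.maximalAtlas (𝓡 m) ∞ M)
    {V W : ∀ x : M, TangentSpace (𝓡 m) x}
    (hV : ContMDiff (𝓡 m) (𝓡 m).tangent ∞ (fun x => (⟨x, V x⟩ : TangentBundle (𝓡 m) M)))
    (hW : ContMDiff (𝓡 m) (𝓡 m).tangent ∞ (fun x => (⟨x, W x⟩ : TangentBundle (𝓡 m) M)))
    (hVW : ∀ x, mlieBracket (𝓡 m) V W x = 0)
    {y : EuclideanSpace ℝ (Fin m)} (hy : y ∈ φ.target) :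
    fderiv ℝ (chartField φ W) y (chartField φ V y) =
      fderiv ℝ (chartField φ V) y (chartField φ W y) := by
  have : IsManifold (𝓡 m) (minSmoothness ℝ 2) M := by
    rw [minSmoothness_of_isRCLikeNormedField]
    exact IsManifold.of_le (n := ∞) (WithTop.coe_le_coe.2 le_top)
  have : IsManifold (𝓡 m) (minSmoothness ℝ 3) M := by
    rw [minSmoothness_of_isRCLikeNormedField]
    exact IsManifold.of_le (n := ∞) (WithTop.coe_le_coe.2 le_top)
  have h := mpullback_mlieBracket (I := 𝓡 m) (I' := 𝓡 m) (n := ∞) (f := φ.symm) (x₀ := y)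
    ((hV (φ.symm y)).mdifferentiableAt (by simp)) ((hW (φ.symm y)).mdifferentiableAt (by simp))
    (contMDiffAt_symm_of_mem_maximalAtlas hφ hy)
    (by rw [minSmoothness_of_isRCLikeNormedField]; exact WithTop.coe_le_coe.2 le_top)
  rw [mpullback_apply, hVW, map_zero, ← mlieBracketWithin_univ,
    mlieBracketWithin_eq_lieBracketWithin] at h
  have h' := (congrFun (lieBracketWithin_univ (𝕜 := ℝ) (V := chartField φ V)
    (W := chartField φ W)) y).symm.trans h.symm
  exact sub_eq_zero.1 h'

theorem hasDerivAt_chart_comp (hφ : φ ∈ IsManifold.maximalAtlas (𝓡 m) ∞ M)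
    {V : ∀ x : M, TangentSpace (𝓡 m) x} {γ : ℝ → M} {t : ℝ} (ht : γ t ∈ φ.source)
    (hγ : HasMFDerivAt 𝓘(ℝ, ℝ) (𝓡 m) γ t ((1 : ℝ →L[ℝ] ℝ).smulRight (V (γ t)))) :
    HasDerivAt (φ ∘ γ) (chartField φ V (φ (γ t))) t := by
  have hd := mdifferentiable_of_mem_maximalAtlas_infty hφ
  have h := (hd.mdifferentiableAt ht).hasMFDerivAt.comp t hγ
  have h' : HasFDerivAt (φ ∘ γ) ((1 : ℝ →L[ℝ] ℝ).smulRight (chartField φ V (φ (γ t)))) t := by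
    rw [chartField_apply hφ V ht]
    refine h.hasFDerivAt.congr_fderiv ?_
    ext1
    exact (map_smul (mfderiv (𝓡 m) (𝓡 m) φ (γ t)) (1 : ℝ) (V (γ t)))
  simpa using h'.hasDerivAt

theorem isOpen_ne_zero_of_contMDiff {V : ∀ x : M, TangentSpace (𝓡 m) x}
    (hV : ContMDiff (𝓡 m) (𝓡 m).tangent ∞ (fun x => (⟨x, V x⟩ : TangentBundle (𝓡 m) M))) :
    IsOpen {x | V x ≠ 0} := by
  rw [isOpen_iff_mem_nhds]
  intro x hx
  set φ := chartAt (EuclideanSpace ℝ (Fin m)) x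
  have hφ : φ ∈ IsManifold.maximalAtlas (𝓡 m) ∞ M := IsManifold.chart_mem_maximalAtlas x
  have hxs : x ∈ φ.source := mem_chart_source _ x
  have hc : ContinuousAt (fun z => chartField φ V (φ z)) x :=
    ((contDiffAt_chartField hφ hV (φ.map_source hxs)).continuousAt).comp (φ.continuousAt hxs)
  have h0 : chartField φ V (φ x) ≠ 0 := fun h => hx ((chartField_eq_zero_iff hφ V hxs).1 h)
  filter_upwards [hc.eventually_ne h0, φ.open_source.mem_nhds hxs] with z hz hzs h
  exact hz ((chartField_eq_zero_iff hφ V hzs).2 h)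

/-- A vector field commuting with `V` which vanishes at a point of an integral curve of `V`
vanishes on the curve near this point. -/
theorem eventually_eq_zero_of_commute {V W : ∀ x : M, TangentSpace (𝓡 m) x}
    (hV : ContMDiff (𝓡 m) (𝓡 m).tangent ∞ (fun x => (⟨x, V x⟩ : TangentBundle (𝓡 m) M)))
    (hW : ContMDiff (𝓡 m) (𝓡 m).tangent ∞ (fun x => (⟨x, W x⟩ : TangentBundle (𝓡 m) M)))
    (hVW : ∀ x, mlieBracket (𝓡 m) V W x = 0) {γ : ℝ → M} {t₀ : ℝ}
    (hγ : IsMIntegralCurveAt (I := 𝓡 m) γ V t₀) (h0 : W (γ t₀) = 0) :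
    ∀ᶠ t in 𝓝 t₀, W (γ t) = 0 := by
  set φ := chartAt (EuclideanSpace ℝ (Fin m)) (γ t₀)
  have hφ : φ ∈ IsManifold.maximalAtlas (𝓡 m) ∞ M := IsManifold.chart_mem_maximalAtlas _
  have hxs : γ t₀ ∈ φ.source := mem_chart_source _ _
  have hsrc : ∀ᶠ t in 𝓝 t₀, γ t ∈ φ.source :=
    hγ.continuousAt.preimage_mem_nhds (φ.open_source.mem_nhds hxs)
  have hBc : ContinuousAt (fun t => fderiv ℝ (chartField φ V) (φ (γ t))) t₀ := by
    have h1 : ContinuousAt (fderiv ℝ (chartField φ V)) (φ (γ t₀)) :=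
      ((contDiffAt_chartField hφ hV (φ.map_source hxs)).fderiv_right (m := 0)
        (by simp)).continuousAt
    exact ContinuousAt.comp (f := fun t => φ (γ t)) h1
      (ContinuousAt.comp (f := γ) (φ.continuousAt hxs) hγ.continuousAt)
  have hK : ∀ᶠ t in 𝓝 t₀, ‖fderiv ℝ (chartField φ V) (φ (γ t))‖₊ <
      ‖fderiv ℝ (chartField φ V) (φ (γ t₀))‖₊ + 1 :=
    hBc.nnnorm.eventually_lt continuousAt_const (by simp)
  -- Commutation says that the chart expression of `W` along the curve solves the linear equation
  -- `z' = DV(γ) z`. So does zero, with the same value at `t₀`.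
  have key := ODE_solution_unique_of_eventually (t₀ := t₀)
    (v := fun t z => fderiv ℝ (chartField φ V) (φ (γ t)) z) (s := fun _ => Set.univ)
    (K := ‖fderiv ℝ (chartField φ V) (φ (γ t₀))‖₊ + 1)
    (f := fun t => chartField φ W (φ (γ t))) (g := fun _ => 0) ?_ ?_ ?_ ?_
  · filter_upwards [key, hsrc] with t ht hts
    exact (chartField_eq_zero_iff hφ W hts).1 ht
  · filter_upwards [hK] with t ht
    exact ((fderiv ℝ (chartField φ V) (φ (γ t))).lipschitz.weaken ht.le).lipschitzOnWith
  · filter_upwards [hsrc, hγ] with t hts ht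
    refine ⟨?_, Set.mem_univ _⟩
    have h1 := hasDerivAt_chart_comp hφ hts ht
    have h2 := ((contDiffAt_chartField hφ hW (φ.map_source hts)).differentiableAt
      (by simp)).hasFDerivAt
    have h3 := HasFDerivAt.comp_hasDerivAt t h2 h1
    rw [chartField_commute hφ hV hW hVW (φ.map_source hts)] at h3
    exact h3
  · exact Filter.Eventually.of_forall fun t => ⟨by simpa using hasDerivAt_const t _, Set.mem_univ _⟩
  · exact (chartField_eq_zero_iff hφ W hxs).2 h0

/-- The zeros along the curve form a closed set, which is open by the local statement; the line is
connected. -/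
theorem eq_zero_of_commute {V W : ∀ x : M, TangentSpace (𝓡 m) x}
    (hV : ContMDiff (𝓡 m) (𝓡 m).tangent ∞ (fun x => (⟨x, V x⟩ : TangentBundle (𝓡 m) M)))
    (hW : ContMDiff (𝓡 m) (𝓡 m).tangent ∞ (fun x => (⟨x, W x⟩ : TangentBundle (𝓡 m) M)))
    (hVW : ∀ x, mlieBracket (𝓡 m) V W x = 0) {γ : ℝ → M}
    (hγ : IsMIntegralCurve (I := 𝓡 m) γ V) {t₀ : ℝ} (h0 : W (γ t₀) = 0) (t : ℝ) :
    W (γ t) = 0 := by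
  have hcl : IsClopen {t | W (γ t) = 0} := by
    constructor
    · have := (isOpen_ne_zero_of_contMDiff hW).preimage hγ.continuous
      rw [← isOpen_compl_iff]
      exact this
    · rw [isOpen_iff_mem_nhds]
      intro s hs
      exact eventually_eq_zero_of_commute hV hW hVW (hγ.isMIntegralCurveAt s) hs
  have := hcl.eq_univ ⟨t₀, h0⟩
  exact (this ▸ Set.mem_univ t : t ∈ {t | W (γ t) = 0})

end ChartField

/-! ### The combinations of the two fields and their potentials -/

namespace TwoMorse

variable {m : ℕ} {M : Type*} [TopologicalSpace M] [ChartedSpace (EuclideanSpace ℝ (Fin m)) M]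
  [IsManifold (𝓡 m) ∞ M] (T : TwoMorse m M)

/-- The field `a v + b w` for `d = (a, b)`. -/
abbrev comb (d : ℝ × ℝ) (x : M) : TangentSpace (𝓡 m) x := combField T.v T.w d x

/-- The function with gradient `a v + b w`. -/
def combFun (d : ℝ × ℝ) (x : M) : ℝ := d.1 * T.fv x + d.2 * T.fw x

theorem smooth_comb (d : ℝ × ℝ) :
    ContMDiff (𝓡 m) (𝓡 m).tangent ∞ (fun x => (⟨x, T.comb d x⟩ : TangentBundle (𝓡 m) M)) := by
  have h1 := ContMDiff.const_smul_section (a := d.1) T.smooth_v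
  have h2 := ContMDiff.const_smul_section (a := d.2) T.smooth_w
  exact h1.add_section h2

theorem smooth_combFun (d : ℝ × ℝ) : ContMDiff (𝓡 m) 𝓘(ℝ, ℝ) ∞ (T.combFun d) :=
  (contMDiff_const.mul T.smooth_fv).add (contMDiff_const.mul T.smooth_fw)

theorem comb_commute (d d' : ℝ × ℝ) (x : M) :
    VectorField.mlieBracket (𝓡 m) (T.comb d) (T.comb d') x = 0 := by
  have : IsManifold (𝓡 m) (minSmoothness ℝ 2) M := by
    rw [minSmoothness_of_isRCLikeNormedField]
    exact IsManifold.of_le (n := ∞) (WithTop.coe_le_coe.2 le_top)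
  have hv := (T.smooth_v x).mdifferentiableAt (by simp)
  have hw := (T.smooth_w x).mdifferentiableAt (by simp)
  have hv' := fun a : ℝ => ((ContMDiff.const_smul_section (a := a) T.smooth_v) x).mdifferentiableAt
    (by simp)
  have hw' := fun a : ℝ => ((ContMDiff.const_smul_section (a := a) T.smooth_w) x).mdifferentiableAt
    (by simp)
  have h0 : VectorField.mlieBracket (𝓡 m) T.w T.v x = 0 := by
    rw [VectorField.mlieBracket_swap_apply, T.commute, neg_zero]
  have hL : ∀ (a : ℝ) (U : ∀ x : M, TangentSpace (𝓡 m) x),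
      VectorField.mlieBracket (𝓡 m) (a • T.v) U x =
        a • VectorField.mlieBracket (𝓡 m) T.v U x := fun a U =>
    VectorField.mlieBracket_const_smul_left hv
  have hL' : ∀ (a : ℝ) (U : ∀ x : M, TangentSpace (𝓡 m) x),
      VectorField.mlieBracket (𝓡 m) (a • T.w) U x =
        a • VectorField.mlieBracket (𝓡 m) T.w U x := fun a U =>
    VectorField.mlieBracket_const_smul_left hw
  have hR : ∀ (a : ℝ) (U : ∀ x : M, TangentSpace (𝓡 m) x),
      VectorField.mlieBracket (𝓡 m) U (a • T.v) x =
        a • VectorField.mlieBracket (𝓡 m) U T.v x := fun a U =>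
    VectorField.mlieBracket_const_smul_right hv
  have hR' : ∀ (a : ℝ) (U : ∀ x : M, TangentSpace (𝓡 m) x),
      VectorField.mlieBracket (𝓡 m) U (a • T.w) x =
        a • VectorField.mlieBracket (𝓡 m) U T.w x := fun a U =>
    VectorField.mlieBracket_const_smul_right hw
  change VectorField.mlieBracket (𝓡 m) (d.1 • T.v + d.2 • T.w) (d'.1 • T.v + d'.2 • T.w) x = 0
  rw [VectorField.mlieBracket_add_left (hv' _) (hw' _), hL, hL',
    VectorField.mlieBracket_add_right (hv' _) (hw' _), hR, hR',
    VectorField.mlieBracket_add_right (hv' _) (hw' _), hR, hR', h0, T.commute]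
  simp

end TwoMorse
end

/-! ### Critical edges as gradient curves -/

noncomputable section

namespace TwoMorse

variable {m : ℕ} {M : Type*} [TopologicalSpace M] [ChartedSpace (EuclideanSpace ℝ (Fin m)) M]
  [IsManifold (𝓡 m) ∞ M] (T : TwoMorse m M)

theorem inner_comb (d : ℝ × ℝ) (x : M) (u : TangentSpace (𝓡 m) x) :
    T.metric.inner x (T.comb d x) u = (mfderiv (𝓡 m) 𝓘(ℝ, ℝ) (T.combFun d) x u : ℝ) := by
  obtain ⟨A, h1⟩ : ∃ A : TangentSpace (𝓡 m) x →L[ℝ] ℝ, HasMFDerivAt (𝓡 m) 𝓘(ℝ, ℝ) T.fv x A :=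
    ⟨_, (T.smooth_fv.mdifferentiable (by simp) x).hasMFDerivAt⟩
  obtain ⟨B, h2⟩ : ∃ B : TangentSpace (𝓡 m) x →L[ℝ] ℝ, HasMFDerivAt (𝓡 m) 𝓘(ℝ, ℝ) T.fw x B :=
    ⟨_, (T.smooth_fw.mdifferentiable (by simp) x).hasMFDerivAt⟩
  have hv : (T.metric.inner x (T.v x) u : ℝ) = mfderiv (𝓡 m) 𝓘(ℝ, ℝ) T.fv x u := T.grad_v x u
  have hw : (T.metric.inner x (T.w x) u : ℝ) = mfderiv (𝓡 m) 𝓘(ℝ, ℝ) T.fw x u := T.grad_w x u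
  rw [h1.mfderiv] at hv
  rw [h2.mfderiv] at hw
  have h3 : HasMFDerivAt (𝓡 m) 𝓘(ℝ, ℝ) (T.combFun d) x (d.1 • A + d.2 • B) :=
    (h1.const_smul d.1).add (h2.const_smul d.2)
  rw [h3.mfderiv]
  change T.metric.inner x (d.1 • T.v x + d.2 • T.w x) u = d.1 • A u + d.2 • B u
  have e1 : d.1 • A u + d.2 • B u =
      d.1 • T.metric.inner x (T.v x) u + d.2 • T.metric.inner x (T.w x) u :=
    congrArg₂ (fun a b : ℝ => d.1 • a + d.2 • b) hv.symm hw.symm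
  rw [e1, map_add, map_smul, map_smul]
  rfl

theorem hasDerivAt_combFun (d : ℝ × ℝ) {γ : ℝ → M} {t : ℝ} {u : TangentSpace (𝓡 m) (γ t)}
    (hγ : HasMFDerivAt 𝓘(ℝ, ℝ) (𝓡 m) γ t ((1 : ℝ →L[ℝ] ℝ).smulRight u)) :
    HasDerivAt (fun s => T.combFun d (γ s)) (T.metric.inner (γ t) (T.comb d (γ t)) u) t := by
  have h1 : HasMFDerivAt (𝓡 m) 𝓘(ℝ, ℝ) (T.combFun d) (γ t)
      (mfderiv (𝓡 m) 𝓘(ℝ, ℝ) (T.combFun d) (γ t)) :=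
    ((T.smooth_combFun d).mdifferentiable (by simp) _).hasMFDerivAt
  have h2 := (h1.comp t hγ)
  have h3 : HasFDerivAt (fun s => T.combFun d (γ s))
      ((1 : ℝ →L[ℝ] ℝ).smulRight (T.metric.inner (γ t) (T.comb d (γ t)) u)) t := by
    refine HasFDerivAt.congr_fderiv h2.hasFDerivAt ?_
    ext
    rw [T.inner_comb]
    exact map_smul (mfderiv (𝓡 m) 𝓘(ℝ, ℝ) (T.combFun d) (γ t)) (1 : ℝ) u
  simpa using h3.hasDerivAt

/-- Writing `d'` in the orthonormal basis of `d` and its perpendicular, only the component along `d`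
survives where the perpendicular field vanishes. -/
theorem comb_eq_smul {d : ℝ × ℝ} (hd : d.1 ^ 2 + d.2 ^ 2 = 1) {x : M}
    (hx : T.comb (d.2, -d.1) x = 0) (d' : ℝ × ℝ) :
    T.comb d' x = (d'.1 * d.1 + d'.2 * d.2) • T.comb d x := by
  simp only [combField] at hx ⊢
  have h : T.v x = d.1 • (d.1 • T.v x + d.2 • T.w x) := by
    have : T.v x = (d.1 ^ 2 + d.2 ^ 2) • T.v x := by rw [hd, one_smul]
    calc T.v x = (d.1 ^ 2 + d.2 ^ 2) • T.v x := this
      _ = d.1 • (d.1 • T.v x + d.2 • T.w x) + d.2 • (d.2 • T.v x + -d.1 • T.w x) := by module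
      _ = _ := by rw [hx, smul_zero, add_zero]
  have h' : T.w x = d.2 • (d.1 • T.v x + d.2 • T.w x) := by
    have : T.w x = (d.1 ^ 2 + d.2 ^ 2) • T.w x := by rw [hd, one_smul]
    calc T.w x = (d.1 ^ 2 + d.2 ^ 2) • T.w x := this
      _ = d.2 • (d.1 • T.v x + d.2 • T.w x) - d.1 • (d.2 • T.v x + -d.1 • T.w x) := by module
      _ = _ := by rw [hx, smul_zero, sub_zero]
  calc d'.1 • T.v x + d'.2 • T.w x
      = d'.1 • (d.1 • (d.1 • T.v x + d.2 • T.w x)) +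
        d'.2 • (d.2 • (d.1 • T.v x + d.2 • T.w x)) := by rw [← h, ← h']
    _ = _ := by module

theorem eq_zero_of_comb_eq_zero {d : ℝ × ℝ} (hd : d.1 ^ 2 + d.2 ^ 2 = 1) {x : M}
    (hx : T.comb (d.2, -d.1) x = 0) (hx' : T.comb d x = 0) : T.v x = 0 ∧ T.w x = 0 := by
  constructor
  · have := T.comb_eq_smul hd hx (1, 0)
    rw [hx', smul_zero] at this
    simpa [combField] using this
  · have := T.comb_eq_smul hd hx (0, 1)
    rw [hx', smul_zero] at this
    simpa [combField] using this

theorem pos_eq_of_combFun {d : ℝ × ℝ} (hd : d.1 ^ 2 + d.2 ^ 2 = 1) (p q : T.CriticalPoint)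
    (h : T.combFun (d.2, -d.1) q.1 = T.combFun (d.2, -d.1) p.1) :
    T.pos q - T.pos p = (T.combFun d q.1 - T.combFun d p.1) • d := by
  simp only [combFun, pos] at *
  ext
  · simp only [Prod.fst_sub, Prod.smul_fst, smul_eq_mul]
    linear_combination (T.fv p.1 - T.fv q.1) * hd + d.2 * h
  · simp only [Prod.snd_sub, Prod.smul_snd, smul_eq_mul]
    linear_combination (T.fw p.1 - T.fw q.1) * hd - d.1 * h

theorem hasDerivAt_combFun_of_perp {d : ℝ × ℝ} (hd : d.1 ^ 2 + d.2 ^ 2 = 1) (d' : ℝ × ℝ)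
    {γ : ℝ → M} {t : ℝ} (h0 : T.comb (d.2, -d.1) (γ t) = 0)
    (hγ : HasMFDerivAt 𝓘(ℝ, ℝ) (𝓡 m) γ t ((1 : ℝ →L[ℝ] ℝ).smulRight (T.comb d (γ t)))) :
    HasDerivAt (fun s => T.combFun d' (γ s)) ((d'.1 * d.1 + d'.2 * d.2) *
      T.metric.inner (γ t) (T.comb d (γ t)) (T.comb d (γ t))) t := by
  convert T.hasDerivAt_combFun d' hγ using 1
  rw [T.comb_eq_smul hd h0 d', map_smul]
  rfl

theorem strictMono_combFun {d : ℝ × ℝ} (hd : d.1 ^ 2 + d.2 ^ 2 = 1) {γ : ℝ → M}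
    (hγ : IsMIntegralCurve (I := 𝓡 m) γ (T.comb d))
    (h0 : ∀ t, T.comb (d.2, -d.1) (γ t) = 0) (h1 : ∀ t, T.comb d (γ t) ≠ 0) :
    StrictMono fun t => T.combFun d (γ t) := by
  refine strictMono_of_hasDerivAt_pos (fun t => T.hasDerivAt_combFun_of_perp hd d (h0 t) (hγ t)) ?_
  intro t
  have := T.metric.pos (γ t) _ (h1 t)
  have h2 : d.1 * d.1 + d.2 * d.2 = 1 := by rw [← hd]; ring
  rw [h2, one_mul]
  exact this

theorem combFun_perp_const {d : ℝ × ℝ} (hd : d.1 ^ 2 + d.2 ^ 2 = 1) {γ : ℝ → M}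
    (hγ : IsMIntegralCurve (I := 𝓡 m) γ (T.comb d))
    (h0 : ∀ t, T.comb (d.2, -d.1) (γ t) = 0) (s t : ℝ) :
    T.combFun (d.2, -d.1) (γ s) = T.combFun (d.2, -d.1) (γ t) := by
  have key : ∀ t, HasDerivAt (fun s => T.combFun (d.2, -d.1) (γ s)) 0 t := fun t => by
    convert T.hasDerivAt_combFun_of_perp hd (d.2, -d.1) (h0 t) (hγ t) using 1
    ring
  exact is_const_of_deriv_eq_zero (fun t => (key t).differentiableAt) (fun t => (key t).deriv) s t

variable {T}

/-- Along the edge the potential in the direction `dir` increases strictly, because the curve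
follows its gradient, while the perpendicular potential is constant. Both facts pass to the limits
at the ends. -/
theorem OrientedEdge.pos_tgt_sub (e : T.OrientedEdge) :
    ∃ c : ℝ, 0 < c ∧ T.pos e.tgt - T.pos e.src = c • e.dir := by
  obtain ⟨γ, h1, h2, h3, h4, h5, h6⟩ := e.exists_curve
  have hs := fun d => ((T.smooth_combFun d).continuous.tendsto e.src.1).comp h5
  have ht := fun d => ((T.smooth_combFun d).continuous.tendsto e.tgt.1).comp h6
  have hc : T.combFun (e.dir.2, -e.dir.1) e.tgt.1 = T.combFun (e.dir.2, -e.dir.1) e.src.1 := by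
    have e1 : (T.combFun (e.dir.2, -e.dir.1) ∘ γ) =
        fun _ => T.combFun (e.dir.2, -e.dir.1) (γ 0) :=
      funext fun t => T.combFun_perp_const e.norm_dir h1 h3 t 0
    have a := hs (e.dir.2, -e.dir.1)
    have b := ht (e.dir.2, -e.dir.1)
    rw [e1] at a b
    rw [tendsto_nhds_unique a tendsto_const_nhds, tendsto_nhds_unique b tendsto_const_nhds]
  have hm := T.strictMono_combFun e.norm_dir h1 h3 h4
  have a : T.combFun e.dir e.src.1 ≤ T.combFun e.dir (γ 0) :=
    hm.monotone.le_of_tendsto (hs e.dir) 0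
  have b : T.combFun e.dir (γ 1) ≤ T.combFun e.dir e.tgt.1 :=
    hm.monotone.ge_of_tendsto (ht e.dir) 1
  have c : T.combFun e.dir (γ 0) < T.combFun e.dir (γ 1) := hm one_pos
  exact ⟨_, by linarith, T.pos_eq_of_combFun e.norm_dir _ _ hc⟩

/-- Integral curves of one field through a common point differ by a time shift, so they have the
same limits. The end points are thus determined by the other data. -/
theorem OrientedEdge.ext_of_carrier [T2Space M] {e e' : T.OrientedEdge}
    (hc : e.carrier = e'.carrier) (hd : e.dir = e'.dir) : e = e' := by
  obtain ⟨γ, h1, h2, h3, h4, h5, h6⟩ := e.exists_curve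
  obtain ⟨γ', h1', h2', h3', h4', h5', h6'⟩ := e'.exists_curve
  have : γ' 0 ∈ Set.range γ := by rw [h2, hc, ← h2']; exact ⟨0, rfl⟩
  obtain ⟨s, hs⟩ := this
  rw [← hd] at h1'
  have hsm : ContMDiff (𝓡 m) (𝓡 m).tangent 1
      (fun x => (⟨x, T.comb e.dir x⟩ : TangentBundle (𝓡 m) M)) :=
    (T.smooth_comb e.dir).of_le (by exact_mod_cast le_top)
  have heq := isMIntegralCurve_Ioo_eq_of_contMDiff_boundaryless (t₀ := 0) hsm h1'
    (h1.comp_add s) (by simp [hs])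
  have hsrc : e.src = e'.src := by
    refine Subtype.ext (tendsto_nhds_unique ?_ h5')
    rw [heq]
    exact h5.comp (Filter.tendsto_atBot_add_const_right _ s Filter.tendsto_id)
  have htgt : e.tgt = e'.tgt := by
    refine Subtype.ext (tendsto_nhds_unique ?_ h6')
    rw [heq]
    exact h6.comp (Filter.tendsto_atTop_add_const_right _ s Filter.tendsto_id)
  cases e; cases e'
  simp_all

/-- At a common point the field along one direction is nonzero and the field perpendicular to the
other vanishes, so the two unit directions are parallel. This lets internal edges be counted by
their carriers. -/
theorem OrientedEdge.eq_or_eq_rev_of_carrier [T2Space M] {e e' : T.OrientedEdge}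
    (hc : e.carrier = e'.carrier) : e' = e ∨ e' = e.rev := by
  obtain ⟨γ, h1, h2, h3, h4, h5, h6⟩ := e.exists_curve
  obtain ⟨γ', h1', h2', h3', h4', h5', h6'⟩ := e'.exists_curve
  have : γ' 0 ∈ Set.range γ := by rw [h2, hc, ← h2']; exact ⟨0, rfl⟩
  obtain ⟨s, hs⟩ := this
  have hz := T.comb_eq_smul e.norm_dir (h3 s) (e'.dir.2, -e'.dir.1)
  rw [hs] at hz
  have hne : T.comb e.dir (γ' 0) ≠ 0 := hs ▸ h4 s
  have hdet : e'.dir.2 * e.dir.1 - e'.dir.1 * e.dir.2 = 0 := by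
    have h := h3' 0
    rw [show combField T.v T.w = T.comb from rfl] at h
    rw [hz] at h
    rcases smul_eq_zero.1 h with h | h
    · simpa [sub_eq_add_neg] using h
    · exact absurd h hne
  have n1 := e.norm_dir
  have n2 := e'.norm_dir
  set c := e'.dir.1 * e.dir.1 + e'.dir.2 * e.dir.2 with hcdef
  have e1 : e'.dir.1 = c * e.dir.1 := by
    linear_combination (-e'.dir.1) * n1 - e.dir.2 * hdet
  have e2 : e'.dir.2 = c * e.dir.2 := by
    linear_combination (-e'.dir.2) * n1 + e.dir.1 * hdet
  have hc2 : c ^ 2 = 1 := by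
    rw [e1, e2] at n2
    linear_combination n2 - c ^ 2 * n1
  rcases (by simpa using sq_eq_sq_iff_eq_or_eq_neg.1 (hc2.trans (one_pow 2).symm) : c = 1 ∨ c = -1) with h | h
  · left
    refine (ext_of_carrier hc ?_).symm
    rw [h] at e1 e2
    ext <;> simp [e1, e2]
  · right
    refine (ext_of_carrier (e' := e') (e := e.rev) hc ?_).symm
    rw [h] at e1 e2
    ext <;> simp [e1, e2, OrientedEdge.rev]

theorem OrientedEdge.rev_rev (e : T.OrientedEdge) : e.rev.rev = e := by
  cases e
  simp [OrientedEdge.rev]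

end TwoMorse
end

/-! ### Characters at critical points and isolated orbits -/

noncomputable section

namespace TwoMorse

variable {m : ℕ} {M : Type*} [TopologicalSpace M] [ChartedSpace (EuclideanSpace ℝ (Fin m)) M]
  [IsManifold (𝓡 m) ∞ M] (T : TwoMorse m M)

theorem exists_linearizing_chart (p : T.CriticalPoint) :
    ∃ φ ∈ IsManifold.maximalAtlas (𝓡 m) ∞ M, p.1 ∈ φ.source ∧ φ p.1 = 0 ∧
      ∀ (d : ℝ × ℝ), ∀ y ∈ φ.target, chartField φ (T.comb d) y =
        WithLp.toLp 2 (fun i => (d.1 * (T.weight p i).1 + d.2 * (T.weight p i).2) * y i) := by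
  obtain ⟨φ, hφ, hp, h0, hlin⟩ := Classical.choose_spec (T.linearizable p.1 p.2.1 p.2.2)
  refine ⟨φ, hφ, hp, h0, fun d y hy => ?_⟩
  obtain ⟨hv, hw⟩ := hlin (φ.symm y) (φ.map_target hy)
  have h := chartField_apply hφ (T.comb d) (φ.map_target hy)
  rw [φ.right_inv hy] at h hv hw
  have e1 : (mfderiv (𝓡 m) (𝓡 m) φ (φ.symm y) (T.comb d (φ.symm y)) : EuclideanSpace ℝ (Fin m)) =
      d.1 • (mfderiv (𝓡 m) (𝓡 m) φ (φ.symm y) (T.v (φ.symm y)) : EuclideanSpace ℝ (Fin m)) +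
      d.2 • (mfderiv (𝓡 m) (𝓡 m) φ (φ.symm y) (T.w (φ.symm y)) : EuclideanSpace ℝ (Fin m)) := by
    refine (map_add (mfderiv (𝓡 m) (𝓡 m) φ (φ.symm y)) _ _).trans ?_
    exact congrArg₂ (fun a b : EuclideanSpace ℝ (Fin m) => a + b)
      (map_smul (mfderiv (𝓡 m) (𝓡 m) φ (φ.symm y)) _ _)
      (map_smul (mfderiv (𝓡 m) (𝓡 m) φ (φ.symm y)) _ _)
  refine h.trans (e1.trans ((congrArg₂ (fun a b : EuclideanSpace ℝ (Fin m) => d.1 • a + d.2 • b)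
    hv hw).trans ?_))
  ext i
  change d.1 * ((T.weight p i).1 * y i) + d.2 * ((T.weight p i).2 * y i) = _
  simp only
  ring

omit [ChartedSpace (EuclideanSpace ℝ (Fin m)) M] [IsManifold (𝓡 m) ∞ M] in
theorem tendsto_symm_single {φ : OpenPartialHomeomorph M (EuclideanSpace ℝ (Fin m))} {p : M}
    (hp : p ∈ φ.source) (h0 : φ p = 0) (i : Fin m) :
    Filter.Tendsto (fun ε : ℝ => φ.symm (EuclideanSpace.single i ε)) (𝓝 0) (𝓝 p) ∧
      ∀ᶠ ε : ℝ in 𝓝 0, EuclideanSpace.single i ε ∈ φ.target := by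
  have hc : Filter.Tendsto (fun ε : ℝ => (EuclideanSpace.single i ε : EuclideanSpace ℝ (Fin m)))
      (𝓝 0) (𝓝 0) := by
    have : (fun ε : ℝ => (EuclideanSpace.single i ε : EuclideanSpace ℝ (Fin m))) =
        fun ε : ℝ => ε • EuclideanSpace.single i (1 : ℝ) := by
      ext ε j; simp
    rw [this]
    have h : Continuous fun ε : ℝ => ε • (EuclideanSpace.single i (1 : ℝ) :
      EuclideanSpace ℝ (Fin m)) := by fun_prop
    simpa using h.tendsto 0
  have ht : (0 : EuclideanSpace ℝ (Fin m)) ∈ φ.target := h0 ▸ φ.map_source hp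
  refine ⟨?_, hc.eventually (φ.open_target.mem_nhds ht)⟩
  have h1 := (φ.continuousAt_symm ht).tendsto.comp hc
  rwa [← h0, φ.left_inv hp] at h1

/-- Otherwise a coordinate axis of the linearizing chart would consist of critical points, which are
isolated. -/
theorem weight_ne_zero (p : T.CriticalPoint) (i : Fin m) : T.weight p i ≠ 0 := by
  intro hi
  obtain ⟨φ, hφ, hp, h0, hlin⟩ := T.exists_linearizing_chart p
  obtain ⟨h1, h2⟩ := tendsto_symm_single hp h0 i
  have hz : ∀ ε : ℝ, EuclideanSpace.single i ε ∈ φ.target → ∀ d : ℝ × ℝ,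
      T.comb d (φ.symm (EuclideanSpace.single i ε)) = 0 := by
    intro ε hε d
    rw [← chartField_eq_zero_iff hφ _ (φ.map_target hε), φ.right_inv hε, hlin d _ hε]
    ext j
    by_cases hj : j = i
    · subst hj; simp [hi]
    · simp [hj]
  have hev := (h1.eventually (T.isolated_points p.1 p.2.1 p.2.2)).and h2
  obtain ⟨ε, hε, hε0⟩ := ((hev.filter_mono nhdsWithin_le_nhds).and
    (self_mem_nhdsWithin (a := (0 : ℝ)) (s := {0}ᶜ))).exists
  have hv := hz ε hε.2 (1, 0)
  have hw := hz ε hε.2 (0, 1)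
  have := hε.1 (by simpa [combField] using hv) (by simpa [combField] using hw)
  have h3 := congrArg φ this
  rw [φ.right_inv hε.2, h0] at h3
  apply hε0
  have := congrArg (fun z : EuclideanSpace ℝ (Fin m) => z i) h3
  simpa using this

theorem comb_eq_zero_of_eq (p : T.CriticalPoint) (d : ℝ × ℝ) {x : M} (hx : x = p.1) :
    T.comb d x = 0 := by
  subst hx
  simp [combField, p.2.1, p.2.2]

theorem eq_smul_of_perp {d l : ℝ × ℝ} (hd : d.1 ^ 2 + d.2 ^ 2 = 1)
    (h : d.2 * l.1 + -d.1 * l.2 = 0) : l = (d.1 * l.1 + d.2 * l.2) • d := by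
  ext
  · simp only [Prod.smul_fst, smul_eq_mul]; linear_combination (-l.1) * hd + d.2 * h
  · simp only [Prod.smul_snd, smul_eq_mul]; linear_combination (-l.2) * hd - d.1 * h

/-- Near the source, some coordinate of the edge in the linearizing chart is nonzero. The vanishing
of the perpendicular field makes its character parallel to the direction of the edge, and the
convergence to the source in backward time makes the factor positive. -/
theorem OrientedEdge.exists_weight_onRay {T : TwoMorse m M} (e : T.OrientedEdge) :
    ∃ i, OnRay e.dir (T.weight e.src i) := by
  obtain ⟨γ, h1, h2, h3, h4, h5, h6⟩ := e.exists_curve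
  obtain ⟨φ, hφ, hp, h0, hlin⟩ := T.exists_linearizing_chart e.src
  obtain ⟨t₀, ht₀⟩ := Filter.eventually_atBot.1 (h5.eventually (φ.open_source.mem_nhds hp))
  have hcomp : ∀ t ≤ t₀, ∀ i, HasDerivAt (fun t => φ (γ t) i)
      ((e.dir.1 * (T.weight e.src i).1 + e.dir.2 * (T.weight e.src i).2) * φ (γ t) i) t := by
    intro t ht i
    have h := hasDerivAt_chart_comp hφ (ht₀ t ht) (h1 t)
    have h' := (EuclideanSpace.proj (𝕜 := ℝ) i :
      EuclideanSpace ℝ (Fin m) →L[ℝ] ℝ).hasFDerivAt.comp_hasDerivAt t h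
    rw [hlin _ _ (φ.map_source (ht₀ t ht))] at h'
    exact h'
  have hne : φ (γ t₀) ≠ 0 := by
    intro h
    have : γ t₀ = e.src.1 := by
      rw [← φ.left_inv (ht₀ t₀ le_rfl), h, ← h0, φ.left_inv hp]
    exact h4 t₀ (T.comb_eq_zero_of_eq e.src _ this)
  obtain ⟨i, hi⟩ : ∃ i, φ (γ t₀) i ≠ 0 := by
    by_contra! h
    exact hne (by ext i; simpa using h i)
  have hperp : e.dir.2 * (T.weight e.src i).1 + -e.dir.1 * (T.weight e.src i).2 = 0 := by
    have h := (chartField_eq_zero_iff hφ _ (ht₀ t₀ le_rfl)).2 (h3 t₀)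
    rw [hlin _ _ (φ.map_source (ht₀ t₀ le_rfl))] at h
    have h' := congrArg (fun z : EuclideanSpace ℝ (Fin m) => z i) h
    simpa [hi] using h'
  refine ⟨i, _, ?_, eq_smul_of_perp e.norm_dir hperp⟩
  by_contra hμ
  push Not at hμ
  set μ := e.dir.1 * (T.weight e.src i).1 + e.dir.2 * (T.weight e.src i).2
  have hsq : ∀ t ≤ t₀, HasDerivAt (fun t => φ (γ t) i ^ 2) (2 * μ * φ (γ t) i ^ 2) t := by
    intro t ht
    refine ((hcomp t ht i).pow 2).congr_deriv ?_
    push_cast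
    ring
  -- With a nonpositive rate the square of the coordinate would not increase with time, and could
  -- not tend to zero at `-∞` without vanishing.
  have hanti : AntitoneOn (fun t => φ (γ t) i ^ 2) (Set.Iic t₀) := by
    refine antitoneOn_of_deriv_nonpos (convex_Iic _)
      (fun t ht => (hsq t ht).continuousAt.continuousWithinAt)
      (fun t ht => (hsq t (interior_subset (s := Set.Iic t₀) ht)).differentiableAt.differentiableWithinAt) ?_
    intro t ht
    rw [(hsq t (interior_subset (s := Set.Iic t₀) ht)).deriv]
    nlinarith [sq_nonneg (φ (γ t) i)]
  have hlim : Filter.Tendsto (fun t => φ (γ t) i ^ 2) Filter.atBot (𝓝 0) := by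
    have h := (φ.continuousAt hp).tendsto.comp h5
    have h' := ((EuclideanSpace.proj (𝕜 := ℝ) i :
      EuclideanSpace ℝ (Fin m) →L[ℝ] ℝ).continuous.tendsto _).comp h
    have h'' := h'.pow 2
    rw [h0] at h''
    simpa using h''
  have : φ (γ t₀) i ^ 2 ≤ 0 := by
    refine ge_of_tendsto hlim ?_
    filter_upwards [Filter.eventually_le_atBot t₀] with t ht
    exact hanti (Set.mem_Iic.2 ht) (Set.mem_Iic.2 le_rfl) ht
  exact hi (by nlinarith [sq_nonneg (φ (γ t₀) i)])

theorem oneDimAt_of_perp {d : ℝ × ℝ} (hd : d.1 ^ 2 + d.2 ^ 2 = 1) {x : M}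
    (hx : T.comb (d.2, -d.1) x = 0) (hx' : T.comb d x ≠ 0) : OneDimAt T.v T.w x := by
  have hv := T.comb_eq_smul hd hx (1, 0)
  have hw := T.comb_eq_smul hd hx (0, 1)
  simp only [combField, one_smul, zero_smul, add_zero, one_mul, zero_mul, zero_add] at hv hw
  have : Submodule.span ℝ {T.v x, T.w x} = Submodule.span ℝ {T.comb d x} := by
    refine le_antisymm (Submodule.span_le.2 ?_) (Submodule.span_le.2 ?_)
    · rintro _ (rfl | rfl)
      · rw [SetLike.mem_coe, Submodule.mem_span_singleton]; exact ⟨_, hv.symm⟩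
      · rw [SetLike.mem_coe, Submodule.mem_span_singleton]; exact ⟨_, hw.symm⟩
    · rintro _ rfl
      exact Submodule.add_mem _ (Submodule.smul_mem _ _ (Submodule.subset_span (by simp)))
        (Submodule.smul_mem _ _ (Submodule.subset_span (by simp)))
  rw [OneDimAt, this]
  exact finrank_span_singleton hx'

theorem contMDiff_one_comb (d : ℝ × ℝ) : ContMDiff (𝓡 m) (𝓡 m).tangent 1
    (fun x => (⟨x, T.comb d x⟩ : TangentBundle (𝓡 m) M)) :=
  (T.smooth_comb d).of_le (by exact_mod_cast le_top)

/-- All combinations of the fields are multiples of the one in direction `d` along the orbit, with a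
constant factor. A nonzero factor is a change of time; a zero factor gives a constant curve. -/
theorem exists_curve_of_mem_pairOrbit [T2Space M] {d : ℝ × ℝ} (hd : d.1 ^ 2 + d.2 ^ 2 = 1) {x y : M}
    (hx : T.comb (d.2, -d.1) x = 0) (hy : y ∈ pairOrbit T.v T.w x) :
    y = x ∨ ∃ γ, IsMIntegralCurve (I := 𝓡 m) γ (T.comb d) ∧ γ 0 = x ∧ ∃ s, γ s = y := by
  obtain ⟨d', γ, hγ, h0, h1⟩ := hy
  have hperp : ∀ t, T.comb (d.2, -d.1) (γ t) = 0 := fun t =>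
    eq_zero_of_commute (T.smooth_comb d') (T.smooth_comb _) (T.comb_commute _ _) hγ
      (t₀ := 0) (by rw [h0]; exact hx) t
  have hs := fun t => T.comb_eq_smul hd (hperp t) d'
  by_cases hk : d'.1 * d.1 + d'.2 * d.2 = 0
  · left
    have hc : IsMIntegralCurve (I := 𝓡 m) (fun _ => x) (T.comb d') := by
      refine isMIntegralCurve_const ?_
      rw [← h0, hs 0, hk, zero_smul]
    have := isMIntegralCurve_Ioo_eq_of_contMDiff_boundaryless (t₀ := 0)
      (T.contMDiff_one_comb d') hγ hc h0
    rw [← h1, this]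
  · right
    refine ⟨γ ∘ (· * (d'.1 * d.1 + d'.2 * d.2)⁻¹), ?_, by simp [h0],
      (d'.1 * d.1 + d'.2 * d.2), by simp [hk, h1]⟩
    intro t
    have h := hγ.comp_mul (d'.1 * d.1 + d'.2 * d.2)⁻¹ t
    have e : ((d'.1 * d.1 + d'.2 * d.2)⁻¹ • combField T.v T.w d') (γ (t * (d'.1 * d.1 + d'.2 * d.2)⁻¹)) =
        T.comb d (γ (t * (d'.1 * d.1 + d'.2 * d.2)⁻¹)) := by
      rw [Pi.smul_apply]
      change _ • T.comb d' _ = _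
      rw [hs, smul_smul, inv_mul_cancel₀ hk, one_smul]
    have h' := h
    simp only [Function.comp] at h' ⊢
    rw [e] at h'
    exact h'

/-- The orbit is a single gradient curve, by uniqueness of integral curves, and the potential
increases strictly along it. A circle therefore cannot lie in such an orbit. -/
theorem combFun_injOn_pairOrbit [T2Space M] {d : ℝ × ℝ} (hd : d.1 ^ 2 + d.2 ^ 2 = 1) {x : M}
    (hx : T.comb (d.2, -d.1) x = 0) (hx' : T.comb d x ≠ 0) :
    Set.InjOn (T.combFun d) (pairOrbit T.v T.w x) := by
  have hmono : ∀ γ, IsMIntegralCurve (I := 𝓡 m) γ (T.comb d) → γ 0 = x →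
      StrictMono fun t => T.combFun d (γ t) := by
    intro γ hγ h0
    refine T.strictMono_combFun hd hγ (fun t => ?_) (fun t ht => ?_)
    · exact eq_zero_of_commute (T.smooth_comb d) (T.smooth_comb _) (T.comb_commute _ _) hγ
        (t₀ := 0) (by rw [h0]; exact hx) t
    · exact hx' (h0 ▸ eq_zero_of_commute (T.smooth_comb d) (T.smooth_comb _)
        (T.comb_commute _ _) hγ (t₀ := t) ht 0)
  intro y hy z hz hyz
  rcases T.exists_curve_of_mem_pairOrbit hd hx hy with rfl | ⟨γ, hγ, h0, s, rfl⟩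
  · rcases T.exists_curve_of_mem_pairOrbit hd hx hz with rfl | ⟨γ', hγ', h0', s', rfl⟩
    · rfl
    · rw [← h0'] at hyz
      rw [← h0', (hmono γ' hγ' h0').injective hyz]
  · rcases T.exists_curve_of_mem_pairOrbit hd hx hz with rfl | ⟨γ', hγ', h0', s', rfl⟩
    · rw [← h0] at hyz
      rw [(hmono γ hγ h0).injective hyz, h0]
    · have := isMIntegralCurve_Ioo_eq_of_contMDiff_boundaryless (t₀ := 0)
        (T.contMDiff_one_comb d) hγ hγ' (by rw [h0, h0'])
      subst this
      rw [(hmono γ hγ h0).injective hyz]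

end TwoMorse
end

/-! ### Characters on a ray -/

noncomputable section

namespace TwoMorse

variable {m : ℕ} {M : Type*} [TopologicalSpace M] [ChartedSpace (EuclideanSpace ℝ (Fin m)) M]
  [IsManifold (𝓡 m) ∞ M] (T : TwoMorse m M)

theorem mfderiv_symm_chartField {φ : OpenPartialHomeomorph M (EuclideanSpace ℝ (Fin m))}
    (hφ : φ ∈ IsManifold.maximalAtlas (𝓡 m) ∞ M) (V : ∀ x : M, TangentSpace (𝓡 m) x)
    {y : EuclideanSpace ℝ (Fin m)} (hy : y ∈ φ.target) :
    mfderiv (𝓡 m) (𝓡 m) φ.symm y (chartField φ V y) = V (φ.symm y) := by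
  obtain ⟨L, hL⟩ := isInvertible_mfderiv_symm hφ hy
  rw [chartField, VectorField.mpullback_apply, ← hL, ContinuousLinearMap.inverse_equiv]
  simp

/-- At most one character lies on a given ray. -/
theorem weight_onRay_unique [T2Space M] (p : T.CriticalPoint) {d : ℝ × ℝ}
    (hd : d.1 ^ 2 + d.2 ^ 2 = 1) {i j : Fin m} (hi : OnRay d (T.weight p i))
    (hj : OnRay d (T.weight p j)) : i = j := by
  by_contra hij
  obtain ⟨φ, hφ, hp, h0, hlin⟩ := T.exists_linearizing_chart p
  obtain ⟨-, h2⟩ := tendsto_symm_single hp h0 i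
  obtain ⟨δ, hδt, hδ⟩ := ((h2.filter_mono nhdsWithin_le_nhds).and
    (self_mem_nhdsWithin (a := (0 : ℝ)) (s := Set.Ioi 0))).exists
  replace hδ : 0 < δ := hδ
  obtain ⟨a, ha, hwi⟩ := hi
  obtain ⟨b, hb, hwj⟩ := hj
  have hd' : d.1 * d.1 + d.2 * d.2 = 1 := by rw [← hd]; ring
  -- the field along the coordinate plane
  have hperp : ∀ s t : ℝ, EuclideanSpace.single i s + EuclideanSpace.single j t ∈ φ.target →
      T.comb (d.2, -d.1) (φ.symm (EuclideanSpace.single i s + EuclideanSpace.single j t)) = 0 := by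
    intro s t h
    rw [← chartField_eq_zero_iff hφ _ (φ.map_target h), φ.right_inv h, hlin _ _ h]
    ext k
    by_cases hki : k = i
    · subst hki; simp only [hwi, Prod.smul_fst, Prod.smul_snd, smul_eq_mul, PiLp.zero_apply]; ring
    by_cases hkj : k = j
    · subst hkj; simp only [hwj, Prod.smul_fst, Prod.smul_snd, smul_eq_mul, PiLp.zero_apply]; ring
    simp [hki, hkj]
  have hnz : ∀ s t : ℝ, 0 < s → EuclideanSpace.single i s + EuclideanSpace.single j t ∈ φ.target →
      T.comb d (φ.symm (EuclideanSpace.single i s + EuclideanSpace.single j t)) ≠ 0 := by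
    intro s t hs h hz
    rw [← chartField_eq_zero_iff hφ _ (φ.map_target h), φ.right_inv h, hlin _ _ h] at hz
    have hz' := congrArg (fun z : EuclideanSpace ℝ (Fin m) => z i) hz
    simp [hwi, hij, hs.ne'] at hz'
    have : a * (d.1 * d.1 + d.2 * d.2) = 0 := by linear_combination hz'
    rw [hd', mul_one] at this
    exact ha.ne' this
  set z₀ : EuclideanSpace ℝ (Fin m) := EuclideanSpace.single i δ + EuclideanSpace.single j 0 with hz₀
  have hz₀t : z₀ ∈ φ.target := by
    rw [hz₀, show (EuclideanSpace.single j (0 : ℝ) : EuclideanSpace ℝ (Fin m)) = 0 by ext; simp,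
      add_zero]
    exact hδt
  have hone := T.oneDimAt_of_perp hd (hperp _ _ hz₀t) (hnz _ _ hδ hz₀t)
  have hiso := (φ.continuousAt_symm hz₀t).eventually (T.isolated_edges _ hone)
  obtain ⟨r, hr, hball⟩ := Metric.eventually_nhds_iff.1
    (hiso.and (φ.open_target.mem_nhds hz₀t))
  obtain ⟨ρ, hρ, hρδ, hρr⟩ : ∃ ρ : ℝ, 0 < ρ ∧ ρ < δ ∧ 2 * ρ < r :=
    ⟨min (δ / 2) (r / 4), lt_min (by linarith) (by linarith),
      lt_of_le_of_lt (min_le_left _ _) (by linarith),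
      by have := min_le_right (δ / 2) (r / 4); linarith⟩
  -- Two characters on one ray would make a half-plane of the chart consist of one-dimensional
  -- orbits. By isolation, a small circle around a point of it lies in a single orbit.
  let q : ℝ → EuclideanSpace ℝ (Fin m) := fun θ =>
    EuclideanSpace.single i (δ + ρ * Real.cos θ) + EuclideanSpace.single j (ρ * Real.sin θ)
  have hqd : ∀ θ, dist (q θ) z₀ < r := by
    intro θ
    have e : q θ - z₀ = EuclideanSpace.single i (ρ * Real.cos θ) +
        EuclideanSpace.single j (ρ * Real.sin θ) := by
      ext k
      simp only [q, hz₀, PiLp.sub_apply, PiLp.add_apply, PiLp.single_apply]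
      split_ifs <;> ring
    rw [dist_eq_norm, e]
    refine lt_of_le_of_lt (norm_add_le _ _) (lt_of_le_of_lt ?_ hρr)
    rw [PiLp.norm_single, PiLp.norm_single, norm_mul, norm_mul,
      Real.norm_of_nonneg hρ.le]
    have h1 := Real.abs_cos_le_one θ
    have h2 := Real.abs_sin_le_one θ
    simp only [Real.norm_eq_abs]
    nlinarith
  have hqt : ∀ θ, q θ ∈ φ.target := fun θ => (hball (hqd θ)).2
  have hpos : ∀ θ, 0 < δ + ρ * Real.cos θ := fun θ => by
    have := Real.neg_one_le_cos θ
    nlinarith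
  have horb : ∀ θ, φ.symm (q θ) ∈ pairOrbit T.v T.w (φ.symm z₀) := fun θ =>
    (hball (hqd θ)).1 (T.oneDimAt_of_perp hd (hperp _ _ (hqt θ)) (hnz _ _ (hpos θ) (hqt θ)))
  have hinj := T.combFun_injOn_pairOrbit hd (hperp _ _ hz₀t) (hnz _ _ hδ hz₀t)
  have hqc : Continuous q := by
    have e : q = fun θ => (δ + ρ * Real.cos θ) • EuclideanSpace.single i (1 : ℝ) +
        (ρ * Real.sin θ) • EuclideanSpace.single j (1 : ℝ) := by
      ext θ k; simp [q]
    rw [e]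
    fun_prop
  have hF : Continuous fun θ => T.combFun d (φ.symm (q θ)) :=
    (T.smooth_combFun d).continuous.comp
      (φ.continuousOn_symm.comp_continuous hqc hqt)
  -- The difference of the potential at antipodal points of the circle changes sign, so two
  -- antipodal points have the same potential, against injectivity on the orbit.
  let g : ℝ → ℝ := fun θ => T.combFun d (φ.symm (q θ)) - T.combFun d (φ.symm (q (θ + Real.pi)))
  have hg : Continuous g := hF.sub (hF.comp (continuous_id.add continuous_const))
  have hper : q (0 + Real.pi + Real.pi) = q 0 := by
    simp [q, Real.cos_add_pi, Real.sin_add_pi]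
  have hgpi : g (0 + Real.pi) = - g 0 := by
    simp only [g, hper]; ring
  obtain ⟨θ, hθ⟩ : ∃ θ, g θ = 0 := by
    rcases le_total (g 0) 0 with h | h
    · exact mem_range_of_exists_le_of_exists_ge hg ⟨0, h⟩ ⟨0 + Real.pi, by rw [hgpi]; linarith⟩
    · exact mem_range_of_exists_le_of_exists_ge hg ⟨0 + Real.pi, by rw [hgpi]; linarith⟩ ⟨0, h⟩
  have heq := hinj (horb θ) (horb (θ + Real.pi)) (sub_eq_zero.1 hθ)
  have heq' : q θ = q (θ + Real.pi) := φ.symm.injOn (hqt θ) (hqt _) heq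
  have e1 := congrArg (fun z : EuclideanSpace ℝ (Fin m) => z i) heq'
  have e2 := congrArg (fun z : EuclideanSpace ℝ (Fin m) => z j) heq'
  have hji : j ≠ i := fun h => hij h.symm
  simp [q, hij, hji, Real.cos_add_pi, Real.sin_add_pi] at e1 e2
  have c0 : ρ * Real.cos θ = 0 := by linarith
  have s0 : ρ * Real.sin θ = 0 := by linarith
  have := Real.sin_sq_add_cos_sq θ
  rcases mul_eq_zero.1 c0 with h | h
  · exact hρ.ne' h
  rcases mul_eq_zero.1 s0 with h' | h'
  · exact hρ.ne' h'
  rw [h, h'] at this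
  norm_num at this

/-- A character on a ray gives a critical point in the direction of this ray. -/
theorem exists_criticalPoint_of_weight [CompactSpace M] (p : T.CriticalPoint)
    {d : ℝ × ℝ} (hd : d.1 ^ 2 + d.2 ^ 2 = 1) {i : Fin m} (hi : OnRay d (T.weight p i)) :
    ∃ q : T.CriticalPoint, ∃ c : ℝ, 0 < c ∧ T.pos q - T.pos p = c • d := by
  obtain ⟨φ, hφ, hp, h0, hlin⟩ := T.exists_linearizing_chart p
  obtain ⟨a, ha, hwi⟩ := hi
  have hd' : d.1 * d.1 + d.2 * d.2 = 1 := by rw [← hd]; ring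
  obtain ⟨-, h2⟩ := tendsto_symm_single hp h0 i
  obtain ⟨r, hr, hball⟩ := Metric.eventually_nhds_iff.1 h2
  -- The coordinate axis of the character: near the critical point the potential along `d` grows on
  -- it and the perpendicular potential is constant.
  let ζ : ℝ → M := fun s => φ.symm (EuclideanSpace.single i s)
  have htar : ∀ s, |s| < r → EuclideanSpace.single i s ∈ φ.target := fun s hs =>
    hball (by simpa using hs)
  have hperp : ∀ s, |s| < r → T.comb (d.2, -d.1) (ζ s) = 0 := by
    intro s hs
    have h := htar s hs
    rw [← chartField_eq_zero_iff hφ _ (φ.map_target h), φ.right_inv h, hlin _ _ h]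
    ext k
    by_cases hki : k = i
    · subst hki; simp only [hwi, Prod.smul_fst, Prod.smul_snd, smul_eq_mul, PiLp.zero_apply]; ring
    simp [hki]
  have hder : ∀ s, |s| < r → ∃ k : ℝ, 0 < k ∧ ∀ d' : ℝ × ℝ,
      HasDerivAt (fun s => T.combFun d' (ζ s)) ((d'.1 * d.1 + d'.2 * d.2) * (a * s * k)) s := by
    intro s hs
    have h := htar s hs
    have hmd := mdifferentiable_of_mem_maximalAtlas_infty hφ
    have hsingle : HasFDerivAt (fun s : ℝ => (EuclideanSpace.single i s : EuclideanSpace ℝ (Fin m)))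
        ((1 : ℝ →L[ℝ] ℝ).smulRight (EuclideanSpace.single i (1 : ℝ))) s := by
      have e : (fun s : ℝ => (EuclideanSpace.single i s : EuclideanSpace ℝ (Fin m))) =
          fun s : ℝ => ((1 : ℝ →L[ℝ] ℝ).smulRight (EuclideanSpace.single i (1 : ℝ))) s := by
        ext s k; simp
      rw [e]
      exact ContinuousLinearMap.hasFDerivAt _
    set u : TangentSpace (𝓡 m) (ζ s) := mfderiv (𝓡 m) (𝓡 m) φ.symm (EuclideanSpace.single i s)
      (EuclideanSpace.single i (1 : ℝ) : EuclideanSpace ℝ (Fin m)) with hu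
    have hζ : HasMFDerivAt 𝓘(ℝ, ℝ) (𝓡 m) ζ s ((1 : ℝ →L[ℝ] ℝ).smulRight u) := by
      have h1 := (hmd.symm.mdifferentiableAt h).hasMFDerivAt.comp s hsingle.hasMFDerivAt
      refine h1.congr_mfderiv ?_
      ext
      exact map_smul (mfderiv (𝓡 m) (𝓡 m) φ.symm (EuclideanSpace.single i s)) (1 : ℝ)
        (EuclideanSpace.single i (1 : ℝ) : EuclideanSpace ℝ (Fin m))
    have hune : u ≠ 0 := by
      intro h0'
      have h1 := hmd.symm.mfderiv_injective h (a₁ := (EuclideanSpace.single i (1 : ℝ) :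
        EuclideanSpace ℝ (Fin m))) (a₂ := (0 : EuclideanSpace ℝ (Fin m)))
        (h0'.trans (map_zero (mfderiv (𝓡 m) (𝓡 m) φ.symm (EuclideanSpace.single i s))).symm)
      have := congrArg (fun z : EuclideanSpace ℝ (Fin m) => z i) h1
      simp at this
    have hcu : T.comb d (ζ s) = (a * s) • u := by
      rw [← mfderiv_symm_chartField hφ (T.comb d) h, hlin _ _ h, hu]
      refine Eq.trans ?_ (map_smul (mfderiv (𝓡 m) (𝓡 m) φ.symm (EuclideanSpace.single i s)) (a * s)
        (EuclideanSpace.single i (1 : ℝ) : EuclideanSpace ℝ (Fin m)))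
      refine congrArg (mfderiv (𝓡 m) (𝓡 m) φ.symm (EuclideanSpace.single i s)) ?_
      refine PiLp.ext fun k => ?_
      by_cases hki : k = i
      · subst hki
        simp only [hwi, Prod.smul_fst, Prod.smul_snd, smul_eq_mul, PiLp.single_apply, if_true,
          PiLp.smul_apply]
        linear_combination a * s * hd'
      · simp [hki]
    refine ⟨_, T.metric.pos (ζ s) u hune, fun d' => ?_⟩
    refine (T.hasDerivAt_combFun d' hζ).congr_deriv ?_
    rw [T.comb_eq_smul hd (hperp s hs) d', hcu, map_smul, map_smul]
    change (d'.1 * d.1 + d'.2 * d.2) * ((a * s) * T.metric.inner (ζ s) u u) = _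
    ring
  have hζ0 : ζ 0 = p.1 := by
    simp only [ζ]
    rw [show (EuclideanSpace.single i (0 : ℝ) : EuclideanSpace ℝ (Fin m)) = 0 by ext; simp, ← h0,
      φ.left_inv hp]
  have hr2 : ∀ s ∈ Set.Icc 0 (r / 2), |s| < r := fun s hs => by
    rw [abs_of_nonneg hs.1]; linarith [hs.2]
  have hcont : ∀ d', ContinuousOn (fun s => T.combFun d' (ζ s)) (Set.Icc 0 (r / 2)) :=
    fun d' s hs => by
      obtain ⟨k, -, hk⟩ := hder s (hr2 s hs)
      exact (hk d').continuousAt.continuousWithinAt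
  have hinc : T.combFun d (ζ 0) < T.combFun d (ζ (r / 2)) := by
    refine strictMonoOn_of_deriv_pos (convex_Icc 0 (r / 2)) (hcont d) ?_
      (Set.left_mem_Icc.2 (by linarith)) (Set.right_mem_Icc.2 (by linarith)) (by linarith)
    intro s hs
    rw [interior_Icc] at hs
    obtain ⟨k, hk0, hk⟩ := hder s (hr2 s (Set.Ioo_subset_Icc_self hs))
    rw [(hk d).deriv, hd', one_mul]
    have := hs.1
    positivity
  have hconst : T.combFun (d.2, -d.1) (ζ (r / 2)) = T.combFun (d.2, -d.1) (ζ 0) := by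
    refine (convex_Icc 0 (r / 2)).is_const_of_fderivWithin_eq_zero (𝕜 := ℝ)
      (f := fun s => T.combFun (d.2, -d.1) (ζ s)) ?_ ?_
      (Set.right_mem_Icc.2 (by linarith)) (Set.left_mem_Icc.2 (by linarith))
    · intro s hs
      obtain ⟨k, hk0, hk⟩ := hder s (hr2 s hs)
      exact (hk _).differentiableAt.differentiableWithinAt
    · intro s hs
      obtain ⟨k, hk0, hk⟩ := hder s (hr2 s hs)
      have h1 := (hk (d.2, -d.1)).hasFDerivAt.hasFDerivWithinAt (s := Set.Icc 0 (r / 2))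
      rw [h1.fderivWithin ((uniqueDiffOn_Icc (by linarith)) s hs)]
      ext
      simp only [ContinuousLinearMap.toSpanSingleton_apply]
      simp
      left; ring
  set x₁ := ζ (r / 2)
  -- Instead of following the flow line to its limit, the potential is maximized on the zeros of the
  -- perpendicular field at the same perpendicular level and at least as high as `x₁`. At a maximum
  -- the field along `d` must vanish, since its flow stays in this set and raises the potential.
  have hK : IsCompact {x : M | T.comb (d.2, -d.1) x = 0 ∧
      T.combFun (d.2, -d.1) x = T.combFun (d.2, -d.1) p.1 ∧ T.combFun d x₁ ≤ T.combFun d x} := by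
    have hcl : IsClosed {x : M | T.comb (d.2, -d.1) x = 0} :=
      ⟨isOpen_ne_zero_of_contMDiff (T.smooth_comb (d.2, -d.1))⟩
    refine IsClosed.isCompact (hcl.inter (IsClosed.inter ?_ ?_))
    · exact isClosed_eq (T.smooth_combFun _).continuous continuous_const
    · exact isClosed_le continuous_const (T.smooth_combFun _).continuous
  obtain ⟨y, ⟨hy1, hy2, hy3⟩, hymax⟩ := hK.exists_isMaxOn
    ⟨x₁, hperp _ (hr2 _ (Set.right_mem_Icc.2 (by linarith))), by rw [hconst, hζ0], le_rfl⟩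
    (T.smooth_combFun d).continuous.continuousOn
  have hy0 : T.comb d y = 0 := by
    by_contra hne
    obtain ⟨γ, hγ0, hγ⟩ := exists_isMIntegralCurveAt_of_contMDiffAt_boundaryless (t₀ := (0 : ℝ))
      (T.contMDiff_one_comb d y)
    subst hγ0
    have hz := eventually_eq_zero_of_commute (T.smooth_comb d) (T.smooth_comb (d.2, -d.1))
      (T.comb_commute _ _) hγ hy1
    have hnz : ∀ᶠ t in 𝓝 0, T.comb d (γ t) ≠ 0 :=
      hγ.continuousAt.eventually ((isOpen_ne_zero_of_contMDiff (T.smooth_comb d)).mem_nhds hne)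
    obtain ⟨ε, hε, hev⟩ := Metric.eventually_nhds_iff.1 ((hz.and hnz).and hγ)
    have hmem : ∀ t ∈ Set.Icc 0 (ε / 2), dist t 0 < ε := fun t ht => by
      rw [dist_zero_right, Real.norm_of_nonneg ht.1]; linarith [ht.2]
    have hdr : ∀ t ∈ Set.Icc 0 (ε / 2), ∀ d', HasDerivAt (fun s => T.combFun d' (γ s))
        ((d'.1 * d.1 + d'.2 * d.2) * T.metric.inner (γ t) (T.comb d (γ t)) (T.comb d (γ t))) t :=
      fun t ht d' => T.hasDerivAt_combFun_of_perp hd d' (hev (hmem t ht)).1.1 (hev (hmem t ht)).2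
    have hl : (0 : ℝ) ∈ Set.Icc 0 (ε / 2) := Set.left_mem_Icc.2 (by linarith)
    have hr' : ε / 2 ∈ Set.Icc 0 (ε / 2) := Set.right_mem_Icc.2 (by linarith)
    have hlt : T.combFun d (γ 0) < T.combFun d (γ (ε / 2)) := by
      refine strictMonoOn_of_deriv_pos (convex_Icc 0 (ε / 2))
        (fun t ht => (hdr t ht d).continuousAt.continuousWithinAt) ?_ hl hr' (by linarith)
      intro t ht
      have ht' := interior_subset (s := Set.Icc 0 (ε / 2)) ht
      rw [(hdr t ht' d).deriv, hd', one_mul]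
      exact T.metric.pos _ _ (hev (hmem t ht')).1.2
    have hcst : T.combFun (d.2, -d.1) (γ (ε / 2)) = T.combFun (d.2, -d.1) (γ 0) := by
      refine (convex_Icc 0 (ε / 2)).is_const_of_fderivWithin_eq_zero (𝕜 := ℝ)
        (f := fun s => T.combFun (d.2, -d.1) (γ s))
        (fun t ht => (hdr t ht _).differentiableAt.differentiableWithinAt) ?_ hr' hl
      intro t ht
      have h1 := (hdr t ht (d.2, -d.1)).hasFDerivAt.hasFDerivWithinAt (s := Set.Icc 0 (ε / 2))
      rw [h1.fderivWithin ((uniqueDiffOn_Icc (by linarith)) t ht)]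
      ext
      simp only [ContinuousLinearMap.toSpanSingleton_apply]
      simp
      left; ring
    have := hymax (a := γ (ε / 2)) ⟨(hev (hmem _ hr')).1.1, hcst.trans hy2, hy3.trans hlt.le⟩
    exact absurd hlt (not_lt.2 this)
  obtain ⟨hv, hw⟩ := T.eq_zero_of_comb_eq_zero hd hy1 hy0
  refine ⟨⟨y, hv, hw⟩, _, ?_, T.pos_eq_of_combFun hd p ⟨y, hv, hw⟩ hy2⟩
  rw [hζ0] at hinc
  change 0 < T.combFun d y - _
  linarith

end TwoMorse
end

/-! ### Linearization along an edge and the characters at its ends -/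

noncomputable section

section Linearization

variable {m : ℕ} {M : Type*} [TopologicalSpace M] [ChartedSpace (EuclideanSpace ℝ (Fin m)) M]
  [IsManifold (𝓡 m) ∞ M]

/-- The trace of the `k`-th power of the linearization of a vector field in a chart. -/
def linTrace (φ : OpenPartialHomeomorph M (EuclideanSpace ℝ (Fin m)))
    (V : ∀ x : M, TangentSpace (𝓡 m) x) (k : ℕ) (x : M) : ℝ :=
  LinearMap.trace ℝ (EuclideanSpace ℝ (Fin m))
    ((fderiv ℝ (chartField φ V) (φ x) ^ k :
      EuclideanSpace ℝ (Fin m) →L[ℝ] EuclideanSpace ℝ (Fin m)) : _ →ₗ[ℝ] _)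

/-- In the derivative of the transformation rule, the second derivative of the coordinate change is
multiplied by the value of the field. At a zero only conjugation by the first derivative remains. -/
theorem linTrace_congr_chart {φ ψ : OpenPartialHomeomorph M (EuclideanSpace ℝ (Fin m))}
    (hφ : φ ∈ IsManifold.maximalAtlas (𝓡 m) ∞ M) (hψ : ψ ∈ IsManifold.maximalAtlas (𝓡 m) ∞ M)
    {V : ∀ x : M, TangentSpace (𝓡 m) x}
    (hV : ContMDiff (𝓡 m) (𝓡 m).tangent ∞ (fun x => (⟨x, V x⟩ : TangentBundle (𝓡 m) M)))
    (k : ℕ) {x : M} (hx : x ∈ φ.source) (hx' : x ∈ ψ.source) (h0 : V x = 0) :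
    linTrace φ V k x = linTrace ψ V k x := by
  have hdφ := mdifferentiable_of_mem_maximalAtlas_infty hφ
  have hdψ := mdifferentiable_of_mem_maximalAtlas_infty hψ
  set Ψ : EuclideanSpace ℝ (Fin m) → EuclideanSpace ℝ (Fin m) := ψ ∘ φ.symm with hΨ
  have hxφ := φ.map_source hx
  have hmem : ∀ᶠ y in 𝓝 (φ x), y ∈ φ.target ∧ φ.symm y ∈ ψ.source := by
    have h1 : ∀ᶠ y in 𝓝 (φ x), y ∈ φ.target := φ.open_target.mem_nhds hxφ
    refine h1.and ?_
    refine (φ.continuousAt_symm hxφ).eventually (ψ.open_source.mem_nhds ?_)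
    rwa [φ.left_inv hx]
  have hsmooth : ContDiffAt ℝ ∞ Ψ (φ x) := by
    rw [← contMDiffAt_iff_contDiffAt]
    refine ContMDiffAt.comp (φ x) (contMDiffAt_of_mem_maximalAtlas (x := φ.symm (φ x)) hψ ?_)
      (contMDiffAt_symm_of_mem_maximalAtlas hφ hxφ)
    rwa [φ.left_inv hx]
  have hrel : ∀ y, y ∈ φ.target → φ.symm y ∈ ψ.source →
      chartField ψ V (Ψ y) = fderiv ℝ Ψ y (chartField φ V y) := by
    intro y hy hy'
    have h1 : HasMFDerivAt (𝓡 m) (𝓡 m) Ψ y _ :=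
      (hdψ.mdifferentiableAt hy').hasMFDerivAt.comp y (hdφ.mdifferentiableAt_symm hy).hasMFDerivAt
    rw [← mfderiv_eq_fderiv, h1.mfderiv]
    have h2 := chartField_apply hψ V hy'
    have h3 := TwoMorse.mfderiv_symm_chartField hφ V hy
    refine h2.trans ?_
    exact congrArg (mfderiv (𝓡 m) (𝓡 m) ψ (φ.symm y)) h3.symm
  set A := fderiv ℝ (chartField φ V) (φ x) with hA
  set B := fderiv ℝ (chartField ψ V) (ψ x) with hB
  set L := fderiv ℝ Ψ (φ x) with hL
  have hΨx : Ψ (φ x) = ψ x := by simp [Ψ, φ.left_inv hx]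
  have hBL : B.comp L = L.comp A := by
    have h1 : HasFDerivAt (fun y => chartField ψ V (Ψ y)) (B.comp L) (φ x) := by
      refine HasFDerivAt.comp (φ x) ?_ (hsmooth.differentiableAt (by simp)).hasFDerivAt
      rw [hΨx]
      exact ((contDiffAt_chartField hψ hV (ψ.map_source hx')).differentiableAt
        (by simp)).hasFDerivAt
    have h2 : HasFDerivAt (fun y => fderiv ℝ Ψ y (chartField φ V y)) (L.comp A) (φ x) := by
      have h3 : DifferentiableAt ℝ (fderiv ℝ Ψ) (φ x) :=
        (hsmooth.fderiv_right (m := ∞) (by simp)).differentiableAt (by simp)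
      have h4 := h3.hasFDerivAt.clm_apply
        ((contDiffAt_chartField hφ hV hxφ).differentiableAt (by simp)).hasFDerivAt
      refine h4.congr_fderiv ?_
      rw [(chartField_eq_zero_iff hφ V hx).2 h0]
      ext; simp [hL, hA]
    refine (h1.congr_of_eventuallyEq ?_).unique h2
    filter_upwards [hmem] with y hy
    exact (hrel y hy.1 hy.2).symm
  obtain ⟨E, hE⟩ : ∃ E : EuclideanSpace ℝ (Fin m) ≃L[ℝ] EuclideanSpace ℝ (Fin m), (E : _ →L[ℝ] _) = L := by
    have hx2 : φ.symm (φ x) ∈ ψ.source := by rwa [φ.left_inv hx]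
    have h1 : HasMFDerivAt (𝓡 m) (𝓡 m) Ψ (φ x) _ :=
      (hdψ.mdifferentiableAt hx2).hasMFDerivAt.comp (φ x)
        (hdφ.mdifferentiableAt_symm hxφ).hasMFDerivAt
    refine ⟨(hdφ.symm.mfderiv hxφ).trans (hdψ.mfderiv hx2), ?_⟩
    rw [hL, ← mfderiv_eq_fderiv, h1.mfderiv]
    rfl
  have hpow : ∀ k : ℕ, (B ^ k).comp L = L.comp (A ^ k) := by
    intro k
    induction k with
    | zero => ext; simp
    | succ k ih =>
      calc (B ^ (k + 1)).comp L = (B ^ k).comp (B.comp L) := by rw [pow_succ]; rfl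
        _ = ((B ^ k).comp L).comp A := by rw [hBL]; rfl
        _ = L.comp (A ^ (k + 1)) := by rw [ih, pow_succ]; rfl
  have hconj : ((B ^ k : EuclideanSpace ℝ (Fin m) →L[ℝ] EuclideanSpace ℝ (Fin m)) : _ →ₗ[ℝ] _) =
      E.toLinearEquiv.conj ((A ^ k : EuclideanSpace ℝ (Fin m) →L[ℝ] EuclideanSpace ℝ (Fin m)) :
        _ →ₗ[ℝ] _) := by
    ext1 z
    have := congrArg (fun F : EuclideanSpace ℝ (Fin m) →L[ℝ] EuclideanSpace ℝ (Fin m) =>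
      F (E.symm z)) (hpow k)
    rw [← hE] at this
    have h2 : (B ^ k) (E (E.symm z)) = E ((A ^ k) (E.symm z)) := this
    rw [E.apply_symm_apply] at h2
    exact h2
  rw [linTrace, linTrace, ← hA, ← hB, hconj, LinearMap.trace_conj']

/-- The linearization along a curve of zeros satisfies a Lax equation. -/
theorem eventually_linTrace_eq {V W : ∀ x : M, TangentSpace (𝓡 m) x}
    (hV : ContMDiff (𝓡 m) (𝓡 m).tangent ∞ (fun x => (⟨x, V x⟩ : TangentBundle (𝓡 m) M)))
    (hW : ContMDiff (𝓡 m) (𝓡 m).tangent ∞ (fun x => (⟨x, W x⟩ : TangentBundle (𝓡 m) M)))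
    (hVW : ∀ x, VectorField.mlieBracket (𝓡 m) V W x = 0) {γ : ℝ → M}
    (hγ : IsMIntegralCurve (I := 𝓡 m) γ V) (h0 : ∀ t, W (γ t) = 0)
    {φ : OpenPartialHomeomorph M (EuclideanSpace ℝ (Fin m))}
    (hφ : φ ∈ IsManifold.maximalAtlas (𝓡 m) ∞ M) {t₀ : ℝ} (ht₀ : γ t₀ ∈ φ.source) (k : ℕ) :
    ∀ᶠ t in 𝓝 t₀, linTrace φ W k (γ t) = linTrace φ W k (γ t₀) := by
  set A : ℝ → EuclideanSpace ℝ (Fin m) →L[ℝ] EuclideanSpace ℝ (Fin m) :=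
    fun t => fderiv ℝ (chartField φ W) (φ (γ t)) with hA
  set C : ℝ → EuclideanSpace ℝ (Fin m) →L[ℝ] EuclideanSpace ℝ (Fin m) :=
    fun t => fderiv ℝ (chartField φ V) (φ (γ t)) with hC
  -- Differentiate `DW·V = DV·W` and use `W = 0` on the curve: the derivative of `DW` along `V` is
  -- the commutator of `DV` and `DW`.
  have hLax : ∀ t, γ t ∈ φ.source → HasDerivAt A (C t * A t - A t * C t) t := by
    intro t ht
    have hy := φ.map_source ht
    have hWs := contDiffAt_chartField hφ hW hy
    have hVs := contDiffAt_chartField hφ hV hy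
    have hW2 : DifferentiableAt ℝ (fderiv ℝ (chartField φ W)) (φ (γ t)) :=
      (hWs.fderiv_right (m := ∞) (by simp)).differentiableAt (by simp)
    have hV2 : DifferentiableAt ℝ (fderiv ℝ (chartField φ V)) (φ (γ t)) :=
      (hVs.fderiv_right (m := ∞) (by simp)).differentiableAt (by simp)
    have h1 := HasFDerivAt.comp_hasDerivAt t hW2.hasFDerivAt (hasDerivAt_chart_comp hφ ht (hγ t))
    refine h1.congr_deriv ?_
    have hl := hW2.hasFDerivAt.clm_apply (hVs.differentiableAt (by simp)).hasFDerivAt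
    have hr := hV2.hasFDerivAt.clm_apply (hWs.differentiableAt (by simp)).hasFDerivAt
    have heq := (hl.congr_of_eventuallyEq (f₁ := fun y => fderiv ℝ (chartField φ V) y
      (chartField φ W y)) (by
        filter_upwards [φ.open_target.mem_nhds hy] with z hz
        exact (chartField_commute hφ hV hW hVW hz).symm)).unique hr
    rw [(chartField_eq_zero_iff hφ W ht).2 (h0 t)] at heq
    have hsymm : IsSymmSndFDerivAt ℝ (chartField φ W) (φ (γ t)) :=
      hWs.isSymmSndFDerivAt (by
        rw [minSmoothness_of_isRCLikeNormedField]; exact WithTop.coe_le_coe.2 le_top)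
    ext1 ξ
    have h2 := congrArg (fun F : EuclideanSpace ℝ (Fin m) →L[ℝ] EuclideanSpace ℝ (Fin m) => F ξ) heq
    have h3 := hsymm.eq (chartField φ V (φ (γ t))) ξ
    simp only [add_apply, ContinuousLinearMap.comp_apply,
      ContinuousLinearMap.flip_apply, map_zero, add_zero] at h2
    simp only [sub_apply, mul_apply_eq_comp, hA, hC]
    rw [eq_sub_iff_add_eq, h3, add_comm]
    exact h2
  have hpow : ∀ k t, γ t ∈ φ.source →
      HasDerivAt (fun t => A t ^ k) (C t * A t ^ k - A t ^ k * C t) t := by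
    intro k t ht
    induction k with
    | zero => simpa using hasDerivAt_const t (1 : EuclideanSpace ℝ (Fin m) →L[ℝ] _)
    | succ k ih =>
      have h := ih.mul (hLax t ht)
      have e : (fun t => A t ^ (k + 1)) = (fun t => A t ^ k) * A := by
        funext t; exact pow_succ _ _
      rw [e]
      refine h.congr_deriv ?_
      rw [pow_succ]
      simp only [sub_mul, mul_sub, mul_assoc]
      abel
  let tr : (EuclideanSpace ℝ (Fin m) →L[ℝ] EuclideanSpace ℝ (Fin m)) →L[ℝ] ℝ :=
    LinearMap.toContinuousLinearMap
      ((LinearMap.trace ℝ (EuclideanSpace ℝ (Fin m))).comp (ContinuousLinearMap.coeLM ℝ))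
  have htr : ∀ F : EuclideanSpace ℝ (Fin m) →L[ℝ] EuclideanSpace ℝ (Fin m),
      tr F = LinearMap.trace ℝ (EuclideanSpace ℝ (Fin m)) (F : _ →ₗ[ℝ] _) := fun F => rfl
  -- Each power satisfies the same commutator equation, and commutators have trace zero.
  have hder : ∀ t, γ t ∈ φ.source → HasDerivAt (fun t => linTrace φ W k (γ t)) 0 t := by
    intro t ht
    have h := tr.hasFDerivAt.comp_hasDerivAt t (hpow k t ht)
    refine h.congr_deriv ?_
    rw [map_sub, htr, htr, sub_eq_zero]
    exact LinearMap.trace_mul_comm ℝ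
      (C t : EuclideanSpace ℝ (Fin m) →ₗ[ℝ] EuclideanSpace ℝ (Fin m))
      ((A t ^ k : EuclideanSpace ℝ (Fin m) →L[ℝ] EuclideanSpace ℝ (Fin m)) :
        EuclideanSpace ℝ (Fin m) →ₗ[ℝ] EuclideanSpace ℝ (Fin m))
  have hsrc : ∀ᶠ t in 𝓝 t₀, γ t ∈ φ.source :=
    hγ.continuous.continuousAt.preimage_mem_nhds (φ.open_source.mem_nhds ht₀)
  obtain ⟨r, hr, hball⟩ := Metric.eventually_nhds_iff_ball.1 hsrc
  filter_upwards [Metric.ball_mem_nhds t₀ hr] with t ht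
  refine (convex_ball t₀ r).is_const_of_fderivWithin_eq_zero (𝕜 := ℝ)
    (f := fun t => linTrace φ W k (γ t))
    (fun s hs => (hder s (hball s hs)).differentiableAt.differentiableWithinAt) ?_ ht
    (Metric.mem_ball_self hr)
  intro s hs
  rw [fderivWithin_of_isOpen Metric.isOpen_ball hs, (hder s (hball s hs)).hasFDerivAt.fderiv]
  ext; simp

end Linearization

/-- Equal power sums give equal sums of all polynomials. The polynomial used interpolates the
indicator function of `P` on the finitely many values. -/
theorem card_filter_eq_of_sum_pow_eq {n n' : ℕ} (a : Fin n → ℝ) (b : Fin n' → ℝ)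
    (h : ∀ k : ℕ, ∑ i, a i ^ k = ∑ i, b i ^ k) (P : ℝ → Prop) [DecidablePred P] :
    (Finset.univ.filter fun i => P (a i)).card = (Finset.univ.filter fun i => P (b i)).card := by
  have hpoly : ∀ Q : Polynomial ℝ, ∑ i, Q.eval (a i) = ∑ i, Q.eval (b i) := by
    intro Q
    simp only [Polynomial.eval_eq_sum, Polynomial.sum]
    rw [Finset.sum_comm, Finset.sum_comm (s := Finset.univ)]
    refine Finset.sum_congr rfl fun k _ => ?_
    rw [← Finset.mul_sum, ← Finset.mul_sum, h]
  classical
  set s : Finset ℝ := Finset.univ.image a ∪ Finset.univ.image b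
  have hinj : Set.InjOn (id : ℝ → ℝ) s := Function.injective_id.injOn
  have hval : ∀ x ∈ s, (Lagrange.interpolate s id (fun x => if P x then (1 : ℝ) else 0)).eval x =
      if P x then (1 : ℝ) else 0 := fun x hx => Lagrange.eval_interpolate_at_node _ hinj hx
  have := hpoly (Lagrange.interpolate s id (fun x => if P x then (1 : ℝ) else 0))
  rw [Finset.sum_congr rfl fun i _ => hval (a i) (by simp [s]),
    Finset.sum_congr rfl fun i _ => hval (b i) (by simp [s])] at this
  simp only [Finset.sum_boole] at this
  exact_mod_cast this

namespace TwoMorse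

variable {m : ℕ} {M : Type*} [TopologicalSpace M] [ChartedSpace (EuclideanSpace ℝ (Fin m)) M]
  [IsManifold (𝓡 m) ∞ M] {T : TwoMorse m M}

theorem linTrace_comb_of_linearizing {p : T.CriticalPoint}
    {φ : OpenPartialHomeomorph M (EuclideanSpace ℝ (Fin m))}
    (d : ℝ × ℝ) (hlin : ∀ y ∈ φ.target, chartField φ (T.comb d) y =
        WithLp.toLp 2 (fun i => (d.1 * (T.weight p i).1 + d.2 * (T.weight p i).2) * y i))
    {x : M} (hx : x ∈ φ.source) (k : ℕ) :
    linTrace φ (T.comb d) k x =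
      ∑ i, (d.1 * (T.weight p i).1 + d.2 * (T.weight p i).2) ^ k := by
  set μ : Fin m → ℝ := fun i => d.1 * (T.weight p i).1 + d.2 * (T.weight p i).2
  let D : EuclideanSpace ℝ (Fin m) →ₗ[ℝ] EuclideanSpace ℝ (Fin m) :=
    { toFun := fun y => WithLp.toLp 2 (fun i => μ i * y i)
      map_add' := fun y z => by ext i; simp [mul_add]
      map_smul' := fun c y => by ext i; simp; ring }
  have h1 : HasFDerivAt (chartField φ (T.comb d)) (LinearMap.toContinuousLinearMap D) (φ x) := by
    refine (LinearMap.toContinuousLinearMap D).hasFDerivAt.congr_of_eventuallyEq ?_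
    filter_upwards [φ.open_target.mem_nhds (φ.map_source hx)] with y hy
    exact hlin y hy
  rw [linTrace, h1.fderiv]
  have h2 : ∀ k : ℕ, ∀ y : EuclideanSpace ℝ (Fin m),
      (LinearMap.toContinuousLinearMap D ^ k) y = WithLp.toLp 2 (fun i => μ i ^ k * y i) := by
    intro k
    induction k with
    | zero => intro y; ext i; simp
    | succ k ih =>
      intro y
      rw [pow_succ]
      change (LinearMap.toContinuousLinearMap D ^ k) (D y) = _
      rw [ih]
      ext i
      simp [D, pow_succ, mul_assoc]
  rw [LinearMap.trace_eq_matrix_trace ℝ (EuclideanSpace.basisFun (Fin m) ℝ).toBasis, Matrix.trace]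
  refine Finset.sum_congr rfl fun i _ => ?_
  simp only [Matrix.diag_apply, LinearMap.toMatrix_apply, ContinuousLinearMap.coe_coe, h2]
  simp [μ]

open Classical in
/-- The number of characters with a given pairing with the normal of an edge is the same at the
two ends of the edge. -/
theorem OrientedEdge.card_weight_eq (e : T.OrientedEdge) (P : ℝ → Prop) :
    (Finset.univ.filter fun i => P (planeDet e.dir (T.weight e.src i))).card =
      (Finset.univ.filter fun i => P (planeDet e.dir (T.weight e.tgt i))).card := by
  obtain ⟨γ, h1, h2, h3, h4, h5, h6⟩ := e.exists_curve
  refine card_filter_eq_of_sum_pow_eq _ _ (fun k => ?_) P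
  have hchart := fun x : M => IsManifold.chart_mem_maximalAtlas (n := ∞) (I := 𝓡 m) x
  set d : ℝ × ℝ := (-e.dir.2, e.dir.1)
  have h3' : ∀ t, T.comb d (γ t) = 0 := fun t => by
    have : d = -(e.dir.2, -e.dir.1) := by simp [d]
    change combField T.v T.w d (γ t) = 0
    rw [this, combField_neg, Pi.smul_apply, h3 t, smul_zero]
  -- Since the trace does not depend on the chart, it can be followed with moving charts along the
  -- whole edge. In the linearizing charts at the two ends it is a power sum of the pairings of the
  -- characters with the normal.
  let τ : ℝ → ℝ := fun t => linTrace (chartAt (EuclideanSpace ℝ (Fin m)) (γ t)) (T.comb d) k (γ t)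
  have hτ : ∀ t, ∀ φ ∈ IsManifold.maximalAtlas (𝓡 m) ∞ M, γ t ∈ φ.source →
      τ t = linTrace φ (T.comb d) k (γ t) := fun t φ hφ ht =>
    linTrace_congr_chart (hchart _) hφ (T.smooth_comb d) k (mem_chart_source _ _) ht (h3' t)
  have hloc : IsLocallyConstant τ := by
    rw [IsLocallyConstant.iff_eventually_eq]
    intro t₀
    have hs : γ t₀ ∈ (chartAt (EuclideanSpace ℝ (Fin m)) (γ t₀)).source := mem_chart_source _ _
    filter_upwards [eventually_linTrace_eq (T.smooth_comb e.dir) (T.smooth_comb d)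
      (T.comb_commute _ _) h1 h3' (hchart _) hs k,
      h1.continuous.continuousAt.preimage_mem_nhds
        ((chartAt (EuclideanSpace ℝ (Fin m)) (γ t₀)).open_source.mem_nhds hs)] with t ht hts
    rw [hτ t _ (hchart _) hts, ht]
  have hend : ∀ (p : T.CriticalPoint) (t : Filter ℝ) [t.NeBot], Filter.Tendsto γ t (𝓝 p.1) →
      ∃ s, τ s = ∑ i, planeDet e.dir (T.weight p i) ^ k := by
    intro p l _ hl
    obtain ⟨φ, hφ, hp, h0, hlin⟩ := T.exists_linearizing_chart p
    obtain ⟨s, hs⟩ := (hl.eventually (φ.open_source.mem_nhds hp)).exists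
    refine ⟨s, ?_⟩
    rw [hτ s φ hφ hs, linTrace_comb_of_linearizing d (hlin d) hs]
    refine Finset.sum_congr rfl fun i _ => ?_
    simp only [planeDet, d]
    ring
  obtain ⟨s, hs⟩ := hend e.src _ h5
  obtain ⟨t, ht⟩ := hend e.tgt _ h6
  rw [← hs, ← ht]
  exact hloc.apply_eq_of_isPreconnected isPreconnected_univ (Set.mem_univ _) (Set.mem_univ _)

end TwoMorse
end

noncomputable section

open scoped Classical

/-! ### Plane graphs and their convex cycles -/

theorem planeDet_smul_left (c : ℝ) (x y : ℝ × ℝ) : planeDet (c • x) y = c * planeDet x y := by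
  simp only [planeDet, Prod.smul_fst, Prod.smul_snd, smul_eq_mul]; ring

theorem planeDet_swap (x y : ℝ × ℝ) : planeDet x y = -planeDet y x := by
  simp only [planeDet]; ring

/-- Two vectors with positive determinant are a basis; Cramer's rule. -/
theorem planeDet_smul_eq (x y z : ℝ × ℝ) :
    planeDet x y • z = planeDet z y • x + planeDet x z • y := by
  ext <;> simp only [planeDet, Prod.fst_add, Prod.snd_add, Prod.smul_fst, Prod.smul_snd,
    smul_eq_mul] <;> ring

/-- A graph in the plane, with oriented edges, whose vertices are in general position. -/
structure PlaneGraph (V E : Type*) where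
  pos : V → ℝ × ℝ
  src : E → V
  tgt : E → V
  rev : E → E
  rev_rev : ∀ e, rev (rev e) = e
  src_rev : ∀ e, src (rev e) = tgt e
  src_ne_tgt : ∀ e, src e ≠ tgt e
  fst_ne : ∀ p q, p ≠ q → (pos p).1 ≠ (pos q).1
  not_collinear : ∀ a b c, a ≠ b → a ≠ c → b ≠ c → planeDet (pos b - pos a) (pos c - pos a) ≠ 0

namespace PlaneGraph

variable {V E : Type*} (G : PlaneGraph V E)

/-- The vector of an edge. -/
def vec (e : E) : ℝ × ℝ := G.pos (G.tgt e) - G.pos (G.src e)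

/-- The affine function vanishing on the line of an edge and positive to its left. -/
def side (e : E) (q : ℝ × ℝ) : ℝ := planeDet (G.vec e) (q - G.pos (G.src e))

theorem tgt_rev (e : E) : G.tgt (G.rev e) = G.src e := by
  rw [← G.src_rev, G.rev_rev]

theorem rev_injective : Function.Injective G.rev :=
  Function.LeftInverse.injective G.rev_rev

theorem vec_rev (e : E) : G.vec (G.rev e) = -G.vec e := by
  simp [vec, G.tgt_rev, G.src_rev]

@[simp] theorem side_src (e : E) : G.side e (G.pos (G.src e)) = 0 := by
  simp [side, planeDet]

@[simp] theorem side_tgt (e : E) : G.side e (G.pos (G.tgt e)) = 0 := by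
  simp only [side, vec, planeDet, Prod.fst_sub, Prod.snd_sub]; ring

theorem side_rev (e : E) (q : ℝ × ℝ) : G.side (G.rev e) q = -G.side e q := by
  simp only [side, vec, planeDet, G.tgt_rev, G.src_rev, Prod.fst_sub, Prod.snd_sub]; ring

theorem side_eq_zero {e : E} {p : V} (h : G.side e (G.pos p) = 0) : p = G.src e ∨ p = G.tgt e := by
  by_contra! hp
  exact G.not_collinear _ _ _ (G.src_ne_tgt e) hp.1.symm hp.2.symm h

theorem pos_injective : Function.Injective G.pos := fun p q h => by
  by_contra hpq
  exact G.fst_ne p q hpq (by rw [h])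

theorem vec_ne_zero (e : E) : G.vec e ≠ 0 := fun h =>
  G.src_ne_tgt e (G.pos_injective (sub_eq_zero.1 h).symm)

theorem side_sub_side (e : E) (q q' : ℝ × ℝ) :
    G.side e q' - G.side e q = planeDet (G.vec e) (q' - q) := by
  simp only [side, planeDet, Prod.fst_sub, Prod.snd_sub]; ring

/-- The boundary of a convex polygon, oriented counterclockwise. -/
structure IsFrame (U : Finset E) : Prop where
  nonempty : U.Nonempty
  exists_next : ∀ e ∈ U, ∃ e' ∈ U, G.src e' = G.tgt e
  src_inj : ∀ e ∈ U, ∀ e' ∈ U, G.src e = G.src e' → e = e'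
  side_nonneg : ∀ e ∈ U, ∀ e' ∈ U, 0 ≤ G.side e (G.pos (G.src e'))
  no_digon : ∀ e ∈ U, ∀ e' ∈ U, G.src e' = G.tgt e → G.tgt e' ≠ G.src e

namespace IsFrame

variable {G} {U : Finset E} (hU : G.IsFrame U)
include hU

theorem side_pos {e e' : E} (he : e ∈ U) (he' : e' ∈ U) (h1 : G.src e' ≠ G.src e)
    (h2 : G.src e' ≠ G.tgt e) : 0 < G.side e (G.pos (G.src e')) :=
  (hU.side_nonneg e he e' he').lt_of_ne fun h => by
    rcases G.side_eq_zero h.symm with h | h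
    exacts [h1 h, h2 h]

theorem side_tgt_nonneg {e e' : E} (he : e ∈ U) (he' : e' ∈ U) :
    0 ≤ G.side e (G.pos (G.tgt e')) := by
  obtain ⟨e₁, h1, h2⟩ := hU.exists_next e' he'
  rw [← h2]
  exact hU.side_nonneg e he e₁ h1

/-- If two edges with one target had different sources, each source would lie weakly to the left of
the other edge, one strictly. But the two side values are opposite. -/
theorem tgt_inj {e e' : E} (he : e ∈ U) (he' : e' ∈ U) (h : G.tgt e = G.tgt e') : e = e' := by
  by_contra hne
  have hs : G.src e ≠ G.src e' := fun h => hne (hU.src_inj e he e' he' h)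
  have h1 := hU.side_pos he he' hs.symm (by rw [h]; exact G.src_ne_tgt e')
  have h2 := hU.side_nonneg e' he' e he
  simp only [side, vec, planeDet, Prod.fst_sub, Prod.snd_sub, h] at h1 h2
  linarith

/-- The next edge. -/
theorem exists_perm : ∃ σ : Equiv.Perm U, ∀ e, G.src (σ e).1 = G.tgt e.1 := by
  choose f hf hf' using hU.exists_next
  have hinj : Function.Injective fun e : U => (⟨f e.1 e.2, hf _ _⟩ : U) := by
    intro e e' h
    have h' : f e.1 e.2 = f e'.1 e'.2 := congrArg Subtype.val h
    exact Subtype.ext (hU.tgt_inj e.2 e'.2 (by rw [← hf' _ e.2, ← hf' _ e'.2, h']))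
  exact ⟨Equiv.ofBijective _ (Finite.injective_iff_bijective.1 hinj), fun e => hf' _ e.2⟩

theorem exists_prev {e : E} (he : e ∈ U) : ∃ e' ∈ U, G.tgt e' = G.src e := by
  obtain ⟨σ, hσ⟩ := hU.exists_perm
  refine ⟨_, (σ.symm ⟨e, he⟩).2, ?_⟩
  rw [← hσ, Equiv.apply_symm_apply]

theorem src_ne {e e' : E} (he : e ∈ U) (he' : e' ∈ U) (h : G.src e' = G.tgt e) :
    G.tgt e' ≠ G.src e ∧ G.tgt e' ≠ G.tgt e :=
  ⟨hU.no_digon e he e' he' h, fun h' => G.src_ne_tgt e' (by rw [h, h'])⟩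

theorem turn {e e' : E} (he : e ∈ U) (he' : e' ∈ U) (h : G.src e' = G.tgt e) :
    0 < planeDet (G.vec e) (G.vec e') := by
  obtain ⟨h1, h2⟩ := hU.src_ne he he' h
  obtain ⟨e₁, h3, h4⟩ := hU.exists_next e' he'
  rw [← h4] at h1 h2
  have := hU.side_pos he h3 h1 h2
  rw [h4] at this
  have e1 : planeDet (G.vec e) (G.vec e') = G.side e (G.pos (G.tgt e')) := by
    simp only [side, vec, planeDet, Prod.fst_sub, Prod.snd_sub, h]; ring
  rwa [e1]

theorem exists_side_pos {e : E} (he : e ∈ U) : ∃ e' ∈ U, 0 < G.side e (G.pos (G.src e')) := by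
  obtain ⟨e₁, h3, h4⟩ := hU.exists_next e he
  obtain ⟨h1, h2⟩ := hU.src_ne he h3 h4
  obtain ⟨e₂, h5, h6⟩ := hU.exists_next e₁ h3
  exact ⟨e₂, h5, hU.side_pos he h5 (h6 ▸ h1) (h6 ▸ h2)⟩

theorem rev_notMem {e : E} (he : e ∈ U) : G.rev e ∉ U := fun h => by
  obtain ⟨e', h1, h2⟩ := hU.exists_side_pos he
  have := hU.side_nonneg _ h e' h1
  rw [G.side_rev] at this
  linarith

/-- A vertex at which a linear function is minimal. -/
theorem exists_min (u : ℝ × ℝ) {W : Finset E} (hW : W ⊆ U) (hne : W.Nonempty)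
    (hnext : ∀ e ∈ W, ∃ e' ∈ W, G.src e' = G.tgt e) :
    ∃ e ∈ W, ∃ e' ∈ W, G.src e' = G.tgt e ∧ ∃ x y : ℝ, 0 ≤ x ∧ 0 ≤ y ∧
      u = x • G.vec e + y • G.vec e' := by
  -- The minimum is taken over the targets of the edges of `W`. As the neighbours in `W` of the
  -- minimal vertex are not lower, `u` lies in the cone of the two edge vectors there.
  obtain ⟨e₀, he₀, hmin⟩ := W.exists_min_image (fun e => planeDet u (G.pos (G.tgt e))) hne
  obtain ⟨e', he', h⟩ := hnext e₀ he₀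
  have hW' : ∃ e ∈ W, G.tgt e = G.tgt e₀ := ⟨e₀, he₀, rfl⟩
  have hturn := hU.turn (hW he₀) (hW he') h
  -- the vertex before `e₀` is a target too
  have hprev : ∃ e₁ ∈ W, G.tgt e₁ = G.src e₀ := by
    choose f hf hf' using hnext
    have hinj : Function.Injective fun e : W => (⟨f e.1 e.2, hf _ _⟩ : W) := by
      intro e e' h
      have h' : f e.1 e.2 = f e'.1 e'.2 := congrArg Subtype.val h
      exact Subtype.ext (hU.tgt_inj (hW e.2) (hW e'.2) (by rw [← hf' _ e.2, ← hf' _ e'.2, h']))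
    obtain ⟨e₁, h1⟩ := (Finite.injective_iff_surjective.1 hinj) ⟨e₀, he₀⟩
    refine ⟨e₁.1, e₁.2, ?_⟩
    rw [← hf' _ e₁.2]
    exact congrArg G.src (congrArg Subtype.val h1)
  obtain ⟨e₁, he₁, h1⟩ := hprev
  have m1 := hmin e' he'
  have m2 := hmin e₁ he₁
  rw [h1] at m2
  refine ⟨e₀, he₀, e', he', h, planeDet u (G.vec e') / planeDet (G.vec e₀) (G.vec e'),
    planeDet (G.vec e₀) u / planeDet (G.vec e₀) (G.vec e'), ?_, ?_, ?_⟩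
  · refine div_nonneg ?_ hturn.le
    simp only [vec, planeDet, Prod.fst_sub, Prod.snd_sub, h] at m1 ⊢
    linarith
  · refine div_nonneg ?_ hturn.le
    simp only [vec, planeDet, Prod.fst_sub, Prod.snd_sub] at m2 ⊢
    linarith
  · rw [div_eq_inv_mul, div_eq_inv_mul, mul_smul, mul_smul, ← smul_add, ← planeDet_smul_eq,
      inv_smul_smul₀ hturn.ne']

/-- A frame is a single cycle, though this is not part of the definition. If `g` is missing from a
subfamily `W` closed under successors, consider the vertex of `W` that is extreme for the direction
of `g`. The source of `g` is strictly to the left of both edges of `W` there, which would put this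
vertex strictly to the right of `g`. -/
theorem eq_of_subset {W : Finset E} (hW : W ⊆ U) (hne : W.Nonempty)
    (hnext : ∀ e ∈ W, ∃ e' ∈ W, G.src e' = G.tgt e) : W = U := by
  refine hW.antisymm fun g hg => ?_
  by_contra hgW
  obtain ⟨e, he, e', he', h, x, y, hx, hy, hu⟩ := hU.exists_min (G.vec g) hW hne hnext
  have hsrc : ∀ e₁ ∈ W, G.src g ≠ G.src e₁ := fun e₁ h1 h2 =>
    hgW (hU.src_inj g hg e₁ (hW h1) h2 ▸ h1)
  have hsrc' : ∀ e₁ ∈ W, G.src g ≠ G.tgt e₁ := fun e₁ h1 h2 => by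
    obtain ⟨e₂, h3, h4⟩ := hnext e₁ h1
    exact hsrc e₂ h3 (h2.trans h4.symm)
  have p1 := hU.side_pos (hW he) hg (hsrc _ he) (hsrc' _ he)
  have p2 := hU.side_pos (hW he') hg (hsrc _ he') (hsrc' _ he')
  have p3 := hU.side_nonneg g hg e' (hW he')
  have key : G.side g (G.pos (G.src e')) =
      -(x * G.side e (G.pos (G.src g)) + y * G.side e' (G.pos (G.src g))) := by
    simp only [side] at *
    rw [hu]
    simp only [vec, planeDet, Prod.fst_sub, Prod.snd_sub, Prod.fst_add, Prod.snd_add,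
      Prod.smul_fst, Prod.smul_snd, smul_eq_mul, h]
    ring
  have hx0 : x = 0 := by nlinarith [mul_nonneg hx p1.le, mul_nonneg hy p2.le]
  have hy0 : y = 0 := by nlinarith [mul_nonneg hx p1.le, mul_nonneg hy p2.le]
  refine G.vec_ne_zero g ?_
  rw [hu, hx0, hy0]; simp

theorem eq_of_subset_frame {W : Finset E} (hW : G.IsFrame W) (h : W ⊆ U) : W = U :=
  hU.eq_of_subset h hW.nonempty hW.exists_next

end IsFrame

/-! ### Crossing numbers -/

/-- The signed crossing number of an edge with the ray from `q` in the direction `u`. -/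
def cross (e : E) (q u : ℝ × ℝ) : ℝ :=
  if planeDet u (G.pos (G.src e) - q) < 0 ∧ 0 < planeDet u (G.pos (G.tgt e) - q) ∧ 0 < G.side e q
  then 1
  else if 0 < planeDet u (G.pos (G.src e) - q) ∧ planeDet u (G.pos (G.tgt e) - q) < 0 ∧
    G.side e q < 0 then -1 else 0

theorem cross_rev (e : E) (q u : ℝ × ℝ) : G.cross (G.rev e) q u = -G.cross e q u := by
  simp only [cross, G.src_rev, G.tgt_rev, G.side_rev]
  simp only [Left.neg_pos_iff, neg_lt_zero]
  split_ifs <;> grind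

/-- It compares the places where the line through `q` along `u` meets two edges. With the side
inequalities of a frame it orders these places; using it with both orders of the edges shows that
only one edge crosses upwards. -/
theorem cross_identity (e e' : E) (q u : ℝ × ℝ) :
    planeDet u (G.vec e) * G.side e' q - G.side e q * planeDet u (G.vec e') =
      planeDet u (G.pos (G.tgt e) - q) * G.side e' (G.pos (G.src e)) -
      planeDet u (G.pos (G.src e) - q) * G.side e' (G.pos (G.tgt e)) := by
  simp only [side, vec, planeDet, Prod.fst_sub, Prod.snd_sub]; ring

theorem planeDet_vec (e : E) (q u : ℝ × ℝ) : planeDet u (G.vec e) =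
    planeDet u (G.pos (G.tgt e) - q) - planeDet u (G.pos (G.src e) - q) := by
  simp only [vec, planeDet, Prod.fst_sub, Prod.snd_sub]; ring

/-- The open polygon of a frame. -/
def inner (U : Finset E) : Set (ℝ × ℝ) := {q | ∀ e ∈ U, 0 < G.side e q}

namespace IsFrame

variable {G} {U : Finset E} (hU : G.IsFrame U)
include hU

theorem exists_src_neg {q u : ℝ × ℝ} (hu : u ≠ 0) (hq : q ∈ G.inner U) :
    ∃ e ∈ U, planeDet u (G.pos (G.src e) - q) < 0 := by
  obtain ⟨e, he, e', he', h, x, y, hx, hy, hxy⟩ :=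
    hU.exists_min u subset_rfl hU.nonempty hU.exists_next
  refine ⟨e', he', ?_⟩
  have key : planeDet u (G.pos (G.src e') - q) = -(x * G.side e q + y * G.side e' q) := by
    rw [hxy]
    simp only [side, vec, planeDet, Prod.fst_sub, Prod.snd_sub, Prod.fst_add, Prod.snd_add,
      Prod.smul_fst, Prod.smul_snd, smul_eq_mul, h]
    ring
  rw [key]
  have p1 := hq e he
  have p2 := hq e' he'
  rcases hx.lt_or_eq with hx | hx
  · nlinarith [mul_pos hx p1, mul_nonneg hy p2.le]
  · rcases hy.lt_or_eq with hy | hy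
    · nlinarith [mul_pos hy p2, mul_nonneg hx.le p1.le]
    · exact absurd (by rw [hxy, ← hx, ← hy]; simp) hu

/-- A function on the vertices which is negative somewhere and positive somewhere changes from
negative to positive along some edge. -/
theorem exists_change {s : V → ℝ} (hs : ∀ p, s p ≠ 0) (h1 : ∃ e ∈ U, s (G.src e) < 0)
    (h2 : ∃ e ∈ U, 0 < s (G.src e)) : ∃ e ∈ U, s (G.src e) < 0 ∧ 0 < s (G.tgt e) := by
  by_contra! hno
  obtain ⟨e₀, he₀, hneg⟩ := h1
  have := hU.eq_of_subset (W := U.filter fun e => s (G.src e) < 0) (Finset.filter_subset _ _)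
    ⟨e₀, by simp [he₀, hneg]⟩ (fun e he => by
      rw [Finset.mem_filter] at he
      obtain ⟨e', he', h⟩ := hU.exists_next e he.1
      refine ⟨e', ?_, h⟩
      rw [Finset.mem_filter, h]
      exact ⟨he', (hno e he.1 he.2).lt_of_ne (hs _)⟩)
  obtain ⟨e₁, he₁, hpos⟩ := h2
  rw [← this, Finset.mem_filter] at he₁
  exact lt_asymm hpos he₁.2

theorem up_unique {e e' : E} {q u : ℝ × ℝ} (he : e ∈ U) (he' : e' ∈ U)
    (h1 : planeDet u (G.pos (G.src e) - q) < 0) (h2 : 0 < planeDet u (G.pos (G.tgt e) - q))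
    (h1' : planeDet u (G.pos (G.src e') - q) < 0) (h2' : 0 < planeDet u (G.pos (G.tgt e') - q)) :
    e = e' := by
  have i1 := G.cross_identity e e' q u
  have i2 := G.cross_identity e' e q u
  have a1 := mul_nonneg h2.le (hU.side_nonneg e' he' e he)
  have a2 := mul_nonneg (neg_pos.2 h1).le (hU.side_tgt_nonneg he' he)
  have a3 := mul_nonneg h2'.le (hU.side_nonneg e he e' he')
  have a4 := mul_nonneg (neg_pos.2 h1').le (hU.side_tgt_nonneg he he')
  have a5 : planeDet u (G.pos (G.tgt e) - q) * G.side e' (G.pos (G.src e)) = 0 := by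
    nlinarith
  rcases mul_eq_zero.1 a5 with h | h
  · exact absurd h h2.ne'
  · rcases G.side_eq_zero h with h | h
    · exact hU.src_inj e he e' he' h
    · rw [h] at h1; exact absurd h1 h2'.le.not_gt

/-- The winding number of a convex polygon. A line that meets the polygon is crossed by exactly one
edge in each sense. For a point inside, only the upward one lies ahead on the ray; for a point
outside, both are ahead or both behind, and they cancel. -/
theorem sum_cross {q u : ℝ × ℝ} (hgen : ∀ p, planeDet u (G.pos p - q) ≠ 0)
    (hside : ∀ e ∈ U, G.side e q ≠ 0) :
    ∑ e ∈ U, G.cross e q u = if q ∈ G.inner U then 1 else 0 := by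
  have hneg : ∀ p : V, planeDet (-u) (G.pos p - q) = -planeDet u (G.pos p - q) := fun p => by
    simp only [planeDet, Prod.fst_neg, Prod.snd_neg]; ring
  have down_unique : ∀ e ∈ U, ∀ e' ∈ U, 0 < planeDet u (G.pos (G.src e) - q) →
      planeDet u (G.pos (G.tgt e) - q) < 0 → 0 < planeDet u (G.pos (G.src e') - q) →
      planeDet u (G.pos (G.tgt e') - q) < 0 → e = e' := by
    intro e he e' he' h1 h2 h1' h2'
    refine hU.up_unique (q := q) (u := -u) he he' ?_ ?_ ?_ ?_ <;> rw [hneg] <;> linarith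
  by_cases hin : q ∈ G.inner U
  · rw [if_pos hin]
    obtain ⟨e₀, he₀⟩ := hU.nonempty
    have hu : u ≠ 0 := by
      rintro rfl
      exact hgen (G.src e₀) (by simp [planeDet])
    obtain ⟨e₁, he₁, h1⟩ := hU.exists_src_neg hu hin
    obtain ⟨e₂, he₂, h2⟩ := hU.exists_src_neg (neg_ne_zero.2 hu) hin
    rw [hneg] at h2
    obtain ⟨e, he, h3, h4⟩ := hU.exists_change (s := fun p => planeDet u (G.pos p - q)) hgen
      ⟨e₁, he₁, h1⟩ ⟨e₂, he₂, by linarith⟩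
    rw [Finset.sum_eq_single_of_mem e he]
    · rw [cross, if_pos ⟨h3, h4, hin e he⟩]
    · intro e' he' hne
      rw [cross, if_neg, if_neg]
      · exact fun h => lt_asymm (hin e' he') h.2.2
      · exact fun h => hne (hU.up_unique he' he h.1 h.2.1 h3 h4)
  · rw [if_neg hin]
    obtain ⟨e₀, he₀, h0⟩ : ∃ e ∈ U, G.side e q < 0 := by
      simp only [inner, Set.mem_ofPred_eq, not_forall, not_lt] at hin
      obtain ⟨e, he, h⟩ := hin
      exact ⟨e, he, h.lt_of_ne (hside e he)⟩
    by_cases hup : ∃ e ∈ U, planeDet u (G.pos (G.src e) - q) < 0 ∧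
      0 < planeDet u (G.pos (G.tgt e) - q)
    · obtain ⟨e, he, h1, h2⟩ := hup
      obtain ⟨e₁, he₁, h3⟩ := hU.exists_next e he
      obtain ⟨e', he', h1', h2'⟩ := hU.exists_change (s := fun p => -planeDet u (G.pos p - q))
        (fun p => neg_ne_zero.2 (hgen p)) ⟨e₁, he₁, by rw [h3]; linarith⟩ ⟨e, he, by linarith⟩
      have h1' : 0 < planeDet u (G.pos (G.src e') - q) := by linarith
      have h2' : planeDet u (G.pos (G.tgt e') - q) < 0 := by linarith
      have hee : e ≠ e' := by rintro rfl; exact lt_asymm h1 h1'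
      rw [← Finset.sum_subset (s₁ := {e, e'}) (by simp [Finset.insert_subset_iff, he, he']),
        Finset.sum_pair hee]
      · have up : ∀ e₂ ∈ U, G.side e q * planeDet u (G.vec e₂) ≤
            planeDet u (G.vec e) * G.side e₂ q := fun e₂ he₂ => by
          have := G.cross_identity e e₂ q u
          nlinarith [mul_nonneg h2.le (hU.side_nonneg e₂ he₂ e he),
            mul_nonneg (neg_pos.2 h1).le (hU.side_tgt_nonneg he₂ he)]
        have down : ∀ e₂ ∈ U, planeDet u (G.vec e') * G.side e₂ q ≤
            G.side e' q * planeDet u (G.vec e₂) := fun e₂ he₂ => by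
          have := G.cross_identity e' e₂ q u
          nlinarith [mul_nonneg (neg_pos.2 h2').le (hU.side_nonneg e₂ he₂ e' he'),
            mul_nonneg h1'.le (hU.side_tgt_nonneg he₂ he')]
        have v : 0 < planeDet u (G.vec e) := by rw [G.planeDet_vec e q]; linarith
        have v' : planeDet u (G.vec e') < 0 := by rw [G.planeDet_vec e' q]; linarith
        have c1 : ¬ (0 < planeDet u (G.pos (G.src e) - q)) := h1.le.not_gt
        have c2 : ¬ (planeDet u (G.pos (G.src e') - q) < 0) := h1'.le.not_gt
        simp only [cross, h1, h2, h1', h2', c1, c2, true_and, false_and, if_false]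
        by_cases hs : 0 < G.side e q
        · have : G.side e' q < 0 := by
            by_contra hs'
            have hs' : 0 < G.side e' q := (not_lt.1 hs').lt_of_ne (hside e' he').symm
            have u1 := up e₀ he₀
            have d1 := down e₀ he₀
            have : planeDet u (G.vec e₀) < 0 := by
              by_contra hc
              nlinarith [mul_nonneg hs.le (not_lt.1 hc), mul_pos v (neg_pos.2 h0)]
            nlinarith [mul_pos hs' (neg_pos.2 this), mul_pos (neg_pos.2 v') (neg_pos.2 h0)]
          simp [hs, this]
        · have : ¬ G.side e' q < 0 := fun hc => by
            have u1 := up e' he'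
            have hs' : G.side e q ≤ 0 := not_lt.1 hs
            nlinarith [mul_pos v (neg_pos.2 hc), mul_nonneg (neg_nonneg.2 hs') (neg_pos.2 v').le]
          simp [hs, this]
      · intro e₂ he₂ hne
        simp only [Finset.mem_insert, Finset.mem_singleton, not_or] at hne
        rw [cross, if_neg, if_neg]
        · exact fun h => hne.2 (down_unique e₂ he₂ e' he' h.1 h.2.1 h1' h2')
        · exact fun h => hne.1 (hU.up_unique he₂ he h.1 h.2.1 h1 h2)
    · refine Finset.sum_eq_zero fun e he => ?_
      rw [cross, if_neg (fun h => hup ⟨e, he, h.1, h.2.1⟩), if_neg]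
      intro h
      obtain ⟨e₁, he₁, h3⟩ := hU.exists_next e he
      exact hup (hU.exists_change (s := fun p => planeDet u (G.pos p - q)) hgen
        ⟨e₁, he₁, by rw [h3]; exact h.2.1⟩ ⟨e, he, h.1⟩)

end IsFrame

end PlaneGraph

end

/-! ### Generic points and directions -/

noncomputable section

open scoped Classical

theorem continuous_planeDet_left (v a : ℝ × ℝ) : Continuous fun q => planeDet v (q - a) := by
  unfold planeDet; fun_prop

/-- A nonempty open set of the plane is not covered by finitely many lines. -/
theorem exists_open_avoiding_lines {ι : Type*} (s : Finset ι) (v a : ι → ℝ × ℝ)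
    (hv : ∀ i ∈ s, v i ≠ 0) {O : Set (ℝ × ℝ)} (hO : IsOpen O) (hne : O.Nonempty) :
    ∃ O' ⊆ O, IsOpen O' ∧ O'.Nonempty ∧ ∀ q ∈ O', ∀ i ∈ s, planeDet (v i) (q - a i) ≠ 0 := by
  induction s using Finset.induction_on with
  | empty => exact ⟨O, subset_rfl, hO, hne, by simp⟩
  | insert i s hi ih =>
    obtain ⟨O', h1, h2, ⟨q, hq⟩, h4⟩ := ih fun j hj => hv j (Finset.mem_insert_of_mem hj)
    refine ⟨O' ∩ {q | planeDet (v i) (q - a i) ≠ 0}, Set.inter_subset_left.trans h1,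
      h2.inter (isOpen_ne.preimage (continuous_planeDet_left _ _)), ?_, ?_⟩
    · by_cases h0 : planeDet (v i) (q - a i) = 0
      · have hc : Continuous fun ε : ℝ => q + ε • ((-(v i).2, (v i).1) : ℝ × ℝ) := by fun_prop
        have h5 : ∀ᶠ ε in 𝓝 (0 : ℝ), q + ε • ((-(v i).2, (v i).1) : ℝ × ℝ) ∈ O' :=
          hc.continuousAt.eventually (h2.mem_nhds (by simpa using hq))
        obtain ⟨ε, h6, h7⟩ := ((h5.filter_mono nhdsWithin_le_nhds).and
          (self_mem_nhdsWithin : ∀ᶠ ε : ℝ in 𝓝[>] 0, 0 < ε)).exists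
        refine ⟨_, h6, ?_⟩
        have h8 := hv i (Finset.mem_insert_self _ _)
        have h9 : 0 < (v i).1 ^ 2 + (v i).2 ^ 2 := by
          by_contra hc
          refine h8 (Prod.ext ?_ ?_) <;> simp only [Prod.fst_zero, Prod.snd_zero] <;> nlinarith
            [sq_nonneg (v i).1, sq_nonneg (v i).2]
        have h10 : planeDet (v i) (q + ε • ((-(v i).2, (v i).1) : ℝ × ℝ) - a i) =
            planeDet (v i) (q - a i) + ε * ((v i).1 ^ 2 + (v i).2 ^ 2) := by
          simp only [planeDet, Prod.fst_sub, Prod.snd_sub, Prod.fst_add, Prod.snd_add,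
            Prod.smul_fst, Prod.smul_snd, smul_eq_mul]
          ring
        change planeDet _ _ ≠ 0
        rw [h10, h0, zero_add]
        exact (mul_pos h7 h9).ne'
      · exact ⟨q, hq, h0⟩
    · rintro q ⟨hq, hq'⟩ j hj
      rcases Finset.mem_insert.1 hj with rfl | hj
      exacts [hq', h4 q hq j hj]

namespace PlaneGraph

variable {V E : Type*} (G : PlaneGraph V E)

theorem continuous_side (e : E) : Continuous (G.side e) := continuous_planeDet_left _ _

theorem isOpen_inner (U : Finset E) : IsOpen (G.inner U) := by
  have : G.inner U = ⋂ e ∈ U, {q | 0 < G.side e q} := by ext; simp [inner]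
  rw [this]
  exact isOpen_biInter_finset fun e _ => isOpen_lt continuous_const (G.continuous_side e)

theorem exists_generic_point [Finite V] (s : Finset E) {O : Set (ℝ × ℝ)} (hO : IsOpen O)
    (hne : O.Nonempty) : ∃ q ∈ O, (∀ e ∈ s, G.side e q ≠ 0) ∧ ∀ p, G.pos p ≠ q := by
  have := Fintype.ofFinite V
  obtain ⟨O₁, h1, h2, h3, h4⟩ := exists_open_avoiding_lines s G.vec (fun e => G.pos (G.src e))
    (fun e _ => G.vec_ne_zero e) hO hne
  -- Only the vertices have to be avoided; the horizontal lines through them are removed because the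
  -- lemma speaks of lines.
  obtain ⟨O₂, h5, -, ⟨q, hq⟩, h8⟩ := exists_open_avoiding_lines (Finset.univ : Finset V)
    (fun _ => ((1, 0) : ℝ × ℝ)) G.pos (fun _ _ => by simp) h2 h3
  refine ⟨q, h1 (h5 hq), fun e he => h4 q (h5 hq) e he, fun p hp => ?_⟩
  exact h8 q hq p (Finset.mem_univ _) (by simp [hp, planeDet])

theorem exists_generic_dir [Finite V] {q : ℝ × ℝ} (hq : ∀ p, G.pos p ≠ q) {O : Set (ℝ × ℝ)}
    (hO : IsOpen O) (hne : O.Nonempty) : ∃ u ∈ O, ∀ p, planeDet u (G.pos p - q) ≠ 0 := by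
  have := Fintype.ofFinite V
  obtain ⟨O₂, h5, -, ⟨u, hu⟩, h8⟩ := exists_open_avoiding_lines (Finset.univ : Finset V)
    (fun p => G.pos p - q) (fun _ => 0) (fun p _ => sub_ne_zero.2 (hq p)) hO hne
  refine ⟨u, h5 hu, fun p hp => h8 u hu p (Finset.mem_univ _) ?_⟩
  rw [sub_zero, planeDet_swap, hp, neg_zero]

theorem side_lineMap (e : E) (a b : ℝ × ℝ) (t : ℝ) :
    G.side e (a + t • (b - a)) = (1 - t) * G.side e a + t * G.side e b := by
  simp only [side, planeDet, Prod.fst_sub, Prod.snd_sub, Prod.fst_add, Prod.snd_add,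
    Prod.smul_fst, Prod.smul_snd, smul_eq_mul]
  ring

theorem IsFrame.inner_nonempty {U : Finset E} (hU : G.IsFrame U) : (G.inner U).Nonempty := by
  refine ⟨(U.card : ℝ)⁻¹ • ∑ e ∈ U, G.pos (G.src e), fun e he => ?_⟩
  have hc : (0 : ℝ) < U.card := by exact_mod_cast Finset.card_pos.2 hU.nonempty
  have key : G.side e ((U.card : ℝ)⁻¹ • ∑ e ∈ U, G.pos (G.src e)) =
      (U.card : ℝ)⁻¹ * ∑ e' ∈ U, G.side e (G.pos (G.src e')) := by
    simp only [side, planeDet, Prod.fst_sub, Prod.snd_sub, Prod.smul_fst, Prod.smul_snd,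
      smul_eq_mul, Finset.sum_sub_distrib, ← Finset.mul_sum, Prod.fst_sum, Prod.snd_sum,
      Finset.sum_const, nsmul_eq_mul]
    field_simp
  rw [key]
  obtain ⟨e', h1, h2⟩ := hU.exists_side_pos he
  exact mul_pos (inv_pos.2 hc)
    (Finset.sum_pos' (fun e₁ h => hU.side_nonneg e he e₁ h) ⟨e', h1, h2⟩)

/-- Points on the boundary are limits of inner points. -/
theorem IsFrame.mem_closure_inner {U : Finset E} (hU : G.IsFrame U) {q : ℝ × ℝ}
    (hq : ∀ e ∈ U, 0 ≤ G.side e q) : q ∈ closure (G.inner U) := by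
  obtain ⟨c, hc⟩ := hU.inner_nonempty
  have h1 : Filter.Tendsto (fun t : ℝ => q + t • (c - q)) (𝓝[>] 0) (𝓝 q) := by
    have : Continuous fun t : ℝ => q + t • (c - q) := by fun_prop
    simpa using (this.tendsto 0).mono_left nhdsWithin_le_nhds
  refine mem_closure_of_tendsto h1 ?_
  filter_upwards [Ioo_mem_nhdsGT (zero_lt_one' ℝ)] with t ht e he
  rw [G.side_lineMap]
  have := mul_pos ht.1 (hc e he)
  nlinarith [mul_nonneg (sub_nonneg.2 ht.2.le) (hq e he)]

/-! ### Tilings -/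

/-- All edges of a family of frames. -/
def edgesOf (𝒟 : Finset (Finset E)) : Finset E := 𝒟.biUnion id

/-- The edges which are not glued. -/
def boundary (𝒟 : Finset (Finset E)) : Finset E := (edgesOf 𝒟).filter fun e => G.rev e ∉ edgesOf 𝒟

/-- The edges which are glued, with both orientations. -/
def internal (𝒟 : Finset (Finset E)) : Finset E := (edgesOf 𝒟).filter fun e => G.rev e ∈ edgesOf 𝒟

/-- The piece containing an edge. -/
def owner (𝒟 : Finset (Finset E)) (e : E) : Finset E :=
  if h : ∃ U ∈ 𝒟, e ∈ U then Classical.choose h else ∅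

/-- Frames which are glued along common edges, each edge being used once, such that the remaining
edges form a frame. -/
structure IsTiling (𝒟 : Finset (Finset E)) : Prop where
  frames : ∀ U ∈ 𝒟, G.IsFrame U
  unique : ∀ U ∈ 𝒟, ∀ U' ∈ 𝒟, ∀ e ∈ U, e ∈ U' → U = U'
  boundary : G.IsFrame (G.boundary 𝒟)

theorem mem_edgesOf {𝒟 : Finset (Finset E)} {e : E} : e ∈ edgesOf 𝒟 ↔ ∃ U ∈ 𝒟, e ∈ U := by
  simp [edgesOf]

theorem owner_spec {𝒟 : Finset (Finset E)} {e : E} (h : e ∈ edgesOf 𝒟) :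
    owner 𝒟 e ∈ 𝒟 ∧ e ∈ owner 𝒟 e := by
  rw [mem_edgesOf] at h
  rw [owner, dif_pos h]
  exact Classical.choose_spec h

variable {G}
variable {𝒟 : Finset (Finset E)}

theorem mem_boundary {e : E} :
    e ∈ G.boundary 𝒟 ↔ e ∈ edgesOf 𝒟 ∧ G.rev e ∉ edgesOf 𝒟 := Finset.mem_filter

theorem mem_internal {e : E} :
    e ∈ G.internal 𝒟 ↔ e ∈ edgesOf 𝒟 ∧ G.rev e ∈ edgesOf 𝒟 := Finset.mem_filter

theorem rev_mem_internal {e : E} (h : e ∈ G.internal 𝒟) : G.rev e ∈ G.internal 𝒟 := by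
  rw [mem_internal] at h ⊢
  rw [G.rev_rev]
  exact h.symm

/-- Summation by parts. An edge function odd under reversal leaves the boundary terms and, at each
glued edge, the jump of the weight; the division by two accounts for the two orientations. -/
theorem sum_tiling (hd : ∀ U ∈ 𝒟, ∀ U' ∈ 𝒟, ∀ e ∈ U, e ∈ U' → U = U')
    (κ : Finset E → ℝ) (φ : E → ℝ) (hφ : ∀ e, φ (G.rev e) = -φ e) :
    ∑ U ∈ 𝒟, κ U * ∑ e ∈ U, φ e = ∑ e ∈ G.boundary 𝒟, κ (owner 𝒟 e) * φ e +
      (∑ e ∈ G.internal 𝒟, (κ (owner 𝒟 e) - κ (owner 𝒟 (G.rev e))) * φ e) / 2 := by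
  have h1 : ∑ U ∈ 𝒟, κ U * ∑ e ∈ U, φ e = ∑ e ∈ edgesOf 𝒟, κ (owner 𝒟 e) * φ e := by
    rw [edgesOf, Finset.sum_biUnion]
    · refine Finset.sum_congr rfl fun U hU => ?_
      rw [Finset.mul_sum]
      refine Finset.sum_congr rfl fun e he => ?_
      have := owner_spec (mem_edgesOf.2 ⟨U, hU, he⟩)
      rw [hd _ this.1 U hU e this.2 he]
    · intro U hU U' hU' hne
      refine Finset.disjoint_left.2 fun e he he' => hne (hd U hU U' hU' e he he')
  have h2 : ∑ e ∈ G.internal 𝒟, κ (owner 𝒟 (G.rev e)) * φ e =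
      -∑ e ∈ G.internal 𝒟, κ (owner 𝒟 e) * φ e := by
    rw [← Finset.sum_neg_distrib]
    refine Finset.sum_bij (fun e _ => G.rev e) (fun e he => rev_mem_internal he)
      (fun _ _ _ _ h => G.rev_injective h)
      (fun e he => ⟨_, rev_mem_internal he, G.rev_rev e⟩) fun e _ => ?_
    rw [hφ]; ring
  have h3 : ∑ e ∈ edgesOf 𝒟, κ (owner 𝒟 e) * φ e =
      ∑ e ∈ G.internal 𝒟, κ (owner 𝒟 e) * φ e + ∑ e ∈ G.boundary 𝒟, κ (owner 𝒟 e) * φ e :=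
    (Finset.sum_filter_add_sum_filter_not (edgesOf 𝒟) _ _).symm
  simp only [sub_mul, Finset.sum_sub_distrib]
  rw [h1, h2, h3]; ring

theorem owner_eq (hd : ∀ U ∈ 𝒟, ∀ U' ∈ 𝒟, ∀ e ∈ U, e ∈ U' → U = U') {U : Finset E} (hU : U ∈ 𝒟)
    {e : E} (he : e ∈ U) : owner 𝒟 e = U := by
  have := owner_spec (mem_edgesOf.2 ⟨U, hU, he⟩)
  exact hd _ this.1 U hU e this.2 he

theorem sum_edges_tiling (hd : ∀ U ∈ 𝒟, ∀ U' ∈ 𝒟, ∀ e ∈ U, e ∈ U' → U = U')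
    (φ : E → ℝ) (hφ : ∀ e, φ (G.rev e) = -φ e) :
    ∑ U ∈ 𝒟, ∑ e ∈ U, φ e = ∑ e ∈ G.boundary 𝒟, φ e := by
  simpa using sum_tiling hd (fun _ => 1) φ hφ

theorem boundary_subset_edgesOf : G.boundary 𝒟 ⊆ edgesOf 𝒟 := Finset.filter_subset _ _

theorem side_ne_of_edgesOf {q : ℝ × ℝ} (hq : ∀ e ∈ edgesOf 𝒟, G.side e q ≠ 0) {U : Finset E}
    (hU : U ∈ 𝒟) : ∀ e ∈ U, G.side e q ≠ 0 := fun e he => hq e (mem_edgesOf.2 ⟨U, hU, he⟩)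

namespace IsTiling

variable (h : G.IsTiling 𝒟)
include h

/-- Crossing numbers are odd under reversal, so those of glued edges cancel: the number of pieces
containing a generic point is the winding number of the boundary. Disjointness and covering of the
pieces both come from here. -/
theorem sum_inner {q u : ℝ × ℝ} (hq : ∀ e ∈ edgesOf 𝒟, G.side e q ≠ 0)
    (hu : ∀ p, planeDet u (G.pos p - q) ≠ 0) :
    ∑ U ∈ 𝒟, (if q ∈ G.inner U then (1 : ℝ) else 0) =
      if q ∈ G.inner (G.boundary 𝒟) then 1 else 0 := by
  rw [← h.boundary.sum_cross hu fun e he => hq e (boundary_subset_edgesOf he),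
    ← sum_edges_tiling h.unique _ fun e => G.cross_rev e q u]
  refine Finset.sum_congr rfl fun U hU => ?_
  rw [(h.frames U hU).sum_cross hu (side_ne_of_edgesOf hq hU)]

variable [Finite V]

theorem eq_of_mem_inner {U U' : Finset E} (hU : U ∈ 𝒟) (hU' : U' ∈ 𝒟) {q : ℝ × ℝ}
    (hq : q ∈ G.inner U) (hq' : q ∈ G.inner U') : U = U' := by
  by_contra hne
  obtain ⟨q, ⟨h1, h2⟩, h3, h4⟩ := G.exists_generic_point (edgesOf 𝒟)
    ((G.isOpen_inner U).inter (G.isOpen_inner U')) ⟨q, hq, hq'⟩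
  obtain ⟨u, -, hu⟩ := G.exists_generic_dir h4 isOpen_univ ⟨0, trivial⟩
  have := h.sum_inner h3 hu
  have h5 : ∑ W ∈ ({U, U'} : Finset (Finset E)), (if q ∈ G.inner W then (1 : ℝ) else 0) ≤
      ∑ W ∈ 𝒟, (if q ∈ G.inner W then (1 : ℝ) else 0) :=
    Finset.sum_le_sum_of_subset_of_nonneg (by simp [Finset.insert_subset_iff, hU, hU'])
      fun _ _ _ => by split_ifs <;> norm_num
  rw [Finset.sum_pair hne, if_pos h1, if_pos h2, this] at h5
  split_ifs at h5 <;> linarith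

theorem inner_subset {U : Finset E} (hU : U ∈ 𝒟) {q : ℝ × ℝ}
    (hq : ∀ e ∈ edgesOf 𝒟, G.side e q ≠ 0) (hp : ∀ p, G.pos p ≠ q) (hqU : q ∈ G.inner U) :
    q ∈ G.inner (G.boundary 𝒟) := by
  obtain ⟨u, -, hu⟩ := G.exists_generic_dir hp isOpen_univ ⟨0, trivial⟩
  have := h.sum_inner hq hu
  by_contra hc
  rw [if_neg hc] at this
  have := (Finset.sum_eq_zero_iff_of_nonneg fun _ _ => by split_ifs <;> norm_num).1 this U hU
  simp [hqU] at this

theorem side_boundary_nonneg {U : Finset E} (hU : U ∈ 𝒟) {q : ℝ × ℝ}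
    (hq : q ∈ closure (G.inner U)) {e : E} (he : e ∈ G.boundary 𝒟) : 0 ≤ G.side e q := by
  by_contra hneg
  have hO : IsOpen {q | G.side e q < 0} := isOpen_lt (G.continuous_side e) continuous_const
  obtain ⟨q₁, h1, h2⟩ := mem_closure_iff.1 hq _ hO (not_le.1 hneg)
  obtain ⟨q, ⟨h1, h2⟩, h3, h4⟩ := G.exists_generic_point (edgesOf 𝒟)
    ((G.isOpen_inner U).inter hO) ⟨q₁, h2, h1⟩
  exact lt_asymm h2 (h.inner_subset hU h3 h4 h1 e he)

end IsTiling

/-! ### Webs -/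

variable (G)

/-- A dual web, turned by a right angle: the edges of the web are parallel to those of the
tiling. -/
def IsWeb (𝒟 : Finset (Finset E)) (x : Finset E → ℝ × ℝ) : Prop :=
  ∀ U ∈ 𝒟, ∀ U' ∈ 𝒟, ∀ e ∈ U, G.rev e ∈ U' → ∃ t : ℝ, 0 < t ∧ x U' - x U = t • G.vec e

/-- A web some of whose edges may be contracted. -/
def IsWeakWeb (𝒟 : Finset (Finset E)) (x : Finset E → ℝ × ℝ) : Prop :=
  ∀ U ∈ 𝒟, ∀ U' ∈ 𝒟, ∀ e ∈ U, G.rev e ∈ U' → ∃ t : ℝ, 0 ≤ t ∧ x U' - x U = t • G.vec e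

variable {G}

theorem IsWeb.isWeakWeb {x : Finset E → ℝ × ℝ} (hx : G.IsWeb 𝒟 x) : G.IsWeakWeb 𝒟 x :=
  fun U hU U' hU' e he he' => by
    obtain ⟨t, ht, h⟩ := hx U hU U' hU' e he he'
    exact ⟨t, ht.le, h⟩

/-- Advancing along the ray can only leave edges behind. Passing an edge removes a crossing whose
sign is that of `planeDet (q' - q) (G.vec e)`. -/
theorem cross_mono (e : E) (q q' : ℝ × ℝ) :
    planeDet (q' - q) (G.vec e) * (G.cross e q' (q' - q) - G.cross e q (q' - q)) ≤ 0 ∧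
    (planeDet (q' - q) (G.vec e) * (G.cross e q' (q' - q) - G.cross e q (q' - q)) = 0 →
      G.cross e q' (q' - q) = G.cross e q (q' - q)) := by
  have hs : ∀ p : V, planeDet (q' - q) (G.pos p - q') = planeDet (q' - q) (G.pos p - q) := by
    intro p; simp only [planeDet, Prod.fst_sub, Prod.snd_sub]; ring
  have hv := G.planeDet_vec e q (q' - q)
  have hd := G.side_sub_side e q q'
  rw [planeDet_swap] at hd
  simp only [cross, hs]
  set s := planeDet (q' - q) (G.pos (G.src e) - q)
  set t := planeDet (q' - q) (G.pos (G.tgt e) - q)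
  rw [hv] at hd ⊢
  by_cases h1 : s < 0 ∧ 0 < t
  · have h2 : ¬ 0 < s := h1.1.le.not_gt
    simp only [h1, h2, true_and, false_and, if_false]
    split_ifs
    · simp
    · exfalso; linarith
    · refine ⟨by linarith, fun h => by linarith⟩
    · simp
  · by_cases h3 : 0 < s ∧ t < 0
    · have h2 : ¬ s < 0 := h3.1.le.not_gt
      simp only [h3, h2, true_and, false_and, if_false]
      split_ifs
      · simp
      · exfalso; linarith
      · refine ⟨by linarith, fun h => by linarith⟩
      · simp
    · have a1 : ∀ P : Prop, ¬ (s < 0 ∧ 0 < t ∧ P) := fun P h => h1 ⟨h.1, h.2.1⟩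
      have a2 : ∀ P : Prop, ¬ (0 < s ∧ t < 0 ∧ P) := fun P h => h3 ⟨h.1, h.2.1⟩
      simp [a1, a2]

theorem cross_eq_of_side_pos (e : E) {q q' : ℝ × ℝ} (h : 0 < G.side e q) (h' : 0 < G.side e q') :
    G.cross e q' (q' - q) = G.cross e q (q' - q) := by
  have hs : ∀ p : V, planeDet (q' - q) (G.pos p - q') = planeDet (q' - q) (G.pos p - q) := by
    intro p; simp only [planeDet, Prod.fst_sub, Prod.snd_sub]; ring
  have a := h.le.not_gt
  have a' := h'.le.not_gt
  simp [cross, hs, h, h', a, a']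

namespace IsTiling

variable (h : G.IsTiling 𝒟) [Finite V]
include h

/-- Weight the change of the winding number of each piece, from `q` to `q'`, by `planeDet u (x W)`:
the total is the pairing of `u` with `x U' - x U`. Summation by parts turns it into a sum over
internal edges, where the jump of `x` is a nonnegative multiple of the edge vector and `cross_mono`
makes each term nonnegative. If the total vanishes for a strict web, no crossing number changes, so
both points lie in the same piece. -/
theorem mono_generic {x : Finset E → ℝ × ℝ} (hx : G.IsWeakWeb 𝒟 x) {U U' : Finset E} (hU : U ∈ 𝒟)
    (hU' : U' ∈ 𝒟) {q q' : ℝ × ℝ} (hq : q ∈ G.inner U) (hq' : q' ∈ G.inner U')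
    (hs : ∀ e ∈ edgesOf 𝒟, G.side e q ≠ 0) (hs' : ∀ e ∈ edgesOf 𝒟, G.side e q' ≠ 0)
    (hgen : ∀ p, planeDet (q' - q) (G.pos p - q) ≠ 0) :
    0 ≤ planeDet (q' - q) (x U' - x U) ∧
    (G.IsWeb 𝒟 x → planeDet (q' - q) (x U' - x U) = 0 → U = U') := by
  have hgen' : ∀ p, planeDet (q' - q) (G.pos p - q') ≠ 0 := fun p => by
    have := hgen p
    simp only [planeDet, Prod.fst_sub, Prod.snd_sub] at this ⊢
    intro h; apply this; linarith
  have hp : ∀ p, G.pos p ≠ q := fun p hp => hgen p (by simp [hp, planeDet])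
  have hp' : ∀ p, G.pos p ≠ q' := fun p hp => hgen' p (by simp [hp, planeDet])
  set u := q' - q with hu
  have hsum : ∀ W ∈ 𝒟, ∀ q₁ q₂ : ℝ × ℝ, ∀ W₁ ∈ 𝒟, q₁ ∈ G.inner W₁ →
      (if q₁ ∈ G.inner W then (1 : ℝ) else 0) = if W = W₁ then 1 else 0 := by
    intro W hW q₁ q₂ W₁ hW₁ h₁
    by_cases hWW : W = W₁
    · rw [if_pos hWW, if_pos (hWW ▸ h₁)]
    · rw [if_neg hWW, if_neg fun h₂ => hWW (h.eq_of_mem_inner hW hW₁ h₂ h₁)]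
  have h1 : planeDet u (x U' - x U) = ∑ W ∈ 𝒟, planeDet u (x W) *
      ∑ e ∈ W, (G.cross e q' u - G.cross e q u) := by
    have : ∀ W ∈ 𝒟, planeDet u (x W) * ∑ e ∈ W, (G.cross e q' u - G.cross e q u) =
        (if W = U' then planeDet u (x W) else 0) - if W = U then planeDet u (x W) else 0 := by
      intro W hW
      rw [Finset.sum_sub_distrib, (h.frames W hW).sum_cross hgen' (side_ne_of_edgesOf hs' hW),
        (h.frames W hW).sum_cross hgen (side_ne_of_edgesOf hs hW), hsum W hW q' q U' hU' hq',
        hsum W hW q q' U hU hq]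
      split_ifs <;> ring
    rw [Finset.sum_congr rfl this, Finset.sum_sub_distrib, Finset.sum_ite_eq' , if_pos hU',
      Finset.sum_ite_eq', if_pos hU]
    simp only [planeDet, Prod.fst_sub, Prod.snd_sub]; ring
  have hbd : ∀ e ∈ G.boundary 𝒟, G.cross e q' u - G.cross e q u = 0 := fun e he => by
    rw [sub_eq_zero]
    exact cross_eq_of_side_pos e (h.inner_subset hU hs hp hq e he)
      (h.inner_subset hU' hs' hp' hq' e he)
  rw [sum_tiling h.unique (fun W => planeDet u (x W)) (fun e => G.cross e q' u - G.cross e q u)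
    fun e => by rw [G.cross_rev, G.cross_rev]; ring] at h1
  rw [Finset.sum_eq_zero fun e he => by rw [hbd e he, mul_zero], zero_add] at h1
  have hterm : ∀ e ∈ G.internal 𝒟, ∃ t : ℝ, 0 ≤ t ∧ (G.IsWeb 𝒟 x → 0 < t) ∧
      (planeDet u (x (owner 𝒟 e)) - planeDet u (x (owner 𝒟 (G.rev e)))) *
        (G.cross e q' u - G.cross e q u) =
      -t * (planeDet u (G.vec e) * (G.cross e q' u - G.cross e q u)) := by
    intro e he
    rw [mem_internal] at he
    obtain ⟨o1, o2⟩ := owner_spec he.1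
    obtain ⟨o3, o4⟩ := owner_spec he.2
    obtain ⟨t, ht, hxt⟩ := hx _ o1 _ o3 e o2 o4
    refine ⟨t, ht, fun hw => ?_, ?_⟩
    · obtain ⟨t', ht', hxt'⟩ := hw _ o1 _ o3 e o2 o4
      rw [hxt] at hxt'
      rwa [smul_left_injective ℝ (G.vec_ne_zero e) hxt']
    · have : planeDet u (x (owner 𝒟 e)) - planeDet u (x (owner 𝒟 (G.rev e))) =
          - planeDet u (x (owner 𝒟 (G.rev e)) - x (owner 𝒟 e)) := by
        simp only [planeDet, Prod.fst_sub, Prod.snd_sub]; ring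
      rw [this, hxt]
      simp only [planeDet, Prod.smul_fst, Prod.smul_snd, smul_eq_mul]; ring
  have hnn : ∀ e ∈ G.internal 𝒟, 0 ≤
      (planeDet u (x (owner 𝒟 e)) - planeDet u (x (owner 𝒟 (G.rev e)))) *
        (G.cross e q' u - G.cross e q u) := by
    intro e he
    obtain ⟨t, ht, -, h2⟩ := hterm e he
    rw [h2]
    nlinarith [(cross_mono (G := G) e q q').1]
  refine ⟨by rw [h1]; exact div_nonneg (Finset.sum_nonneg hnn) zero_le_two, fun hw h0 => ?_⟩
  rw [h1, div_eq_zero_iff, or_iff_left two_ne_zero, Finset.sum_eq_zero_iff_of_nonneg hnn] at h0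
  have hall : ∀ e ∈ edgesOf 𝒟, G.cross e q' u - G.cross e q u = 0 := by
    intro e he
    by_cases hr : G.rev e ∈ edgesOf 𝒟
    · have hi := mem_internal.2 ⟨he, hr⟩
      obtain ⟨t, -, ht, h2⟩ := hterm e hi
      rw [h0 e hi] at h2
      rw [sub_eq_zero]
      refine (cross_mono (G := G) e q q').2 ?_
      rcases mul_eq_zero.1 h2.symm with h3 | h3
      · exact absurd h3 (neg_ne_zero.2 (ht hw).ne')
      · exact h3
    · exact hbd e (mem_boundary.2 ⟨he, hr⟩)
  have h3 : ∑ e ∈ U, (G.cross e q' u - G.cross e q u) = 0 :=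
    Finset.sum_eq_zero fun e he => hall e (mem_edgesOf.2 ⟨U, hU, he⟩)
  rw [Finset.sum_sub_distrib, (h.frames U hU).sum_cross hgen' (side_ne_of_edgesOf hs' hU),
    (h.frames U hU).sum_cross hgen (side_ne_of_edgesOf hs hU), if_pos hq] at h3
  by_contra hne
  rw [if_neg fun h₂ => hne (h.eq_of_mem_inner hU hU' h₂ hq')] at h3
  norm_num at h3

omit h in
theorem exists_generic_pair {O O' : Set (ℝ × ℝ)} (hO : IsOpen O) (hO' : IsOpen O')
    (hne : O.Nonempty) (hne' : O'.Nonempty) : ∃ q ∈ O, ∃ q' ∈ O',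
      (∀ e ∈ edgesOf 𝒟, G.side e q ≠ 0) ∧ (∀ e ∈ edgesOf 𝒟, G.side e q' ≠ 0) ∧
      ∀ p, planeDet (q' - q) (G.pos p - q) ≠ 0 := by
  have := Fintype.ofFinite V
  obtain ⟨q, hq, h1, h2⟩ := G.exists_generic_point (edgesOf 𝒟) hO hne
  obtain ⟨O₁, h3, h4, h5, h6⟩ := exists_open_avoiding_lines (edgesOf 𝒟) G.vec
    (fun e => G.pos (G.src e)) (fun e _ => G.vec_ne_zero e) hO' hne'
  obtain ⟨O₂, h7, -, ⟨q', hq'⟩, h10⟩ := exists_open_avoiding_lines (Finset.univ : Finset V)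
    (fun p => G.pos p - q) (fun _ => q) (fun p _ => sub_ne_zero.2 (h2 p)) h4 h5
  refine ⟨q, hq, q', h3 (h7 hq'), h1, fun e he => h6 q' (h7 hq') e he, fun p hp => ?_⟩
  exact h10 q' hq' p (Finset.mem_univ _) (by rw [planeDet_swap, hp, neg_zero])

/-- The pieces are ordered like the points of a weak web. -/
theorem mono {x : Finset E → ℝ × ℝ} (hx : G.IsWeakWeb 𝒟 x) {U U' : Finset E} (hU : U ∈ 𝒟)
    (hU' : U' ∈ 𝒟) {q q' : ℝ × ℝ} (hq : q ∈ closure (G.inner U))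
    (hq' : q' ∈ closure (G.inner U')) : 0 ≤ planeDet (q' - q) (x U' - x U) := by
  by_contra hneg
  rw [not_le] at hneg
  have hc : Continuous fun z : (ℝ × ℝ) × (ℝ × ℝ) => planeDet (z.2 - z.1) (x U' - x U) := by
    unfold planeDet; fun_prop
  -- Strict negativity is an open condition, so it would hold at generic points of the open polygons
  -- nearby.
  have h1 := (isOpen_lt hc continuous_const).mem_nhds (show (q, q') ∈ {z | _ < (0 : ℝ)} from hneg)
  rw [nhds_prod_eq, Filter.mem_prod_iff] at h1
  obtain ⟨t, ht, t', ht', hsub⟩ := h1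
  obtain ⟨O, hOt, hO, hqO⟩ := mem_nhds_iff.1 ht
  obtain ⟨O', hOt', hO', hqO'⟩ := mem_nhds_iff.1 ht'
  obtain ⟨q₁, ⟨a1, a2⟩, q₂, ⟨b1, b2⟩, c1, c2, c3⟩ := exists_generic_pair (G := G) (𝒟 := 𝒟)
    (hO.inter (G.isOpen_inner U)) (hO'.inter (G.isOpen_inner U'))
    (mem_closure_iff.1 hq _ hO hqO) (mem_closure_iff.1 hq' _ hO' hqO')
  have h2 := (h.mono_generic hx hU hU' a2 b2 c1 c2 c3).1
  have h3 : planeDet (q₂ - q₁) (x U' - x U) < 0 := hsub (Set.mk_mem_prod (hOt a1) (hOt' b1))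
  linarith

theorem web_injective {x : Finset E → ℝ × ℝ} (hx : G.IsWeb 𝒟 x) {U U' : Finset E} (hU : U ∈ 𝒟)
    (hU' : U' ∈ 𝒟) (heq : x U = x U') : U = U' := by
  obtain ⟨q₁, a2, q₂, b2, c1, c2, c3⟩ := exists_generic_pair (G := G) (𝒟 := 𝒟)
    (G.isOpen_inner U) (G.isOpen_inner U')
    (h.frames U hU).inner_nonempty (h.frames U' hU').inner_nonempty
  exact (h.mono_generic hx.isWeakWeb hU hU' a2 b2 c1 c2 c3).2 hx (by simp [heq, planeDet])

end IsTiling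

end PlaneGraph

end

noncomputable section

open scoped Classical

namespace PlaneGraph

variable {V E : Type*} {G : PlaneGraph V E}

/-! ### Germs of frames -/

theorem eventually_mem_inner {U : Finset E} {q z : ℝ × ℝ}
    (h : ∀ e ∈ U, 0 < G.side e q ∨ G.side e q = 0 ∧ 0 < planeDet (G.vec e) z) :
    ∀ᶠ ε : ℝ in 𝓝[>] 0, q + ε • z ∈ G.inner U := by
  have : ∀ e ∈ U, ∀ᶠ ε : ℝ in 𝓝[>] 0, 0 < G.side e (q + ε • z) := by
    intro e he
    have hval : ∀ ε : ℝ, G.side e (q + ε • z) = G.side e q + ε * planeDet (G.vec e) z := fun ε => by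
      simp only [side, planeDet, Prod.fst_sub, Prod.snd_sub, Prod.fst_add, Prod.snd_add,
        Prod.smul_fst, Prod.smul_snd, smul_eq_mul]
      ring
    simp only [hval]
    rcases h e he with h | ⟨h0, h⟩
    · have hc : Continuous fun ε : ℝ => G.side e q + ε * planeDet (G.vec e) z := by fun_prop
      exact (hc.continuousAt.eventually (lt_mem_nhds (by simpa using h))).filter_mono
        nhdsWithin_le_nhds
    · filter_upwards [self_mem_nhdsWithin] with ε hε
      rw [h0, zero_add]
      exact mul_pos hε h
  exact (Finset.eventually_all U).2 this

theorem IsFrame.eventually_mem_inner_corner {U : Finset E} (hU : G.IsFrame U) {e e' : E}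
    (he : e ∈ U) (he' : e' ∈ U) (h : G.src e' = G.tgt e) {z : ℝ × ℝ}
    (h1 : 0 < planeDet (G.vec e) z) (h2 : 0 < planeDet (G.vec e') z) :
    ∀ᶠ ε : ℝ in 𝓝[>] 0, G.pos (G.src e') + ε • z ∈ G.inner U := by
  refine eventually_mem_inner fun e₁ he₁ => ?_
  rcases (hU.side_nonneg e₁ he₁ e' he').lt_or_eq with h3 | h3
  · exact Or.inl h3
  · refine Or.inr ⟨h3.symm, ?_⟩
    rcases G.side_eq_zero h3.symm with h4 | h4
    · rwa [← hU.src_inj _ he' _ he₁ h4]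
    · rwa [← hU.tgt_inj he he₁ (by rw [← h, h4])]

theorem IsFrame.eventually_mem_inner_edge {U : Finset E} (hU : G.IsFrame U) {e : E}
    (he : e ∈ U) : ∀ᶠ ε : ℝ in 𝓝[>] 0, (G.pos (G.src e) + (1 / 2 : ℝ) •
      (G.pos (G.tgt e) - G.pos (G.src e))) + ε • ((-(G.vec e).2, (G.vec e).1) : ℝ × ℝ) ∈
        G.inner U := by
  refine eventually_mem_inner fun e₁ he₁ => ?_
  rw [G.side_lineMap]
  have p1 := hU.side_nonneg e₁ he₁ e he
  have p2 := hU.side_tgt_nonneg he₁ he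
  by_cases hee : e₁ = e
  · subst hee
    refine Or.inr ⟨by simp, ?_⟩
    simp only [planeDet]
    have : (G.vec e₁).1 ≠ 0 := sub_ne_zero.2 (G.fst_ne _ _ (G.src_ne_tgt e₁).symm)
    nlinarith [sq_pos_of_ne_zero this, sq_nonneg (G.vec e₁).2]
  · left
    rcases p1.lt_or_eq with h | h
    · linarith
    rcases p2.lt_or_eq with h' | h'
    · linarith
    exfalso
    rcases G.side_eq_zero h.symm with h1 | h1
    · exact hee (hU.src_inj _ he _ he₁ h1).symm
    · rcases G.side_eq_zero h'.symm with h2 | h2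
      · exact hU.no_digon _ he₁ _ he h1 h2
      · exact hee (hU.tgt_inj he he₁ h2).symm

/-- Both polygons contain the points just to the left of the midpoint of the common segment. -/
theorem exists_mem_inner_of_parallel {U U' : Finset E} (hU : G.IsFrame U) (hU' : G.IsFrame U')
    {e e' : E} (he : e ∈ U) (he' : e' ∈ U') (h1 : G.src e = G.src e') (h2 : G.tgt e = G.tgt e') :
    (G.inner U ∩ G.inner U').Nonempty := by
  have a := hU.eventually_mem_inner_edge he
  have b := hU'.eventually_mem_inner_edge he'
  have hv : G.vec e' = G.vec e := by simp [vec, h1, h2]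
  rw [← h1, ← h2, hv] at b
  obtain ⟨ε, h3, h4⟩ := (a.and b).exists
  exact ⟨_, h3, h4⟩

variable {𝒟 : Finset (Finset E)}

/-- Several edges may join the same two vertices, so coincidence of segments is weaker than equality
of edges. Distinct pieces on the same side of a segment would overlap all the same. -/
theorem IsTiling.eq_of_parallel [Finite V] (h : G.IsTiling 𝒟) {U U' : Finset E} (hU : U ∈ 𝒟)
    (hU' : U' ∈ 𝒟) {e e' : E} (he : e ∈ U) (he' : e' ∈ U') (h1 : G.src e = G.src e')
    (h2 : G.tgt e = G.tgt e') : U = U' := by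
  obtain ⟨q, h3, h4⟩ :=
    exists_mem_inner_of_parallel (h.frames U hU) (h.frames U' hU') he he' h1 h2
  exact h.eq_of_mem_inner hU hU' h3 h4

theorem IsFrame.src_mem_closure {U : Finset E} (hU : G.IsFrame U) {e : E} (he : e ∈ U) :
    G.pos (G.src e) ∈ closure (G.inner U) :=
  hU.mem_closure_inner _ fun e₁ he₁ => hU.side_nonneg e₁ he₁ e he

theorem IsFrame.tgt_mem_closure {U : Finset E} (hU : G.IsFrame U) {e : E} (he : e ∈ U) :
    G.pos (G.tgt e) ∈ closure (G.inner U) :=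
  hU.mem_closure_inner _ fun _ he₁ => hU.side_tgt_nonneg he₁ he

/-! ### Boundaries of subfamilies -/

/-- The boundary of a family of cycles is balanced. -/
theorem exists_next_boundary (hf : ∀ U ∈ 𝒟, G.IsFrame U)
    (hd : ∀ U ∈ 𝒟, ∀ U' ∈ 𝒟, ∀ e ∈ U, e ∈ U' → U = U') {e : E} (he : e ∈ G.boundary 𝒟) :
    ∃ e' ∈ G.boundary 𝒟, G.src e' = G.tgt e := by
  by_contra! hno
  set p := G.tgt e
  -- Incoming minus outgoing edges at `p`: this function is odd under reversal and has sum zero on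
  -- every cycle, hence on the boundary.
  have h1 := sum_edges_tiling (G := G) hd
    (fun e => (if G.tgt e = p then (1 : ℝ) else 0) - if G.src e = p then 1 else 0)
    (fun e => by rw [G.tgt_rev, G.src_rev]; ring)
  have h2 : ∀ U ∈ 𝒟, ∑ e ∈ U, ((if G.tgt e = p then (1 : ℝ) else 0) -
      if G.src e = p then 1 else 0) = 0 := by
    intro U hU
    obtain ⟨σ, hσ⟩ := (hf U hU).exists_perm
    have e1 : ∑ e ∈ U, (if G.src e = p then (1 : ℝ) else 0) =
        ∑ e : U, if G.src (σ e).1 = p then 1 else 0 := by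
      rw [← Finset.sum_coe_sort U]
      exact (Equiv.sum_comp σ fun e : U => if G.src e.1 = p then (1 : ℝ) else 0).symm
    rw [Finset.sum_sub_distrib, sub_eq_zero, e1, ← Finset.sum_coe_sort U]
    simp only [hσ]
  rw [Finset.sum_eq_zero h2] at h1
  have h3 : ∀ e₁ ∈ G.boundary 𝒟, (if G.src e₁ = p then (1 : ℝ) else 0) = 0 := fun e₁ h =>
    if_neg (hno e₁ h)
  rw [Finset.sum_sub_distrib, Finset.sum_eq_zero h3, sub_zero] at h1
  have := (Finset.sum_eq_zero_iff_of_nonneg fun _ _ => by split_ifs <;> norm_num).1 h1.symm e he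
  simp [p] at this

variable [Finite V] (h : G.IsTiling 𝒟)
include h

namespace IsTiling

omit [Finite V] in
theorem unique_subset {C : Finset (Finset E)} (hC : C ⊆ 𝒟) :
    ∀ U ∈ C, ∀ U' ∈ C, ∀ e ∈ U, e ∈ U' → U = U' :=
  fun U hU U' hU' => h.unique U (hC hU) U' (hC hU')

/-- A subfamily which lies to the left of its boundary is glued to a frame. -/
theorem isFrame_boundary {C : Finset (Finset E)} (hC : C ⊆ 𝒟) (hne : C.Nonempty)
    (hleft : ∀ e ∈ G.boundary C, ∀ U ∈ C, ∀ e' ∈ U, 0 ≤ G.side e (G.pos (G.src e'))) :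
    G.IsFrame (G.boundary C) := by
  have hf : ∀ U ∈ C, G.IsFrame U := fun U hU => h.frames U (hC hU)
  have hd := h.unique_subset hC
  have hleft' : ∀ e ∈ G.boundary C, ∀ U ∈ C, ∀ e' ∈ U, 0 ≤ G.side e (G.pos (G.tgt e')) := by
    intro e he U hU e' he'
    obtain ⟨e₁, h1, h2⟩ := (hf U hU).exists_next e' he'
    rw [← h2]
    exact hleft e he U hU e₁ h1
  refine ⟨?_, fun e he => exists_next_boundary hf hd he, ?_, ?_, ?_⟩
  -- With empty boundary the crossing numbers around a generic point inside a piece would sum to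
  -- zero, but every piece contributes a nonnegative number and one of them contributes one.
  · by_contra hemp
    rw [Finset.not_nonempty_iff_eq_empty] at hemp
    obtain ⟨U, hU⟩ := hne
    obtain ⟨q, h1, h2, h3⟩ := G.exists_generic_point (edgesOf C) (G.isOpen_inner U)
      (hf U hU).inner_nonempty
    obtain ⟨u, -, hu⟩ := G.exists_generic_dir h3 isOpen_univ ⟨0, trivial⟩
    have h4 := sum_edges_tiling (G := G) hd (fun e => G.cross e q u) fun e => G.cross_rev e q u
    rw [hemp, Finset.sum_empty, Finset.sum_congr rfl fun W hW =>
      (hf W hW).sum_cross hu (side_ne_of_edgesOf h2 hW)] at h4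
    have := (Finset.sum_eq_zero_iff_of_nonneg fun _ _ => by split_ifs <;> norm_num).1 h4 U hU
    simp [h1] at this
  · intro e he e' he' hs
    obtain ⟨U, hU, heU⟩ := mem_edgesOf.1 (mem_boundary.1 he).1
    obtain ⟨U', hU', heU'⟩ := mem_edgesOf.1 (mem_boundary.1 he').1
    have h1 := hleft' e he U' hU' e' heU'
    have h2 := hleft' e' he' U hU e heU
    have h3 : G.side e (G.pos (G.tgt e')) = 0 := by
      have : G.side e' (G.pos (G.tgt e)) = -G.side e (G.pos (G.tgt e')) := by
        simp only [side, vec, planeDet, Prod.fst_sub, Prod.snd_sub, hs]; ring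
      linarith
    have ht : G.tgt e = G.tgt e' := by
      rcases G.side_eq_zero h3 with h4 | h4
      · exact absurd (hs.symm.trans h4.symm) (G.src_ne_tgt e')
      · exact h4.symm
    have := h.eq_of_parallel (hC hU) (hC hU') heU heU' hs ht
    subst this
    exact (hf U hU).src_inj e heU e' heU' hs
  · intro e he e' he'
    obtain ⟨U', hU', heU'⟩ := mem_edgesOf.1 (mem_boundary.1 he').1
    exact hleft e he U' hU' e' heU'
  · intro e he e' he' h1 h2
    obtain ⟨U, hU, heU⟩ := mem_edgesOf.1 (mem_boundary.1 he).1
    obtain ⟨e₁, h3, h4⟩ := (hf U hU).exists_side_pos heU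
    have h5 := hleft e' he' U hU e₁ h3
    have : G.side e' (G.pos (G.src e₁)) = -G.side e (G.pos (G.src e₁)) := by
      simp only [side, vec, planeDet, Prod.fst_sub, Prod.snd_sub, h1, h2]; ring
    linarith

omit [Finite V] in
theorem isTiling_subset {C : Finset (Finset E)} (hC : C ⊆ 𝒟)
    (hb : G.IsFrame (G.boundary C)) : G.IsTiling C :=
  ⟨fun U hU => h.frames U (hC hU), h.unique_subset hC, hb⟩

end IsTiling

omit [Finite V] h in
theorem IsWeb.mono_set {x : Finset E → ℝ × ℝ} {C : Finset (Finset E)} (hC : C ⊆ 𝒟)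
    (hx : G.IsWeb 𝒟 x) : G.IsWeb C x :=
  fun U hU U' hU' => hx U (hC hU) U' (hC hU')

namespace IsTiling

/-- The pieces at one point of a weak web form a convex polygon. -/
theorem isFrame_boundary_fiber {x : Finset E → ℝ × ℝ} (hx : G.IsWeakWeb 𝒟 x) {ρ : ℝ × ℝ}
    (hne : (𝒟.filter fun U => x U = ρ).Nonempty) :
    G.IsFrame (G.boundary (𝒟.filter fun U => x U = ρ)) := by
  refine h.isFrame_boundary (Finset.filter_subset _ _) hne fun e he U' hU' e' he' => ?_
  rw [mem_boundary, mem_edgesOf] at he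
  obtain ⟨⟨U, hU, heU⟩, hr⟩ := he
  rw [Finset.mem_filter] at hU hU'
  have hc := (h.frames U' hU'.1).src_mem_closure he'
  by_cases hb : G.rev e ∈ edgesOf 𝒟
  · obtain ⟨j, hj, hej⟩ := mem_edgesOf.1 hb
    obtain ⟨t, ht, hxt⟩ := hx U hU.1 j hj e heU hej
    have ht0 : t ≠ 0 := by
      rintro rfl
      rw [zero_smul, sub_eq_zero] at hxt
      exact hr (mem_edgesOf.2 ⟨j, Finset.mem_filter.2 ⟨hj, hxt.trans hU.2⟩, hej⟩)
    -- Across `e` the web moves by a positive multiple of the edge vector. Monotonicity between any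
    -- piece at `ρ` and the piece behind `e` says that the former lies to the left of `e`.
    have hm := h.mono hx hU'.1 hj hc ((h.frames j hj).tgt_mem_closure hej)
    rw [hU'.2, ← hU.2, hxt, G.tgt_rev] at hm
    have key : planeDet (G.pos (G.src e) - G.pos (G.src e')) (t • G.vec e) =
        t * G.side e (G.pos (G.src e')) := by
      simp only [side, vec, planeDet, Prod.fst_sub, Prod.snd_sub, Prod.smul_fst, Prod.smul_snd,
        smul_eq_mul]
      ring
    rw [key] at hm
    exact nonneg_of_mul_nonneg_right hm (ht.lt_of_ne ht0.symm)
  · exact h.side_boundary_nonneg hU'.1 hc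
      (mem_boundary.2 ⟨mem_edgesOf.2 ⟨U, hU.1, heU⟩, hb⟩)

end IsTiling

/-! ### Coarsening -/

omit h in
/-- The polygons obtained by merging the pieces with the same value. -/
def merge (G : PlaneGraph V E) (𝒟 : Finset (Finset E)) (x : Finset E → ℝ × ℝ) :
    Finset (Finset E) :=
  (𝒟.image x).image fun ρ => G.boundary (𝒟.filter fun U => x U = ρ)

omit [Finite V] in
theorem mem_edgesOf_fiber {x : Finset E → ℝ × ℝ} {ρ : ℝ × ℝ} {e : E} :
    e ∈ edgesOf (𝒟.filter fun U => x U = ρ) ↔ e ∈ edgesOf 𝒟 ∧ x (owner 𝒟 e) = ρ := by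
  constructor
  · intro he
    obtain ⟨U, hU, heU⟩ := mem_edgesOf.1 he
    rw [Finset.mem_filter] at hU
    exact ⟨mem_edgesOf.2 ⟨U, hU.1, heU⟩, by rw [owner_eq h.unique hU.1 heU, hU.2]⟩
  · rintro ⟨he, hx⟩
    have := owner_spec he
    exact mem_edgesOf.2 ⟨_, Finset.mem_filter.2 ⟨this.1, hx⟩, this.2⟩

omit [Finite V] in
theorem mem_boundary_fiber {x : Finset E → ℝ × ℝ} {ρ : ℝ × ℝ} {e : E} :
    e ∈ G.boundary (𝒟.filter fun U => x U = ρ) ↔ e ∈ edgesOf 𝒟 ∧ x (owner 𝒟 e) = ρ ∧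
      (G.rev e ∈ edgesOf 𝒟 → x (owner 𝒟 (G.rev e)) ≠ ρ) := by
  rw [mem_boundary, mem_edgesOf_fiber h, mem_edgesOf_fiber h]
  tauto

omit [Finite V] in
theorem mem_internal_fiber {x : Finset E → ℝ × ℝ} {ρ : ℝ × ℝ} {e : E} :
    e ∈ G.internal (𝒟.filter fun U => x U = ρ) ↔ e ∈ G.internal 𝒟 ∧ x (owner 𝒟 e) = ρ ∧
      x (owner 𝒟 (G.rev e)) = ρ := by
  rw [mem_internal, mem_edgesOf_fiber h, mem_edgesOf_fiber h, mem_internal]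
  tauto

omit [Finite V] in
theorem mem_edgesOf_merge {x : Finset E → ℝ × ℝ} {e : E} :
    e ∈ edgesOf (merge G 𝒟 x) ↔ e ∈ edgesOf 𝒟 ∧
      (G.rev e ∈ edgesOf 𝒟 → x (owner 𝒟 (G.rev e)) ≠ x (owner 𝒟 e)) := by
  rw [mem_edgesOf, merge]
  simp only [Finset.mem_image, exists_exists_and_eq_and]
  constructor
  · rintro ⟨U, hU, he⟩
    rw [mem_boundary_fiber h] at he
    rw [he.2.1]
    exact ⟨he.1, he.2.2⟩
  · rintro ⟨h1, h2⟩
    exact ⟨_, (owner_spec h1).1, (mem_boundary_fiber h).2 ⟨h1, rfl, h2⟩⟩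

omit [Finite V] in
theorem mem_internal_merge {x : Finset E → ℝ × ℝ} {e : E} :
    e ∈ G.internal (merge G 𝒟 x) ↔ e ∈ G.internal 𝒟 ∧
      x (owner 𝒟 (G.rev e)) ≠ x (owner 𝒟 e) := by
  rw [mem_internal, mem_edgesOf_merge h, mem_edgesOf_merge h, mem_internal, G.rev_rev]
  constructor
  · rintro ⟨⟨h1, h2⟩, h3, -⟩
    exact ⟨⟨h1, h3⟩, h2 h3⟩
  · rintro ⟨⟨h1, h3⟩, h2⟩
    exact ⟨⟨h1, fun _ => h2⟩, h3, fun _ => h2.symm⟩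

omit [Finite V] in
theorem boundary_merge (x : Finset E → ℝ × ℝ) : G.boundary (merge G 𝒟 x) = G.boundary 𝒟 := by
  ext e
  rw [mem_boundary, mem_edgesOf_merge h, mem_edgesOf_merge h, mem_boundary, G.rev_rev]
  constructor
  · rintro ⟨⟨h1, h2⟩, h3⟩
    refine ⟨h1, fun h4 => h3 ⟨h4, fun _ => (h2 h4).symm⟩⟩
  · rintro ⟨h1, h2⟩
    exact ⟨⟨h1, fun h => absurd h h2⟩, fun h => h2 h.1⟩

omit [Finite V] in
theorem card_internal_merge (x : Finset E → ℝ × ℝ) :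
    (G.internal 𝒟).card = ∑ ρ ∈ 𝒟.image x, (G.internal (𝒟.filter fun U => x U = ρ)).card +
      (G.internal (merge G 𝒟 x)).card := by
  have h1 : (G.internal (merge G 𝒟 x)) = (G.internal 𝒟).filter
      fun e => ¬ x (owner 𝒟 (G.rev e)) = x (owner 𝒟 e) := by
    ext e; rw [mem_internal_merge h, Finset.mem_filter]
  rw [h1, ← Finset.card_filter_add_card_filter_not (s := G.internal 𝒟)
    (fun e => x (owner 𝒟 (G.rev e)) = x (owner 𝒟 e))]
  congr 1
  rw [Finset.card_eq_sum_card_fiberwise (f := fun e => x (owner 𝒟 e)) (t := 𝒟.image x)]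
  · refine Finset.sum_congr rfl fun ρ _ => congrArg _ ?_
    ext e
    rw [mem_internal_fiber h, Finset.mem_filter, Finset.mem_filter]
    constructor
    · rintro ⟨⟨h1, h2⟩, h3⟩
      exact ⟨h1, h3, h2.trans h3⟩
    · rintro ⟨h1, h2, h3⟩
      exact ⟨⟨h1, h3.trans h2.symm⟩, h2⟩
  · intro e he
    have he := Finset.mem_filter.1 (Finset.mem_coe.1 he)
    exact Finset.mem_coe.2 (Finset.mem_image_of_mem _ (owner_spec (mem_internal.1 he.1).1).1)

/-- The points of the merged polygons. -/
def mergeWeb (𝒟 : Finset (Finset E)) (x : Finset E → ℝ × ℝ) (g : Finset E) : ℝ × ℝ :=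
  if h : g.Nonempty then x (owner 𝒟 h.choose) else 0

namespace IsTiling

theorem mergeWeb_boundary {x : Finset E → ℝ × ℝ} (hx : G.IsWeakWeb 𝒟 x) {ρ : ℝ × ℝ}
    (hρ : ρ ∈ 𝒟.image x) : mergeWeb 𝒟 x (G.boundary (𝒟.filter fun U => x U = ρ)) = ρ := by
  obtain ⟨U, hU, rfl⟩ := Finset.mem_image.1 hρ
  have hne := (h.isFrame_boundary_fiber hx (ρ := x U) ⟨U, by simp [hU]⟩).nonempty
  rw [mergeWeb, dif_pos hne]
  exact ((mem_boundary_fiber h).1 hne.choose_spec).2.1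

/-- The fibres of a weak web lie to the left of their boundaries and so become convex polygons;
edges inside a fibre disappear, the others keep their gluing. -/
theorem merge_isTiling {x : Finset E → ℝ × ℝ} (hx : G.IsWeakWeb 𝒟 x) :
    G.IsTiling (merge G 𝒟 x) := by
  refine ⟨?_, ?_, ?_⟩
  · intro g hg
    simp only [merge, Finset.mem_image, exists_exists_and_eq_and] at hg
    obtain ⟨U, hU, rfl⟩ := hg
    exact h.isFrame_boundary_fiber hx ⟨U, by simp [hU]⟩
  · intro g hg g' hg' e he he'
    simp only [merge, Finset.mem_image, exists_exists_and_eq_and] at hg hg'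
    obtain ⟨U, hU, rfl⟩ := hg
    obtain ⟨U', hU', rfl⟩ := hg'
    rw [← ((mem_boundary_fiber h).1 he).2.1, ← ((mem_boundary_fiber h).1 he').2.1]
  · rw [boundary_merge h]
    exact h.boundary

theorem card_merge {x : Finset E → ℝ × ℝ} (hx : G.IsWeakWeb 𝒟 x) :
    (merge G 𝒟 x).card = (𝒟.image x).card := by
  refine Finset.card_image_of_injOn fun ρ hρ ρ' hρ' he => ?_
  rw [← h.mergeWeb_boundary hx hρ, ← h.mergeWeb_boundary hx hρ']
  exact congrArg _ he

theorem merge_isWeb {x : Finset E → ℝ × ℝ} (hx : G.IsWeakWeb 𝒟 x) :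
    G.IsWeb (merge G 𝒟 x) (mergeWeb 𝒟 x) := by
  intro g hg g' hg' e he he'
  rw [merge, Finset.mem_image] at hg hg'
  obtain ⟨ρ, hρ, rfl⟩ := hg
  obtain ⟨ρ', hρ', rfl⟩ := hg'
  rw [h.mergeWeb_boundary hx hρ, h.mergeWeb_boundary hx hρ']
  rw [mem_boundary_fiber h] at he he'
  have o1 := owner_spec he.1
  have o2 := owner_spec he'.1
  obtain ⟨t, ht, hxt⟩ := hx _ o1.1 _ o2.1 e o1.2 o2.2
  rw [he.2.1, he'.2.1] at hxt
  refine ⟨t, ht.lt_of_ne ?_, hxt⟩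
  rintro rfl
  rw [zero_smul, sub_eq_zero] at hxt
  exact he.2.2 he'.1 (he'.2.1.trans hxt)

end IsTiling

end PlaneGraph

end

/-! ### Generic rank, affine relations and convex position -/

noncomputable section

open scoped Classical

/-- A matrix of polynomials has independent rows at each generic point, unless there is a relation
with polynomial coefficients, not all of which vanish at the generic points. -/
theorem exists_generic_rank {σ ι κ : Type*} [Fintype ι] [Fintype κ]
    (M : Matrix ι κ (MvPolynomial σ ℤ)) : ∃ P : MvPolynomial σ ℤ, P ≠ 0 ∧
      ∀ a : σ → ℝ, MvPolynomial.aeval a P ≠ 0 →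
        (∀ τ : ι → ℝ, Matrix.vecMul τ (M.map (MvPolynomial.aeval a)) = 0 → τ = 0) ∨
        ∃ τ : ι → MvPolynomial σ ℤ, Matrix.vecMul τ M = 0 ∧
          ∃ i, MvPolynomial.aeval a (τ i) ≠ 0 := by
  by_cases hdet : (M * M.transpose).det = 0
  · obtain ⟨τ, hτ, h⟩ := Matrix.exists_vecMul_eq_zero_iff.2 hdet
    obtain ⟨i, hi⟩ := Function.ne_iff.1 hτ
    refine ⟨τ i, hi, fun a ha => Or.inr ⟨τ, ?_, i, ha⟩⟩
    have h1 : ∑ j, Matrix.vecMul τ M j * Matrix.vecMul τ M j = 0 := by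
      have : dotProduct (Matrix.vecMul τ (M * M.transpose)) τ = 0 := by rw [h, zero_dotProduct]
      rw [← Matrix.vecMul_vecMul, ← Matrix.dotProduct_mulVec, Matrix.mulVec_transpose] at this
      exact this
    funext j
    refine MvPolynomial.funext fun x => ?_
    have h2 := congrArg (MvPolynomial.eval x) h1
    simp only [map_sum, map_mul, map_zero] at h2
    have := (Finset.sum_eq_zero_iff_of_nonneg fun j _ => mul_self_nonneg _).1 h2 j
      (Finset.mem_univ _)
    simpa using this
  · refine ⟨_, hdet, fun a ha => Or.inl fun τ hτ => ?_⟩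
    have h1 : (M.map (MvPolynomial.aeval a) * (M.map (MvPolynomial.aeval a)).transpose).det =
        MvPolynomial.aeval a (M * M.transpose).det := by
      rw [AlgHom.map_det]
      congr 1
      ext i j
      simp [Matrix.mul_apply]
    by_contra hne
    refine ha ?_
    rw [← h1]
    refine Matrix.exists_vecMul_eq_zero_iff.1 ⟨τ, hne, ?_⟩
    rw [← Matrix.vecMul_vecMul, hτ, Matrix.zero_vecMul]

/-- An affine relation between points in convex position involves at least four of them. -/
theorem four_le_card_of_affine_relation {ι : Type*} (s : Finset ι) (c : ι → ℝ) (X : ι → ℝ × ℝ)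
    (h0 : ∑ i ∈ s, c i = 0) (h1 : ∑ i ∈ s, c i • X i = 0) (hne : ∃ i ∈ s, c i ≠ 0)
    (hex : ∀ i ∈ s, c i ≠ 0 → ∃ u : ℝ × ℝ, ∀ j ∈ s, c j ≠ 0 → j ≠ i →
      0 < planeDet u (X j - X i)) : 4 ≤ (s.filter fun i => c i ≠ 0).card := by
  have hval : ∀ (d : ι → ℝ), ∑ i ∈ s, d i = 0 → ∑ i ∈ s, d i • X i = 0 → ∀ (u : ℝ × ℝ) (i : ι),
      ∑ j ∈ s, d j * planeDet u (X j - X i) = 0 := by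
    intro d h0 h1 u i
    have e1 : ∀ j, d j * planeDet u (X j - X i) =
        u.1 * (d j • X j).2 - u.2 * (d j • X j).1 - d j * planeDet u (X i) := fun j => by
      simp only [planeDet, Prod.fst_sub, Prod.snd_sub, Prod.smul_fst, Prod.smul_snd, smul_eq_mul]
      ring
    simp only [e1, Finset.sum_sub_distrib, ← Finset.mul_sum, ← Finset.sum_mul, ← Prod.fst_sum,
      ← Prod.snd_sum, h0, h1]
    simp
  -- At least two coefficients are positive: none contradicts the vanishing sum, and with only one
  -- the functional exposing its point would force all other coefficients to vanish. The same holds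
  -- for `-c`, which gives four.
  have two : ∀ d : ι → ℝ, (∀ i, d i ≠ 0 ↔ c i ≠ 0) → ∑ i ∈ s, d i = 0 → ∑ i ∈ s, d i • X i = 0 →
      1 < (s.filter fun i => 0 < d i).card := by
    intro d hd h0 h1
    by_contra hle
    rw [not_lt] at hle
    obtain ⟨i₀, hi₀, hci₀⟩ := hne
    rcases Nat.le_one_iff_eq_zero_or_eq_one.1 hle with hc | hc
    · rw [Finset.card_eq_zero, Finset.filter_eq_empty_iff] at hc
      have := (Finset.sum_eq_zero_iff_of_nonpos fun i hi => not_lt.1 (hc hi)).1 h0 i₀ hi₀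
      exact (hd i₀).2 hci₀ this
    · obtain ⟨i, hi⟩ := Finset.card_eq_one.1 hc
      have his : i ∈ s.filter fun i => 0 < d i := by rw [hi]; simp
      rw [Finset.mem_filter] at his
      obtain ⟨u, hu⟩ := hex i his.1 ((hd i).1 his.2.ne')
      have hle : ∀ j ∈ s, j ≠ i → d j ≤ 0 := fun j hj hji => by
        by_contra hc
        have : j ∈ s.filter fun i => 0 < d i := Finset.mem_filter.2 ⟨hj, not_le.1 hc⟩
        rw [hi] at this
        exact hji (Finset.mem_singleton.1 this)
      have hnp : ∀ j ∈ s, d j * planeDet u (X j - X i) ≤ 0 := fun j hj => by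
        by_cases hji : j = i
        · simp [hji, planeDet]
        · by_cases hcj : d j = 0
          · simp [hcj]
          · exact mul_nonpos_of_nonpos_of_nonneg (hle j hj hji) (hu j hj ((hd j).1 hcj) hji).le
      have hz := (Finset.sum_eq_zero_iff_of_nonpos hnp).1 (hval d h0 h1 u i)
      have hz' : ∀ j ∈ s, j ≠ i → d j = 0 := fun j hj hji => by
        by_contra hcj
        rcases mul_eq_zero.1 (hz j hj) with h | h
        · exact hcj h
        · exact (hu j hj ((hd j).1 hcj) hji).ne' h
      rw [Finset.sum_eq_single_of_mem i his.1 hz'] at h0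
      exact his.2.ne' h0
  have p := two c (fun _ => Iff.rfl) h0 h1
  have m := two (fun i => -c i) (fun i => by simp) (by simp [h0]) (by
    simp only [neg_smul, Finset.sum_neg_distrib, h1, neg_zero])
  have hsplit : (s.filter fun i => c i ≠ 0) = (s.filter fun i => 0 < c i) ∪
      s.filter fun i => 0 < -c i := by
    ext i
    simp only [Finset.mem_filter, Finset.mem_union, ne_eq]
    constructor
    · rintro ⟨hi, hc⟩
      rcases lt_or_gt_of_ne hc with h | h
      · exact Or.inr ⟨hi, by linarith⟩
      · exact Or.inl ⟨hi, h⟩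
    · rintro (⟨hi, hc⟩ | ⟨hi, hc⟩)
      · exact ⟨hi, hc.ne'⟩
      · exact ⟨hi, by intro h; rw [h] at hc; simp at hc⟩
  rw [hsplit, Finset.card_union_of_disjoint]
  · omega
  · refine Finset.disjoint_left.2 fun i h h' => ?_
    rw [Finset.mem_filter] at h h'
    linarith [h.2, h'.2]

namespace PlaneGraph

variable {V E : Type*} {G : PlaneGraph V E} {U : Finset E}

theorem vec_fst_ne (e : E) : (G.vec e).1 ≠ 0 := sub_ne_zero.2 (G.fst_ne _ _ (G.src_ne_tgt e).symm)

namespace IsFrame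

variable (hU : G.IsFrame U)
include hU

/-- The polygon lies in the cone of each corner. -/
theorem corner_cone {e e' e₁ : E} (he : e ∈ U) (he' : e' ∈ U) (h : G.src e' = G.tgt e)
    (he₁ : e₁ ∈ U) : ∃ x y : ℝ, 0 ≤ x ∧ 0 ≤ y ∧
      G.pos (G.src e₁) - G.pos (G.src e') = y • G.vec e' - x • G.vec e := by
  have ht := hU.turn he he' h
  have p1 := hU.side_nonneg e he e₁ he₁
  have p2 := hU.side_nonneg e' he' e₁ he₁
  have e1 : G.side e (G.pos (G.src e₁)) =
      planeDet (G.vec e) (G.pos (G.src e₁) - G.pos (G.src e')) := by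
    simp only [side, vec, planeDet, Prod.fst_sub, Prod.snd_sub, h]; ring
  have hc := planeDet_smul_eq (G.vec e) (G.vec e') (G.pos (G.src e₁) - G.pos (G.src e'))
  refine ⟨G.side e' (G.pos (G.src e₁)) / planeDet (G.vec e) (G.vec e'),
    G.side e (G.pos (G.src e₁)) / planeDet (G.vec e) (G.vec e'), div_nonneg p2 ht.le,
    div_nonneg p1 ht.le, ?_⟩
  rw [div_eq_inv_mul, div_eq_inv_mul, mul_smul, mul_smul, ← smul_sub, eq_inv_smul_iff₀ ht.ne', hc,
    e1, planeDet_swap _ (G.vec e'), side]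
  module

theorem fst_le_of_turn {e e' e₁ : E} (he : e ∈ U) (he' : e' ∈ U) (h : G.src e' = G.tgt e)
    (he₁ : e₁ ∈ U) (h1 : 0 < (G.vec e).1) (h2 : (G.vec e').1 < 0) :
    (G.pos (G.src e₁)).1 ≤ (G.pos (G.src e')).1 := by
  obtain ⟨x, y, hx, hy, hxy⟩ := hU.corner_cone he he' h he₁
  have := congrArg Prod.fst hxy
  simp only [Prod.fst_sub, Prod.smul_fst, smul_eq_mul] at this
  nlinarith [mul_nonneg hx h1.le, mul_nonneg hy (neg_pos.2 h2).le]

theorem le_fst_of_turn {e e' e₁ : E} (he : e ∈ U) (he' : e' ∈ U) (h : G.src e' = G.tgt e)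
    (he₁ : e₁ ∈ U) (h1 : (G.vec e).1 < 0) (h2 : 0 < (G.vec e').1) :
    (G.pos (G.src e')).1 ≤ (G.pos (G.src e₁)).1 := by
  obtain ⟨x, y, hx, hy, hxy⟩ := hU.corner_cone he he' h he₁
  have := congrArg Prod.fst hxy
  simp only [Prod.fst_sub, Prod.smul_fst, smul_eq_mul] at this
  nlinarith [mul_nonneg hx (neg_pos.2 h1).le, mul_nonneg hy h2.le]

/-- The side functionals of the two edges at the corner add up to one that is nonnegative on the
polygon and vanishes at no other vertex. -/
theorem corner_exposed {e e' e₁ : E} (he : e ∈ U) (he' : e' ∈ U) (h : G.src e' = G.tgt e)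
    (he₁ : e₁ ∈ U) (hne : G.src e₁ ≠ G.src e') :
    0 < planeDet (G.vec e + G.vec e') (G.pos (G.src e₁) - G.pos (G.src e')) := by
  have p1 := hU.side_nonneg e he e₁ he₁
  have p2 := hU.side_nonneg e' he' e₁ he₁
  have e1 : planeDet (G.vec e + G.vec e') (G.pos (G.src e₁) - G.pos (G.src e')) =
      G.side e (G.pos (G.src e₁)) + G.side e' (G.pos (G.src e₁)) := by
    simp only [side, vec, planeDet, Prod.fst_sub, Prod.snd_sub, Prod.fst_add, Prod.snd_add, h]
    ring
  rw [e1]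
  refine (add_nonneg p1 p2).lt_of_ne fun h0 => ?_
  have z1 : G.side e (G.pos (G.src e₁)) = 0 := by linarith
  have z2 : G.side e' (G.pos (G.src e₁)) = 0 := by linarith
  rcases G.side_eq_zero z2 with h3 | h3
  · exact hne h3
  · rcases G.side_eq_zero z1 with h4 | h4
    · exact hU.no_digon e he e' he' h (h3.symm.trans h4)
    · exact hne (h4.trans h.symm)

end IsFrame

variable {𝒟 : Finset (Finset E)} [Finite V]

/-- The pieces around a vertex are placed in convex position by a web. -/
theorem IsTiling.exists_exposing (h : G.IsTiling 𝒟) {x : Finset E → ℝ × ℝ} (hx : G.IsWeb 𝒟 x)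
    (hU : U ∈ 𝒟) (q₀ : ℝ × ℝ) : ∃ u : ℝ × ℝ, ∀ U' ∈ 𝒟, q₀ ∈ closure (G.inner U') → U' ≠ U →
      0 < planeDet u (x U' - x U) := by
  -- The exposing functional is `q₀ - q` for a point `q` inside `U`. Monotonicity makes it
  -- nonnegative on the displacements of the other pieces at `q₀`; choosing `q` off finitely many
  -- lines makes it positive.
  obtain ⟨O, hO, -, ⟨q, hq⟩, hgen⟩ := exists_open_avoiding_lines (𝒟.erase U)
    (fun U' => x U' - x U) (fun _ => q₀)
    (fun U' hU' => sub_ne_zero.2 fun he => (Finset.mem_erase.1 hU').1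
      (h.web_injective hx (Finset.mem_erase.1 hU').2 hU he))
    (G.isOpen_inner U) (h.frames U hU).inner_nonempty
  refine ⟨q₀ - q, fun U' hU' hc hne => ?_⟩
  have h1 := h.mono hx.isWeakWeb hU hU' (subset_closure (hO hq)) hc
  refine h1.lt_of_ne fun h0 => hgen q hq U' (Finset.mem_erase.2 ⟨hne, hU'⟩) ?_
  simp only [planeDet, Prod.fst_sub, Prod.snd_sub] at h0 ⊢
  linarith

end PlaneGraph

end

/-! ### Stresses and the count of corners -/

noncomputable section

open scoped Classical

namespace PlaneGraph

variable {V E : Type*} {G : PlaneGraph V E} {U : Finset E} {𝒟 : Finset (Finset E)}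

/-- The contribution of a stress on a frame at a vertex. -/
def defect (G : PlaneGraph V E) (τ : E → ℝ) (p : V) (U : Finset E) : ℝ :=
  ∑ e ∈ U, τ e * ((if G.tgt e = p then 1 else 0) - if G.src e = p then 1 else 0)

theorem IsFrame.exists_corner_of_defect_ne (hU : G.IsFrame U) {τ : E → ℝ} {p : V}
    (h : G.defect τ p U ≠ 0) : ∃ e ∈ U, ∃ e' ∈ U, G.src e' = G.tgt e ∧ G.src e' = p := by
  by_contra! hno
  refine h (Finset.sum_eq_zero fun e he => ?_)
  obtain ⟨e', he', h1⟩ := hU.exists_next e he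
  obtain ⟨e'', he'', h2⟩ := hU.exists_prev he
  rw [if_neg fun h => hno e he e' he' h1 (h1.trans h), if_neg (hno e'' he'' e he h2.symm), sub_zero,
    mul_zero]

theorem sum_defect [Fintype V] (τ : E → ℝ) (U : Finset E) : ∑ p, G.defect τ p U = 0 := by
  simp only [defect]
  rw [Finset.sum_comm]
  refine Finset.sum_eq_zero fun e _ => ?_
  simp [← Finset.mul_sum, Finset.sum_sub_distrib]

theorem sum_defect_smul [Fintype V] (τ : E → ℝ) (U : Finset E) :
    ∑ p, G.defect τ p U • G.pos p = ∑ e ∈ U, τ e • G.vec e := by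
  simp only [defect, Finset.sum_smul]
  rw [Finset.sum_comm]
  refine Finset.sum_congr rfl fun e _ => ?_
  simp only [mul_smul, ← Finset.smul_sum, sub_smul, Finset.sum_sub_distrib, ite_smul, one_smul,
    zero_smul, Finset.sum_ite_eq, Finset.mem_univ, if_true, vec]

/-- Zero defect at a vertex says that the arriving and the leaving edge carry the same stress, so
the edges with a given stress are closed under successors. -/
theorem IsFrame.eq_of_defect_eq_zero (hU : G.IsFrame U) {τ : E → ℝ}
    (h : ∀ p, G.defect τ p U = 0) {e e' : E} (he : e ∈ U) (he' : e' ∈ U) : τ e = τ e' := by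
  have := hU.eq_of_subset (W := U.filter fun e₁ => τ e₁ = τ e) (Finset.filter_subset _ _)
    ⟨e, by simp [he]⟩ (fun e₁ h1 => by
      rw [Finset.mem_filter] at h1
      obtain ⟨e₂, h2, h3⟩ := hU.exists_next e₁ h1.1
      refine ⟨e₂, Finset.mem_filter.2 ⟨h2, ?_⟩, h3⟩
      have hp := h (G.tgt e₁)
      have t1 : ∑ e₃ ∈ U, τ e₃ * (if G.tgt e₃ = G.tgt e₁ then (1 : ℝ) else 0) = τ e₁ := by
        rw [Finset.sum_eq_single_of_mem e₁ h1.1]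
        · simp
        · intro e₃ h4 h5
          rw [if_neg fun h6 => h5 (hU.tgt_inj h4 h1.1 h6), mul_zero]
      have t2 : ∑ e₃ ∈ U, τ e₃ * (if G.src e₃ = G.tgt e₁ then (1 : ℝ) else 0) = τ e₂ := by
        rw [Finset.sum_eq_single_of_mem e₂ h2]
        · simp [h3]
        · intro e₃ h4 h5
          rw [if_neg fun h6 => h5 (hU.src_inj _ h4 _ h2 (h6.trans h3.symm)), mul_zero]
      simp only [defect, mul_sub, Finset.sum_sub_distrib, t1, t2] at hp
      linarith [h1.2])
  rw [← this, Finset.mem_filter] at he'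
  exact he'.2.symm

/-- The work of a symmetric edge function against a solution of the web equations: after summation
by parts each internal edge contributes the determinant of its vector with the jump of `x`. -/
theorem sum_planeDet_web (hd : ∀ U ∈ 𝒟, ∀ U' ∈ 𝒟, ∀ e ∈ U, e ∈ U' → U = U') {η : E → ℝ}
    (hη : ∀ e, η (G.rev e) = η e) (hη' : ∀ e ∈ G.boundary 𝒟, η e = 0) {x : Finset E → ℝ × ℝ}
    (hx : ∀ U ∈ 𝒟, ∀ U' ∈ 𝒟, ∀ e ∈ U, G.rev e ∈ U' → planeDet (G.vec e) (x U' - x U) = 0) :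
    ∑ U ∈ 𝒟, planeDet (∑ e ∈ U, η e • G.vec e) (x U) = 0 := by
  have h1 := sum_tiling (G := G) hd (fun U => (x U).2) (fun e => η e * (G.vec e).1)
    (fun e => by rw [hη, G.vec_rev]; simp)
  have h2 := sum_tiling (G := G) hd (fun U => (x U).1) (fun e => η e * (G.vec e).2)
    (fun e => by rw [hη, G.vec_rev]; simp)
  rw [Finset.sum_eq_zero (s := G.boundary 𝒟) fun e he => by rw [hη' e he]; ring,
    zero_add] at h1 h2
  have h3 : ∀ U, planeDet (∑ e ∈ U, η e • G.vec e) (x U) =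
      (x U).2 * ∑ e ∈ U, η e * (G.vec e).1 - (x U).1 * ∑ e ∈ U, η e * (G.vec e).2 := fun U => by
    simp only [planeDet, Prod.fst_sum, Prod.snd_sum, Prod.smul_fst, Prod.smul_snd, smul_eq_mul]
    ring
  simp only [h3, Finset.sum_sub_distrib, h1, h2, ← sub_div]
  rw [← Finset.sum_sub_distrib, Finset.sum_eq_zero, zero_div]
  intro e he
  obtain ⟨a1, a2⟩ := mem_internal.1 he
  have := hx _ (owner_spec a1).1 _ (owner_spec a2).1 e (owner_spec a1).2 (owner_spec a2).2
  simp only [planeDet, Prod.fst_sub, Prod.snd_sub] at this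
  linear_combination (-η e) * this

/-- Both polygons contain a short segment from the vertex in the direction `z`, so they overlap. -/
theorem IsTiling.lower_unique [Finite V] (h : G.IsTiling 𝒟) {U U' : Finset E} (hU : U ∈ 𝒟)
    (hU' : U' ∈ 𝒟) {e₁ e₂ e₁' e₂' : E} (h1 : e₁ ∈ U) (h2 : e₂ ∈ U) (h3 : G.src e₂ = G.tgt e₁)
    (h1' : e₁' ∈ U') (h2' : e₂' ∈ U') (h3' : G.src e₂' = G.tgt e₁') (hp : G.src e₂ = G.src e₂')
    {z : ℝ × ℝ} (p1 : 0 < planeDet (G.vec e₁) z) (p2 : 0 < planeDet (G.vec e₂) z)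
    (p1' : 0 < planeDet (G.vec e₁') z) (p2' : 0 < planeDet (G.vec e₂') z) : U = U' := by
  have a := (h.frames U hU).eventually_mem_inner_corner h1 h2 h3 p1 p2
  have b := (h.frames U' hU').eventually_mem_inner_corner h1' h2' h3' p1' p2'
  rw [← hp] at b
  obtain ⟨ε, c1, c2⟩ := (a.and b).exists
  exact h.eq_of_mem_inner hU hU' c1 c2

/-- There is no nonzero matrix supported on the corners of a tiling which is a relation between
the vertices of each piece, and between the points of a web around each vertex: a planar graph
with bipartite structure has few edges. -/
theorem IsTiling.eq_zero_of_relations [Fintype V] (h : G.IsTiling 𝒟) {x : Finset E → ℝ × ℝ}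
    (hx : G.IsWeb 𝒟 x) (c : V → Finset E → ℝ)
    (hc : ∀ U ∈ 𝒟, ∀ p, c p U ≠ 0 → ∃ e ∈ U, ∃ e' ∈ U, G.src e' = G.tgt e ∧ G.src e' = p)
    (h1 : ∀ U ∈ 𝒟, ∑ p, c p U = 0) (h2 : ∀ U ∈ 𝒟, ∑ p, c p U • G.pos p = 0)
    (h3 : ∀ p, ∑ U ∈ 𝒟, c p U = 0) (h4 : ∀ p, ∑ U ∈ 𝒟, c p U • x U = 0) :
    ∀ U ∈ 𝒟, ∀ p, c p U = 0 := by
  by_contra! hne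
  obtain ⟨U₀, hU₀, p₀, hp₀⟩ := hne
  let X : V → ℝ := fun p => (G.pos p).1
  have hX : Function.Injective X := fun p q h => by
    by_contra hpq
    exact G.fst_ne p q hpq h
  set S : Finset (V × Finset E) := (Finset.univ ×ˢ 𝒟).filter fun z => c z.1 z.2 ≠ 0 with hS
  have memS : ∀ p U, (p, U) ∈ S ↔ U ∈ 𝒟 ∧ c p U ≠ 0 := fun p U => by simp [hS]
  set V' := S.image Prod.fst with hV'
  set F' := S.image Prod.snd with hF'
  -- The coefficients at a vertex are an affine relation between web points in convex position, so
  -- at least four are nonzero. The same is true below for the vertices of a piece.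
  have row : 4 * V'.card ≤ S.card := by
    rw [Finset.card_eq_sum_card_fiberwise (f := Prod.fst) (t := V')
      fun z hz => Finset.mem_image_of_mem _ hz, mul_comm, ← smul_eq_mul]
    refine Finset.card_nsmul_le_sum _ _ _ fun p hp => ?_
    obtain ⟨⟨p', U⟩, hz, rfl⟩ := Finset.mem_image.1 hp
    have hcU := (memS _ _).1 hz
    have := four_le_card_of_affine_relation 𝒟 (c p') x (h3 p') (h4 p') ⟨U, hcU⟩ fun U₁ hU₁ hc₁ => by
      obtain ⟨u, hu⟩ := h.exists_exposing hx hU₁ (G.pos p')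
      refine ⟨u, fun U₂ hU₂ hc₂ hne => hu U₂ hU₂ ?_ hne⟩
      obtain ⟨-, -, e', he', -, rfl⟩ := hc U₂ hU₂ _ hc₂
      exact (h.frames U₂ hU₂).src_mem_closure he'
    refine this.trans (Finset.card_le_card_of_injOn (fun U => (p', U)) ?_ ?_)
    · intro U₁ hU₁
      have hU₁ := Finset.mem_filter.1 (Finset.mem_coe.1 hU₁)
      exact Finset.mem_coe.2 (Finset.mem_filter.2 ⟨(memS _ _).2 hU₁, rfl⟩)
    · intro _ _ _ _ h
      exact (Prod.ext_iff.1 h).2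
  have col : 4 * F'.card ≤ S.card := by
    rw [Finset.card_eq_sum_card_fiberwise (f := Prod.snd) (t := F')
      fun z hz => Finset.mem_image_of_mem _ hz, mul_comm, ← smul_eq_mul]
    refine Finset.card_nsmul_le_sum _ _ _ fun U hU => ?_
    obtain ⟨⟨p, U'⟩, hz, rfl⟩ := Finset.mem_image.1 hU
    have hcU := (memS _ _).1 hz
    have hfr := h.frames U' hcU.1
    have := four_le_card_of_affine_relation Finset.univ (fun p => c p U') G.pos (h1 U' hcU.1)
      (h2 U' hcU.1) ⟨p, Finset.mem_univ _, hcU.2⟩ fun p₁ _ hc₁ => by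
        obtain ⟨e, he, e', he', h5, rfl⟩ := hc U' hcU.1 p₁ hc₁
        refine ⟨G.vec e + G.vec e', fun p₂ _ hc₂ hne => ?_⟩
        obtain ⟨-, -, e₁, he₁, -, rfl⟩ := hc U' hcU.1 p₂ hc₂
        exact hfr.corner_exposed he he' h5 he₁ hne
    refine this.trans (Finset.card_le_card_of_injOn (fun p => (p, U')) ?_ ?_)
    · intro p₁ hp₁
      have hp₁ := Finset.mem_filter.1 (Finset.mem_coe.1 hp₁)
      exact Finset.mem_coe.2 (Finset.mem_filter.2 ⟨(memS _ _).2 ⟨hcU.1, hp₁.2⟩, rfl⟩)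
    · intro _ _ _ _ h
      exact (Prod.ext_iff.1 h).1
  -- the four kinds of corners
  set Sl := S.filter fun z => ∀ p, c p z.2 ≠ 0 → X z.1 ≤ X p with hSl
  set Sr := S.filter fun z => ∀ p, c p z.2 ≠ 0 → X p ≤ X z.1 with hSr
  let lower : ℝ × ℝ → V × Finset E → Prop := fun v z => ∃ e ∈ z.2, ∃ e' ∈ z.2, G.src e' = G.tgt e ∧
    G.src e' = z.1 ∧ 0 < planeDet (G.vec e) v ∧ 0 < planeDet (G.vec e') v
  set Su := S.filter fun z => z ∉ Sl ∧ lower (0, 1) z with hSu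
  set Sd := S.filter fun z => z ∉ Sl ∧ lower (0, -1) z with hSd
  have cl : Sl.card ≤ F'.card := Finset.card_le_card_of_injOn Prod.snd
    (fun z hz => Finset.mem_image_of_mem _ (Finset.mem_filter.1 (Finset.mem_coe.1 hz)).1) (by
      rintro ⟨p, U⟩ hz ⟨p', U'⟩ hz' (rfl : U = U')
      have hz := Finset.mem_filter.1 (Finset.mem_coe.1 hz)
      have hz' := Finset.mem_filter.1 (Finset.mem_coe.1 hz')
      have := hX (le_antisymm (hz.2 p' ((memS _ _).1 hz'.1).2) (hz'.2 p ((memS _ _).1 hz.1).2))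
      simpa using this)
  have cr : Sr.card ≤ F'.card := Finset.card_le_card_of_injOn Prod.snd
    (fun z hz => Finset.mem_image_of_mem _ (Finset.mem_filter.1 (Finset.mem_coe.1 hz)).1) (by
      rintro ⟨p, U⟩ hz ⟨p', U'⟩ hz' (rfl : U = U')
      have hz := Finset.mem_filter.1 (Finset.mem_coe.1 hz)
      have hz' := Finset.mem_filter.1 (Finset.mem_coe.1 hz')
      have := hX (le_antisymm (hz'.2 p ((memS _ _).1 hz.1).2) (hz.2 p' ((memS _ _).1 hz'.1).2))
      simpa using this)
  -- The leftmost vertex that occurs is also leftmost in each of its pieces, hence is never an upper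
  -- or lower corner. This saves one in each of the two counts and makes the final inequality
  -- strict.
  obtain ⟨pm, hpm, hmin⟩ := V'.exists_min_image X
    ⟨p₀, Finset.mem_image_of_mem Prod.fst ((memS p₀ U₀).2 ⟨hU₀, hp₀⟩)⟩
  have hpm' : ∀ U, (pm, U) ∈ S → (pm, U) ∈ Sl := fun U hz => by
    refine Finset.mem_filter.2 ⟨hz, fun p hp => hmin p ?_⟩
    exact Finset.mem_image_of_mem Prod.fst ((memS p U).2 ⟨((memS _ _).1 hz).1, hp⟩)
  have cv : ∀ v : ℝ × ℝ, (S.filter fun z => z ∉ Sl ∧ lower v z).card ≤ V'.card - 1 := by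
    intro v
    rw [← Finset.card_erase_of_mem hpm]
    refine Finset.card_le_card_of_injOn Prod.fst (fun z hz => ?_) ?_
    · have hz := Finset.mem_filter.1 (Finset.mem_coe.1 hz)
      refine Finset.mem_coe.2 (Finset.mem_erase.2 ⟨fun h5 => hz.2.1 ?_,
        Finset.mem_image_of_mem _ hz.1⟩)
      obtain ⟨p, U⟩ := z
      obtain rfl : p = pm := h5
      exact hpm' U hz.1
    · rintro ⟨p, U⟩ hz ⟨p', U'⟩ hz' (rfl : p = p')
      have hz := Finset.mem_filter.1 (Finset.mem_coe.1 hz)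
      have hz' := Finset.mem_filter.1 (Finset.mem_coe.1 hz')
      obtain ⟨-, e, he, e', he', a1, a2, a3, a4⟩ := hz.2
      obtain ⟨-, f, hf, f', hf', b1, b2, b3, b4⟩ := hz'.2
      have := h.lower_unique ((memS _ _).1 hz.1).1 ((memS _ _).1 hz'.1).1 he he' a1 hf hf' b1
        (a2.trans b2.symm) a3 a4 b3 b4
      rw [this]
  -- A corner that is neither leftmost nor rightmost among the corners of its piece that occur has
  -- the vertical direction, up or down, inside its cone. So there are at most `2 |F'| + 2 (|V'| -
  -- 1)` corners, whereas the rows and columns require at least `4 |V'|` and at least `4 |F'|`.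
  have cover : S ⊆ (Sl ∪ Sr) ∪ (Su ∪ Sd) := by
    rintro ⟨p, U⟩ hz
    by_cases hl : (p, U) ∈ Sl
    · simp [hl]
    by_cases hr : (p, U) ∈ Sr
    · simp [hr]
    obtain ⟨hU, hcp⟩ := (memS _ _).1 hz
    have hfr := h.frames U hU
    obtain ⟨e, he, e', he', a1, a2⟩ := hc U hU p hcp
    have hl' : ∃ q, c q U ≠ 0 ∧ X q < X p := by
      by_contra! hno
      exact hl (Finset.mem_filter.2 ⟨hz, hno⟩)
    have hr' : ∃ q, c q U ≠ 0 ∧ X p < X q := by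
      by_contra! hno
      exact hr (Finset.mem_filter.2 ⟨hz, hno⟩)
    obtain ⟨q, hq, hqp⟩ := hl'
    obtain ⟨r, hr, hpr⟩ := hr'
    obtain ⟨-, -, f, hf, -, rfl⟩ := hc U hU q hq
    obtain ⟨-, -, g, hg, -, rfl⟩ := hc U hU r hr
    subst a2
    have d1 : ∀ e : E, planeDet (G.vec e) (0, 1) = (G.vec e).1 := fun e => by simp [planeDet]
    have d2 : ∀ e : E, planeDet (G.vec e) (0, -1) = -(G.vec e).1 := fun e => by simp [planeDet]
    have hcases : (0 < (G.vec e).1 ∧ 0 < (G.vec e').1) ∨ ((G.vec e).1 < 0 ∧ (G.vec e').1 < 0) := by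
      rcases lt_or_gt_of_ne (vec_fst_ne (G := G) e) with s1 | s1 <;>
      rcases lt_or_gt_of_ne (vec_fst_ne (G := G) e') with s2 | s2
      · exact Or.inr ⟨s1, s2⟩
      · exact absurd (hfr.le_fst_of_turn he he' a1 hf s1 s2) (not_le.2 hqp)
      · exact absurd (hfr.fst_le_of_turn he he' a1 hg s1 s2) (not_le.2 hpr)
      · exact Or.inl ⟨s1, s2⟩
    rcases hcases with s | s
    · refine Finset.mem_union_right _ (Finset.mem_union_left _ (Finset.mem_filter.2 ⟨hz, hl, ?_⟩))
      exact ⟨e, he, e', he', a1, rfl, by rw [d1]; exact s.1, by rw [d1]; exact s.2⟩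
    · refine Finset.mem_union_right _ (Finset.mem_union_right _ (Finset.mem_filter.2 ⟨hz, hl, ?_⟩))
      exact ⟨e, he, e', he', a1, rfl, by rw [d2]; linarith [s.1], by rw [d2]; linarith [s.2]⟩
  have k1 := Finset.card_le_card cover
  have k2 := Finset.card_union_le (Sl ∪ Sr) (Su ∪ Sd)
  have k3 := Finset.card_union_le Sl Sr
  have k4 := Finset.card_union_le Su Sd
  have k5 := cv (0, 1)
  have k6 := cv (0, -1)
  have k7 : 0 < V'.card := Finset.card_pos.2 ⟨pm, hpm⟩
  rw [← hSu] at k5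
  rw [← hSd] at k6
  omega

/-- A stress of a tiling with a dual web vanishes, if it persists under all infinitesimal
deformations of the vertices. -/
theorem IsTiling.stress_eq_zero [Fintype V] (h : G.IsTiling 𝒟) {x : Finset E → ℝ × ℝ}
    (hx : G.IsWeb 𝒟 x) {τ : E → ℝ} (hτ : ∀ e, τ (G.rev e) = τ e)
    (hτ' : ∀ e, e ∉ G.internal 𝒟 → τ e = 0) (heq : ∀ U ∈ 𝒟, ∑ e ∈ U, τ e • G.vec e = 0)
    (hdef : ∀ p, ∀ b : ℝ × ℝ, ∃ η : E → ℝ, (∀ e, η (G.rev e) = η e) ∧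
      (∀ e, e ∉ G.internal 𝒟 → η e = 0) ∧
      ∀ U ∈ 𝒟, ∑ e ∈ U, η e • G.vec e = G.defect τ p U • b) : τ = 0 := by
  have hbi : ∀ e ∈ G.boundary 𝒟, e ∉ G.internal 𝒟 := fun e he hi =>
    (mem_boundary.1 he).2 (mem_internal.1 hi).2
  have h3 : ∀ p, ∑ U ∈ 𝒟, G.defect τ p U = 0 := by
    intro p
    have := sum_edges_tiling (G := G) h.unique
      (fun e => τ e * ((if G.tgt e = p then 1 else 0) - if G.src e = p then 1 else 0))
      fun e => by rw [hτ, G.tgt_rev, G.src_rev]; ring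
    simp only [defect]
    rw [this]
    exact Finset.sum_eq_zero fun e he => by rw [hτ' e (hbi e he), zero_mul]
  -- The deformation `η` of the stress does no work against the web, and its force on each piece is
  -- the defect times the arbitrary vector `b`.
  have h4 : ∀ p, ∑ U ∈ 𝒟, G.defect τ p U • x U = 0 := by
    intro p
    have key : ∀ b : ℝ × ℝ, planeDet b (∑ U ∈ 𝒟, G.defect τ p U • x U) = 0 := by
      intro b
      obtain ⟨η, e1, e2, e3⟩ := hdef p b
      have := sum_planeDet_web h.unique e1 (fun e he => e2 e (hbi e he)) (x := x)
        fun U hU U' hU' e he he' => by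
          obtain ⟨t, -, ht⟩ := hx U hU U' hU' e he he'
          rw [ht]; simp only [planeDet, Prod.smul_fst, Prod.smul_snd, smul_eq_mul]; ring
      rw [Finset.sum_congr rfl fun U hU => by rw [e3 U hU, planeDet_smul_left]] at this
      rw [← this]
      simp only [planeDet, Prod.fst_sum, Prod.snd_sum, Prod.smul_fst, Prod.smul_snd, smul_eq_mul,
        Finset.mul_sum, ← Finset.sum_sub_distrib]
      exact Finset.sum_congr rfl fun U _ => by ring
    have k1 := key (1, 0)
    have k2 := key (0, 1)
    simp only [planeDet, one_mul, zero_mul, sub_zero, zero_sub, neg_eq_zero] at k1 k2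
    exact Prod.ext k2 k1
  have hzero := h.eq_zero_of_relations hx (G.defect τ)
    (fun U hU p hp => (h.frames U hU).exists_corner_of_defect_ne hp)
    (fun U _ => sum_defect τ U) (fun U hU => by rw [sum_defect_smul, heq U hU]) h3 h4
  have hconst : ∀ U ∈ 𝒟, ∀ e ∈ U, ∀ e' ∈ U, τ e = τ e' := fun U hU e he e' he' =>
    (h.frames U hU).eq_of_defect_eq_zero (hzero U hU) he he'
  let κ : Finset E → ℝ := fun U => if hU : U.Nonempty then τ hU.choose else 0
  have hκ : ∀ U ∈ 𝒟, ∀ e ∈ U, κ U = τ e := fun U hU e he => by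
    have hne : U.Nonempty := ⟨e, he⟩
    simp only [κ, dif_pos hne]
    exact hconst U hU _ hne.choose_spec e he
  funext e
  by_cases he : e ∈ G.internal 𝒟
  · obtain ⟨o1, o2⟩ := owner_spec (mem_internal.1 he).1
    obtain ⟨q, h1, h2, h5⟩ := G.exists_generic_point (edgesOf 𝒟) (G.isOpen_inner (owner 𝒟 e))
      (h.frames _ o1).inner_nonempty
    obtain ⟨u, -, hu⟩ := G.exists_generic_dir h5 isOpen_univ ⟨0, trivial⟩
    -- The stress is now constant on each piece and symmetric, so its jumps across glued edges
    -- vanish, and it is zero on the boundary. The left side is the value on the piece that contains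
    -- `q`.
    have h6 := sum_tiling h.unique κ (fun e => G.cross e q u) fun e => G.cross_rev e q u
    rw [Finset.sum_eq_zero (s := G.boundary 𝒟) fun e₁ he₁ => by
      have := owner_spec (boundary_subset_edgesOf he₁)
      rw [hκ _ this.1 e₁ this.2, hτ' e₁ (hbi e₁ he₁), zero_mul],
      Finset.sum_eq_zero (s := G.internal 𝒟) fun e₁ he₁ => by
        have a := owner_spec (mem_internal.1 he₁).1
        have b := owner_spec (mem_internal.1 he₁).2
        rw [hκ _ a.1 e₁ a.2, hκ _ b.1 _ b.2, hτ, sub_self, zero_mul]] at h6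
    rw [Finset.sum_congr rfl fun U hU => by
      rw [(h.frames U hU).sum_cross hu (side_ne_of_edgesOf h2 hU)],
      Finset.sum_eq_single_of_mem _ o1 fun U hU hne => by
        rw [if_neg fun h7 => hne (h.eq_of_mem_inner hU o1 h7 h1), mul_zero], if_pos h1,
      hκ _ o1 e o2] at h6
    simpa using h6
  · exact hτ' e he

end PlaneGraph

end

/-! ### General position excludes stresses -/

noncomputable section

open scoped Classical

namespace PlaneGraph

/-- The combinatorial data which determine the equations of the dual webs of a tiling: the vertex
sets of the two pieces at an internal edge, and its end points. -/
abbrev Gluing (n : ℕ) := Finset (Fin n) × Finset (Fin n) × Fin n × Fin n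

/-- The equations for the dual webs. -/
def gluingEntry {n : ℕ} (r : Gluing n) (c : Finset (Fin n) × Fin 2) :
    MvPolynomial (Fin n × Fin 2) ℤ :=
  ((if c.1 = r.1 then 1 else 0) - if c.1 = r.2.1 then 1 else 0) *
    (MvPolynomial.X (r.2.2.2, c.2) - MvPolynomial.X (r.2.2.1, c.2))

/-- The matrix of the equations for the dual webs of a tiling. -/
def gluingMatrix {n : ℕ} (X : Finset (Gluing n)) :
    Matrix X (Finset (Fin n) × Fin 2) (MvPolynomial (Fin n × Fin 2) ℤ) :=
  fun r c => gluingEntry r.1 c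

/-- A polynomial which vanishes when the equations for the dual webs are exceptional. -/
def rankPoly {n : ℕ} (X : Finset (Gluing n)) : MvPolynomial (Fin n × Fin 2) ℤ :=
  Classical.choose (exists_generic_rank (gluingMatrix X))

theorem rankPoly_ne_zero {n : ℕ} (X : Finset (Gluing n)) : rankPoly X ≠ 0 :=
  (Classical.choose_spec (exists_generic_rank (gluingMatrix X))).1

theorem vecMul_gluingMatrix {n : ℕ} {A : Type*} [CommRing A] (X : Finset (Gluing n))
    (g : MvPolynomial (Fin n × Fin 2) ℤ →+* A) (τ : X → A) (c : Finset (Fin n) × Fin 2) :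
    Matrix.vecMul τ ((gluingMatrix X).map g) c =
      ∑ r ∈ X, (if h : r ∈ X then τ ⟨r, h⟩ else 0) * g (gluingEntry r c) := by
  rw [← Finset.sum_coe_sort X]
  refine Finset.sum_congr rfl fun r _ => ?_
  rw [dif_pos r.2]
  rfl

variable {V E : Type*} {G : PlaneGraph V E} {U : Finset E} {𝒟 : Finset (Finset E)}

/-- For pieces with the same vertices, monotonicity at the two ends of an edge, taken in both
orders, makes the displacement of the web parallel to this edge. Two consecutive edges force it to
vanish. Pieces can therefore be encoded by sets of vertex labels, so that for given `n` only
finitely many matrices occur. -/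
theorem IsTiling.src_image_injOn [Finite V] (h : G.IsTiling 𝒟) {x : Finset E → ℝ × ℝ}
    (hx : G.IsWeb 𝒟 x) {U' : Finset E} (hU : U ∈ 𝒟) (hU' : U' ∈ 𝒟)
    (heq : U.image G.src = U'.image G.src) : U = U' := by
  have hfr := h.frames U hU
  refine h.web_injective hx hU hU' ?_
  have key : ∀ e ∈ U, planeDet (G.vec e) (x U' - x U) = 0 := by
    intro e he
    obtain ⟨e', he', h1⟩ := hfr.exists_next e he
    obtain ⟨f, hf, h2⟩ := Finset.mem_image.1 (heq ▸ Finset.mem_image_of_mem G.src he)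
    obtain ⟨f', hf', h3⟩ := Finset.mem_image.1 (heq ▸ Finset.mem_image_of_mem G.src he')
    have m1 := h.mono hx.isWeakWeb hU hU' (hfr.src_mem_closure he)
      ((h.frames U' hU').src_mem_closure hf')
    have m2 := h.mono hx.isWeakWeb hU hU' (hfr.src_mem_closure he')
      ((h.frames U' hU').src_mem_closure hf)
    rw [h3, h1] at m1
    rw [h2, h1] at m2
    simp only [vec, planeDet, Prod.fst_sub, Prod.snd_sub] at m1 m2 ⊢
    linarith
  obtain ⟨e, he⟩ := hfr.nonempty
  obtain ⟨e', he', h1⟩ := hfr.exists_next e he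
  have ht := hfr.turn he he' h1
  have := planeDet_smul_eq (G.vec e) (G.vec e') (x U' - x U)
  rw [planeDet_swap (x U' - x U), key e he, key e' he'] at this
  simp only [neg_zero, zero_smul, add_zero] at this
  rcases smul_eq_zero.1 this with h2 | h2
  · exact absurd h2 ht.ne'
  · exact (sub_eq_zero.1 h2).symm

/-- A sum over one orientation of each internal edge, as a sum over the edges of one piece. -/
theorem IsTiling.sum_half {A : Type*} [CommRing A] (h : G.IsTiling 𝒟) (hU : U ∈ 𝒟) {J : Finset E}
    (hJ : J ⊆ G.internal 𝒟) (hJ' : ∀ e ∈ J, G.rev e ∉ J) (g D : E → A)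
    (hD : ∀ e, D (G.rev e) = -D e) :
    ∑ e ∈ J, g e * (((if U = owner 𝒟 e then 1 else 0) - if U = owner 𝒟 (G.rev e) then 1 else 0) *
      D e) = ∑ e ∈ U, (if e ∈ J then g e else if G.rev e ∈ J then g (G.rev e) else 0) * D e := by
  have e1 : ∀ e ∈ U, (if e ∈ J then g e else if G.rev e ∈ J then g (G.rev e) else 0) * D e =
      (if e ∈ J then g e * D e else 0) +
        if G.rev e ∈ J then g (G.rev e) * D e else 0 := fun e _ => by
    by_cases h1 : e ∈ J
    · simp [h1, hJ' e h1]
    · simp [h1]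
  rw [Finset.sum_congr rfl e1, Finset.sum_add_distrib]
  simp only [sub_mul, mul_sub, Finset.sum_sub_distrib]
  rw [sub_eq_add_neg]
  have own : ∀ e ∈ edgesOf 𝒟, U = owner 𝒟 e ↔ e ∈ U := fun e he =>
    ⟨fun h1 => h1 ▸ (owner_spec he).2, fun h1 => (owner_eq h.unique hU h1).symm⟩
  congr 1
  · rw [← Finset.sum_filter]
    simp only [ite_mul, one_mul, zero_mul, mul_ite, mul_zero]
    rw [← Finset.sum_filter]
    refine Finset.sum_congr ?_ fun _ _ => rfl
    ext e
    rw [Finset.mem_filter, Finset.mem_filter]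
    constructor
    · rintro ⟨h1, h2⟩
      exact ⟨(own e (mem_internal.1 (hJ h1)).1).1 h2, h1⟩
    · rintro ⟨h1, h2⟩
      exact ⟨h2, (own e (mem_internal.1 (hJ h2)).1).2 h1⟩
  · simp only [ite_mul, one_mul, zero_mul, mul_ite, mul_zero]
    rw [← Finset.sum_filter, ← Finset.sum_filter, ← Finset.sum_neg_distrib]
    refine Finset.sum_bij (fun e _ => G.rev e) ?_ (fun _ _ _ _ h => G.rev_injective h) ?_ ?_
    · intro e he
      rw [Finset.mem_filter] at he ⊢
      rw [G.rev_rev]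
      exact ⟨(own _ (mem_internal.1 (hJ he.1)).2).1 he.2, he.1⟩
    · intro e he
      rw [Finset.mem_filter] at he
      refine ⟨G.rev e, ?_, G.rev_rev e⟩
      rw [Finset.mem_filter, G.rev_rev]
      refine ⟨he.2, (own _ ?_).2 he.1⟩
      have := (mem_internal.1 (hJ he.2)).2
      rwa [G.rev_rev] at this
    · intro e he
      rw [G.rev_rev, hD]; ring

/-- The coordinates of the vertices. -/
def coord (G : PlaneGraph V E) {n : ℕ} (label : Fin n ≃ V) (ij : Fin n × Fin 2) : ℝ :=
  ![(G.pos (label ij.1)).1, (G.pos (label ij.1)).2] ij.2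

/-- For points in general position, a tiling with a dual web has no nonzero stress, so that the
equations for its dual webs are independent. -/
theorem IsTiling.stress_eq_zero_of_generic {n : ℕ} (label : Fin n ≃ V)
    (hgen : ∀ X : Finset (Gluing n), MvPolynomial.aeval (G.coord label) (rankPoly X) ≠ 0)
    (h : G.IsTiling 𝒟) {x : Finset E → ℝ × ℝ} (hx : G.IsWeb 𝒟 x) {τ : E → ℝ}
    (hτ : ∀ e, τ (G.rev e) = τ e) (hτ' : ∀ e, e ∉ G.internal 𝒟 → τ e = 0)
    (heq : ∀ U ∈ 𝒟, ∑ e ∈ U, τ e • G.vec e = 0) : τ = 0 := by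
  have : Fintype V := Fintype.ofEquiv _ label
  let lab := label.symm
  let verts : Finset E → Finset (Fin n) := fun U => (U.image G.src).image lab
  let code : E → Gluing n := fun e =>
    (verts (owner 𝒟 e), verts (owner 𝒟 (G.rev e)), lab (G.src e), lab (G.tgt e))
  have hverts : ∀ U ∈ 𝒟, ∀ U' ∈ 𝒟, verts U = verts U' → U = U' := fun U hU U' hU' he =>
    h.src_image_injOn hx hU hU' (Finset.image_injective lab.injective he)
  -- One orientation of each internal edge, chosen by the labels of its end points.
  set J := (G.internal 𝒟).filter fun e => lab (G.src e) < lab (G.tgt e) with hJ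
  have hJsub : J ⊆ G.internal 𝒟 := Finset.filter_subset _ _
  have hJrev : ∀ e ∈ J, G.rev e ∉ J := fun e he he' => by
    have h1 := (Finset.mem_filter.1 he).2
    have h2 := (Finset.mem_filter.1 he').2
    rw [G.src_rev, G.tgt_rev] at h2
    exact lt_asymm h1 h2
  have hJint : ∀ e ∈ G.internal 𝒟, e ∉ J → G.rev e ∈ J := fun e he hn => by
    refine Finset.mem_filter.2 ⟨rev_mem_internal he, ?_⟩
    rw [G.src_rev, G.tgt_rev]
    refine lt_of_le_of_ne (not_lt.1 fun h1 => hn (Finset.mem_filter.2 ⟨he, h1⟩)) fun h1 => ?_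
    exact G.src_ne_tgt e (lab.injective h1.symm)
  have hcode : Set.InjOn code J := by
    intro e he e' he' hc
    have a := owner_spec (mem_internal.1 (hJsub he)).1
    have a' := owner_spec (mem_internal.1 (hJsub he')).1
    have ho := hverts _ a.1 _ a'.1 (congrArg Prod.fst hc)
    have hs : G.src e = G.src e' := lab.injective (congrArg (fun z => z.2.2.1) hc)
    exact (h.frames _ a.1).src_inj e a.2 e' (ho ▸ a'.2) hs
  set X := J.image code with hX
  -- The two columns of a piece express the equilibrium of the coefficients, made symmetric, on this
  -- piece. It is needed for real coefficients and for polynomial ones.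
  have col : ∀ {A : Type} [CommRing A] (g : MvPolynomial (Fin n × Fin 2) ℤ →+* A) (σ : X → A)
      (b : E → A), (∀ e (he : e ∈ J), σ ⟨code e, Finset.mem_image_of_mem _ he⟩ = b e) →
      ∀ U ∈ 𝒟, ∀ i : Fin 2, Matrix.vecMul σ ((gluingMatrix X).map g) (verts U, i) =
        ∑ e ∈ U, (if e ∈ J then b e else if G.rev e ∈ J then b (G.rev e) else 0) *
          g (MvPolynomial.X (lab (G.tgt e), i) - MvPolynomial.X (lab (G.src e), i)) := by
    intro A _ g σ b hb U hU i
    refine (vecMul_gluingMatrix X g σ _).trans ((Finset.sum_image hcode).trans ?_)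
    rw [← h.sum_half hU hJsub hJrev]
    · refine Finset.sum_congr rfl fun e he => ?_
      rw [dif_pos (Finset.mem_image_of_mem _ he), hb e he]
      congr 1
      have a := owner_spec (mem_internal.1 (hJsub he)).1
      have a' := owner_spec (mem_internal.1 (hJsub he)).2
      have i1 : (verts U = verts (owner 𝒟 e)) ↔ U = owner 𝒟 e :=
        ⟨hverts _ hU _ a.1, fun h => by rw [h]⟩
      have i2 : (verts U = verts (owner 𝒟 (G.rev e))) ↔ U = owner 𝒟 (G.rev e) :=
        ⟨hverts _ hU _ a'.1, fun h => by rw [h]⟩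
      simp only [gluingEntry, code, map_mul, map_sub, i1, i2, apply_ite g, map_one, map_zero]
    · intro e
      rw [G.src_rev, G.tgt_rev, map_sub, map_sub, neg_sub]
  have hcoord : ∀ (p : V), G.coord label (lab p, 0) = (G.pos p).1 ∧
      G.coord label (lab p, 1) = (G.pos p).2 := fun p => by simp [coord, lab]
  have hvec : ∀ e : E, ∀ i : Fin 2, MvPolynomial.aeval (G.coord label)
      (MvPolynomial.X (lab (G.tgt e), i) - MvPolynomial.X (lab (G.src e), i) :
        MvPolynomial (Fin n × Fin 2) ℤ) = ![(G.vec e).1, (G.vec e).2] i := fun e i => by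
    rw [map_sub, MvPolynomial.aeval_X, MvPolynomial.aeval_X]
    fin_cases i
    · simp [(hcoord _).1, vec]
    · simp [(hcoord _).2, vec]
  rcases (Classical.choose_spec (exists_generic_rank (gluingMatrix X))).2 (G.coord label) (hgen X)
    with hr | ⟨σ, hσ, i₀, hi₀⟩
  -- Independent rows: the given stress is itself a relation between them.
  · have hex : ∀ r : X, ∃ e ∈ J, code e = r.1 := fun r => Finset.mem_image.1 r.2
    choose f hf hf' using hex
    have hb : ∀ e (he : e ∈ J), τ (f ⟨code e, Finset.mem_image_of_mem _ he⟩) = τ e :=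
      fun e he => congrArg τ (hcode (hf _) he (hf' _))
    have hz := hr (fun r => τ (f r)) ?_
    · have hJ0 : ∀ e ∈ J, τ e = 0 := fun e he => by
        rw [← hb e he]; exact congrFun hz _
      funext e
      by_cases he : e ∈ G.internal 𝒟
      · by_cases heJ : e ∈ J
        · exact hJ0 e heJ
        · rw [← hτ]; exact hJ0 _ (hJint e he heJ)
      · exact hτ' e he
    · funext ⟨F, i⟩
      by_cases hF : ∃ U ∈ 𝒟, verts U = F
      · obtain ⟨U, hU, rfl⟩ := hF
        refine (col (MvPolynomial.aeval (G.coord label) :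
          MvPolynomial (Fin n × Fin 2) ℤ →ₐ[ℤ] ℝ).toRingHom _ τ hb U hU i).trans ?_
        have e1 : ∀ e ∈ U, (if e ∈ J then τ e else if G.rev e ∈ J then τ (G.rev e) else 0) = τ e :=
          fun e _ => by
            split_ifs with h1 h2
            · rfl
            · exact hτ e
            · refine (hτ' e fun h3 => ?_).symm
              exact h2 (hJint e h3 h1)
        have e2 := congrArg (fun z : ℝ × ℝ => ![z.1, z.2] i) (heq U hU)
        rw [Finset.sum_congr rfl fun e he => by rw [e1 e he]]
        refine Eq.trans ?_ (e2.trans (by fin_cases i <;> simp))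
        refine (Finset.sum_congr rfl fun e _ => congrArg (τ e * ·) (hvec e i)).trans ?_
        fin_cases i <;> simp [Prod.fst_sum, Prod.snd_sum]
      · push Not at hF
        refine (vecMul_gluingMatrix X (MvPolynomial.aeval (G.coord label) :
          MvPolynomial (Fin n × Fin 2) ℤ →ₐ[ℤ] ℝ).toRingHom _ _).trans ?_
        refine Finset.sum_eq_zero fun r hr => ?_
        obtain ⟨e, he, rfl⟩ := Finset.mem_image.1 hr
        have a := owner_spec (mem_internal.1 (hJsub he)).1
        have a' := owner_spec (mem_internal.1 (hJsub he)).2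
        have : gluingEntry (code e) (F, i) = 0 := by
          simp only [gluingEntry, code]
          rw [if_neg (hF _ a.1).symm, if_neg (hF _ a'.1).symm, sub_zero, zero_mul]
        rw [this, map_zero, mul_zero]
  -- Now there is a stress depending polynomially on the vertices. Its partial derivatives are the
  -- deformations that `stress_eq_zero` asks for, so it vanishes at the given points, against the
  -- nonvanishing of one entry.
  · exfalso
    let b : E → MvPolynomial (Fin n × Fin 2) ℤ := fun e =>
      if he : e ∈ J then σ ⟨code e, Finset.mem_image_of_mem _ he⟩ else 0
    let τ' : E → MvPolynomial (Fin n × Fin 2) ℤ := fun e =>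
      if e ∈ J then b e else if G.rev e ∈ J then b (G.rev e) else 0
    have hrel : ∀ U ∈ 𝒟, ∀ i : Fin 2, ∑ e ∈ U, τ' e *
        (MvPolynomial.X (lab (G.tgt e), i) - MvPolynomial.X (lab (G.src e), i)) = 0 := by
      intro U hU i
      have := col (RingHom.id _) σ b (fun e he => by simp only [b, dif_pos he]) U hU i
      simp only [RingHom.id_apply] at this
      rw [← this]
      exact congrFun hσ _
    have sym : ∀ e, τ' (G.rev e) = τ' e := fun e => by
      simp only [τ', G.rev_rev]
      by_cases h1 : e ∈ J
      · simp [h1, hJrev e h1]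
      · simp [h1]
    have supp : ∀ e, e ∉ G.internal 𝒟 → τ' e = 0 := fun e he => by
      have h1 : e ∉ J := fun h => he (hJsub h)
      have h2 : G.rev e ∉ J := fun h => he (by
        have := rev_mem_internal (hJsub h)
        rwa [G.rev_rev] at this)
      simp [τ', h1, h2]
    let ev : MvPolynomial (Fin n × Fin 2) ℤ →ₐ[ℤ] ℝ := MvPolynomial.aeval (G.coord label)
    have hz := h.stress_eq_zero hx (τ := fun e => ev (τ' e)) (fun e => by rw [sym])
      (fun e he => by rw [supp e he, map_zero]) ?_ ?_
    · obtain ⟨e, he, hc⟩ := Finset.mem_image.1 i₀.2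
      refine hi₀ ?_
      have := congrFun hz e
      simp only [τ', if_pos he, b, dif_pos he] at this
      rw [show i₀ = ⟨code e, Finset.mem_image_of_mem _ he⟩ from Subtype.ext hc.symm]
      exact this
    · intro U hU
      have key : ∀ i : Fin 2, ∑ e ∈ U, ev (τ' e) * ![(G.vec e).1, (G.vec e).2] i = 0 := fun i => by
        have := congrArg ev (hrel U hU i)
        simp only [map_sum, map_mul, map_zero] at this
        rw [← this]
        exact Finset.sum_congr rfl fun e _ => by rw [← hvec e i]
      have k0 := key 0
      have k1 := key 1
      simp only [Matrix.cons_val_zero, Matrix.cons_val_one] at k0 k1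
      exact Prod.ext (by simpa [Prod.fst_sum] using k0) (by simpa [Prod.snd_sum] using k1)
    -- By the product rule, differentiating the equilibrium with respect to the vertex `p` gives the
    -- derivative of the stress applied to the edge vectors, plus the defect at `p`. This accounts
    -- for the minus sign in the choice of `η`.
    · intro p c
      let dd : Fin 2 → MvPolynomial (Fin n × Fin 2) ℤ → ℝ := fun i q =>
        ev (MvPolynomial.pderiv (lab p, i) q)
      have key : ∀ U ∈ 𝒟, ∀ i j : Fin 2, ∑ e ∈ U, dd i (τ' e) * ![(G.vec e).1, (G.vec e).2] j =
          -(if i = j then G.defect (fun e => ev (τ' e)) p U else 0) := by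
        intro U hU i j
        have h1 := congrArg (fun q => ev (MvPolynomial.pderiv (lab p, i) q)) (hrel U hU j)
        simp only [map_sum, Derivation.leibniz, map_sub, MvPolynomial.pderiv_X, smul_eq_mul,
          map_zero, map_add, map_mul, Finset.sum_add_distrib] at h1
        have h2 : ∀ q : V, ev (Pi.single (M := fun _ : Fin n × Fin 2 =>
            MvPolynomial (Fin n × Fin 2) ℤ) (lab p, i) 1 (lab q, j)) =
            if i = j then (if q = p then 1 else 0) else 0 := fun q => by
          simp only [Pi.single_apply, Prod.mk.injEq, lab.injective.eq_iff]
          by_cases hij : i = j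
          · by_cases hqp : q = p <;> simp [hij, hqp]
          · simp [hij, Ne.symm hij]
        simp only [h2] at h1
        have h3 : ∀ e : E, ev (MvPolynomial.X (lab (G.tgt e), j)) -
            ev (MvPolynomial.X (lab (G.src e), j)) = ![(G.vec e).1, (G.vec e).2] j := fun e => by
          rw [← hvec e j, map_sub]
        simp only [h3] at h1
        have h4 : ∑ e ∈ U, dd i (τ' e) * ![(G.vec e).1, (G.vec e).2] j = ∑ e ∈ U,
            ![(G.vec e).1, (G.vec e).2] j * ev (MvPolynomial.pderiv (lab p, i) (τ' e)) :=
          Finset.sum_congr rfl fun e _ => mul_comm _ _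
        rw [h4, eq_neg_iff_add_eq_zero, add_comm]
        refine Eq.trans ?_ h1
        congr 1
        by_cases hij : i = j
        · simp only [hij, if_true, defect]
        · simp [hij]
      refine ⟨fun e => -(c.1 * dd 0 (τ' e) + c.2 * dd 1 (τ' e)), fun e => by simp only [sym],
        fun e he => by simp [dd, supp e he], fun U hU => ?_⟩
      have k00 := key U hU 0 0
      have k01 := key U hU 0 1
      have k10 := key U hU 1 0
      have k11 := key U hU 1 1
      simp only [Matrix.cons_val_zero, Matrix.cons_val_one, if_true, zero_ne_one, one_ne_zero,
        if_false, neg_zero] at k00 k01 k10 k11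
      have lin : ∀ v : E → ℝ, ∑ e ∈ U, -(c.1 * dd 0 (τ' e) + c.2 * dd 1 (τ' e)) * v e =
          -(c.1 * ∑ e ∈ U, dd 0 (τ' e) * v e + c.2 * ∑ e ∈ U, dd 1 (τ' e) * v e) := fun v => by
        rw [Finset.mul_sum, Finset.mul_sum, ← Finset.sum_add_distrib, ← Finset.sum_neg_distrib]
        exact Finset.sum_congr rfl fun e _ => by ring
      refine Prod.ext ?_ ?_
      · simp only [Prod.fst_sum, Prod.smul_fst, smul_eq_mul]
        rw [lin, k00, k10]; ring
      · simp only [Prod.snd_sum, Prod.smul_snd, smul_eq_mul]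
        rw [lin, k01, k11]; ring

end PlaneGraph

end

noncomputable section

open scoped Classical

namespace PlaneGraph

variable {V E : Type*} {G : PlaneGraph V E} {U : Finset E} {𝒟 : Finset (Finset E)}

/-! ### The space of webs -/

/-- The equations of webs. -/
def alpha (G : PlaneGraph V E) (𝒟 : Finset (Finset E)) (e : E) :
    (Finset E → ℝ × ℝ) →ₗ[ℝ] ℝ where
  toFun x := planeDet (G.vec e) (x (owner 𝒟 (G.rev e)) - x (owner 𝒟 e))
  map_add' x y := by
    simp only [planeDet, Pi.add_apply, Prod.fst_sub, Prod.snd_sub, Prod.fst_add, Prod.snd_add]; ring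
  map_smul' c x := by
    simp only [planeDet, Pi.smul_apply, Prod.fst_sub, Prod.snd_sub, Prod.smul_fst, Prod.smul_snd,
      smul_eq_mul, RingHom.id_apply]; ring

/-- The edge lengths of webs. -/
def beta (G : PlaneGraph V E) (𝒟 : Finset (Finset E)) (e : E) :
    (Finset E → ℝ × ℝ) →ₗ[ℝ] ℝ where
  toFun x := (G.vec e).1 * (x (owner 𝒟 (G.rev e)) - x (owner 𝒟 e)).1 +
    (G.vec e).2 * (x (owner 𝒟 (G.rev e)) - x (owner 𝒟 e)).2
  map_add' x y := by
    simp only [Pi.add_apply, Prod.fst_sub, Prod.snd_sub, Prod.fst_add, Prod.snd_add]; ring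
  map_smul' c x := by
    simp only [Pi.smul_apply, Prod.fst_sub, Prod.snd_sub, Prod.smul_fst, Prod.smul_snd,
      smul_eq_mul, RingHom.id_apply]; ring

theorem alpha_apply (e : E) (x : Finset E → ℝ × ℝ) : G.alpha 𝒟 e x =
    planeDet (G.vec e) (x (owner 𝒟 (G.rev e)) - x (owner 𝒟 e)) := rfl

theorem beta_apply (e : E) (x : Finset E → ℝ × ℝ) : G.beta 𝒟 e x =
    (G.vec e).1 * (x (owner 𝒟 (G.rev e)) - x (owner 𝒟 e)).1 +
    (G.vec e).2 * (x (owner 𝒟 (G.rev e)) - x (owner 𝒟 e)).2 := rfl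

theorem alpha_rev (e : E) : G.alpha 𝒟 (G.rev e) = G.alpha 𝒟 e := by
  ext x
  simp only [alpha_apply, G.rev_rev, G.vec_rev, planeDet, Prod.fst_sub, Prod.snd_sub, Prod.fst_neg,
    Prod.snd_neg]
  ring

theorem alpha_const (e : E) (b : ℝ × ℝ) : G.alpha 𝒟 e (fun _ => b) = 0 := by
  simp [alpha_apply, planeDet]

theorem norm_vec_pos (e : E) : 0 < (G.vec e).1 ^ 2 + (G.vec e).2 ^ 2 := by
  have := vec_fst_ne (G := G) e
  positivity

theorem sub_eq_of_alpha_eq_zero {e : E} {x : Finset E → ℝ × ℝ} (h : G.alpha 𝒟 e x = 0) :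
    x (owner 𝒟 (G.rev e)) - x (owner 𝒟 e) =
      (G.beta 𝒟 e x / ((G.vec e).1 ^ 2 + (G.vec e).2 ^ 2)) • G.vec e := by
  have hn := norm_vec_pos (G := G) e
  rw [alpha_apply, planeDet] at h
  rw [beta_apply]
  set a := x (owner 𝒟 (G.rev e)) - x (owner 𝒟 e)
  refine Prod.ext ?_ ?_ <;> simp only [Prod.smul_fst, Prod.smul_snd, smul_eq_mul] <;>
    rw [div_mul_eq_mul_div, eq_div_iff hn.ne']
  · linear_combination (-(G.vec e).2) * h
  · linear_combination (G.vec e).1 * h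

theorem alpha_eq_zero_of_smul {e : E} {x : Finset E → ℝ × ℝ} {t : ℝ}
    (h : x (owner 𝒟 (G.rev e)) - x (owner 𝒟 e) = t • G.vec e) : G.alpha 𝒟 e x = 0 := by
  rw [alpha_apply, h]
  simp only [planeDet, Prod.smul_fst, Prod.smul_snd, smul_eq_mul]; ring

theorem beta_eq_of_smul {e : E} {x : Finset E → ℝ × ℝ} {t : ℝ}
    (h : x (owner 𝒟 (G.rev e)) - x (owner 𝒟 e) = t • G.vec e) :
    G.beta 𝒟 e x = t * ((G.vec e).1 ^ 2 + (G.vec e).2 ^ 2) := by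
  rw [beta_apply, h]
  simp only [Prod.smul_fst, Prod.smul_snd, smul_eq_mul]; ring

theorem beta_eq_zero_iff {e : E} {x : Finset E → ℝ × ℝ} (h : G.alpha 𝒟 e x = 0) :
    G.beta 𝒟 e x = 0 ↔ x (owner 𝒟 (G.rev e)) = x (owner 𝒟 e) := by
  constructor
  · intro h0
    have := sub_eq_of_alpha_eq_zero h
    rw [h0, zero_div, zero_smul] at this
    exact sub_eq_zero.1 this
  · intro h0
    rw [beta_apply, h0]; simp

section

variable (hd : ∀ U ∈ 𝒟, ∀ U' ∈ 𝒟, ∀ e ∈ U, e ∈ U' → U = U')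
include hd

theorem isWeakWeb_iff {x : Finset E → ℝ × ℝ} : G.IsWeakWeb 𝒟 x ↔
    ∀ e ∈ G.internal 𝒟, G.alpha 𝒟 e x = 0 ∧ 0 ≤ G.beta 𝒟 e x := by
  constructor
  · intro h e he
    obtain ⟨a1, a2⟩ := mem_internal.1 he
    obtain ⟨t, ht, hxt⟩ := h _ (owner_spec a1).1 _ (owner_spec a2).1 e (owner_spec a1).2
      (owner_spec a2).2
    exact ⟨alpha_eq_zero_of_smul hxt, by
      rw [beta_eq_of_smul hxt]; exact mul_nonneg ht (norm_vec_pos e).le⟩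
  · intro h U hU U' hU' e he he'
    obtain ⟨h1, h2⟩ := h e (mem_internal.2 ⟨mem_edgesOf.2 ⟨U, hU, he⟩, mem_edgesOf.2 ⟨U', hU', he'⟩⟩)
    have := sub_eq_of_alpha_eq_zero h1
    rw [owner_eq hd hU he, owner_eq hd hU' he'] at this
    exact ⟨_, div_nonneg h2 (norm_vec_pos e).le, this⟩

theorem isWeb_iff {x : Finset E → ℝ × ℝ} : G.IsWeb 𝒟 x ↔
    ∀ e ∈ G.internal 𝒟, G.alpha 𝒟 e x = 0 ∧ 0 < G.beta 𝒟 e x := by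
  constructor
  · intro h e he
    obtain ⟨a1, a2⟩ := mem_internal.1 he
    obtain ⟨t, ht, hxt⟩ := h _ (owner_spec a1).1 _ (owner_spec a2).1 e (owner_spec a1).2
      (owner_spec a2).2
    exact ⟨alpha_eq_zero_of_smul hxt, by
      rw [beta_eq_of_smul hxt]; exact mul_pos ht (norm_vec_pos e)⟩
  · intro h U hU U' hU' e he he'
    obtain ⟨h1, h2⟩ := h e (mem_internal.2 ⟨mem_edgesOf.2 ⟨U, hU, he⟩, mem_edgesOf.2 ⟨U', hU', he'⟩⟩)
    have := sub_eq_of_alpha_eq_zero h1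
    rw [owner_eq hd hU he, owner_eq hd hU' he'] at this
    exact ⟨_, div_pos h2 (norm_vec_pos e), this⟩

end

/-- There is no nonzero stress. -/
def Independent (G : PlaneGraph V E) (𝒟 : Finset (Finset E)) : Prop :=
  ∀ τ : E → ℝ, (∀ e, τ (G.rev e) = τ e) → (∀ e, e ∉ G.internal 𝒟 → τ e = 0) →
    (∀ U ∈ 𝒟, ∑ e ∈ U, τ e • G.vec e = 0) → τ = 0

/-- One orientation of each internal edge. -/
def halfInternal (G : PlaneGraph V E) (𝒟 : Finset (Finset E)) : Finset E :=
  (G.internal 𝒟).filter fun e => 0 < (G.vec e).1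

theorem halfInternal_subset : G.halfInternal 𝒟 ⊆ G.internal 𝒟 := Finset.filter_subset _ _

theorem rev_notMem_halfInternal {e : E} (he : e ∈ G.halfInternal 𝒟) :
    G.rev e ∉ G.halfInternal 𝒟 := fun he' => by
  have h1 := (Finset.mem_filter.1 he).2
  have h2 := (Finset.mem_filter.1 he').2
  rw [G.vec_rev, Prod.fst_neg] at h2
  linarith

theorem rev_mem_halfInternal {e : E} (he : e ∈ G.internal 𝒟) (hn : e ∉ G.halfInternal 𝒟) :
    G.rev e ∈ G.halfInternal 𝒟 := by
  refine Finset.mem_filter.2 ⟨rev_mem_internal he, ?_⟩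
  have h1 : ¬ 0 < (G.vec e).1 := fun h => hn (Finset.mem_filter.2 ⟨he, h⟩)
  rw [G.vec_rev, Prod.fst_neg]
  have := lt_of_le_of_ne (not_lt.1 h1) (vec_fst_ne (G := G) e)
  linarith

theorem card_halfInternal : 2 * (G.halfInternal 𝒟).card = (G.internal 𝒟).card := by
  have h1 : ((G.internal 𝒟).filter fun e => ¬ 0 < (G.vec e).1).card = (G.halfInternal 𝒟).card := by
    refine Finset.card_bij (fun e _ => G.rev e) ?_ (fun _ _ _ _ h => G.rev_injective h) ?_
    · intro e he
      rw [Finset.mem_filter] at he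
      exact rev_mem_halfInternal he.1 fun h => he.2 (Finset.mem_filter.1 h).2
    · intro e he
      refine ⟨G.rev e, ?_, G.rev_rev e⟩
      refine Finset.mem_filter.2 ⟨rev_mem_internal (halfInternal_subset he), ?_⟩
      have := (Finset.mem_filter.1 he).2
      rw [G.vec_rev, Prod.fst_neg]
      linarith
  rw [← Finset.card_filter_add_card_filter_not (s := G.internal 𝒟) (fun e => 0 < (G.vec e).1), h1,
    halfInternal]
  omega

/-- Extension by zero. -/
def extend (𝒟 : Finset (Finset E)) : (𝒟 → ℝ × ℝ) →ₗ[ℝ] Finset E → ℝ × ℝ where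
  toFun y U := if h : U ∈ 𝒟 then y ⟨U, h⟩ else 0
  map_add' x y := by funext U; by_cases h : U ∈ 𝒟 <;> simp [h]
  map_smul' c x := by funext U; by_cases h : U ∈ 𝒟 <;> simp [h]

theorem extend_apply (y : 𝒟 → ℝ × ℝ) {U : Finset E} (h : U ∈ 𝒟) : extend 𝒟 y U = y ⟨U, h⟩ :=
  dif_pos h

/-- All equations of webs. -/
def equations (G : PlaneGraph V E) (𝒟 : Finset (Finset E)) :
    (𝒟 → ℝ × ℝ) →ₗ[ℝ] G.halfInternal 𝒟 → ℝ :=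
  LinearMap.pi fun e => (G.alpha 𝒟 e.1).comp (extend 𝒟)

/-- The coefficients of a linear form that vanishes on the range, used for both orientations of an
edge, are a stress: its equilibrium on a piece is seen by moving only the point of this piece. -/
theorem Independent.range_equations (hi : G.Independent 𝒟) (h : G.IsTiling 𝒟) :
    LinearMap.range (G.equations 𝒟) = ⊤ := by
  by_contra hne
  obtain ⟨f, hf, hle⟩ := Submodule.exists_le_ker_of_lt_top _ (lt_top_iff_ne_top.2 hne)
  let g : E → ℝ := fun e => if he : e ∈ G.halfInternal 𝒟 then f (Pi.single ⟨e, he⟩ 1) else 0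
  let τ : E → ℝ := fun e => if e ∈ G.halfInternal 𝒟 then g e else
    if G.rev e ∈ G.halfInternal 𝒟 then g (G.rev e) else 0
  have hfval : ∀ z : G.halfInternal 𝒟 → ℝ, f z = ∑ e : G.halfInternal 𝒟, g e.1 * z e := by
    intro z
    conv_lhs => rw [← Finset.univ_sum_single z]
    rw [map_sum]
    refine Finset.sum_congr rfl fun e _ => ?_
    have : (Pi.single e (z e) : G.halfInternal 𝒟 → ℝ) = z e • Pi.single e 1 := by
      rw [← Pi.single_smul, smul_eq_mul, mul_one]
    rw [this, map_smul, smul_eq_mul, mul_comm]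
    simp only [g, dif_pos e.2]
  have hτ : τ = 0 := by
    refine hi τ (fun e => ?_) (fun e he => ?_) fun U hU => ?_
    · simp only [τ, G.rev_rev]
      by_cases h1 : e ∈ G.halfInternal 𝒟
      · simp [h1, rev_notMem_halfInternal h1]
      · simp [h1]
    · have h1 : e ∉ G.halfInternal 𝒟 := fun h => he (halfInternal_subset h)
      have h2 : G.rev e ∉ G.halfInternal 𝒟 := fun h => he (by
        have := rev_mem_internal (halfInternal_subset h)
        rwa [G.rev_rev] at this)
      simp [τ, h1, h2]
    · have key : ∀ b : ℝ × ℝ, planeDet (∑ e ∈ U, τ e • G.vec e) b = 0 := by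
        intro b
        have h1 := hle (LinearMap.mem_range_self (G.equations 𝒟) (Pi.single ⟨U, hU⟩ b))
        rw [LinearMap.mem_ker, hfval] at h1
        have h2 := h.sum_half hU halfInternal_subset
          (fun e he => rev_notMem_halfInternal he) g (fun e => planeDet (G.vec e) b)
          (fun e => by rw [G.vec_rev]; simp only [planeDet, Prod.fst_neg, Prod.snd_neg]; ring)
        have h3 : planeDet (∑ e ∈ U, τ e • G.vec e) b = ∑ e ∈ U, τ e * planeDet (G.vec e) b := by
          simp only [planeDet, Prod.fst_sum, Prod.snd_sum, Prod.smul_fst, Prod.smul_snd,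
            smul_eq_mul, Finset.sum_mul, ← Finset.sum_sub_distrib]
          exact Finset.sum_congr rfl fun e _ => by ring
        rw [h3, ← h2, ← neg_eq_zero]
        refine Eq.trans ?_ h1
        rw [← Finset.sum_coe_sort, ← Finset.sum_neg_distrib]
        refine Finset.sum_congr rfl fun e _ => ?_
        obtain ⟨a1, a2⟩ := mem_internal.1 (halfInternal_subset e.2)
        have ev : ∀ W (hW : W ∈ 𝒟), extend 𝒟 (Pi.single ⟨U, hU⟩ b) W = if U = W then b else 0 := by
          intro W hW
          rw [extend_apply _ hW, Pi.single_apply]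
          simp only [Subtype.mk.injEq, eq_comm]
        simp only [equations, LinearMap.pi_apply, LinearMap.comp_apply, alpha_apply]
        rw [ev _ (owner_spec a1).1, ev _ (owner_spec a2).1]
        split_ifs <;> simp [planeDet] <;> ring
      have k1 := key (1, 0)
      have k2 := key (0, 1)
      simp only [planeDet, mul_one, mul_zero, sub_zero, zero_sub, neg_eq_zero] at k1 k2
      exact Prod.ext k2 k1
  refine hf (LinearMap.ext fun z => ?_)
  rw [hfval, LinearMap.zero_apply]
  refine Finset.sum_eq_zero fun e _ => ?_
  have := congrFun hτ e.1
  simp only [τ, if_pos e.2, Pi.zero_apply] at this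
  rw [this, zero_mul]

/-- The web equations have solutions with any right hand sides. -/
theorem Independent.exists_alpha_eq (hi : G.Independent 𝒟) (h : G.IsTiling 𝒟) (c : E → ℝ)
    (hc : ∀ e, c (G.rev e) = c e) :
    ∃ y : Finset E → ℝ × ℝ, ∀ e ∈ G.internal 𝒟, G.alpha 𝒟 e y = c e := by
  obtain ⟨y, hy⟩ := LinearMap.range_eq_top.1 (hi.range_equations h) fun e => c e.1
  refine ⟨extend 𝒟 y, fun e he => ?_⟩
  by_cases h1 : e ∈ G.halfInternal 𝒟
  · exact congrFun hy ⟨e, h1⟩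
  · rw [← alpha_rev, ← hc]
    exact congrFun hy ⟨_, rev_mem_halfInternal he h1⟩

/-- Rank and nullity: the solutions have dimension `2k - s`. All is doubled because `internal`
contains both orientations of an edge. -/
theorem Independent.finrank_ker (hi : G.Independent 𝒟) (h : G.IsTiling 𝒟) :
    2 * Module.finrank ℝ (LinearMap.ker (G.equations 𝒟)) + (G.internal 𝒟).card = 4 * 𝒟.card := by
  have h1 := LinearMap.finrank_range_add_finrank_ker (G.equations 𝒟)
  rw [hi.range_equations h, finrank_top, Module.finrank_fintype_fun_eq_card,
    Module.finrank_pi_fintype] at h1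
  simp only [Module.finrank_prod, Module.finrank_self, Finset.sum_const, Finset.card_univ,
    Fintype.card_coe, smul_eq_mul] at h1
  have h2 := card_halfInternal (G := G) (𝒟 := 𝒟)
  omega

/-- The translations and the combinations of given configurations. -/
def combination {N : ℕ} (𝒟 : Finset (Finset E)) (x : Fin N → Finset E → ℝ × ℝ) :
    (ℝ × ℝ) × (Fin N → ℝ) →ₗ[ℝ] 𝒟 → ℝ × ℝ where
  toFun b U := b.1 + ∑ i, b.2 i • x i U.1
  map_add' b c := by
    funext U
    simp only [Prod.fst_add, Prod.snd_add, Pi.add_apply, add_smul, Finset.sum_add_distrib]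
    abel
  map_smul' a b := by
    funext U
    simp only [Prod.smul_fst, Prod.smul_snd, Pi.smul_apply, smul_eq_mul, mul_smul, smul_add,
      Finset.smul_sum, RingHom.id_apply]

section

variable {N : ℕ} {x : Fin N → Finset E → ℝ × ℝ}
  (hx : ∀ i, ∀ e ∈ G.internal 𝒟, G.alpha 𝒟 e (x i) = 0)
  (hind : ∀ (b : ℝ × ℝ) (c : Fin N → ℝ), (∀ U ∈ 𝒟, b + ∑ i, c i • x i U = 0) → c = 0)
include hx

theorem range_combination_le :
    LinearMap.range (combination 𝒟 x) ≤ LinearMap.ker (G.equations 𝒟) := by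
  rintro _ ⟨b, rfl⟩
  rw [LinearMap.mem_ker]
  funext e
  have he := halfInternal_subset e.2
  obtain ⟨a1, a2⟩ := mem_internal.1 he
  simp only [equations, LinearMap.pi_apply, LinearMap.comp_apply, Pi.zero_apply]
  have : G.alpha 𝒟 e (extend 𝒟 (combination 𝒟 x b)) =
      G.alpha 𝒟 e ((fun _ => b.1) + ∑ i, b.2 i • x i) := by
    rw [alpha_apply, alpha_apply, extend_apply _ (owner_spec a1).1, extend_apply _ (owner_spec a2).1]
    simp [combination]
  rw [this, map_add, map_sum, alpha_const, zero_add]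
  exact Finset.sum_eq_zero fun i _ => by rw [map_smul, hx i e he, smul_zero]

include hind

omit hx in
theorem combination_injective (hne : 𝒟.Nonempty) : Function.Injective (combination 𝒟 x) := by
  rw [← LinearMap.ker_eq_bot, LinearMap.ker_eq_bot']
  intro b hb
  have hb' : ∀ U ∈ 𝒟, b.1 + ∑ i, b.2 i • x i U = 0 := fun U hU => congrFun hb ⟨U, hU⟩
  have hc := hind b.1 b.2 hb'
  obtain ⟨U, hU⟩ := hne
  have := hb' U hU
  simp only [hc, Pi.zero_apply, zero_smul, Finset.sum_const_zero, add_zero] at this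
  exact Prod.ext this hc

theorem Independent.le_card (hi : G.Independent 𝒟) (h : G.IsTiling 𝒟) (hne : 𝒟.Nonempty) :
    2 * (2 + N) + (G.internal 𝒟).card ≤ 4 * 𝒟.card := by
  rw [← hi.finrank_ker h]
  have h1 := LinearMap.finrank_range_of_inj (combination_injective hind hne)
  have h2 := Submodule.finrank_mono (range_combination_le hx)
  rw [h1] at h2
  simp only [Module.finrank_prod, Module.finrank_self, Module.finrank_fintype_fun_eq_card,
    Fintype.card_fin] at h2
  omega

/-- The numerical hypothesis says that the two translations and the `N` given solutions, which are
independent, are as many as the dimension of the solution space. -/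
theorem Independent.exists_eq_combination (hi : G.Independent 𝒟) (h : G.IsTiling 𝒟)
    (hne : 𝒟.Nonempty) (hcard : 2 * (2 + N) + (G.internal 𝒟).card = 4 * 𝒟.card)
    {y : Finset E → ℝ × ℝ} (hy : ∀ e ∈ G.internal 𝒟, G.alpha 𝒟 e y = 0) :
    ∃ (b : ℝ × ℝ) (c : Fin N → ℝ), ∀ U ∈ 𝒟, y U = b + ∑ i, c i • x i U := by
  have h1 := LinearMap.finrank_range_of_inj (combination_injective hind hne)
  have h2 : LinearMap.range (combination 𝒟 x) = LinearMap.ker (G.equations 𝒟) := by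
    refine Submodule.eq_of_le_of_finrank_eq (range_combination_le hx) ?_
    rw [h1]
    have := hi.finrank_ker h
    simp only [Module.finrank_prod, Module.finrank_self, Module.finrank_fintype_fun_eq_card,
      Fintype.card_fin]
    omega
  have h3 : (fun U : 𝒟 => y U.1) ∈ LinearMap.ker (G.equations 𝒟) := by
    rw [LinearMap.mem_ker]
    funext e
    have he := halfInternal_subset e.2
    obtain ⟨a1, a2⟩ := mem_internal.1 he
    simp only [equations, LinearMap.pi_apply, LinearMap.comp_apply, Pi.zero_apply]
    rw [← hy e he, alpha_apply, alpha_apply, extend_apply _ (owner_spec a1).1,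
      extend_apply _ (owner_spec a2).1]
  rw [← h2] at h3
  obtain ⟨⟨b, c⟩, hbc⟩ := h3
  exact ⟨b, c, fun U hU => (congrFun hbc ⟨U, hU⟩).symm⟩

end

theorem IsTiling.eq_boundary_of_internal_empty (h : G.IsTiling 𝒟) (hU : U ∈ 𝒟)
    (hint : ∀ e ∈ U, e ∉ G.internal 𝒟) : U = G.boundary 𝒟 :=
  h.boundary.eq_of_subset_frame (h.frames U hU) fun e he => by
    have h1 := mem_edgesOf.2 ⟨U, hU, he⟩
    exact mem_boundary.2 ⟨h1, fun h2 => hint e he (mem_internal.2 ⟨h1, h2⟩)⟩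

/-- Each piece has an internal edge, unless it is the only one. -/
theorem IsTiling.exists_internal [Finite V] (h : G.IsTiling 𝒟) (hU : U ∈ 𝒟) (hc : 2 ≤ 𝒟.card) :
    ∃ e ∈ U, e ∈ G.internal 𝒟 := by
  by_contra! hno
  have hb := h.eq_boundary_of_internal_empty hU hno
  obtain ⟨U', hU', hne⟩ := Finset.exists_mem_ne (by omega : 1 < 𝒟.card) U
  obtain ⟨q, h1, h2, h3⟩ := G.exists_generic_point (edgesOf 𝒟) (G.isOpen_inner U')
    (h.frames U' hU').inner_nonempty
  have h4 := h.inner_subset hU' h2 h3 h1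
  rw [← hb] at h4
  exact hne (h.eq_of_mem_inner hU' hU h1 h4)

theorem IsWeb.independent_of_mem_internal {x : Finset E → ℝ × ℝ}
    (hd : ∀ U ∈ 𝒟, ∀ U' ∈ 𝒟, ∀ e ∈ U, e ∈ U' → U = U') (hx : G.IsWeb 𝒟 x) {e : E}
    (he : e ∈ G.internal 𝒟) (b : ℝ × ℝ) (c : Fin 1 → ℝ)
    (h : ∀ U ∈ 𝒟, b + ∑ i, c i • x U = 0) : c = 0 := by
  obtain ⟨a1, a2⟩ := mem_internal.1 he
  have h1 := h _ (owner_spec a1).1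
  have h2 := h _ (owner_spec a2).1
  have h3 := ((isWeb_iff hd).1 hx e he).2
  simp only [Finset.univ_unique, Fin.default_eq_zero, Finset.sum_singleton] at h1 h2
  have h4 : c 0 • (x (owner 𝒟 (G.rev e)) - x (owner 𝒟 e)) = 0 := by
    rw [smul_sub, sub_eq_zero, ← add_right_inj b, h1, h2]
  rcases smul_eq_zero.1 h4 with h5 | h5
  · funext i; fin_cases i; exact h5
  · rw [beta_apply, h5] at h3
    simp at h3

/-- A web of at least two pieces is not a translation. -/
theorem IsTiling.six_le [Finite V] (h : G.IsTiling 𝒟) (hi : G.Independent 𝒟)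
    {x : Finset E → ℝ × ℝ} (hx : G.IsWeb 𝒟 x) (hc : 2 ≤ 𝒟.card) :
    (G.internal 𝒟).card + 6 ≤ 4 * 𝒟.card := by
  obtain ⟨U, hU⟩ := Finset.card_pos.1 (by omega : 0 < 𝒟.card)
  obtain ⟨e, -, he⟩ := h.exists_internal hU hc
  have := hi.le_card (x := fun _ : Fin 1 => x) (fun _ e he => ((isWeb_iff h.unique).1 hx e he).1)
    (fun b c => hx.independent_of_mem_internal h.unique he b c) h ⟨U, hU⟩
  omega

end PlaneGraph

end

noncomputable section

open scoped Classical

namespace PlaneGraph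

variable {V E : Type*} {G : PlaneGraph V E} {U : Finset E} {𝒟 S : Finset (Finset E)}

/-! ### Subdividing a piece of a tiling -/

/-- The family in which the pieces in `S` are merged. -/
def coarse (G : PlaneGraph V E) (𝒟 S : Finset (Finset E)) : Finset (Finset E) :=
  insert (G.boundary S) (𝒟 \ S)

/-- The piece of the coarse family containing a piece. -/
def collapse (G : PlaneGraph V E) (S : Finset (Finset E)) (U : Finset E) : Finset E :=
  if U ∈ S then G.boundary S else U

/-- A tiling of a piece of a tiling. -/
structure IsNested (G : PlaneGraph V E) (𝒟 S : Finset (Finset E)) : Prop where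
  subset : S ⊆ 𝒟
  fine : G.IsTiling S
  coarse : G.IsTiling (G.coarse 𝒟 S)
  notMem : G.boundary S ∉ 𝒟 \ S

namespace IsNested

/-- Pieces of `S` lie inside the polygon of their boundary, which does not overlap the remaining
pieces. An edge common to both kinds would produce an overlap next to it. -/
theorem unique [Finite V] (h : G.IsNested 𝒟 S) :
    ∀ U ∈ 𝒟, ∀ U' ∈ 𝒟, ∀ e ∈ U, e ∈ U' → U = U' := by
  have mixed : ∀ U ∈ S, ∀ U' ∈ 𝒟, U' ∉ S → ∀ e ∈ U, e ∉ U' := by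
    intro U hU U' hU' hS' e he he'
    have hc : U' ∈ G.coarse 𝒟 S :=
      Finset.mem_insert_of_mem (Finset.mem_sdiff.2 ⟨hU', hS'⟩)
    obtain ⟨q, ⟨h1, h2⟩, h3, h4⟩ := G.exists_generic_point (edgesOf S)
      ((G.isOpen_inner U).inter (G.isOpen_inner U'))
      (exists_mem_inner_of_parallel (h.fine.frames U hU) (h.coarse.frames U' hc) he he' rfl rfl)
    have h5 := h.fine.inner_subset hU h3 h4 h1
    have := h.coarse.eq_of_mem_inner (Finset.mem_insert_self _ _) hc h5 h2
    exact h.notMem (this ▸ Finset.mem_sdiff.2 ⟨hU', hS'⟩)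
  intro U hU U' hU' e he he'
  by_cases h1 : U ∈ S <;> by_cases h2 : U' ∈ S
  · exact h.fine.unique U h1 U' h2 e he he'
  · exact absurd he' (mixed U h1 U' hU' h2 e he)
  · exact absurd he (mixed U' h2 U hU h1 e he')
  · exact h.coarse.unique U (Finset.mem_insert_of_mem (Finset.mem_sdiff.2 ⟨hU, h1⟩)) U'
      (Finset.mem_insert_of_mem (Finset.mem_sdiff.2 ⟨hU', h2⟩)) e he he'

theorem mem_edgesOf_fine [Finite V] (h : G.IsNested 𝒟 S) {e : E} :
    e ∈ edgesOf S ↔ e ∈ edgesOf 𝒟 ∧ owner 𝒟 e ∈ S := by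
  constructor
  · intro he
    obtain ⟨U, hU, heU⟩ := mem_edgesOf.1 he
    exact ⟨mem_edgesOf.2 ⟨U, h.subset hU, heU⟩, by rwa [owner_eq h.unique (h.subset hU) heU]⟩
  · rintro ⟨h1, h2⟩
    exact mem_edgesOf.2 ⟨_, h2, (owner_spec h1).2⟩

theorem mem_edgesOf_coarse [Finite V] (h : G.IsNested 𝒟 S) {e : E} :
    e ∈ edgesOf (G.coarse 𝒟 S) ↔ e ∈ edgesOf 𝒟 ∧ ¬ (e ∈ edgesOf S ∧ G.rev e ∈ edgesOf S) := by
  constructor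
  · intro he
    obtain ⟨U, hU, heU⟩ := mem_edgesOf.1 he
    rcases Finset.mem_insert.1 hU with rfl | hU
    · obtain ⟨h1, h2⟩ := mem_boundary.1 heU
      exact ⟨(h.mem_edgesOf_fine.1 h1).1, fun h => h2 h.2⟩
    · obtain ⟨h1, h2⟩ := Finset.mem_sdiff.1 hU
      refine ⟨mem_edgesOf.2 ⟨U, h1, heU⟩, fun h3 => h2 ?_⟩
      have := (h.mem_edgesOf_fine.1 h3.1).2
      rwa [owner_eq h.unique h1 heU] at this
  · rintro ⟨h1, h2⟩
    obtain ⟨o1, o2⟩ := owner_spec h1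
    by_cases hS : owner 𝒟 e ∈ S
    · have h3 := h.mem_edgesOf_fine.2 ⟨h1, hS⟩
      exact mem_edgesOf.2 ⟨_, Finset.mem_insert_self _ _,
        mem_boundary.2 ⟨h3, fun h4 => h2 ⟨h3, h4⟩⟩⟩
    · exact mem_edgesOf.2 ⟨_, Finset.mem_insert_of_mem (Finset.mem_sdiff.2 ⟨o1, hS⟩), o2⟩

theorem owner_coarse [Finite V] (h : G.IsNested 𝒟 S) {e : E} (he : e ∈ edgesOf (G.coarse 𝒟 S)) :
    owner (G.coarse 𝒟 S) e = G.collapse S (owner 𝒟 e) := by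
  obtain ⟨h1, h2⟩ := h.mem_edgesOf_coarse.1 he
  obtain ⟨o1, o2⟩ := owner_spec h1
  rw [collapse]
  split_ifs with hS
  · have h3 := h.mem_edgesOf_fine.2 ⟨h1, hS⟩
    exact owner_eq h.coarse.unique (Finset.mem_insert_self _ _)
      (mem_boundary.2 ⟨h3, fun h4 => h2 ⟨h3, h4⟩⟩)
  · exact owner_eq h.coarse.unique (Finset.mem_insert_of_mem (Finset.mem_sdiff.2 ⟨o1, hS⟩)) o2

theorem mem_internal_coarse [Finite V] (h : G.IsNested 𝒟 S) {e : E} :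
    e ∈ G.internal (G.coarse 𝒟 S) ↔ e ∈ G.internal 𝒟 ∧ e ∉ G.internal S := by
  rw [mem_internal, h.mem_edgesOf_coarse, h.mem_edgesOf_coarse, mem_internal, mem_internal,
    G.rev_rev]
  tauto

theorem internal_fine_subset (h : G.IsNested 𝒟 S) : G.internal S ⊆ G.internal 𝒟 := by
  intro e he
  obtain ⟨h1, h2⟩ := mem_internal.1 he
  obtain ⟨U, hU, h3⟩ := mem_edgesOf.1 h1
  obtain ⟨U', hU', h4⟩ := mem_edgesOf.1 h2
  exact mem_internal.2 ⟨mem_edgesOf.2 ⟨U, h.subset hU, h3⟩, mem_edgesOf.2 ⟨U', h.subset hU', h4⟩⟩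

theorem boundary_coarse [Finite V] (h : G.IsNested 𝒟 S) :
    G.boundary (G.coarse 𝒟 S) = G.boundary 𝒟 := by
  ext e
  have hsub : e ∈ edgesOf S → e ∈ edgesOf 𝒟 := fun h1 => (h.mem_edgesOf_fine.1 h1).1
  have hsub' : G.rev e ∈ edgesOf S → G.rev e ∈ edgesOf 𝒟 := fun h1 => (h.mem_edgesOf_fine.1 h1).1
  rw [mem_boundary, h.mem_edgesOf_coarse, h.mem_edgesOf_coarse, mem_boundary, G.rev_rev]
  tauto

theorem isTiling [Finite V] (h : G.IsNested 𝒟 S) : G.IsTiling 𝒟 := by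
  refine ⟨fun U hU => ?_, h.unique, ?_⟩
  · by_cases hS : U ∈ S
    · exact h.fine.frames U hS
    · exact h.coarse.frames U (Finset.mem_insert_of_mem (Finset.mem_sdiff.2 ⟨hU, hS⟩))
  · rw [← h.boundary_coarse]
    exact h.coarse.boundary

theorem card_internal [Finite V] (h : G.IsNested 𝒟 S) :
    (G.internal 𝒟).card = (G.internal S).card + (G.internal (G.coarse 𝒟 S)).card := by
  have h1 : G.internal (G.coarse 𝒟 S) = G.internal 𝒟 \ G.internal S := by
    ext e; rw [h.mem_internal_coarse, Finset.mem_sdiff]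
  rw [h1, Finset.card_sdiff_of_subset h.internal_fine_subset]
  have := Finset.card_le_card h.internal_fine_subset
  omega

theorem card_coarse (h : G.IsNested 𝒟 S) : (G.coarse 𝒟 S).card + S.card = 𝒟.card + 1 := by
  rw [PlaneGraph.coarse, Finset.card_insert_of_notMem h.notMem, Finset.card_sdiff_of_subset h.subset]
  have := Finset.card_le_card h.subset
  omega

theorem owner_fine [Finite V] (h : G.IsNested 𝒟 S) {e : E} (he : e ∈ edgesOf S) :
    owner 𝒟 e = owner S e :=
  owner_eq h.unique (h.subset (owner_spec he).1) (owner_spec he).2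

theorem sub_fine [Finite V] (h : G.IsNested 𝒟 S) {e : E} (he : e ∈ G.internal S)
    (x : Finset E → ℝ × ℝ) : G.alpha 𝒟 e x = G.alpha S e x ∧ G.beta 𝒟 e x = G.beta S e x := by
  obtain ⟨h1, h2⟩ := mem_internal.1 he
  rw [alpha_apply, alpha_apply, beta_apply, beta_apply, h.owner_fine h1, h.owner_fine h2]
  exact ⟨rfl, rfl⟩

theorem sub_collapse_fine [Finite V] (h : G.IsNested 𝒟 S) {e : E} (he : e ∈ G.internal S)
    (x : Finset E → ℝ × ℝ) : G.alpha 𝒟 e (x ∘ G.collapse S) = 0 ∧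
      G.beta 𝒟 e (x ∘ G.collapse S) = 0 := by
  obtain ⟨h1, h2⟩ := mem_internal.1 he
  have a1 := (h.mem_edgesOf_fine.1 h1).2
  have a2 := (h.mem_edgesOf_fine.1 h2).2
  simp [alpha_apply, beta_apply, collapse, a1, a2, planeDet]

theorem sub_collapse_coarse [Finite V] (h : G.IsNested 𝒟 S) {e : E}
    (he : e ∈ G.internal (G.coarse 𝒟 S)) (x : Finset E → ℝ × ℝ) :
    G.alpha 𝒟 e (x ∘ G.collapse S) = G.alpha (G.coarse 𝒟 S) e x ∧
      G.beta 𝒟 e (x ∘ G.collapse S) = G.beta (G.coarse 𝒟 S) e x := by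
  obtain ⟨h1, h2⟩ := mem_internal.1 he
  simp [alpha_apply, beta_apply, h.owner_coarse h1, h.owner_coarse h2]

end IsNested

/-- A tiling with a dual web, of expected codimension one. -/
structure IsDec (G : PlaneGraph V E) (𝒟 : Finset (Finset E)) : Prop where
  tiling : G.IsTiling 𝒟
  web : ∃ x, G.IsWeb 𝒟 x
  codim : (G.internal 𝒟).card + 6 = 4 * 𝒟.card

/-- A pair of composable operations. -/
structure IsGood (G : PlaneGraph V E) (𝒟 S : Finset (Finset E)) : Prop where
  subset : S ⊆ 𝒟
  fine : G.IsDec S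
  coarse : G.IsDec (G.coarse 𝒟 S)
  notMem : G.boundary S ∉ 𝒟 \ S

/-- The equations for the dual webs of all tilings are independent. -/
def Generic (G : PlaneGraph V E) : Prop :=
  ∀ 𝒟 x, G.IsTiling 𝒟 → G.IsWeb 𝒟 x → G.Independent 𝒟

theorem IsDec.two_le_card (h : G.IsDec 𝒟) : 2 ≤ 𝒟.card := by
  have := h.codim; omega

theorem IsDec.exists_internal [Finite V] (h : G.IsDec 𝒟) : ∃ e, e ∈ G.internal 𝒟 := by
  obtain ⟨U, hU⟩ := Finset.card_pos.1 (by have := h.two_le_card; omega : 0 < 𝒟.card)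
  obtain ⟨e, -, he⟩ := h.tiling.exists_internal hU h.two_le_card
  exact ⟨e, he⟩

/-- A dec is rigid: its web is unique up to translations and scaling. -/
theorem IsDec.eq_const (hG : G.Generic) (h : G.IsDec 𝒟) {e : E}
    (he : e ∈ G.internal 𝒟) {y : Finset E → ℝ × ℝ}
    (hy : ∀ e ∈ G.internal 𝒟, G.alpha 𝒟 e y = 0) (h0 : G.beta 𝒟 e y = 0) :
    ∃ b, ∀ U ∈ 𝒟, y U = b := by
  obtain ⟨x, hx⟩ := h.web
  have hd := h.tiling.unique
  have hx' := (isWeb_iff hd).1 hx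
  have hne : 𝒟.Nonempty := ⟨_, (owner_spec (mem_internal.1 he).1).1⟩
  obtain ⟨b, c, hbc⟩ := (hG 𝒟 x h.tiling hx).exists_eq_combination (x := fun _ : Fin 1 => x)
    (fun _ e he => (hx' e he).1) (fun b c => hx.independent_of_mem_internal hd he b c) h.tiling hne
    (by have := h.codim; omega) hy
  simp only [Finset.univ_unique, Fin.default_eq_zero, Finset.sum_singleton] at hbc
  have h1 : G.beta 𝒟 e y = c 0 * G.beta 𝒟 e x := by
    obtain ⟨a1, a2⟩ := mem_internal.1 he
    rw [beta_apply, hbc _ (owner_spec a1).1, hbc _ (owner_spec a2).1, beta_apply]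
    simp only [Prod.fst_sub, Prod.snd_sub, Prod.fst_add, Prod.snd_add, Prod.smul_fst,
      Prod.smul_snd, smul_eq_mul]
    ring
  have hc : c 0 = 0 := by
    rw [h0] at h1
    rcases mul_eq_zero.1 h1.symm with h2 | h2
    · exact h2
    · exact absurd h2 (hx' e he).2.ne'
  exact ⟨b, fun U hU => by rw [hbc U hU, hc, zero_smul, add_zero]⟩

namespace IsGood

theorem isNested (h : G.IsGood 𝒟 S) : G.IsNested 𝒟 S :=
  ⟨h.subset, h.fine.tiling, h.coarse.tiling, h.notMem⟩

variable [Finite V]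

/-- Internal edges add up, and the numbers of pieces add up to one more; two tilings of codimension
one compose to codimension two. -/
theorem codim (h : G.IsGood 𝒟 S) : (G.internal 𝒟).card + 8 = 4 * 𝒟.card := by
  have h1 := h.isNested.card_internal
  have h2 := h.isNested.card_coarse
  have h3 := h.fine.codim
  have h4 := h.coarse.codim
  omega

/-- The web of the coarse tiling, as a weak web. -/
theorem exists_weakWeb (h : G.IsGood 𝒟 S) : ∃ r : Finset E → ℝ × ℝ,
    (∀ e ∈ G.internal 𝒟, G.alpha 𝒟 e r = 0) ∧ (∀ e ∈ G.internal S, G.beta 𝒟 e r = 0) ∧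
    ∀ e ∈ G.internal 𝒟, e ∉ G.internal S → 0 < G.beta 𝒟 e r := by
  have hn := h.isNested
  obtain ⟨y, hy⟩ := h.coarse.web
  rw [isWeb_iff hn.coarse.unique] at hy
  refine ⟨y ∘ G.collapse S, fun e he => ?_, fun e he => (hn.sub_collapse_fine he y).2,
    fun e he he' => ?_⟩
  · by_cases hS : e ∈ G.internal S
    · exact (hn.sub_collapse_fine hS y).1
    · have hc := hn.mem_internal_coarse.2 ⟨he, hS⟩
      rw [(hn.sub_collapse_coarse hc y).1]
      exact (hy e hc).1
  · have hc := hn.mem_internal_coarse.2 ⟨he, he'⟩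
    rw [(hn.sub_collapse_coarse hc y).2]
    exact (hy e hc).2

/-- The coarse web `r` is perturbed by a small multiple of a fine web. Extending the fine web by
zero spoils the equations of the coarse edges; as these are independent, a configuration constant on
the merged piece corrects them and leaves the fine lengths unchanged. For small `δ` the coarse
lengths stay positive. -/
theorem exists_web (hG : G.Generic) (h : G.IsGood 𝒟 S) : ∃ w, G.IsWeb 𝒟 w := by
  have hn := h.isNested
  obtain ⟨r, hr1, hr2, hr3⟩ := h.exists_weakWeb
  obtain ⟨z, hz⟩ := h.fine.web
  rw [isWeb_iff hn.fine.unique] at hz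
  obtain ⟨yc, hyc⟩ := h.coarse.web
  let z' : Finset E → ℝ × ℝ := fun U => if U ∈ S then z U else 0
  have hz' : ∀ e ∈ G.internal S, G.alpha 𝒟 e z' = G.alpha S e z ∧ G.beta 𝒟 e z' = G.beta S e z := by
    intro e he
    rw [(hn.sub_fine he z').1, (hn.sub_fine he z').2]
    obtain ⟨h1, h2⟩ := mem_internal.1 he
    simp [alpha_apply, beta_apply, z', (owner_spec h1).1, (owner_spec h2).1]
  obtain ⟨y, hy⟩ := (hG _ yc hn.coarse hyc).exists_alpha_eq hn.coarse (fun e => -G.alpha 𝒟 e z')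
    fun e => by rw [alpha_rev]
  set w₀ := z' + y ∘ G.collapse S with hw₀
  have a0 : ∀ e ∈ G.internal 𝒟, G.alpha 𝒟 e w₀ = 0 := by
    intro e he
    rw [hw₀, map_add]
    by_cases hS : e ∈ G.internal S
    · rw [(hn.sub_collapse_fine hS y).1, (hz' e hS).1, (hz e hS).1, add_zero]
    · have hc := hn.mem_internal_coarse.2 ⟨he, hS⟩
      rw [(hn.sub_collapse_coarse hc y).1, hy e hc, add_neg_cancel]
  have b0 : ∀ e ∈ G.internal S, 0 < G.beta 𝒟 e w₀ := by
    intro e hS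
    rw [hw₀, map_add, (hn.sub_collapse_fine hS y).2, (hz' e hS).2, add_zero]
    exact (hz e hS).2
  have hev : ∀ᶠ δ : ℝ in 𝓝[>] 0, ∀ e ∈ G.internal 𝒟, 0 < G.beta 𝒟 e r + δ * G.beta 𝒟 e w₀ := by
    refine (Finset.eventually_all _).2 fun e he => ?_
    by_cases hS : e ∈ G.internal S
    · filter_upwards [self_mem_nhdsWithin] with δ hδ
      rw [hr2 e hS, zero_add]
      exact mul_pos hδ (b0 e hS)
    · have hc : Continuous fun δ : ℝ => G.beta 𝒟 e r + δ * G.beta 𝒟 e w₀ := by fun_prop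
      exact (hc.continuousAt.eventually (lt_mem_nhds (by simpa using hr3 e he hS))).filter_mono
        nhdsWithin_le_nhds
  obtain ⟨δ, hδ⟩ := hev.exists
  refine ⟨r + δ • w₀, (isWeb_iff hn.unique).2 fun e he => ⟨?_, ?_⟩⟩
  · rw [map_add, map_smul, hr1 e he, a0 e he, smul_zero, add_zero]
  · rw [map_add, map_smul, smul_eq_mul]
    exact hδ e he

/-- Every piece of `S` has an edge glued within `S`. So `S` can be recovered from the set of edges
that contract. -/
theorem eq_filter (h : G.IsGood 𝒟 S) :
    S = 𝒟.filter fun U => ∃ e ∈ U, e ∈ G.internal S := by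
  ext U
  rw [Finset.mem_filter]
  constructor
  · intro hU
    exact ⟨h.subset hU, h.fine.tiling.exists_internal hU h.fine.two_le_card⟩
  · rintro ⟨hU, e, he, hi⟩
    obtain ⟨U', hU', he'⟩ := mem_edgesOf.1 (mem_internal.1 hi).1
    rwa [h.isNested.unique U hU U' (h.subset hU') e he he']

end IsGood

theorem internal_singleton (hU : G.IsFrame U) : G.internal {U} = ∅ := by
  rw [Finset.eq_empty_iff_forall_notMem]
  intro e he
  obtain ⟨h1, h2⟩ := mem_internal.1 he
  simp only [edgesOf, Finset.singleton_biUnion, id] at h1 h2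
  exact hU.rev_notMem h1 h2

theorem boundary_singleton (hU : G.IsFrame U) : G.boundary {U} = U := by
  ext e
  rw [mem_boundary]
  simp only [edgesOf, Finset.singleton_biUnion, id]
  exact ⟨fun h => h.1, fun h => ⟨h, hU.rev_notMem h⟩⟩

variable [Finite V]

/-- In codimension two, a degeneration of the webs comes from a pair of composable operations. -/
theorem exists_isGood_of_weakWeb (hG : G.Generic) (h : G.IsTiling 𝒟)
    (hcodim : (G.internal 𝒟).card + 8 = 4 * 𝒟.card) {w x : Finset E → ℝ × ℝ} (hw : G.IsWeb 𝒟 w)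
    (hx : G.IsWeakWeb 𝒟 x) (h0 : ∃ e ∈ G.internal 𝒟, G.beta 𝒟 e x = 0)
    (h1 : ∃ e ∈ G.internal 𝒟, G.beta 𝒟 e x ≠ 0) :
    ∃ S, G.IsGood 𝒟 S ∧ ∀ e ∈ G.internal S, G.beta 𝒟 e x = 0 := by
  have hxa := fun e he => ((isWeakWeb_iff h.unique).1 hx e he).1
  have hT := h.merge_isTiling hx
  have hW := h.merge_isWeb hx
  have hsum := card_internal_merge h x
  have hcard : 𝒟.card = ∑ ρ ∈ 𝒟.image x, (𝒟.filter fun U => x U = ρ).card :=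
    Finset.card_eq_sum_card_image x 𝒟
  -- The budget is in terms of `2k - s`, which is 4 for `𝒟`. It equals the value of the merged
  -- tiling, at least 3, plus the sum over the fibres of their value minus 2. A fibre contributes at
  -- least 0, and at least 1 unless it is a single piece. So exactly one fibre is nontrivial and all
  -- these bounds are attained.
  have hfib : ∀ ρ ∈ 𝒟.image x, (G.internal (𝒟.filter fun U => x U = ρ)).card + 4 ≤
      4 * (𝒟.filter fun U => x U = ρ).card ∧
      (2 ≤ (𝒟.filter fun U => x U = ρ).card →
        (G.internal (𝒟.filter fun U => x U = ρ)).card + 6 ≤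
          4 * (𝒟.filter fun U => x U = ρ).card) := by
    intro ρ hρ
    obtain ⟨U, hU, hUρ⟩ := Finset.mem_image.1 hρ
    have hne : (𝒟.filter fun U => x U = ρ).Nonempty := ⟨U, Finset.mem_filter.2 ⟨hU, hUρ⟩⟩
    have ht := h.isTiling_subset (Finset.filter_subset _ _) (h.isFrame_boundary_fiber hx hne)
    have hwρ := hw.mono_set (Finset.filter_subset (fun U => x U = ρ) 𝒟)
    have h2 : 2 ≤ (𝒟.filter fun U => x U = ρ).card →
        (G.internal (𝒟.filter fun U => x U = ρ)).card + 6 ≤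
          4 * (𝒟.filter fun U => x U = ρ).card :=
      fun h2 => ht.six_le (hG _ w ht hwρ) hwρ h2
    refine ⟨?_, h2⟩
    by_cases hc : 2 ≤ (𝒟.filter fun U => x U = ρ).card
    · have := h2 hc; omega
    · have hpos := Finset.card_pos.2 hne
      obtain ⟨U', hU'⟩ := Finset.card_eq_one.1 (by omega : (𝒟.filter fun U => x U = ρ).card = 1)
      have hfr : G.IsFrame U' := ht.frames U' (by rw [hU']; simp)
      rw [hU', internal_singleton hfr]
      simp
  have hmerge : (G.internal (merge G 𝒟 x)).card + 6 ≤ 4 * (merge G 𝒟 x).card := by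
    refine hT.six_le (hG _ _ hT hW) hW ?_
    rw [h.card_merge hx]
    obtain ⟨e, he, hb⟩ := h1
    obtain ⟨a1, a2⟩ := mem_internal.1 he
    have hne : x (owner 𝒟 (G.rev e)) ≠ x (owner 𝒟 e) :=
      fun hc => hb ((beta_eq_zero_iff (hxa e he)).2 hc)
    exact Finset.one_lt_card.2 ⟨_, Finset.mem_image_of_mem x (owner_spec a2).1, _,
      Finset.mem_image_of_mem x (owner_spec a1).1, hne⟩
  obtain ⟨e, he, hb⟩ := h0
  obtain ⟨a1, a2⟩ := mem_internal.1 he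
  have heq := (beta_eq_zero_iff (hxa e he)).1 hb
  set ρ := x (owner 𝒟 e) with hρ
  set S := 𝒟.filter fun U => x U = ρ with hS
  have hρim : ρ ∈ 𝒟.image x := Finset.mem_image_of_mem x (owner_spec a1).1
  have hne : owner 𝒟 e ≠ owner 𝒟 (G.rev e) := fun hc =>
    (h.frames _ (owner_spec a1).1).rev_notMem (owner_spec a1).2 (hc ▸ (owner_spec a2).2)
  have hS2 : 2 ≤ S.card := Finset.one_lt_card.2 ⟨_, Finset.mem_filter.2 ⟨(owner_spec a1).1, rfl⟩, _,
    Finset.mem_filter.2 ⟨(owner_spec a2).1, heq⟩, hne⟩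
  rw [h.card_merge hx] at hmerge
  have hrest : ∑ ρ' ∈ (𝒟.image x).erase ρ, ((G.internal (𝒟.filter fun U => x U = ρ')).card + 4) ≤
      ∑ ρ' ∈ (𝒟.image x).erase ρ, 4 * (𝒟.filter fun U => x U = ρ').card :=
    Finset.sum_le_sum fun ρ' hρ' => (hfib ρ' (Finset.mem_of_mem_erase hρ')).1
  have hSle : (G.internal S).card + 6 ≤ 4 * S.card := (hfib ρ hρim).2 hS2
  rw [← Finset.sum_erase_add _ _ hρim] at hsum hcard
  have hsplit : ∑ ρ' ∈ (𝒟.image x).erase ρ, ((G.internal (𝒟.filter fun U => x U = ρ')).card + 4) =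
      ∑ ρ' ∈ (𝒟.image x).erase ρ, (G.internal (𝒟.filter fun U => x U = ρ')).card +
      ((𝒟.image x).card - 1) * 4 := by
    rw [Finset.sum_add_distrib, Finset.sum_const, Finset.card_erase_of_mem hρim, smul_eq_mul]
  have hsplit' : ∑ ρ' ∈ (𝒟.image x).erase ρ, 4 * (𝒟.filter fun U => x U = ρ').card =
      4 * ∑ ρ' ∈ (𝒟.image x).erase ρ, (𝒟.filter fun U => x U = ρ').card := by
    rw [Finset.mul_sum]
  have hhS : (𝒟.filter fun U => x U = ρ) = S := rfl
  rw [hhS] at hsum hcard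
  have himpos : 0 < (𝒟.image x).card := Finset.card_pos.2 ⟨ρ, hρim⟩
  have hother : ∀ ρ' ∈ (𝒟.image x).erase ρ, (𝒟.filter fun U => x U = ρ').card = 1 := by
    intro ρ' hρ'
    by_contra hc
    have hρ'im := Finset.mem_of_mem_erase hρ'
    have hpos : 0 < (𝒟.filter fun U => x U = ρ').card := by
      obtain ⟨U, hU, hUρ⟩ := Finset.mem_image.1 hρ'im
      exact Finset.card_pos.2 ⟨U, Finset.mem_filter.2 ⟨hU, hUρ⟩⟩
    have h6 := (hfib ρ' hρ'im).2 (by omega)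
    have hlt : ∑ ρ' ∈ (𝒟.image x).erase ρ, ((G.internal (𝒟.filter fun U => x U = ρ')).card + 4) <
        ∑ ρ' ∈ (𝒟.image x).erase ρ, 4 * (𝒟.filter fun U => x U = ρ').card :=
      Finset.sum_lt_sum (fun ρ'' hρ'' => (hfib ρ'' (Finset.mem_of_mem_erase hρ'')).1)
        ⟨ρ', hρ', by omega⟩
    omega
  have hcoarse : merge G 𝒟 x = G.coarse 𝒟 S := by
    rw [merge, ← Finset.insert_erase hρim, Finset.image_insert, coarse]
    congr 1
    ext U
    rw [Finset.mem_image, Finset.mem_sdiff]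
    have hsingle : ∀ ρ' ∈ (𝒟.image x).erase ρ, ∀ U ∈ 𝒟, x U = ρ' →
        𝒟.filter (fun U => x U = ρ') = {U} := by
      intro ρ' hρ' U hU hUρ
      obtain ⟨U', hU'⟩ := Finset.card_eq_one.1 (hother ρ' hρ')
      have : U ∈ 𝒟.filter fun U => x U = ρ' := Finset.mem_filter.2 ⟨hU, hUρ⟩
      rw [hU', Finset.mem_singleton] at this
      rw [hU', this]
    constructor
    · rintro ⟨ρ', hρ', rfl⟩
      obtain ⟨U', hU', hUρ⟩ := Finset.mem_image.1 (Finset.mem_of_mem_erase hρ')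
      rw [hsingle ρ' hρ' U' hU' hUρ, boundary_singleton (h.frames U' hU')]
      refine ⟨hU', fun hc => (Finset.mem_erase.1 hρ').1 ?_⟩
      rw [← hUρ, (Finset.mem_filter.1 hc).2]
    · rintro ⟨hU, hUS⟩
      have hρ' : x U ∈ (𝒟.image x).erase ρ := Finset.mem_erase.2
        ⟨fun hc => hUS (Finset.mem_filter.2 ⟨hU, hc⟩), Finset.mem_image_of_mem x hU⟩
      refine ⟨x U, hρ', ?_⟩
      rw [hsingle _ hρ' U hU rfl, boundary_singleton (h.frames U hU)]
  have htS := h.isTiling_subset (Finset.filter_subset _ _)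
    (h.isFrame_boundary_fiber hx (ρ := ρ) (Finset.card_pos.1 (lt_of_lt_of_le two_pos hS2)))
  refine ⟨S, ⟨Finset.filter_subset _ _, ⟨htS, ⟨w, hw.mono_set (Finset.filter_subset _ _)⟩, ?_⟩,
    ⟨hcoarse ▸ hT, ⟨_, hcoarse ▸ hW⟩, ?_⟩, fun hc => ?_⟩, fun e' he' => ?_⟩
  · omega
  · rw [← hcoarse, h.card_merge hx]
    omega
  · obtain ⟨e', he'⟩ := htS.boundary.nonempty
    obtain ⟨U, hU, heU⟩ := mem_edgesOf.1 (mem_boundary.1 he').1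
    obtain ⟨c1, c2⟩ := Finset.mem_sdiff.1 hc
    have := h.unique _ c1 U (Finset.mem_filter.1 hU).1 e' he' heU
    exact c2 (this ▸ hU)
  · obtain ⟨b1, b2, b3⟩ := (mem_internal_fiber h).1 he'
    rw [beta_eq_zero_iff (hxa e' b1), b2, b3]

/-- Composable pairs of operations with a given result come in pairs, the two ends of an interval
of dual webs. -/
theorem IsGood.exists_partner (hG : G.Generic) (h : G.IsGood 𝒟 S) :
    ∃ S', G.IsGood 𝒟 S' ∧ S' ≠ S ∧ (∀ e ∈ G.internal S, e ∉ G.internal S') ∧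
      (∀ S'', G.IsGood 𝒟 S'' → S'' = S ∨ S'' = S') ∧
      ∀ e ∈ G.internal S, ∀ e' ∈ G.internal S', ∀ y : Finset E → ℝ × ℝ,
        (∀ e ∈ G.internal 𝒟, G.alpha 𝒟 e y = 0) → G.beta 𝒟 e y = 0 → G.beta 𝒟 e' y = 0 →
        ∃ b, ∀ U ∈ 𝒟, y U = b := by
  have hn := h.isNested
  have ht := hn.isTiling
  obtain ⟨r, hr1, hr2, hr3⟩ := h.exists_weakWeb
  obtain ⟨w, hw⟩ := h.exists_web hG
  have hw' := (isWeb_iff ht.unique).1 hw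
  obtain ⟨eS, heS⟩ := h.fine.exists_internal
  have heS' := hn.internal_fine_subset heS
  obtain ⟨ec, hec⟩ := h.coarse.exists_internal
  obtain ⟨hec1, hec2⟩ := hn.mem_internal_coarse.1 hec
  have hr4 : ∀ e ∈ G.internal 𝒟, 0 ≤ G.beta 𝒟 e r := fun e he => by
    by_cases hS : e ∈ G.internal S
    · exact (hr2 e hS).ge
    · exact (hr3 e he hS).le
  -- the other end of the segment from `r` through `w`
  obtain ⟨e₀, he₀, hmin⟩ := (G.internal 𝒟 \ G.internal S).exists_min_image
    (fun e => G.beta 𝒟 e w / G.beta 𝒟 e r) ⟨ec, Finset.mem_sdiff.2 ⟨hec1, hec2⟩⟩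
  obtain ⟨he₀1, he₀2⟩ := Finset.mem_sdiff.1 he₀
  set c := G.beta 𝒟 e₀ w / G.beta 𝒟 e₀ r with hc
  -- The constant `c` is the least ratio of lengths over the edges outside `S`, so the lengths of
  -- `x` remain nonnegative and that of `e₀` vanishes. Edges inside `S` keep their positive length
  -- in `w`, so the new degeneration contracts none of them.
  set x := w - c • r with hxdef
  have hxa : ∀ e ∈ G.internal 𝒟, G.alpha 𝒟 e x = 0 := fun e he => by
    rw [hxdef, map_sub, map_smul, (hw' e he).1, hr1 e he, smul_zero, sub_zero]
  have hxb : ∀ e, G.beta 𝒟 e x = G.beta 𝒟 e w - c * G.beta 𝒟 e r := fun e => by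
    rw [hxdef, map_sub, map_smul, smul_eq_mul]
  have hxS : ∀ e ∈ G.internal S, 0 < G.beta 𝒟 e x := fun e he => by
    rw [hxb, hr2 e he, mul_zero, sub_zero]
    exact (hw' e (hn.internal_fine_subset he)).2
  have hx : G.IsWeakWeb 𝒟 x := by
    refine (isWeakWeb_iff ht.unique).2 fun e he => ⟨hxa e he, ?_⟩
    by_cases hS : e ∈ G.internal S
    · exact (hxS e hS).le
    · have := hmin e (Finset.mem_sdiff.2 ⟨he, hS⟩)
      rw [hxb, sub_nonneg]
      exact (le_div_iff₀ (hr3 e he hS)).1 this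
  have hx0 : G.beta 𝒟 e₀ x = 0 := by
    rw [hxb, hc, div_mul_cancel₀ _ (hr3 e₀ he₀1 he₀2).ne', sub_self]
  obtain ⟨S', hS', hS'0⟩ := exists_isGood_of_weakWeb hG ht h.codim hw hx ⟨e₀, he₀1, hx0⟩
    ⟨eS, heS', (hxS eS heS).ne'⟩
  have hdisj : ∀ e ∈ G.internal S, e ∉ G.internal S' := fun e he he' =>
    (hxS e he).ne' (hS'0 e he')
  obtain ⟨eS₁, heS₁⟩ := hS'.fine.exists_internal
  -- In codimension two, the translations and two independent solutions span everything. Here `r`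
  -- vanishes on the edges of `S` and not on `e₀`, and `x` does the opposite.
  have hspan : ∀ y : Finset E → ℝ × ℝ, (∀ e ∈ G.internal 𝒟, G.alpha 𝒟 e y = 0) →
      ∃ (b : ℝ × ℝ) (a a' : ℝ), ∀ U ∈ 𝒟, y U = b + a • r U + a' • x U := by
    intro y hy
    have hbeta : ∀ e ∈ G.internal 𝒟, ∀ (b : ℝ × ℝ) (c : Fin 2 → ℝ),
        (∀ U ∈ 𝒟, b + ∑ i, c i • (![r, x] i) U = 0) →
        c 0 * G.beta 𝒟 e r + c 1 * G.beta 𝒟 e x = 0 := by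
      intro e he b c hbc
      obtain ⟨a1, a2⟩ := mem_internal.1 he
      have z1 := hbc _ (owner_spec a1).1
      have z2 := hbc _ (owner_spec a2).1
      simp only [Fin.sum_univ_two, Matrix.cons_val_zero, Matrix.cons_val_one] at z1 z2
      have z3 := congrArg Prod.fst z1
      have z4 := congrArg Prod.snd z1
      have z5 := congrArg Prod.fst z2
      have z6 := congrArg Prod.snd z2
      simp only [Prod.fst_add, Prod.snd_add, Prod.smul_fst, Prod.smul_snd, smul_eq_mul,
        Prod.fst_zero, Prod.snd_zero] at z3 z4 z5 z6
      simp only [beta_apply, Prod.fst_sub, Prod.snd_sub]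
      linear_combination (G.vec e).1 * (z5 - z3) + (G.vec e).2 * (z6 - z4)
    obtain ⟨b, c, hbc⟩ := (hG 𝒟 w ht hw).exists_eq_combination (x := ![r, x])
      (fun i e he => by
        fin_cases i
        · exact hr1 e he
        · exact hxa e he)
      (fun b c hbc => by
        have k1 := hbeta eS heS' b c hbc
        have k2 := hbeta e₀ he₀1 b c hbc
        rw [hr2 eS heS, mul_zero, zero_add] at k1
        rw [hx0, mul_zero, add_zero] at k2
        funext i
        fin_cases i
        · exact (mul_eq_zero.1 k2).resolve_right (hr3 e₀ he₀1 he₀2).ne'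
        · exact (mul_eq_zero.1 k1).resolve_right (hxS eS heS).ne')
      ht ⟨_, (owner_spec (mem_internal.1 heS').1).1⟩ (by have := h.codim; omega) hy
    refine ⟨b, c 0, c 1, fun U hU => ?_⟩
    rw [hbc U hU]
    simp [Fin.sum_univ_two, add_assoc]
  have hbspan : ∀ (y : Finset E → ℝ × ℝ) (b : ℝ × ℝ) (a a' : ℝ),
      (∀ U ∈ 𝒟, y U = b + a • r U + a' • x U) → ∀ e ∈ G.internal 𝒟,
      G.beta 𝒟 e y = a * G.beta 𝒟 e r + a' * G.beta 𝒟 e x := by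
    intro y b a a' hy e he
    obtain ⟨a1, a2⟩ := mem_internal.1 he
    simp only [beta_apply]
    rw [hy _ (owner_spec a1).1, hy _ (owner_spec a2).1]
    simp only [Prod.fst_sub, Prod.snd_sub, Prod.fst_add, Prod.snd_add, Prod.smul_fst,
      Prod.smul_snd, smul_eq_mul]
    ring
  have heS₁' := hS'.isNested.internal_fine_subset heS₁
  have hrS' : ∀ e ∈ G.internal S', 0 < G.beta 𝒟 e r := fun e he =>
    hr3 e (hS'.isNested.internal_fine_subset he) fun hS => hdisj e hS he
  refine ⟨S', hS', fun hc => hdisj eS heS (hc ▸ heS), hdisj, fun S'' hS'' => ?_, ?_⟩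
  -- The coarse web of any good subfamily lies in the cone of `r` and `x`, as its lengths on the
  -- edges `eS` and `eS₁` are nonnegative. One of its lengths vanishes, so it lies on a boundary
  -- ray, and its vanishing lengths determine the subfamily.
  · obtain ⟨r'', q1, q2, q3⟩ := hS''.exists_weakWeb
    have hn'' := hS''.isNested
    have q4 : ∀ e ∈ G.internal 𝒟, 0 ≤ G.beta 𝒟 e r'' := fun e he => by
      by_cases hS : e ∈ G.internal S''
      · exact (q2 e hS).ge
      · exact (q3 e he hS).le
    obtain ⟨b, a, a', hy⟩ := hspan r'' q1
    have hb := hbspan r'' b a a' hy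
    have ha' : 0 ≤ a' := by
      have := q4 eS heS'
      rw [hb eS heS', hr2 eS heS, mul_zero, zero_add] at this
      exact nonneg_of_mul_nonneg_left this (hxS eS heS)
    have ha : 0 ≤ a := by
      have := q4 eS₁ heS₁'
      rw [hb eS₁ heS₁', hS'0 eS₁ heS₁, mul_zero, add_zero] at this
      exact nonneg_of_mul_nonneg_left this (hrS' eS₁ heS₁)
    have hint : ∀ T, G.IsGood 𝒟 T → (∀ e ∈ G.internal 𝒟, e ∈ G.internal S'' → e ∈ G.internal T) →
        (∀ e ∈ G.internal 𝒟, e ∈ G.internal T → e ∈ G.internal S'') → S'' = T := by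
      intro T hT i1 i2
      have : G.internal S'' = G.internal T := by
        ext e
        exact ⟨fun he => i1 e (hn''.internal_fine_subset he) he,
          fun he => i2 e (hT.isNested.internal_fine_subset he) he⟩
      rw [hS''.eq_filter, hT.eq_filter, this]
    have hiff : ∀ e ∈ G.internal 𝒟, e ∈ G.internal S'' ↔ G.beta 𝒟 e r'' = 0 := fun e he =>
      ⟨q2 e, fun h0 => by
        by_contra hS
        exact (q3 e he hS).ne' h0⟩
    obtain ⟨e₂, he₂⟩ := hS''.fine.exists_internal
    have he₂' := hn''.internal_fine_subset he₂
    obtain ⟨e₃, he₃⟩ := hS''.coarse.exists_internal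
    obtain ⟨he₃1, he₃2⟩ := hn''.mem_internal_coarse.1 he₃
    have pos3 := q3 e₃ he₃1 he₃2
    have zero2 := q2 e₂ he₂
    rw [hb e₃ he₃1] at pos3
    rw [hb e₂ he₂'] at zero2
    have hx4 : ∀ e ∈ G.internal 𝒟, 0 ≤ G.beta 𝒟 e x := fun e he =>
      ((isWeakWeb_iff ht.unique).1 hx e he).2
    rcases ha.eq_or_lt with ha0 | ha0
    · -- `r''` is proportional to `x`
      right
      have ha'0 : 0 < a' := ha'.lt_of_ne fun h0 => by rw [← ha0, ← h0] at pos3; simp at pos3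
      have hiff2 : ∀ e ∈ G.internal 𝒟, e ∈ G.internal S'' ↔ G.beta 𝒟 e x = 0 := fun e he => by
        rw [hiff e he, hb e he, ← ha0, zero_mul, zero_add, mul_eq_zero, or_iff_right ha'0.ne']
      have hsub : ∀ e ∈ G.internal 𝒟, e ∈ G.internal S' → e ∈ G.internal S'' :=
        fun e he he' => (hiff2 e he).2 (hS'0 e he')
      -- both are determined by the value classes of rigid webs
      obtain ⟨r₁, p1, p2, p3⟩ := hS'.exists_weakWeb
      obtain ⟨b₁, a₁, a₁', hy₁⟩ := hspan r₁ p1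
      have hb₁ := hbspan r₁ b₁ a₁ a₁' hy₁
      have z₁ := p2 eS₁ heS₁
      rw [hb₁ eS₁ heS₁', hS'0 eS₁ heS₁, mul_zero, add_zero] at z₁
      have a₁0 : a₁ = 0 := (mul_eq_zero.1 z₁).resolve_right (hrS' eS₁ heS₁).ne'
      refine hint S' hS' (fun e he he'' => ?_) hsub
      by_contra hS
      have := p3 e he hS
      rw [hb₁ e he, a₁0, (hiff2 e he).1 he'', zero_mul, mul_zero, add_zero] at this
      exact lt_irrefl _ this
    · left
      have ha'0 : a' = 0 := by
        by_contra hne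
        have ha'p := ha'.lt_of_ne (Ne.symm hne)
        by_cases hS : e₂ ∈ G.internal S
        · rw [hr2 e₂ hS, mul_zero, zero_add] at zero2
          exact (mul_pos ha'p (hxS e₂ hS)).ne' zero2
        · have := mul_pos ha0 (hr3 e₂ he₂' hS)
          have := mul_nonneg ha' (hx4 e₂ he₂')
          linarith
      have hiff2 : ∀ e ∈ G.internal 𝒟, e ∈ G.internal S'' ↔ G.beta 𝒟 e r = 0 := fun e he => by
        rw [hiff e he, hb e he, ha'0, zero_mul, add_zero, mul_eq_zero, or_iff_right ha0.ne']
      refine hint S h (fun e he he'' => ?_) fun e he he' => (hiff2 e he).2 (hr2 e he')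
      by_contra hS
      exact (hr3 e he hS).ne' ((hiff2 e he).1 he'')
  · intro e he e' he' y hy hy0 hy0'
    obtain ⟨b, a, a', hyU⟩ := hspan y hy
    have hb := hbspan y b a a' hyU
    have k1 := hb e (hn.internal_fine_subset he)
    have k2 := hb e' (hS'.isNested.internal_fine_subset he')
    rw [hy0, hr2 e he, mul_zero, zero_add] at k1
    rw [hy0', hS'0 e' he', mul_zero, add_zero] at k2
    have a'0 := (mul_eq_zero.1 k1.symm).resolve_right (hxS e he).ne'
    have a0 := (mul_eq_zero.1 k2.symm).resolve_right (hrS' e' he').ne'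
    exact ⟨b, fun U hU => by rw [hyU U hU, a0, a'0]; simp⟩

end PlaneGraph

end

noncomputable section

open scoped Classical

/-! ### Products of vectors in the exterior algebra -/

section Wedge

variable {W : Type*} [AddCommGroup W] [Module ℝ W]

/-- The product of a list of vectors in the exterior algebra. -/
def wedge (l : List W) : ExteriorAlgebra ℝ W := (l.map (ExteriorAlgebra.ι ℝ)).prod

theorem wedge_cons (u : W) (l : List W) : wedge (u :: l) = ExteriorAlgebra.ι ℝ u * wedge l := by
  rw [wedge, List.map_cons, List.prod_cons, wedge]

theorem wedge_append (l l' : List W) : wedge (l ++ l') = wedge l * wedge l' := by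
  rw [wedge, List.map_append, List.prod_append, wedge, wedge]

theorem map_wedge {W' : Type*} [AddCommGroup W'] [Module ℝ W'] (f : W →ₗ[ℝ] W') (l : List W) :
    ExteriorAlgebra.map f (wedge l) = wedge (l.map f) := by
  rw [wedge, map_list_prod, wedge, List.map_map, List.map_map]
  congr 1
  exact List.map_congr_left fun u _ => ExteriorAlgebra.map_apply_ι f u

theorem ι_mul_ι (u u' : W) : ExteriorAlgebra.ι ℝ u * ExteriorAlgebra.ι ℝ u' =
    -(ExteriorAlgebra.ι ℝ u' * ExteriorAlgebra.ι ℝ u) :=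
  eq_neg_of_add_eq_zero_left (ExteriorAlgebra.ι_add_mul_swap u u')

theorem wedge_perm {l l' : List W} (h : l.Perm l') : ∃ s : ℤˣ, wedge l = s • wedge l' := by
  induction h with
  | nil => exact ⟨1, by simp⟩
  | cons u _ ih =>
    obtain ⟨s, hs⟩ := ih
    refine ⟨s, ?_⟩
    rw [wedge_cons, wedge_cons, hs, Units.smul_def, Units.smul_def, mul_smul_comm]
  | swap u v l =>
    refine ⟨-1, ?_⟩
    simp only [wedge_cons]
    rw [← mul_assoc, ← mul_assoc, ι_mul_ι]
    simp [Units.smul_def]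
  | trans _ _ ih ih' =>
    obtain ⟨s, hs⟩ := ih
    obtain ⟨s', hs'⟩ := ih'
    exact ⟨s * s', by rw [hs, hs', mul_smul]⟩

theorem ι_mul_wedge (u : W) (l : List W) : ExteriorAlgebra.ι ℝ u * wedge l =
    (l.length : ℤ).negOnePow • (wedge l * ExteriorAlgebra.ι ℝ u) := by
  induction l with
  | nil => simp [wedge]
  | cons v l ih =>
    rw [wedge_cons, ← mul_assoc, ι_mul_ι, neg_mul, mul_assoc, ih, List.length_cons]
    push_cast
    rw [Int.negOnePow_succ, Units.smul_def, Units.smul_def, mul_smul_comm, mul_assoc,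
      Units.val_neg, neg_smul]

theorem wedge_mul_wedge (l l' : List W) : wedge l * wedge l' =
    (l.length * l'.length : ℤ).negOnePow • (wedge l' * wedge l) := by
  induction l with
  | nil => simp [wedge]
  | cons v l ih =>
    rw [wedge_cons, mul_assoc, ih, Units.smul_def, mul_smul_comm, ← mul_assoc, ι_mul_wedge,
      List.length_cons]
    push_cast
    rw [add_mul, one_mul, Int.negOnePow_add, Units.smul_def, Units.smul_def, smul_mul_assoc,
      mul_assoc, smul_smul, Units.val_mul]

theorem wedge_comm_of_even {l : List W} (hl : Even l.length) (l' : List W) :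
    wedge l * wedge l' = wedge l' * wedge l := by
  have h : Even ((l.length : ℤ) * l'.length) := Even.mul_right (by exact_mod_cast hl) _
  rw [wedge_mul_wedge, Int.negOnePow_even _ h, one_smul]

theorem ι_mul_wedge_eq_zero {u : W} {l : List W} (h : u ∈ Submodule.span ℝ {x | x ∈ l}) :
    ExteriorAlgebra.ι ℝ u * wedge l = 0 := by
  have h1 : ∀ x ∈ l, ExteriorAlgebra.ι ℝ x * wedge l = 0 := by
    intro x hx
    obtain ⟨s, hs⟩ := wedge_perm (List.perm_cons_erase hx)
    rw [hs, wedge_cons, Units.smul_def, mul_smul_comm, ← mul_assoc, ExteriorAlgebra.ι_sq_zero,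
      zero_mul, smul_zero]
  induction h using Submodule.span_induction with
  | mem x hx => exact h1 x hx
  | zero => simp
  | add x y _ _ hx hy => rw [map_add, add_mul, hx, hy, add_zero]
  | smul c x _ hx => rw [map_smul, smul_mul_assoc, hx, smul_zero]

theorem ι_mul_wedge_congr {u u' : W} {l : List W} (h : u - u' ∈ Submodule.span ℝ {x | x ∈ l}) :
    ExteriorAlgebra.ι ℝ u * wedge l = ExteriorAlgebra.ι ℝ u' * wedge l := by
  rw [← sub_eq_zero, ← sub_mul, ← map_sub]
  exact ι_mul_wedge_eq_zero h

/-- Vectors can be changed by combinations of the first factors. -/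
theorem wedge_mul_wedge_map_congr {I : Type*} {l : List W} {L : List I} {f f' : I → W}
    (h : ∀ i ∈ L, f i - f' i ∈ Submodule.span ℝ {x | x ∈ l}) :
    wedge l * wedge (L.map f) = wedge l * wedge (L.map f') := by
  induction L with
  | nil => rfl
  | cons i L ih =>
    have h1 := ι_mul_wedge_congr (h i (List.mem_cons_self ..))
    have h2 : wedge l * ExteriorAlgebra.ι ℝ (f i) = wedge l * ExteriorAlgebra.ι ℝ (f' i) := by
      rw [ι_mul_wedge, ι_mul_wedge] at h1
      exact smul_left_cancel _ h1
    rw [List.map_cons, List.map_cons, wedge_cons, wedge_cons, ← mul_assoc, ← mul_assoc, h2]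
    have h3 := ih fun j hj => h j (List.mem_cons_of_mem _ hj)
    have h4 : ∀ u, wedge l * ExteriorAlgebra.ι ℝ u =
        (l.length : ℤ).negOnePow • (ExteriorAlgebra.ι ℝ u * wedge l) := fun u => by
      rw [ι_mul_wedge, smul_smul, ← Int.negOnePow_add, Int.negOnePow_even _ ⟨_, rfl⟩, one_smul]
    rw [h4, Units.smul_def, smul_mul_assoc, smul_mul_assoc, mul_assoc, mul_assoc, h3]

theorem wedge_map_ne_zero {I : Type*} {v : I → W} (hv : LinearIndependent ℝ v) {L : List I}
    (hL : L.Nodup) : wedge (L.map v) ≠ 0 := by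
  have h1 : LinearIndependent ℝ (v ∘ L.get) := hv.comp _ (List.nodup_iff_injective_get.1 hL)
  have h2 := (exteriorPower.ιMulti_family_linearIndependent_field (n := L.length) h1).ne_zero
    (Set.powersetCard.ofFinEmbEquiv (RelEmbedding.refl _))
  intro h3
  refine h2 (Subtype.ext ?_)
  rw [exteriorPower.ιMulti_family, Equiv.symm_apply_apply, exteriorPower.ιMulti_apply_coe,
    ExteriorAlgebra.ιMulti_apply, ZeroMemClass.coe_zero]
  refine Eq.trans ?_ h3
  rw [wedge]
  congr 1
  conv_rhs => rw [List.map_map, ← List.ofFn_get L, List.map_ofFn]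
  rfl

/-- Both lists are bases of the same subspace, whose top exterior power is a line; the factor is the
determinant of the change of basis. -/
theorem exists_wedge_eq {I : Type*} {v : I → W} (hv : LinearIndependent ℝ v) {L : List I}
    (hL : L.Nodup) {l : List W} (hlen : l.length = L.length)
    (hsub : ∀ x ∈ l, x ∈ Submodule.span ℝ (v '' {i | i ∈ L}))
    (hspan : ∀ i ∈ L, v i ∈ Submodule.span ℝ {x | x ∈ l}) :
    ∃ c : ℝ, c ≠ 0 ∧ wedge l = c • wedge (L.map v) := by
  have hb : LinearIndependent ℝ (v ∘ L.get) := hv.comp _ (List.nodup_iff_injective_get.1 hL)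
  have hrange : Set.range (v ∘ L.get) = v '' {i | i ∈ L} := by
    rw [Set.range_comp]
    congr 1
    ext i
    exact List.mem_iff_get.symm
  rw [← hrange] at hsub
  obtain ⟨H, hH⟩ : ∃ H, H = Submodule.span ℝ (Set.range (v ∘ L.get)) := ⟨_, rfl⟩
  obtain ⟨B, hB⟩ : ∃ B : Module.Basis (Fin L.length) ℝ H, ∀ i, (B i : W) = v (L.get i) := by
    subst hH
    exact ⟨Module.Basis.span hb, fun i => congrArg Subtype.val (Module.Basis.span_apply hb i)⟩
  rw [← hH] at hsub
  let u : Fin L.length → H := fun i => ⟨l.get (i.cast hlen.symm), hsub _ (List.get_mem _ _)⟩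
  have hu : ⊤ ≤ Submodule.span ℝ (Set.range u) := by
    have h1 : (Submodule.span ℝ (Set.range u)).map H.subtype = H := by
      rw [Submodule.map_span]
      refine le_antisymm (Submodule.span_le.2 ?_) ?_
      · rintro _ ⟨_, ⟨i, rfl⟩, rfl⟩
        exact (u i).2
      · refine hH.le.trans (Submodule.span_le.2 ?_)
        rintro _ ⟨i, rfl⟩
        refine Submodule.span_mono ?_ (hspan _ (List.get_mem L i))
        intro x hx
        obtain ⟨j, rfl⟩ := List.mem_iff_get.1 hx
        exact ⟨_, ⟨j.cast hlen, rfl⟩, rfl⟩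
    intro x _
    have h2 : (x : W) ∈ (Submodule.span ℝ (Set.range u)).map H.subtype := by
      rw [h1]; exact x.2
    obtain ⟨y, hy, hyx⟩ := h2
    rwa [← Subtype.ext hyx]
  have hfin : Fintype.card (Fin L.length) = Module.finrank ℝ H := by
    rw [Module.finrank_eq_card_basis B]
  have hind := linearIndependent_of_top_le_span_of_card_eq_finrank hu hfin
  have hdet := (Module.Basis.is_basis_iff_det B).1 ⟨hind, top_le_iff.1 hu⟩
  let f := (ExteriorAlgebra.ιMulti ℝ L.length (M := W)).compLinearMap H.subtype
  have hf : f = (LinearMap.toSpanSingleton ℝ _ (f B)).compAlternatingMap B.det := by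
    refine Module.Basis.ext_alternating B fun σ hσ => ?_
    let σ' := Equiv.ofBijective σ (Finite.injective_iff_bijective.1 hσ)
    have h1 := f.map_perm B σ'
    have h2 := B.det.map_perm B σ'
    change f (B ∘ σ') = LinearMap.toSpanSingleton ℝ _ (f B) (B.det (B ∘ σ'))
    rw [h1, h2, B.det_self, LinearMap.toSpanSingleton_apply, Units.smul_def, Units.smul_def, zsmul_one]
    exact (Int.cast_smul_eq_zsmul ℝ _ _).symm
  have h3 := congrArg (fun g => g u) hf
  refine ⟨B.det u, hdet.ne_zero, ?_⟩
  have hval : ∀ y : Fin L.length → H, f y =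
      (List.ofFn fun i => ExteriorAlgebra.ι ℝ (y i : W)).prod := fun y =>
    ExteriorAlgebra.ιMulti_apply _
  have h4 : f u = wedge l := by
    rw [hval, wedge]
    congr 1
    refine List.ext_get (by simp [hlen]) fun i h1 h2 => ?_
    simp [u]
  have h5 : f B = wedge (L.map v) := by
    rw [hval, wedge]
    congr 1
    refine List.ext_get (by simp) fun i h1 h2 => ?_
    simp [hB]
  rw [← h4, ← h5]
  exact h3

/-- Membership in the span of a list is tested by linear forms. -/
theorem mem_span_of_forall_dual {u : W} {l : List W}
    (h : ∀ g : W →ₗ[ℝ] ℝ, (∀ x ∈ l, g x = 0) → g u = 0) : u ∈ Submodule.span ℝ {x | x ∈ l} := by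
  by_contra hu
  obtain ⟨g, hg, hle⟩ := Submodule.exists_le_ker_of_notMem hu
  exact hg (h g fun x hx => hle (Submodule.subset_span hx))

end Wedge

/-! ### Koszul signs of lists -/

section Koszul

variable {n : ℕ} (d : Fin n → ℤ)

/-- The Koszul sign of sorting a list. -/
def koszulList : List (Fin n) → ℤˣ
  | [] => 1
  | a :: l => (l.map fun b => if b < a then (d a * d b).negOnePow else 1).prod * koszulList l

theorem koszulList_ofFn {k : ℕ} (f : Fin k → Fin n) : koszulList d (List.ofFn f) =
    ∏ i, ∏ j, if i < j ∧ f j < f i then (d (f i) * d (f j)).negOnePow else 1 := by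
  induction k with
  | zero => simp [koszulList]
  | succ k ih =>
    rw [List.ofFn_succ, koszulList, ih, Fin.prod_univ_succ, List.map_ofFn, List.prod_ofFn,
      Fin.prod_univ_succ]
    simp [Fin.prod_univ_succ (n := k)]

theorem koszulList_append {l l' : List (Fin n)} (hl : l.Pairwise (· ≤ ·))
    (hl' : l'.Pairwise (· ≤ ·)) : koszulList d (l ++ l') =
    (l.map fun a => (l'.map fun b => if b < a then (d a * d b).negOnePow else 1).prod).prod := by
  have hone : ∀ (a : Fin n) (l : List (Fin n)), (∀ b ∈ l, a ≤ b) →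
      (l.map fun b => if b < a then (d a * d b).negOnePow else 1).prod = 1 := by
    intro a l h
    refine List.prod_eq_one fun x hx => ?_
    obtain ⟨b, hb, rfl⟩ := List.mem_map.1 hx
    rw [if_neg (not_lt.2 (h b hb))]
  induction l with
  | nil =>
    induction l' with
    | nil => rfl
    | cons a l' ih =>
      rw [List.pairwise_cons] at hl'
      rw [List.nil_append, koszulList, hone a l' hl'.1, one_mul]
      exact ih hl'.2
  | cons a l ih =>
    rw [List.pairwise_cons] at hl
    rw [List.cons_append, koszulList, ih hl.2, List.map_cons, List.prod_cons, List.map_append,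
      List.prod_append, hone a l hl.1, one_mul]

theorem koszulList_unshuffle (S : Finset (Fin n)) :
    koszulList d (List.ofFn (S.orderEmbOfFin rfl) ++ List.ofFn (Sᶜ.orderEmbOfFin rfl)) =
      unshuffleSign d S := by
  have hs : ∀ T : Finset (Fin n), (List.ofFn (T.orderEmbOfFin rfl)).Pairwise (· ≤ ·) := fun T =>
    List.pairwise_ofFn.2 fun i j hij => (T.orderEmbOfFin rfl).monotone hij.le
  have hp : ∀ (T : Finset (Fin n)) (g : Fin n → ℤˣ),
      ((List.ofFn (T.orderEmbOfFin rfl)).map g).prod = ∏ i ∈ T, g i := by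
    intro T g
    rw [List.map_ofFn, List.prod_ofFn]
    conv_rhs => rw [← Finset.map_orderEmbOfFin_univ T rfl, Finset.prod_map]
    rfl
  rw [koszulList_append d (hs S) (hs Sᶜ), hp, unshuffleSign]
  exact Finset.prod_congr rfl fun a _ => hp _ _

variable {A : Type*} [Ring A] {X : Fin n → A}
  (hX : ∀ i j, X i * X j = (d i * d j).negOnePow • (X j * X i))
include hX

theorem mul_prod_map_eq (a : Fin n) {l : List (Fin n)} (hl : l.Pairwise (· ≤ ·)) :
    X a * (l.map X).prod = (l.map fun b => if b < a then (d a * d b).negOnePow else 1).prod •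
      ((l.orderedInsert (· ≤ ·) a).map X).prod := by
  induction l with
  | nil => simp
  | cons b l ih =>
    rw [List.pairwise_cons] at hl
    by_cases hab : a ≤ b
    · rw [List.orderedInsert_cons_of_le _ _ hab]
      have h1 : ((b :: l).map fun b => if b < a then (d a * d b).negOnePow else 1).prod = 1 := by
        refine List.prod_eq_one fun x hx => ?_
        obtain ⟨c, hc, rfl⟩ := List.mem_map.1 hx
        rcases List.mem_cons.1 hc with rfl | hc
        · rw [if_neg (not_lt.2 hab)]
        · rw [if_neg (not_lt.2 (hab.trans (hl.1 c hc)))]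
      rw [h1, one_smul, List.map_cons, List.prod_cons, List.map_cons, List.prod_cons,
        List.map_cons, List.prod_cons]
    · rw [List.orderedInsert_cons, if_neg hab, List.map_cons, List.prod_cons, List.map_cons,
        List.prod_cons, List.map_cons, List.prod_cons, if_pos (not_le.1 hab), ← mul_assoc, hX,
        mul_smul, Units.smul_def, Units.smul_def, Units.smul_def, smul_mul_assoc, mul_assoc,
        ih hl.2, Units.smul_def, mul_smul_comm]

/-- Insertion sort: a letter picks up a sign for each smaller letter it passes. The sign of the head
of the list does not depend on the order of the tail, so the tail may be sorted beforehand. -/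
theorem prod_map_eq_koszulList (l : List (Fin n)) : (l.map X).prod =
    koszulList d l • ((l.insertionSort (· ≤ ·)).map X).prod := by
  induction l with
  | nil => simp [koszulList]
  | cons a l ih =>
    rw [List.map_cons, List.prod_cons, ih, Units.smul_def, mul_smul_comm,
      mul_prod_map_eq d hX a (List.pairwise_insertionSort _ l), koszulList,
      List.insertionSort_cons, ((List.perm_insertionSort (· ≤ ·) l).map _).prod_eq, mul_comm,
      mul_smul, ← Units.smul_def]

theorem prod_map_eq_koszulList_smul_ofFn {l : List (Fin n)} (hl : l.Nodup) (h : ∀ i, i ∈ l) :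
    (l.map X).prod = koszulList d l • (List.ofFn X).prod := by
  rw [prod_map_eq_koszulList d hX]
  have h1 : l.insertionSort (· ≤ ·) = List.finRange n := by
    refine List.Perm.eq_of_pairwise' (List.pairwise_insertionSort _ _)
      ((List.pairwise_lt_finRange n).imp le_of_lt) ?_
    refine (List.perm_insertionSort _ l).trans ((List.perm_ext_iff_of_nodup hl
      (List.nodup_finRange n)).2 fun i => ?_)
    simp [h i]
  rw [h1, List.ofFn_eq_map]

end Koszul

end

noncomputable section

open scoped Classical

namespace PlaneGraph

variable {V E : Type*} {G : PlaneGraph V E} {U : Finset E} {𝒟 S : Finset (Finset E)}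

/-! ### Formal equations of webs -/

/-- The vector space on the edges and the coordinates of the points of the webs. -/
abbrev Formal (E : Type*) : Type _ := (E ⊕ (Finset E × Fin 2)) →₀ ℝ

/-- The basis vectors. -/
def basisVec (i : E ⊕ (Finset E × Fin 2)) : Formal E := Finsupp.single i 1

theorem linearIndependent_basisVec :
    LinearIndependent ℝ (basisVec : E ⊕ (Finset E × Fin 2) → Formal E) := by
  have := (Finsupp.basisSingleOne (R := ℝ) (ι := E ⊕ (Finset E × Fin 2))).linearIndependent
  rwa [Finsupp.coe_basisSingleOne] at this

/-- The vector of an edge. -/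
def edgeVec (e : E) : Formal E := basisVec (Sum.inl e)

/-- The first coordinate of the point of a piece. -/
def xi (U : Finset E) : Formal E := basisVec (Sum.inr (U, 0))

/-- The second coordinate of the point of a piece. -/
def eta (U : Finset E) : Formal E := basisVec (Sum.inr (U, 1))

/-- The equation at an edge between two pieces. -/
def alphaPair (G : PlaneGraph V E) (e : E) (U U' : Finset E) : Formal E :=
  (G.vec e).1 • (eta U' - eta U) - (G.vec e).2 • (xi U' - xi U)

/-- The length of an edge between two pieces. -/
def betaPair (G : PlaneGraph V E) (e : E) (U U' : Finset E) : Formal E :=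
  (G.vec e).1 • (xi U' - xi U) + (G.vec e).2 • (eta U' - eta U)

/-- The formal equation of webs. -/
def alphaVec (G : PlaneGraph V E) (𝒟 : Finset (Finset E)) (e : E) : Formal E :=
  G.alphaPair e (owner 𝒟 e) (owner 𝒟 (G.rev e))

/-- The formal edge length. -/
def betaVec (G : PlaneGraph V E) (𝒟 : Finset (Finset E)) (e : E) : Formal E :=
  G.betaPair e (owner 𝒟 e) (owner 𝒟 (G.rev e))

/-- The factor of an edge: an equation for an internal edge, or the edge itself. -/
def factor (G : PlaneGraph V E) (𝒟 : Finset (Finset E)) (e : E) : Formal E :=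
  if e ∈ G.internal 𝒟 then G.alphaVec 𝒟 e else edgeVec e

/-- The configuration of points given by a linear form. -/
def config (g : Formal E →ₗ[ℝ] ℝ) (U : Finset E) : ℝ × ℝ := (g (xi U), g (eta U))

theorem apply_alphaVec (g : Formal E →ₗ[ℝ] ℝ) (e : E) :
    g (G.alphaVec 𝒟 e) = G.alpha 𝒟 e (config g) := by
  simp [alphaVec, alphaPair, alpha_apply, planeDet, config]

theorem apply_betaVec (g : Formal E →ₗ[ℝ] ℝ) (e : E) :
    g (G.betaVec 𝒟 e) = G.beta 𝒟 e (config g) := by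
  simp [betaVec, betaPair, beta_apply, config]

variable (odd : E → Prop)

/-- The odd edges of a frame. -/
def oddList (U : Finset E) : List E := (U.filter odd).toList

/-- The odd edges of a list of frames. -/
def edgeList (l : List (Finset E)) : List E := l.flatMap (oddList odd)

/-- The basis of the configurations of points. -/
def pointList (𝒟 : Finset (Finset E)) : List (E ⊕ (Finset E × Fin 2)) :=
  𝒟.toList.flatMap fun U => [Sum.inr (U, 0), Sum.inr (U, 1)]

/-- The factors of the equations of a list of pieces of a tiling. -/
def factorList (G : PlaneGraph V E) (𝒟 : Finset (Finset E)) (l : List (Finset E)) :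
    List (Formal E) := (edgeList odd l).map (G.factor 𝒟)

/-- The volume element of the configurations, and the boundary edges. -/
def target (G : PlaneGraph V E) (𝒟 : Finset (Finset E)) : ExteriorAlgebra ℝ (Formal E) :=
  wedge ((pointList 𝒟).map basisVec) * wedge ((oddList odd (G.boundary 𝒟)).map edgeVec)

variable {odd}

theorem mem_oddList {e : E} : e ∈ oddList odd U ↔ e ∈ U ∧ odd e := by
  rw [oddList, Finset.mem_toList, Finset.mem_filter]

theorem mem_edgeList {l : List (Finset E)} {e : E} :
    e ∈ edgeList odd l ↔ e ∈ edgesOf l.toFinset ∧ odd e := by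
  rw [edgeList, List.mem_flatMap]
  simp only [mem_oddList, mem_edgesOf, List.mem_toFinset]
  exact ⟨fun ⟨U, h1, h2, h3⟩ => ⟨⟨U, h1, h2⟩, h3⟩, fun ⟨⟨U, h1, h2⟩, h3⟩ => ⟨U, h1, h2, h3⟩⟩

theorem nodup_edgeList {l : List (Finset E)} (hl : l.Nodup)
    (hd : ∀ U ∈ l.toFinset, ∀ U' ∈ l.toFinset, ∀ e ∈ U, e ∈ U' → U = U') :
    (edgeList odd l).Nodup := by
  refine List.nodup_flatMap.2 ⟨fun U _ => Finset.nodup_toList _, ?_⟩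
  refine List.Pairwise.imp_of_mem ?_ hl
  intro U U' hU hU' hne e he he'
  exact hne (hd U (List.mem_toFinset.2 hU) U' (List.mem_toFinset.2 hU') e (mem_oddList.1 he).1
    (mem_oddList.1 he').1)

theorem mem_pointList {i : E ⊕ (Finset E × Fin 2)} :
    i ∈ pointList 𝒟 ↔ ∃ U ∈ 𝒟, i = Sum.inr (U, 0) ∨ i = Sum.inr (U, 1) := by
  simp [pointList, List.mem_flatMap]

theorem nodup_pointList : (pointList 𝒟).Nodup := by
  refine List.nodup_flatMap.2 ⟨fun U _ => by simp, ?_⟩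
  refine List.Pairwise.imp ?_ 𝒟.nodup_toList
  intro U U' hne i hi hi'
  simp only [List.mem_cons, List.not_mem_nil, or_false] at hi hi'
  rcases hi with rfl | rfl <;> rcases hi' with h | h <;> simp_all

theorem length_pointList : (pointList 𝒟).length = 2 * 𝒟.card := by
  rw [pointList, List.length_flatMap]
  simp [mul_comm]

theorem target_eq : target odd G 𝒟 =
    wedge ((pointList 𝒟 ++ (oddList odd (G.boundary 𝒟)).map Sum.inl).map basisVec) := by
  rw [List.map_append, wedge_append, List.map_map]
  rfl

theorem target_ne_zero : target odd G 𝒟 ≠ 0 := by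
  rw [target_eq]
  refine wedge_map_ne_zero linearIndependent_basisVec (List.Nodup.append nodup_pointList
    ((Finset.nodup_toList _).map Sum.inl_injective) ?_)
  intro i hi hi'
  obtain ⟨U, -, hU⟩ := mem_pointList.1 hi
  obtain ⟨e, -, rfl⟩ := List.mem_map.1 hi'
  simp at hU

theorem edgeList_perm {l : List (Finset E)} (hl : l.Nodup)
    (hd : ∀ U ∈ l.toFinset, ∀ U' ∈ l.toFinset, ∀ e ∈ U, e ∈ U' → U = U') :
    (edgeList odd l).Perm
      (oddList odd (G.internal l.toFinset) ++ oddList odd (G.boundary l.toFinset)) := by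
  refine (List.perm_ext_iff_of_nodup (nodup_edgeList hl hd) (List.Nodup.append
    (Finset.nodup_toList _) (Finset.nodup_toList _) ?_)).2 fun e => ?_
  · intro e he he'
    exact (mem_boundary.1 (mem_oddList.1 he').1).2 (mem_internal.1 (mem_oddList.1 he).1).2
  · rw [mem_edgeList, List.mem_append, Finset.mem_toList, Finset.mem_toList, Finset.mem_filter,
      Finset.mem_filter, mem_internal, mem_boundary]
    tauto

variable (hodd : ∀ e, odd (G.rev e) ↔ ¬ odd e)
include hodd

/-- Exactly one orientation of each internal edge is odd, so the product of the factors contains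
each web equation once. -/
theorem two_mul_length_oddList_internal :
    2 * (oddList odd (G.internal 𝒟)).length = (G.internal 𝒟).card := by
  have h1 : ((G.internal 𝒟).filter fun e => ¬ odd e).card =
      ((G.internal 𝒟).filter odd).card := by
    refine Finset.card_bij (fun e _ => G.rev e) ?_ (fun _ _ _ _ h => G.rev_injective h) ?_
    · intro e he
      rw [Finset.mem_filter] at he ⊢
      exact ⟨rev_mem_internal he.1, (hodd e).2 he.2⟩
    · intro e he
      rw [Finset.mem_filter] at he
      refine ⟨G.rev e, Finset.mem_filter.2 ⟨rev_mem_internal he.1, fun h => ?_⟩, G.rev_rev e⟩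
      exact (hodd e).1 h he.2
  rw [oddList, Finset.length_toList,
    ← Finset.card_filter_add_card_filter_not (s := G.internal 𝒟) odd, h1]
  omega

theorem alpha_config_eq_zero {l : List (Finset E)} {g : Formal E →ₗ[ℝ] ℝ}
    (hg : ∀ u ∈ factorList odd G l.toFinset l, g u = 0) {e : E} (he : e ∈ G.internal l.toFinset) :
    G.alpha l.toFinset e (config g) = 0 := by
  have key : ∀ e ∈ G.internal l.toFinset, odd e → G.alpha l.toFinset e (config g) = 0 := by
    intro e he ho
    rw [← apply_alphaVec]
    refine hg _ (List.mem_map.2 ⟨e, mem_edgeList.2 ⟨(mem_internal.1 he).1, ho⟩, if_pos he⟩)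
  by_cases ho : odd e
  · exact key e he ho
  · rw [← alpha_rev]
    exact key _ (rev_mem_internal he) ((hodd e).2 ho)

omit hodd in
-- The first two factors change only by elements of the span of the later ones.
theorem wedge_base_change {U U' : Finset E} {r : List (Formal E)}
    (h1 : xi U' - xi U ∈ Submodule.span ℝ {x | x ∈ r})
    (h2 : eta U' - eta U ∈ Submodule.span ℝ {x | x ∈ r}) :
    wedge ([xi U', eta U'] ++ r) = wedge ([xi U, eta U] ++ r) := by
  simp only [List.cons_append, List.nil_append, wedge_cons]
  have h3 := ι_mul_wedge_congr h2
  have h4 : xi U' - xi U ∈ Submodule.span ℝ {x | x ∈ eta U :: r} :=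
    Submodule.span_mono (fun x hx => List.mem_cons_of_mem _ hx) h1
  have h5 := ι_mul_wedge_congr h4
  rw [wedge_cons] at h5
  rw [h3, h5]

omit hodd in
/-- The differences of the points vanish on rigid configurations. -/
theorem wedge_base_change_of_rigid {U U' : Finset E} {r : List (Formal E)}
    (h : ∀ g : Formal E →ₗ[ℝ] ℝ, (∀ x ∈ r, g x = 0) → config g U' = config g U) :
    wedge ([xi U', eta U'] ++ r) = wedge ([xi U, eta U] ++ r) := by
  refine wedge_base_change (mem_span_of_forall_dual fun g hg => ?_)
    (mem_span_of_forall_dual fun g hg => ?_) <;> rw [map_sub, sub_eq_zero]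
  · exact congrArg Prod.fst (h g hg)
  · exact congrArg Prod.snd (h g hg)

omit hodd in
theorem mem_span_pointList {U : Finset E} (hU : U ∈ 𝒟) :
    xi U ∈ Submodule.span ℝ (basisVec '' {i | i ∈ pointList 𝒟}) ∧
    eta U ∈ Submodule.span ℝ (basisVec '' {i | i ∈ pointList 𝒟}) :=
  ⟨Submodule.subset_span ⟨_, mem_pointList.2 ⟨U, hU, Or.inl rfl⟩, rfl⟩,
    Submodule.subset_span ⟨_, mem_pointList.2 ⟨U, hU, Or.inr rfl⟩, rfl⟩⟩

omit hodd in
theorem pair_mem_span {A : Submodule ℝ (Formal E)} {e : E} {U U' : Finset E}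
    (h1 : xi U' - xi U ∈ A) (h2 : eta U' - eta U ∈ A) :
    G.alphaPair e U U' ∈ A ∧ G.betaPair e U U' ∈ A :=
  ⟨A.sub_mem (A.smul_mem _ h2) (A.smul_mem _ h1), A.add_mem (A.smul_mem _ h1) (A.smul_mem _ h2)⟩

omit hodd in
theorem vec_mem_span_pointList {e : E} (he : e ∈ G.internal 𝒟) :
    G.alphaVec 𝒟 e ∈ Submodule.span ℝ (basisVec '' {i | i ∈ pointList 𝒟}) ∧
    G.betaVec 𝒟 e ∈ Submodule.span ℝ (basisVec '' {i | i ∈ pointList 𝒟}) := by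
  obtain ⟨h1, h2⟩ := mem_internal.1 he
  have h3 := mem_span_pointList (owner_spec h1).1
  have h4 := mem_span_pointList (owner_spec h2).1
  exact pair_mem_span (Submodule.sub_mem _ h4.1 h3.1) (Submodule.sub_mem _ h4.2 h3.2)

/-- The coordinates of one point, one length and the equations of the odd internal edges are `2 + 1
+ s = 2k` linear forms on the configurations. They span, because rigidity leaves no configuration on
which all of them vanish. So they are a basis and their product is a multiple of the volume element;
the boundary letters are untouched. -/
theorem exists_wedge_eq_target (hG : G.Generic) {l : List (Finset E)} (hl : l.Nodup)
    (h : G.IsDec l.toFinset) (hU : U ∈ l.toFinset) {e : E} (he : e ∈ G.internal l.toFinset) :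
    ∃ c : ℝ, c ≠ 0 ∧ wedge ([xi U, eta U] ++ (G.betaVec l.toFinset e ::
      factorList odd G l.toFinset l)) = c • target odd G l.toFinset := by
  set 𝒟 := l.toFinset with h𝒟
  obtain ⟨s, hs⟩ := wedge_perm (((edgeList_perm (odd := odd) hl h.tiling.unique).map
    (G.factor 𝒟)).append_left [xi U, eta U, G.betaVec 𝒟 e])
  have hb : (oddList odd (G.boundary 𝒟)).map (G.factor 𝒟) =
      (oddList odd (G.boundary 𝒟)).map edgeVec := by
    refine List.map_congr_left fun e he => if_neg fun hi => ?_
    exact (mem_boundary.1 (mem_oddList.1 he).1).2 (mem_internal.1 hi).2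
  have hi : (oddList odd (G.internal 𝒟)).map (G.factor 𝒟) =
      (oddList odd (G.internal 𝒟)).map (G.alphaVec 𝒟) :=
    List.map_congr_left fun e he => if_pos (mem_oddList.1 he).1
  obtain ⟨c, hc, hc'⟩ := exists_wedge_eq linearIndependent_basisVec
    (nodup_pointList (𝒟 := 𝒟))
    (l := [xi U, eta U, G.betaVec 𝒟 e] ++ (oddList odd (G.internal 𝒟)).map (G.alphaVec 𝒟)) (by
      have h1 := two_mul_length_oddList_internal hodd (𝒟 := 𝒟)
      have h2 := h.codim
      rw [length_pointList, List.length_append, List.length_map]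
      simp only [List.length_cons, List.length_nil]
      omega) (by
      intro x hx
      rcases List.mem_append.1 hx with hx | hx
      · simp only [List.mem_cons, List.not_mem_nil, or_false] at hx
        rcases hx with rfl | rfl | rfl
        · exact (mem_span_pointList hU).1
        · exact (mem_span_pointList hU).2
        · exact (vec_mem_span_pointList he).2
      · obtain ⟨e', he', rfl⟩ := List.mem_map.1 hx
        exact (vec_mem_span_pointList (mem_oddList.1 he').1).1) (by
      intro i hi
      refine mem_span_of_forall_dual fun g hg => ?_
      have ha : ∀ e' ∈ G.internal 𝒟, G.alpha 𝒟 e' (config g) = 0 := by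
        have key : ∀ e' ∈ G.internal 𝒟, odd e' → G.alpha 𝒟 e' (config g) = 0 := by
          intro e' he' ho
          rw [← apply_alphaVec]
          exact hg _ (List.mem_append_right _ (List.mem_map_of_mem (mem_oddList.2 ⟨he', ho⟩)))
        intro e' he'
        by_cases ho : odd e'
        · exact key e' he' ho
        · rw [← alpha_rev]
          exact key _ (rev_mem_internal he') ((hodd e').2 ho)
      obtain ⟨b, hb⟩ := h.eq_const hG he ha (by
        rw [← apply_betaVec]
        exact hg _ (by simp))
      have h0 : b = 0 := by
        rw [← hb U hU]
        exact Prod.ext (hg (xi U) (by simp)) (hg (eta U) (by simp))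
      obtain ⟨U', hU', rfl | rfl⟩ := mem_pointList.1 hi
      · exact congrArg Prod.fst ((hb U' hU').trans h0)
      · exact congrArg Prod.snd ((hb U' hU').trans h0))
  refine ⟨((s : ℤ) : ℝ) * c, mul_ne_zero (by exact_mod_cast s.ne_zero) hc, ?_⟩
  have h1 : [xi U, eta U] ++ (G.betaVec 𝒟 e :: factorList odd G 𝒟 l) =
      [xi U, eta U, G.betaVec 𝒟 e] ++ (edgeList odd l).map (G.factor 𝒟) := rfl
  rw [h1, hs, List.map_append, hb, hi, ← List.append_assoc, wedge_append, hc', target,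
    smul_mul_assoc, mul_smul, Units.smul_def, Int.cast_smul_eq_zsmul]

/-- All internal edges give proportional results. -/
theorem exists_wedge_eq_smul (hG : G.Generic) {l : List (Finset E)}
    (h : G.IsDec l.toFinset) {U U' : Finset E} (hU : U ∈ l.toFinset) (hU' : U' ∈ l.toFinset)
    {e e' : E} (he : e ∈ G.internal l.toFinset) (he' : e' ∈ G.internal l.toFinset) :
    ∃ c : ℝ, 0 < c ∧ wedge ([xi U', eta U'] ++ (G.betaVec l.toFinset e' ::
      factorList odd G l.toFinset l)) = c • wedge ([xi U, eta U] ++ (G.betaVec l.toFinset e ::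
      factorList odd G l.toFinset l)) := by
  set 𝒟 := l.toFinset with h𝒟
  obtain ⟨w, hw⟩ := h.web
  rw [isWeb_iff h.tiling.unique] at hw
  -- Modulo the equations, all lengths are proportional, with the ratios they have in a fixed web.
  -- These ratios are positive, so the orientation does not depend on the edge.
  set c := G.beta 𝒟 e' w / G.beta 𝒟 e w with hc
  refine ⟨c, div_pos (hw e' he').2 (hw e he).2, ?_⟩
  rw [wedge_base_change_of_rigid (U := U) (U' := U') fun g hg => ?_]
  · have h1 : G.betaVec 𝒟 e' - c • G.betaVec 𝒟 e ∈
        Submodule.span ℝ {x | x ∈ factorList odd G 𝒟 l} := by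
      refine mem_span_of_forall_dual fun g hg => ?_
      have ha : ∀ e ∈ G.internal 𝒟, G.alpha 𝒟 e (config g) = 0 := fun e he =>
        alpha_config_eq_zero hodd hg he
      set t := G.beta 𝒟 e (config g) / G.beta 𝒟 e w with ht
      obtain ⟨b, hb⟩ := h.eq_const hG he (y := config g - t • w)
        (fun e he => by rw [map_sub, map_smul, ha e he, (hw e he).1, smul_zero, sub_zero]) (by
          rw [map_sub, map_smul, ht, smul_eq_mul, div_mul_cancel₀ _ (hw e he).2.ne', sub_self])
      have h2 : G.beta 𝒟 e' (config g - t • w) = 0 := by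
        obtain ⟨a1, a2⟩ := mem_internal.1 he'
        rw [beta_apply, hb _ (owner_spec a1).1, hb _ (owner_spec a2).1]
        simp
      rw [map_sub, map_smul, smul_eq_mul, sub_eq_zero] at h2
      rw [map_sub, map_smul, apply_betaVec, apply_betaVec, h2, smul_eq_mul, ht, hc]
      ring
    have h3 := ι_mul_wedge_congr h1
    simp only [List.cons_append, List.nil_append, wedge_cons]
    rw [h3, map_smul, smul_mul_assoc, mul_smul_comm, mul_smul_comm]
  · obtain ⟨b, hb⟩ := h.eq_const hG he' (y := config g)
      (fun e he => alpha_config_eq_zero hodd (fun u hu => hg u (List.mem_cons_of_mem _ hu)) he) (by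
        rw [← apply_betaVec]
        exact hg _ (List.mem_cons_self ..))
    rw [hb U hU, hb U' hU']

omit hodd

variable (odd)

/-- The sign of a decomposition into a list of pieces. -/
def tilingSign (G : PlaneGraph V E) (l : List (Finset E)) : ℤˣ :=
  if ∃ U ∈ l.toFinset, ∃ e ∈ G.internal l.toFinset, ∃ c : ℝ, 0 < c ∧
    wedge ([xi U, eta U] ++ (G.betaVec l.toFinset e :: factorList odd G l.toFinset l)) =
      c • target odd G l.toFinset then 1 else -1

variable {odd}
include hodd

/-- The choice of the piece and of the edge in the definition of the sign is immaterial, because any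
two choices give positive multiples of one product. -/
theorem tilingSign_spec (hG : G.Generic) {l : List (Finset E)} (hl : l.Nodup)
    (h : G.IsDec l.toFinset) (hU : U ∈ l.toFinset) {e : E} (he : e ∈ G.internal l.toFinset) :
    ∃ c : ℝ, 0 < c ∧ wedge ([xi U, eta U] ++ (G.betaVec l.toFinset e ::
      factorList odd G l.toFinset l)) =
      (tilingSign odd G l : ℤ) • c • target odd G l.toFinset := by
  obtain ⟨c, hc, hc'⟩ := exists_wedge_eq_target hodd hG hl h hU he
  rcases lt_or_gt_of_ne hc with h0 | h0
  · refine ⟨-c, neg_pos.2 h0, ?_⟩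
    rw [tilingSign, if_neg, hc']
    · simp
    · rintro ⟨U', hU', e', he', c', h0', h1⟩
      obtain ⟨t, ht, ht'⟩ := exists_wedge_eq_smul (odd := odd) hodd hG h hU hU' he he'
      rw [h1, hc', smul_smul] at ht'
      have := smul_left_injective ℝ (target_ne_zero (odd := odd) (G := G) (𝒟 := l.toFinset)) ht'
      have := mul_neg_of_pos_of_neg ht h0
      linarith
  · refine ⟨c, h0, ?_⟩
    rw [tilingSign, if_pos ⟨U, hU, e, he, c, h0, hc'⟩, hc']
    simp

end PlaneGraph

end

noncomputable section

open scoped Classical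

namespace PlaneGraph

variable {V E : Type*} {G : PlaneGraph V E} {U : Finset E} {𝒟 S : Finset (Finset E)}
  {odd : E → Prop}

/-! ### Signs of composable pairs of operations -/

theorem edgeList_append (l l' : List (Finset E)) :
    edgeList odd (l ++ l') = edgeList odd l ++ edgeList odd l' := List.flatMap_append

theorem edgeList_cons (U : Finset E) (l : List (Finset E)) :
    edgeList odd (U :: l) = oddList odd U ++ edgeList odd l := List.flatMap_cons

theorem factorList_append (l l' : List (Finset E)) : factorList odd G 𝒟 (l ++ l') =
    factorList odd G 𝒟 l ++ factorList odd G 𝒟 l' := by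
  rw [factorList, edgeList_append, List.map_append, factorList, factorList]

/-- Each piece contributes two factors, hence an even element; the volume element does not depend on
an order of the pieces. -/
theorem wedge_pointList_perm {T T' : List (Finset E)} (h : T.Perm T') :
    wedge ((T.flatMap fun U => [Sum.inr (U, 0), Sum.inr (U, 1)]).map
      (basisVec : E ⊕ (Finset E × Fin 2) → Formal E)) =
    wedge ((T'.flatMap fun U => [Sum.inr (U, 0), Sum.inr (U, 1)]).map basisVec) := by
  induction h with
  | nil => rfl
  | cons U _ ih =>
    rw [List.flatMap_cons, List.flatMap_cons, List.map_append, List.map_append, wedge_append,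
      wedge_append, ih]
  | swap U U' l =>
    simp only [List.flatMap_cons, List.map_append, wedge_append]
    rw [← mul_assoc, ← mul_assoc]
    congr 1
    exact wedge_comm_of_even ⟨1, rfl⟩ _
  | trans _ _ ih ih' => rw [ih, ih']

theorem wedge_pointList_insert {T : Finset (Finset E)} (hU : U ∉ T) :
    wedge ((pointList (insert U T)).map basisVec) =
      wedge [xi U, eta U] * wedge ((pointList T).map basisVec) := by
  rw [pointList, wedge_pointList_perm (Finset.toList_insert hU), List.flatMap_cons,
    List.map_append, wedge_append]
  rfl

theorem wedge_pointList_union {T T' : Finset (Finset E)} (h : Disjoint T T') :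
    wedge ((pointList (T ∪ T')).map basisVec) =
      wedge ((pointList T).map basisVec) * wedge ((pointList T').map basisVec) := by
  induction T using Finset.induction_on with
  | empty => simp [pointList, wedge]
  | insert U T hU ih =>
    rw [Finset.disjoint_insert_left] at h
    rw [Finset.insert_union, wedge_pointList_insert, ih h.2, wedge_pointList_insert hU, mul_assoc]
    simp [hU, h.1]

theorem units_eq_of_smul_eq {A : Type*} [AddCommGroup A] [Module ℝ A] {s t : ℤˣ} {c c' : ℝ}
    (hc : 0 < c) (hc' : 0 < c') {x : A} (hx : x ≠ 0)
    (h : (s : ℤ) • c • x = (t : ℤ) • c' • x) : s = t := by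
  rw [← Int.cast_smul_eq_zsmul ℝ, ← Int.cast_smul_eq_zsmul ℝ, smul_smul, smul_smul] at h
  have := smul_left_injective ℝ hx h
  rcases Int.units_eq_one_or s with rfl | rfl <;> rcases Int.units_eq_one_or t with rfl | rfl <;>
    simp at this ⊢ <;> linarith

/-- Replaces the edges by their factors. -/
def substFactor (G : PlaneGraph V E) (𝒟 : Finset (Finset E)) : Formal E →ₗ[ℝ] Formal E :=
  Finsupp.linearCombination ℝ (Sum.elim (G.factor 𝒟) fun i => basisVec (Sum.inr i))

/-- Replaces the point of a piece by that of another one. -/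
def substPoint (B U : Finset E) : Formal E →ₗ[ℝ] Formal E :=
  Finsupp.linearCombination ℝ (Sum.elim edgeVec
    fun i => basisVec (Sum.inr (if i.1 = B then U else i.1, i.2)))

theorem substFactor_edgeVec (e : E) : substFactor G 𝒟 (edgeVec e) = G.factor 𝒟 e := by
  simp [substFactor, edgeVec, basisVec]

theorem substFactor_point (i : Finset E × Fin 2) :
    substFactor G 𝒟 (basisVec (Sum.inr i)) = basisVec (Sum.inr i) := by
  simp [substFactor, basisVec]

theorem substPoint_edgeVec (B U : Finset E) (e : E) :
    substPoint B U (edgeVec e) = edgeVec e := by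
  simp [substPoint, edgeVec, basisVec]

theorem substPoint_xi (B U U' : Finset E) :
    substPoint B U (xi U') = xi (if U' = B then U else U') := by
  simp [substPoint, xi, basisVec]

theorem substPoint_eta (B U U' : Finset E) :
    substPoint B U (eta U') = eta (if U' = B then U else U') := by
  simp [substPoint, eta, basisVec]

theorem substFactor_pair (e : E) (U U' : Finset E) :
    substFactor G 𝒟 (G.alphaPair e U U') = G.alphaPair e U U' ∧
    substFactor G 𝒟 (G.betaPair e U U') = G.betaPair e U U' := by
  simp only [alphaPair, betaPair, map_sub, map_add, map_smul, xi, eta, substFactor_point,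
    and_self]

theorem substPoint_pair (B W : Finset E) (e : E) (U U' : Finset E) :
    substPoint B W (G.alphaPair e U U') =
      G.alphaPair e (if U = B then W else U) (if U' = B then W else U') ∧
    substPoint B W (G.betaPair e U U') =
      G.betaPair e (if U = B then W else U) (if U' = B then W else U') := by
  simp only [alphaPair, betaPair, map_sub, map_add, map_smul, substPoint_xi, substPoint_eta,
    and_self]

theorem map_substFactor_pointList : (pointList S).map ((substFactor G 𝒟) ∘ basisVec) =
    (pointList S).map basisVec := by
  refine List.map_congr_left fun i hi => ?_
  obtain ⟨U, -, rfl | rfl⟩ := mem_pointList.1 hi <;> exact substFactor_point _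

namespace IsNested

variable [Finite V]

theorem substFactor_factor (h : G.IsNested 𝒟 S) {e : E} :
    substFactor G 𝒟 (G.factor S e) = G.factor 𝒟 e := by
  by_cases hi : e ∈ G.internal S
  · obtain ⟨h1, h2⟩ := mem_internal.1 hi
    rw [factor, if_pos hi, factor, if_pos (h.internal_fine_subset hi), alphaVec,
      (substFactor_pair _ _ _).1, alphaVec, h.owner_fine h1, h.owner_fine h2]
  · rw [factor, if_neg hi, substFactor_edgeVec]

theorem substFactor_betaVec (h : G.IsNested 𝒟 S) {e : E} (hi : e ∈ G.internal S) :
    substFactor G 𝒟 (G.betaVec S e) = G.betaVec 𝒟 e := by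
  obtain ⟨h1, h2⟩ := mem_internal.1 hi
  rw [betaVec, (substFactor_pair _ _ _).2, betaVec, h.owner_fine h1, h.owner_fine h2]

theorem sub_owner_mem (h : G.IsNested 𝒟 S) {B : Finset E} {e : E}
    (he : e ∈ edgesOf (G.coarse 𝒟 S)) {A : Submodule ℝ (Formal E)}
    (hA : ∀ U ∈ S, xi U - xi B ∈ A ∧ eta U - eta B ∈ A) :
    xi (owner 𝒟 e) - xi (if owner (G.coarse 𝒟 S) e = G.boundary S then B else
      owner (G.coarse 𝒟 S) e) ∈ A ∧
    eta (owner 𝒟 e) - eta (if owner (G.coarse 𝒟 S) e = G.boundary S then B else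
      owner (G.coarse 𝒟 S) e) ∈ A := by
  rw [h.owner_coarse he, collapse]
  obtain ⟨h1, h2⟩ := owner_spec (h.mem_edgesOf_coarse.1 he).1
  by_cases hS : owner 𝒟 e ∈ S
  · rw [if_pos hS, if_pos rfl]
    exact hA _ hS
  · have hc : owner 𝒟 e ≠ G.boundary S := fun hc =>
      h.notMem (hc ▸ Finset.mem_sdiff.2 ⟨h1, hS⟩)
    rw [if_neg hS, if_neg hc]
    simp

omit [Finite V] in
theorem pair_sub_mem {A : Submodule ℝ (Formal E)} {e : E} {U U' T T' : Finset E}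
    (h1 : xi U - xi T ∈ A ∧ eta U - eta T ∈ A) (h2 : xi U' - xi T' ∈ A ∧ eta U' - eta T' ∈ A) :
    G.alphaPair e U U' - G.alphaPair e T T' ∈ A ∧ G.betaPair e U U' - G.betaPair e T T' ∈ A := by
  have e1 : G.alphaPair e U U' - G.alphaPair e T T' =
      (G.vec e).1 • ((eta U' - eta T') - (eta U - eta T)) -
      (G.vec e).2 • ((xi U' - xi T') - (xi U - xi T)) := by
    simp only [alphaPair]; module
  have e2 : G.betaPair e U U' - G.betaPair e T T' =
      (G.vec e).1 • ((xi U' - xi T') - (xi U - xi T)) +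
      (G.vec e).2 • ((eta U' - eta T') - (eta U - eta T)) := by
    simp only [betaPair]; module
  rw [e1, e2]
  exact ⟨A.sub_mem (A.smul_mem _ (A.sub_mem h2.2 h1.2)) (A.smul_mem _ (A.sub_mem h2.1 h1.1)),
    A.add_mem (A.smul_mem _ (A.sub_mem h2.1 h1.1)) (A.smul_mem _ (A.sub_mem h2.2 h1.2))⟩

/-- With the merged piece represented by the point of `B`, a coarse factor differs from the fine one
only by differences of points of pieces in `S`. -/
theorem sub_substPoint_mem (h : G.IsNested 𝒟 S) {B : Finset E} {A : Submodule ℝ (Formal E)} (hA : ∀ U ∈ S, xi U - xi B ∈ A ∧ eta U - eta B ∈ A) {e : E}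
    (he : e ∉ G.internal S) :
    G.factor 𝒟 e - substPoint (G.boundary S) B (G.factor (G.coarse 𝒟 S) e) ∈ A ∧
    (e ∈ G.internal (G.coarse 𝒟 S) →
      G.betaVec 𝒟 e - substPoint (G.boundary S) B (G.betaVec (G.coarse 𝒟 S) e) ∈ A) := by
  by_cases hi : e ∈ G.internal 𝒟
  · have hc := h.mem_internal_coarse.2 ⟨hi, he⟩
    obtain ⟨h1, h2⟩ := mem_internal.1 hc
    have key := pair_sub_mem (G := G) (e := e) (h.sub_owner_mem h1 hA)
      (h.sub_owner_mem h2 hA)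
    rw [factor, if_pos hi, factor, if_pos hc, alphaVec, alphaVec, betaVec, betaVec,
      (substPoint_pair _ _ _ _ _).1, (substPoint_pair _ _ _ _ _).2]
    exact ⟨key.1, fun _ => key.2⟩
  · have hc : e ∉ G.internal (G.coarse 𝒟 S) := fun hc => hi (h.mem_internal_coarse.1 hc).1
    rw [factor, if_neg hi, factor, if_neg hc, substPoint_edgeVec, sub_self]
    exact ⟨A.zero_mem, fun h => absurd h hc⟩

end IsNested

variable [Finite V] (hodd : ∀ e, odd (G.rev e) ↔ ¬ odd e)
include hodd

/-- The product of the signs of two composable operations. -/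
theorem IsGood.exists_wedge_eq (hG : G.Generic) (h : G.IsGood 𝒟 S) {lS lT : List (Finset E)}
    (hlS : lS.Nodup) (hlT : lT.Nodup) (hS : lS.toFinset = S) (hT : lT.toFinset = 𝒟 \ S)
    {B : Finset E} (hB : B ∈ S) {e e' : E} (he : e ∈ G.internal S)
    (he' : e' ∈ G.internal (G.coarse 𝒟 S)) :
    ∃ c : ℝ, 0 < c ∧ wedge ([xi B, eta B] ++ (G.betaVec 𝒟 e' :: G.betaVec 𝒟 e ::
      factorList odd G 𝒟 (lS ++ lT))) =
      ((tilingSign odd G lS * tilingSign odd G (G.boundary S :: lT) : ℤˣ) : ℤ) •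
        c • target odd G 𝒟 := by
  have hn := h.isNested
  have hbT : G.boundary S ∉ lT := fun hc => h.notMem (hT ▸ List.mem_toFinset.2 hc)
  have hc : (G.boundary S :: lT).toFinset = G.coarse 𝒟 S := by
    rw [List.toFinset_cons, hT, PlaneGraph.coarse]
  -- the two identities
  obtain ⟨c₁, hc₁, id₁⟩ := tilingSign_spec hodd hG hlS (hS ▸ h.fine) (hS ▸ hB) (hS ▸ he)
  obtain ⟨c₂, hc₂, id₂⟩ := tilingSign_spec hodd hG (List.nodup_cons.2 ⟨hbT, hlT⟩)
    (hc ▸ h.coarse) (U := G.boundary S) (by simp) (hc ▸ he')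
  rw [hS] at id₁
  rw [hc] at id₂
  -- In the fine identity the edges of the merged frame are formal letters. Substituting their
  -- factors in `𝒟` turns its right side into the volume element of `S` times the factors with which
  -- the merged frame enters the coarse identity. In the latter the merged point is replaced by that
  -- of `B`.
  have id₁' := congrArg (ExteriorAlgebra.map (substFactor G 𝒟)) id₁
  have id₂' := congrArg (ExteriorAlgebra.map (substPoint (G.boundary S) B)) id₂
  clear id₁ id₂
  refine ⟨c₁ * c₂, mul_pos hc₁ hc₂, ?_⟩
  set s₁ := tilingSign odd G lS
  set s₂ := tilingSign odd G (G.boundary S :: lT)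
  -- rewriting the fine identity
  rw [map_wedge, map_zsmul, map_smul, target, map_mul, map_wedge, map_wedge, List.map_map,
    List.map_map, map_substFactor_pointList, List.map_append,
    List.map_cons (l := factorList odd G S lS), hn.substFactor_betaVec he, factorList, List.map_map] at id₁'
  have r1 : (⇑(substFactor G 𝒟) ∘ G.factor S) = G.factor 𝒟 :=
    funext fun e => hn.substFactor_factor
  have r2 : (⇑(substFactor G 𝒟) ∘ edgeVec) = G.factor 𝒟 :=
    funext fun e => substFactor_edgeVec e
  have r3 : [xi B, eta B].map (substFactor G 𝒟) = [xi B, eta B] := by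
    simp [xi, eta, substFactor_point]
  rw [r1, r2, r3] at id₁'
  -- rewriting the coarse identity
  have hdisj : Disjoint S (𝒟 \ S) := Finset.disjoint_sdiff
  have hSB : S = insert B (S.erase B) := (Finset.insert_erase hB).symm
  have p1 : wedge ((pointList S).map basisVec) =
      wedge [xi B, eta B] * wedge ((pointList (S.erase B)).map basisVec) := by
    conv_lhs => rw [hSB]
    exact wedge_pointList_insert (Finset.notMem_erase _ _)
  have p2 : wedge ((pointList 𝒟).map basisVec) =
      wedge ((pointList (S.erase B)).map basisVec) *
        (wedge [xi B, eta B] * wedge ((pointList (𝒟 \ S)).map basisVec)) := by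
    conv_lhs => rw [← Finset.union_sdiff_of_subset h.subset]
    rw [wedge_pointList_union hdisj, p1, wedge_comm_of_even ⟨1, rfl⟩, mul_assoc]
  have p3 : ExteriorAlgebra.map (substPoint (G.boundary S) B)
      (wedge ((pointList (G.coarse 𝒟 S)).map basisVec)) =
      wedge [xi B, eta B] * wedge ((pointList (𝒟 \ S)).map basisVec) := by
    rw [PlaneGraph.coarse, wedge_pointList_insert h.notMem, map_mul, map_wedge, map_wedge, List.map_map]
    congr 2
    · simp [substPoint_xi, substPoint_eta]
    · refine List.map_congr_left fun i hi => ?_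
      obtain ⟨U, hU, rfl | rfl⟩ := mem_pointList.1 hi
      · exact (substPoint_xi _ _ _).trans (by
          rw [if_neg fun hc => h.notMem (by rwa [← hc])]; rfl)
      · exact (substPoint_eta _ _ _).trans (by
          rw [if_neg fun hc => h.notMem (by rwa [← hc])]; rfl)
  have p4 : ((oddList odd (G.boundary (G.coarse 𝒟 S))).map edgeVec).map
      (substPoint (G.boundary S) B) = (oddList odd (G.boundary 𝒟)).map edgeVec := by
    rw [hn.boundary_coarse, List.map_map]
    exact List.map_congr_left fun e _ => substPoint_edgeVec _ _ _
  rw [map_zsmul, map_smul, target, map_mul, p3, map_wedge, map_wedge, p4, List.map_append]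
    at id₂'
  have p5 : [xi (G.boundary S), eta (G.boundary S)].map (substPoint (G.boundary S) B) =
      [xi B, eta B] := by simp [substPoint_xi, substPoint_eta]
  rw [p5] at id₂'
  -- the coarse factors can be replaced
  have hA : ∀ U ∈ S, xi U - xi B ∈ Submodule.span ℝ {x | x ∈ (pointList S).map basisVec} ∧
      eta U - eta B ∈ Submodule.span ℝ {x | x ∈ (pointList S).map basisVec} := by
    have key : ∀ U ∈ S, xi U ∈ Submodule.span ℝ {x | x ∈ (pointList S).map basisVec} ∧
        eta U ∈ Submodule.span ℝ {x | x ∈ (pointList S).map basisVec} := fun U hU =>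
      ⟨Submodule.subset_span (List.mem_map.2 ⟨_, mem_pointList.2 ⟨U, hU, Or.inl rfl⟩, rfl⟩),
        Submodule.subset_span (List.mem_map.2 ⟨_, mem_pointList.2 ⟨U, hU, Or.inr rfl⟩, rfl⟩)⟩
    exact fun U hU => ⟨Submodule.sub_mem _ (key U hU).1 (key B hB).1,
      Submodule.sub_mem _ (key U hU).2 (key B hB).2⟩
  have hnotint : ∀ e₁ ∈ edgeList odd (G.boundary S :: lT), e₁ ∉ G.internal S := by
    intro e₁ h1 h2
    have h3 := (mem_edgeList.1 h1).1
    rw [hc] at h3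
    exact (hn.mem_edgesOf_coarse.1 h3).2 (mem_internal.1 h2)
  have q1 : wedge ((pointList S).map basisVec) *
      wedge (G.betaVec 𝒟 e' :: factorList odd G 𝒟 (G.boundary S :: lT)) =
      wedge ((pointList S).map basisVec) * wedge ((G.betaVec (G.coarse 𝒟 S) e' ::
        factorList odd G (G.coarse 𝒟 S) (G.boundary S :: lT)).map
        (substPoint (G.boundary S) B)) := by
    have := wedge_mul_wedge_map_congr (l := (pointList S).map basisVec)
      (L := none :: (edgeList odd (G.boundary S :: lT)).map some)
      (f := fun o => Option.elim o (G.betaVec 𝒟 e') (G.factor 𝒟))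
      (f' := fun o => substPoint (G.boundary S) B
        (Option.elim o (G.betaVec (G.coarse 𝒟 S) e') (G.factor (G.coarse 𝒟 S)))) (by
        intro o ho
        rcases List.mem_cons.1 ho with rfl | ho
        · exact (hn.sub_substPoint_mem hA (hn.mem_internal_coarse.1 he').2).2 he'
        · obtain ⟨e₁, h1, rfl⟩ := List.mem_map.1 ho
          exact (hn.sub_substPoint_mem hA (hnotint e₁ h1)).1)
    simpa only [List.map_cons, List.map_map, Function.comp_def, Option.elim, factorList] using this
  -- the product
  have lhs : wedge ([xi B, eta B] ++ (G.betaVec 𝒟 e' :: G.betaVec 𝒟 e ::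
      factorList odd G 𝒟 (lS ++ lT))) = wedge [G.betaVec 𝒟 e'] *
      (wedge ([xi B, eta B] ++ (G.betaVec 𝒟 e :: (edgeList odd lS).map (G.factor 𝒟))) *
        wedge (factorList odd G 𝒟 lT)) := by
    have := wedge_comm_of_even (l := [xi B, eta B]) ⟨1, rfl⟩ [G.betaVec 𝒟 e']
    have e1 : wedge (G.betaVec 𝒟 e' :: G.betaVec 𝒟 e :: factorList odd G 𝒟 (lS ++ lT)) =
        wedge [G.betaVec 𝒟 e'] * (wedge (G.betaVec 𝒟 e :: (edgeList odd lS).map (G.factor 𝒟)) *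
          wedge (factorList odd G 𝒟 lT)) := by
      rw [factorList_append, ← wedge_append, ← wedge_append]
      rfl
    rw [wedge_append, e1, ← mul_assoc, this, wedge_append]
    simp only [mul_assoc]
  rw [lhs, id₁', smul_mul_assoc, smul_mul_assoc, mul_smul_comm, mul_smul_comm]
  have rhs : wedge [G.betaVec 𝒟 e'] * (wedge ((pointList S).map basisVec) *
      wedge ((oddList odd (G.boundary S)).map (G.factor 𝒟)) * wedge (factorList odd G 𝒟 lT)) =
      wedge ((pointList S).map basisVec) *
        wedge (G.betaVec 𝒟 e' :: factorList odd G 𝒟 (G.boundary S :: lT)) := by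
    have := wedge_comm_of_even (l := (pointList S).map (basisVec : _ → Formal E))
      ⟨S.card, by rw [List.length_map, length_pointList]; ring⟩ [G.betaVec 𝒟 e']
    rw [mul_assoc, ← mul_assoc, ← this, mul_assoc, ← wedge_append, ← wedge_append, factorList,
      factorList, edgeList_cons, List.map_append]
    rfl
  rw [rhs, q1, p1, wedge_comm_of_even (l := [xi B, eta B]) ⟨1, rfl⟩, mul_assoc, ← wedge_append,
    id₂', target, p2, mul_smul_comm, mul_smul_comm, Units.val_mul, mul_smul, mul_smul]
  rw [smul_comm c₁ (s₂ : ℤ)]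
  simp only [mul_assoc]

omit [Finite V] in
/-- The coefficients of the two composable pairs of operations are opposite. -/
theorem IsGood.wedge_swap {S' : Finset (Finset E)} (h : G.IsGood 𝒟 S)
    (h' : G.IsGood 𝒟 S') {B B' : Finset E} (hB : B ∈ S) (hB' : B' ∈ S') {e e' : E} {l : List (Finset E)}
    (hl : l.toFinset = 𝒟) (hrigid : ∀ y : Finset E → ℝ × ℝ,
        (∀ e ∈ G.internal 𝒟, G.alpha 𝒟 e y = 0) → G.beta 𝒟 e y = 0 → G.beta 𝒟 e' y = 0 →
        ∃ b, ∀ U ∈ 𝒟, y U = b) :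
    wedge ([xi B, eta B] ++ (G.betaVec 𝒟 e' :: G.betaVec 𝒟 e :: factorList odd G 𝒟 l)) =
    -wedge ([xi B', eta B'] ++ (G.betaVec 𝒟 e :: G.betaVec 𝒟 e' :: factorList odd G 𝒟 l)) := by
  subst hl
  rw [wedge_base_change_of_rigid (U := B') (U' := B) fun g hg => ?_]
  · simp only [List.cons_append, List.nil_append, wedge_cons]
    rw [← mul_assoc (ExteriorAlgebra.ι ℝ (G.betaVec _ e')), ι_mul_ι, neg_mul, mul_assoc,
      mul_neg, mul_neg]
  · obtain ⟨b, hb⟩ := hrigid (config g)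
      (fun e he => alpha_config_eq_zero hodd
        (fun u hu => hg u (List.mem_cons_of_mem _ (List.mem_cons_of_mem _ hu))) he)
      (by rw [← apply_betaVec]; exact hg _ (by simp))
      (by rw [← apply_betaVec]; exact hg _ (by simp))
    rw [hb B (h.subset hB), hb B' (h'.subset hB')]

section Koszul

variable {n : ℕ} {fs : Fin n → Finset E} {d : Fin n → ℤ}
  (hd : ∀ i, (d i).negOnePow = ((oddList odd (fs i)).length : ℤ).negOnePow)

omit [Finite V] hodd in
theorem wedge_factorList_map (l : List (Fin n)) : wedge (factorList odd G 𝒟 (l.map fs)) =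
    (l.map fun i => wedge (factorList odd G 𝒟 [fs i])).prod := by
  induction l with
  | nil => rfl
  | cons i l ih =>
    have : fs i :: l.map fs = [fs i] ++ l.map fs := rfl
    rw [List.map_cons, this, factorList_append, wedge_append, ih, List.map_cons, List.prod_cons]

include hd

omit [Finite V] hodd in
theorem negOnePow_mul_eq (i j : Fin n) : (d i * d j).negOnePow =
    ((oddList odd (fs i)).length * (oddList odd (fs j)).length : ℤ).negOnePow := by
  have h := fun i => (Int.negOnePow_eq_iff _ _).1 (hd i)
  rw [Int.negOnePow_eq_iff]
  have : d i * d j - ((oddList odd (fs i)).length * (oddList odd (fs j)).length : ℤ) =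
      (d i - (oddList odd (fs i)).length) * d j +
      (oddList odd (fs i)).length * (d j - (oddList odd (fs j)).length) := by ring
  rw [this]
  exact ((h i).mul_right _).add ((h j).mul_left _)

omit [Finite V] hodd in
-- The product of the factors of one frame has as many vectors as the frame has odd edges, so by
-- `hd` it commutes with the others like an element of degree `d i`.
theorem wedge_factorList_koszul {l : List (Fin n)} (hl : l.Nodup) (h : ∀ i, i ∈ l) :
    wedge (factorList odd G 𝒟 (l.map fs)) =
      koszulList d l • wedge (factorList odd G 𝒟 (List.ofFn fs)) := by
  rw [wedge_factorList_map, prod_map_eq_koszulList_smul_ofFn d (fun i j => ?_) hl h]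
  · rw [← List.map_id (List.ofFn fs), List.map_ofFn]
    have := wedge_factorList_map (G := G) (𝒟 := 𝒟) (odd := odd) (fs := fs) (List.ofFn id)
    rw [List.map_ofFn, List.map_ofFn] at this
    exact congrArg _ this.symm
  · have hlen : ∀ i, (factorList odd G 𝒟 [fs i]).length = (oddList odd (fs i)).length := by
      intro i
      simp [factorList, edgeList]
    rw [negOnePow_mul_eq hd, wedge_mul_wedge, hlen, hlen]

/-- The volume element, the point and the length do not see the order of the pieces; only the
factors are permuted. -/
theorem tilingSign_perm (hG : G.Generic) (hfs : Function.Injective fs)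
    (h : G.IsDec (Finset.univ.image fs)) (σ : Equiv.Perm (Fin n)) :
    tilingSign odd G (List.ofFn (fs ∘ σ)) =
      koszulSign d σ * tilingSign odd G (List.ofFn fs) := by
  have hset : ∀ σ : Equiv.Perm (Fin n),
      (List.ofFn (fs ∘ σ)).toFinset = Finset.univ.image fs := by
    intro σ
    ext U
    simp only [List.mem_toFinset, List.mem_ofFn, Finset.mem_image, Finset.mem_univ, true_and]
    exact ⟨fun ⟨i, hi⟩ => ⟨σ i, hi⟩, fun ⟨i, hi⟩ => ⟨σ.symm i, by simpa using hi⟩⟩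
  have hnd : ∀ σ : Equiv.Perm (Fin n), (List.ofFn (fs ∘ σ)).Nodup := fun σ =>
    List.nodup_ofFn.2 (hfs.comp σ.injective)
  have hs1 := hset 1
  have hn1 := hnd 1
  simp only [Equiv.Perm.coe_one, Function.comp_id] at hs1 hn1
  obtain ⟨U, hU⟩ := Finset.card_pos.1 (by have := h.two_le_card; omega :
    0 < (Finset.univ.image fs).card)
  obtain ⟨e, he⟩ := h.exists_internal
  obtain ⟨c, hc, id₁⟩ := tilingSign_spec hodd hG hn1 (hs1 ▸ h) (hs1 ▸ hU) (hs1 ▸ he)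
  obtain ⟨c', hc', id₂⟩ := tilingSign_spec hodd hG (hnd σ) ((hset σ).symm ▸ h)
    ((hset σ).symm ▸ hU) ((hset σ).symm ▸ he)
  rw [hs1] at id₁
  rw [hset] at id₂
  have hk := wedge_factorList_koszul (G := G) (𝒟 := Finset.univ.image fs) hd
    (l := List.ofFn σ) (List.nodup_ofFn.2 σ.injective)
    fun i => (List.mem_ofFn' _ _).2 ⟨σ.symm i, by simp⟩
  rw [koszulList_ofFn, List.map_ofFn] at hk
  rw [wedge_append, wedge_cons (G.betaVec _ e), hk, Units.smul_def, mul_smul_comm, mul_smul_comm,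
    ← wedge_cons, ← wedge_append, id₁, smul_smul, ← Units.val_mul] at id₂
  exact (units_eq_of_smul_eq hc hc' target_ne_zero id₂).symm

/-- Take an edge `e` contracted by `I` and an edge `e'` contracted by `I'`. Each is an edge of the
coarse tiling of the other pair, so both composites compare the same vectors with the volume element
of the whole tiling. Sorting the pieces produces the two unshuffle signs; the lengths of `e` and
`e'` appear in opposite orders, which is the minus sign. -/
theorem tilingSign_cancel (hG : G.Generic) (hfs : Function.Injective fs) {I I' : Finset (Fin n)}
    (hI : G.IsGood (Finset.univ.image fs) (I.image fs))
    (hI' : G.IsGood (Finset.univ.image fs) (I'.image fs)) (hne : I' ≠ I) :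
    unshuffleSign d I * (tilingSign odd G (List.ofFn fun a => fs (I.orderEmbOfFin rfl a)) *
      tilingSign odd G (G.boundary (I.image fs) ::
        List.ofFn fun a => fs (Iᶜ.orderEmbOfFin rfl a))) =
    -(unshuffleSign d I' * (tilingSign odd G (List.ofFn fun a => fs (I'.orderEmbOfFin rfl a)) *
      tilingSign odd G (G.boundary (I'.image fs) ::
        List.ofFn fun a => fs (I'ᶜ.orderEmbOfFin rfl a)))) := by
  set 𝒟 := Finset.univ.image fs with h𝒟
  obtain ⟨S', hS', -, hdisj, huniq, hrigid⟩ := hI.exists_partner hG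
  have hS'I : I'.image fs = S' :=
    (huniq _ hI').resolve_left fun hc => hne (Finset.image_injective hfs hc)
  subst hS'I
  obtain ⟨e, he⟩ := hI.fine.exists_internal
  obtain ⟨e', he'⟩ := hI'.fine.exists_internal
  obtain ⟨B, hB⟩ := Finset.card_pos.1 (by have := hI.fine.two_le_card; omega :
    0 < (I.image fs).card)
  obtain ⟨B', hB'⟩ := Finset.card_pos.1 (by have := hI'.fine.two_le_card; omega :
    0 < (I'.image fs).card)
  have hset : ∀ J : Finset (Fin n),
      (List.ofFn fun a => fs (J.orderEmbOfFin rfl a)).toFinset = J.image fs := by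
    intro J
    ext U
    simp only [List.mem_toFinset, List.mem_ofFn, Finset.mem_image]
    constructor
    · rintro ⟨a, rfl⟩
      exact ⟨_, Finset.orderEmbOfFin_mem _ _ _, rfl⟩
    · rintro ⟨i, hi, rfl⟩
      have : i ∈ Set.range (J.orderEmbOfFin rfl) := by rwa [Finset.range_orderEmbOfFin]
      obtain ⟨a, rfl⟩ := this
      exact ⟨a, rfl⟩
  have hcompl : ∀ J : Finset (Fin n), Jᶜ.image fs = 𝒟 \ J.image fs := by
    intro J
    rw [h𝒟, Finset.compl_eq_univ_sdiff, Finset.image_sdiff _ _ hfs]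
  have hnd : ∀ J : Finset (Fin n), (List.ofFn fun a => fs (J.orderEmbOfFin rfl a)).Nodup :=
    fun J => List.nodup_ofFn.2 (hfs.comp (J.orderEmbOfFin rfl).injective)
  have hk : ∀ J : Finset (Fin n), wedge (factorList odd G 𝒟
      ((List.ofFn fun a => fs (J.orderEmbOfFin rfl a)) ++
        List.ofFn fun a => fs (Jᶜ.orderEmbOfFin rfl a))) =
      (unshuffleSign d J : ℤ) • wedge (factorList odd G 𝒟 (List.ofFn fs)) := by
    intro J
    have := wedge_factorList_koszul (G := G) (𝒟 := 𝒟) hd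
      (l := List.ofFn (J.orderEmbOfFin rfl) ++ List.ofFn (Jᶜ.orderEmbOfFin rfl)) ?_ ?_
    · rwa [koszulList_unshuffle, List.map_append, List.map_ofFn, List.map_ofFn] at this
    · refine List.Nodup.append (List.nodup_ofFn.2 (J.orderEmbOfFin rfl).injective)
        (List.nodup_ofFn.2 (Jᶜ.orderEmbOfFin rfl).injective) fun i hi hi' => ?_
      obtain ⟨a, rfl⟩ := (List.mem_ofFn' _ _).1 hi
      obtain ⟨b, hb⟩ := (List.mem_ofFn' _ _).1 hi'
      exact Finset.mem_compl.1 (hb ▸ Finset.orderEmbOfFin_mem Jᶜ rfl b)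
        (Finset.orderEmbOfFin_mem J rfl a)
    · intro i
      rw [List.mem_append, List.mem_ofFn', List.mem_ofFn', Finset.range_orderEmbOfFin,
        Finset.range_orderEmbOfFin]
      by_cases hi : i ∈ J <;> simp [hi]
  obtain ⟨c, hc, id₁⟩ := hI.exists_wedge_eq hodd hG (hnd I) (hnd Iᶜ) (hset I)
    ((hset Iᶜ).trans (hcompl I)) hB he
    (hI.isNested.mem_internal_coarse.2 ⟨hI'.isNested.internal_fine_subset he',
      fun hc => hdisj e' hc he'⟩)
  obtain ⟨c', hc', id₂⟩ := hI'.exists_wedge_eq hodd hG (hnd I') (hnd I'ᶜ) (hset I')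
    ((hset I'ᶜ).trans (hcompl I')) hB' he'
    (hI'.isNested.mem_internal_coarse.2 ⟨hI.isNested.internal_fine_subset he, hdisj e he⟩)
  have hl : (List.ofFn fs).toFinset = 𝒟 := by
    ext U
    simp [h𝒟, List.mem_ofFn]
  have id₃ := IsGood.wedge_swap hodd hI hI' hB hB' hl (hrigid e he e' he')
  have expand : ∀ (J : Finset (Fin n)) (u v x y : Formal E),
      wedge ([u, v] ++ (x :: y :: factorList odd G 𝒟
      ((List.ofFn fun a => fs (J.orderEmbOfFin rfl a)) ++
        List.ofFn fun a => fs (Jᶜ.orderEmbOfFin rfl a)))) = (unshuffleSign d J : ℤ) •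
      wedge ([u, v] ++ (x :: y :: factorList odd G 𝒟 (List.ofFn fs))) := by
    intro J u v x y
    simp only [wedge_append, wedge_cons, hk, mul_smul_comm]
  rw [expand] at id₁ id₂
  set s := tilingSign odd G (List.ofFn fun a => fs (I.orderEmbOfFin rfl a)) *
      tilingSign odd G (G.boundary (I.image fs) ::
        List.ofFn fun a => fs (Iᶜ.orderEmbOfFin rfl a))
  set s' := tilingSign odd G (List.ofFn fun a => fs (I'.orderEmbOfFin rfl a)) *
      tilingSign odd G (G.boundary (I'.image fs) ::
        List.ofFn fun a => fs (I'ᶜ.orderEmbOfFin rfl a))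
  have inv : ∀ (u t : ℤˣ) (x y : ExteriorAlgebra ℝ (Formal E)),
      (u : ℤ) • x = (t : ℤ) • y → x = ((u * t : ℤˣ) : ℤ) • y := by
    intro u t x y h
    have := congrArg (fun z => (u : ℤ) • z) h
    simp only [smul_smul] at this
    rw [Units.val_mul, ← this, ← Units.val_mul, Int.units_mul_self, Units.val_one, one_smul]
  rw [inv _ _ _ _ id₁, inv _ _ _ _ id₂, ← neg_smul, ← Units.val_neg] at id₃
  exact units_eq_of_smul_eq hc hc' target_ne_zero id₃

end Koszul

end PlaneGraph

end

noncomputable section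

open scoped Classical

namespace PlaneGraph

variable {V E : Type*} {G : PlaneGraph V E} {U : Finset E}

/-! ### Convex cycles and the angles of their edges -/

theorem planeDet_cos_sin (a b c d : ℝ) :
    planeDet (c • (Real.cos a, Real.sin a)) (d • (Real.cos b, Real.sin b)) =
      c * d * Real.sin (b - a) := by
  rw [Real.sin_sub]
  simp only [planeDet, Prod.smul_mk, smul_eq_mul]
  ring

/-- Indices are continued periodically and angles by full turns, so that all arcs become sums over
intervals. A chain of edges whose angles span less than `π` advances in the bisecting direction and
cannot close; of two complementary arcs at least one is of this kind, so the vertices are distinct.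
The side of an edge is a sum of sines: if a term past `π` has entered, all remaining terms are
nonpositive, and the full sum is zero. -/
theorem isFrame_of_cyclic {N : ℕ} {e : Fin (N + 3) → E} {θ c : Fin (N + 3) → ℝ}
    (hθ : StrictMono θ) (hlast : θ (Fin.last _) < θ 0 + 2 * Real.pi) (hc : ∀ i, 0 < c i)
    (hvec : ∀ i, G.vec (e i) = c i • (Real.cos (θ i), Real.sin (θ i)))
    (htgt : ∀ i, G.tgt (e i) = G.src (e (i + 1))) : G.IsFrame (Finset.univ.image e) := by
  have hpi := Real.pi_pos
  -- the periodic extension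
  let n := N + 3
  let r : ℕ → Fin n := fun k => ⟨k % n, Nat.mod_lt _ (by omega)⟩
  let e' : ℕ → E := fun k => e (r k)
  let θ' : ℕ → ℝ := fun k => θ (r k) + 2 * Real.pi * (k / n : ℕ)
  have hr : ∀ k, (k + 1) % n = 0 ∧ k % n = n - 1 ∧ (k + 1) / n = k / n + 1 ∨
      (k + 1) % n = k % n + 1 ∧ (k + 1) / n = k / n := by
    intro k
    have h1 := Nat.div_add_mod k n
    have h2 : k % n < n := Nat.mod_lt _ (by omega)
    by_cases h : k % n = n - 1
    · left
      have h3 : k + 1 = n * (k / n + 1) := by rw [mul_add, mul_one]; omega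
      refine ⟨?_, h, ?_⟩
      · rw [h3, Nat.mul_mod_right]
      · conv_lhs => rw [h3]
        exact Nat.mul_div_cancel_left _ (by omega)
    · right
      have h3 : k + 1 = (k % n + 1) + n * (k / n) := by omega
      constructor
      · conv_lhs => rw [h3]
        rw [Nat.add_mul_mod_self_left, Nat.mod_eq_of_lt (by omega)]
      · conv_lhs => rw [h3]
        rw [Nat.add_mul_div_left _ _ (by omega), Nat.div_eq_of_lt (by omega), zero_add]
  have hθ' : StrictMono θ' := by
    refine strictMono_nat_of_lt_succ fun k => ?_
    rcases hr k with ⟨h1, h2, h3⟩ | ⟨h1, h2⟩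
    · have e1 : r (k + 1) = 0 := Fin.ext h1
      have e2 : r k = Fin.last _ := Fin.ext h2
      simp only [θ', e1, e2, h3]
      push_cast
      linarith
    · simp only [θ', h2]
      have : r k < r (k + 1) := Fin.lt_def.2 (by simp only [r]; omega)
      linarith [hθ this]
  have hper : ∀ k, e' (k + n) = e' k ∧ θ' (k + n) = θ' k + 2 * Real.pi := by
    intro k
    have e1 : r (k + n) = r k := Fin.ext (by simp [r])
    simp only [e', θ', e1, Nat.add_div_right k (by omega : 0 < n)]
    refine ⟨trivial, ?_⟩
    push_cast
    ring
  have hnext : ∀ k, G.tgt (e' k) = G.src (e' (k + 1)) := by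
    intro k
    have : r (k + 1) = r k + 1 := by
      refine Fin.ext ?_
      rw [Fin.val_add_one]
      rcases hr k with ⟨h1, h2, -⟩ | ⟨h1, -⟩
      · rw [if_pos (Fin.ext h2)]
        exact h1
      · rw [if_neg]
        · exact h1
        · intro hc
          have h3 := congrArg Fin.val hc
          have h4 : (k + 1) % n < n := Nat.mod_lt _ (by omega)
          simp only [r, Fin.val_last] at h3
          omega
    simp only [e', this]
    exact htgt _
  have hvec' : ∀ k, G.vec (e' k) = c (r k) • (Real.cos (θ' k), Real.sin (θ' k)) := by
    intro k
    have := (mul_comm (2 * Real.pi) ((k / n : ℕ) : ℝ))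
    simp only [e', θ', hvec, this, Real.cos_add_nat_mul_two_pi, Real.sin_add_nat_mul_two_pi]
  have hsum : ∀ i j, i ≤ j → G.pos (G.src (e' j)) - G.pos (G.src (e' i)) =
      ∑ k ∈ Finset.Ico i j, G.vec (e' k) := by
    intro i j hij
    induction j, hij using Nat.le_induction with
    | base => simp
    | succ j hij ih =>
      rw [Finset.sum_Ico_succ_top hij, ← ih, vec, hnext]
      abel
  have hne : ∀ i j, i < j → θ' (j - 1) - θ' i < Real.pi → G.src (e' j) ≠ G.src (e' i) := by
    intro i j hij hlt heq
    have h0 := hsum i j hij.le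
    rw [heq, sub_self] at h0
    set φ := (θ' (j - 1) + θ' i) / 2
    have h1 : 0 < ∑ k ∈ Finset.Ico i j, c (r k) * Real.cos (θ' k - φ) := by
      refine Finset.sum_pos (fun k hk => ?_) ⟨i, Finset.mem_Ico.2 ⟨le_rfl, hij⟩⟩
      obtain ⟨h2, h3⟩ := Finset.mem_Ico.1 hk
      have h4 := hθ'.monotone h2
      have h5 := hθ'.monotone (by omega : k ≤ j - 1)
      refine mul_pos (hc _) (Real.cos_pos_of_mem_Ioo ⟨?_, ?_⟩) <;> simp only [φ] <;> linarith
    have h6 : ∑ k ∈ Finset.Ico i j, c (r k) * Real.cos (θ' k - φ) =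
        (∑ k ∈ Finset.Ico i j, G.vec (e' k)).1 * Real.cos φ +
        (∑ k ∈ Finset.Ico i j, G.vec (e' k)).2 * Real.sin φ := by
      rw [Prod.fst_sum, Prod.snd_sum, Finset.sum_mul, Finset.sum_mul, ← Finset.sum_add_distrib]
      refine Finset.sum_congr rfl fun k _ => ?_
      rw [hvec', Real.cos_sub]
      simp only [Prod.smul_mk, smul_eq_mul]
      ring
    rw [h6, ← h0] at h1
    simp at h1
  have hinj : ∀ i j, i < j → j < i + n → G.src (e' j) ≠ G.src (e' i) := by
    intro i j hij hji
    by_cases hlt : θ' (j - 1) - θ' i < Real.pi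
    · exact hne i j hij hlt
    · have h1 := hne j (i + n) hji (by
        have h2 := hθ' (by omega : j - 1 < j)
        have h3 := hθ' (by omega : i + n - 1 < i + n)
        rw [(hper i).2] at h3
        linarith)
      rw [(hper i).1] at h1
      exact h1.symm
  have hside : ∀ i j, i ≤ j → j < i + n → 0 ≤ G.side (e' i) (G.pos (G.src (e' j))) := by
    intro i j hij hji
    have hval : ∀ j, i ≤ j → G.side (e' i) (G.pos (G.src (e' j))) =
        ∑ k ∈ Finset.Ico i j, c (r i) * c (r k) * Real.sin (θ' k - θ' i) := by
      intro j hij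
      rw [side, hsum i j hij]
      have : planeDet (G.vec (e' i)) (∑ k ∈ Finset.Ico i j, G.vec (e' k)) =
          ∑ k ∈ Finset.Ico i j, planeDet (G.vec (e' i)) (G.vec (e' k)) := by
        simp only [planeDet, Prod.fst_sum, Prod.snd_sum, Finset.mul_sum, Finset.sum_sub_distrib]
      rw [this]
      exact Finset.sum_congr rfl fun k _ => by rw [hvec', hvec', planeDet_cos_sin]
    by_cases hle : ∀ k ∈ Finset.Ico i j, θ' k - θ' i ≤ Real.pi
    · rw [hval j hij]
      refine Finset.sum_nonneg fun k hk => mul_nonneg (mul_pos (hc _) (hc _)).le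
        (Real.sin_nonneg_of_nonneg_of_le_pi ?_ (hle k hk))
      linarith [hθ'.monotone (Finset.mem_Ico.1 hk).1]
    · push Not at hle
      obtain ⟨k₀, hk₀, hlt⟩ := hle
      have htot := hval (i + n) (by omega)
      rw [(hper i).1, side_src, ← Finset.sum_Ico_consecutive _ hij hji.le, ← hval j hij] at htot
      have hrest : ∑ k ∈ Finset.Ico j (i + n), c (r i) * c (r k) * Real.sin (θ' k - θ' i) ≤ 0 := by
        refine Finset.sum_nonpos fun k hk => mul_nonpos_of_nonneg_of_nonpos
          (mul_pos (hc _) (hc _)).le ?_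
        obtain ⟨h1, h2⟩ := Finset.mem_Ico.1 hk
        have h3 := hθ'.monotone ((Finset.mem_Ico.1 hk₀).2.le.trans h1)
        have h4 := hθ' h2
        rw [(hper i).2] at h4
        rw [← Real.sin_sub_two_pi]
        exact Real.sin_nonpos_of_nonpos_of_neg_pi_le (by linarith) (by linarith)
      linarith
  have hmem : ∀ a, a ∈ Finset.univ.image e ↔ ∃ k < n, e' k = a := by
    intro a
    simp only [Finset.mem_image, Finset.mem_univ, true_and]
    constructor
    · rintro ⟨i, rfl⟩
      exact ⟨i, i.2, congrArg e (Fin.ext (Nat.mod_eq_of_lt i.2))⟩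
    · rintro ⟨k, -, rfl⟩
      exact ⟨_, rfl⟩
  refine ⟨⟨e 0, Finset.mem_image_of_mem _ (Finset.mem_univ _)⟩, ?_, ?_, ?_, ?_⟩
  · intro a ha
    obtain ⟨i, -, rfl⟩ := Finset.mem_image.1 ha
    exact ⟨_, Finset.mem_image_of_mem _ (Finset.mem_univ (i + 1)), (htgt i).symm⟩
  · intro a ha b hb hab
    obtain ⟨i, hi, rfl⟩ := (hmem a).1 ha
    obtain ⟨j, hj, rfl⟩ := (hmem b).1 hb
    rcases lt_trichotomy i j with h | h | h
    · exact absurd hab.symm (hinj i j h (by omega))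
    · rw [h]
    · exact absurd hab (hinj j i h (by omega))
  · intro a ha b hb
    obtain ⟨i, hi, rfl⟩ := (hmem a).1 ha
    obtain ⟨j, hj, rfl⟩ := (hmem b).1 hb
    rcases le_or_gt i j with h | h
    · exact hside i j h (by omega)
    · rw [← (hper j).1]
      exact hside i (j + n) (by omega) (by omega)
  · intro a ha b hb hab hba
    obtain ⟨i, hi, rfl⟩ := (hmem a).1 ha
    obtain ⟨j, hj, rfl⟩ := (hmem b).1 hb
    have hb' : e' j = e' (i + 1) := by
      rw [hnext] at hab
      by_contra hne'
      rcases lt_trichotomy j (i + 1) with h | h | h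
      · exact hinj j (i + 1) h (by
          by_contra hlt
          have : i + 1 = j + n := by omega
          exact hne' (by rw [this, (hper j).1])) hab.symm
      · exact hne' (by rw [h])
      · exact hinj (i + 1) j h (by omega) hab
    rw [hb', hnext] at hba
    exact hinj i (i + 1 + 1) (by omega) (by omega) hba

namespace IsFrame

variable (hU : G.IsFrame U)
include hU

theorem three_le_card : 3 ≤ U.card := by
  obtain ⟨e, he⟩ := hU.nonempty
  obtain ⟨e₁, h1, h2⟩ := hU.exists_next e he
  obtain ⟨e₂, h3, h4⟩ := hU.exists_next e₁ h1
  refine Finset.two_lt_card.2 ⟨e, he, e₁, h1, e₂, h3, ?_, ?_, ?_⟩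
  · rintro rfl; exact G.src_ne_tgt _ h2
  · rintro rfl; exact hU.no_digon e he e₁ h1 h2 h4.symm
  · rintro rfl; exact G.src_ne_tgt _ h4

/-- No edge has a direction strictly between those of two consecutive edges. -/
theorem not_between {e e' f : E} (he : e ∈ U) (he' : e' ∈ U) (h : G.src e' = G.tgt e)
    (hf : f ∈ U) (h1 : 0 < planeDet (G.vec e) (G.vec f)) (h2 : 0 < planeDet (G.vec f) (G.vec e')) :
    False := by
  obtain ⟨f', hf', hff'⟩ := hU.exists_next f hf
  -- On the cone of the corner, the side functional of an edge with a direction strictly between is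
  -- least at the corner alone. But it vanishes at both ends of that edge.
  have key : ∀ e₁ ∈ U, G.side f (G.pos (G.src e₁)) = 0 → G.src e₁ = G.src e' := by
    intro e₁ he₁ h0
    obtain ⟨x, y, hx, hy, hxy⟩ := hU.corner_cone he he' h he₁
    have h3 := G.side_sub_side f (G.pos (G.src e')) (G.pos (G.src e₁))
    have h4 : planeDet (G.vec f) (y • G.vec e' - x • G.vec e) =
        y * planeDet (G.vec f) (G.vec e') + x * planeDet (G.vec e) (G.vec f) := by
      simp only [planeDet, Prod.fst_sub, Prod.snd_sub, Prod.smul_fst, Prod.smul_snd, smul_eq_mul]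
      ring
    have h5 := hU.side_nonneg f hf e' he'
    rw [hxy, h4, h0] at h3
    have h6 : 0 ≤ y * planeDet (G.vec f) (G.vec e') := mul_nonneg hy h2.le
    have h7 : 0 ≤ x * planeDet (G.vec e) (G.vec f) := mul_nonneg hx h1.le
    have h8 : y = 0 := (mul_eq_zero.1 (by linarith : y * planeDet (G.vec f) (G.vec e') = 0)
      ).resolve_right h2.ne'
    have h9 : x = 0 := (mul_eq_zero.1 (by linarith : x * planeDet (G.vec e) (G.vec f) = 0)
      ).resolve_right h1.ne'
    rw [h8, h9, zero_smul, zero_smul, sub_zero, sub_eq_zero] at hxy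
    exact G.pos_injective hxy
  have k1 := key f hf (G.side_src f)
  have k2 := key f' hf' (by rw [hff']; exact G.side_tgt f)
  exact G.src_ne_tgt f (by rw [k1, ← k2, hff'])

theorem eq_of_parallel_edges {e f : E} (he : e ∈ U) (hf : f ∈ U) {t : ℝ} (ht : 0 < t)
    (h : G.vec f = t • G.vec e) : e = f := by
  have h1 := hU.side_nonneg e he f hf
  have h2 := hU.side_nonneg f hf e he
  have h3 : G.side f (G.pos (G.src e)) = -(t * G.side e (G.pos (G.src f))) := by
    simp only [side, h, planeDet, Prod.fst_sub, Prod.snd_sub, Prod.smul_fst, Prod.smul_snd,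
      smul_eq_mul]
    ring
  have h4 : G.side e (G.pos (G.src f)) = 0 := by
    by_contra hne
    have := mul_pos ht (h1.lt_of_ne (Ne.symm hne))
    linarith
  rcases G.side_eq_zero h4 with h5 | h5
  · exact hU.src_inj e he f hf h5.symm
  · have := hU.turn he hf h5
    rw [h] at this
    simp [planeDet, mul_comm, mul_left_comm] at this

/-- The edges are sorted by their angles in one turn. The successor of an edge makes a left turn of
less than `π` with no edge direction in between, so it is the next one in this order; a successor
with a smaller angle occurs only from the last edge to the first. -/
theorem exists_cyclic {θ c : E → ℝ} (hc : ∀ e, 0 < c e)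
    (hvec : ∀ e, G.vec e = c e • (Real.cos (θ e), Real.sin (θ e)))
    (hθ : ∀ e, θ e ∈ Set.Ioc (-Real.pi) Real.pi) :
    ∃ (N : ℕ) (e : Fin (N + 3) → E), StrictMono (θ ∘ e) ∧
      (∀ i, G.tgt (e i) = G.src (e (i + 1))) ∧ ∀ a, a ∈ U ↔ a ∈ Set.range e := by
  have hpi := Real.pi_pos
  have hinj : Set.InjOn θ U := by
    intro e he f hf h
    refine hU.eq_of_parallel_edges he hf (t := c f / c e) (div_pos (hc f) (hc e)) ?_
    rw [hvec, hvec e, h, smul_smul, div_mul_cancel₀ _ (hc e).ne']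
  obtain ⟨N, hN⟩ : ∃ N, N + 3 = U.card := ⟨U.card - 3, by have := hU.three_le_card; omega⟩
  have hcard : (U.image θ).card = N + 3 := by rw [Finset.card_image_of_injOn hinj, hN]
  have hex : ∀ i, ∃ e ∈ U, θ e = (U.image θ).orderEmbOfFin hcard i := fun i =>
    Finset.mem_image.1 (Finset.orderEmbOfFin_mem _ hcard i)
  choose e heU he using hex
  have hmono : StrictMono (θ ∘ e) := fun i j hij => by
    simp only [Function.comp_apply, he]
    exact ((U.image θ).orderEmbOfFin hcard).strictMono hij
  have hsurj : ∀ a ∈ U, ∃ i, e i = a := by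
    intro a ha
    have : θ a ∈ Set.range ((U.image θ).orderEmbOfFin hcard) := by
      rw [Finset.range_orderEmbOfFin]
      exact Finset.mem_coe.2 (Finset.mem_image_of_mem θ ha)
    obtain ⟨i, hi⟩ := this
    exact ⟨i, hinj (heU i) ha (by rw [he, hi])⟩
  refine ⟨N, e, hmono, fun i => ?_, fun a => ⟨hsurj a, fun ⟨i, hi⟩ => hi ▸ heU i⟩⟩
  obtain ⟨e', he', hnext⟩ := hU.exists_next (e i) (heU i)
  obtain ⟨j, rfl⟩ := hsurj e' he'
  rw [← hnext]
  have hdet : ∀ a b, planeDet (G.vec a) (G.vec b) = c a * c b * Real.sin (θ b - θ a) := by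
    intro a b; rw [hvec, hvec b, planeDet_cos_sin]
  have hpos : ∀ a b, 0 < Real.sin (θ b - θ a) → 0 < planeDet (G.vec a) (G.vec b) := fun a b h => by
    rw [hdet]; exact mul_pos (mul_pos (hc a) (hc b)) h
  have hturn : 0 < Real.sin (θ (e j) - θ (e i)) := by
    have := hU.turn (heU i) (heU j) hnext
    rw [hdet] at this
    exact pos_of_mul_pos_right this (mul_pos (hc _) (hc _)).le
  have hnb : ∀ k, 0 < Real.sin (θ (e k) - θ (e i)) → 0 < Real.sin (θ (e j) - θ (e k)) → False :=
    fun k h1 h2 => hU.not_between (heU i) (heU j) hnext (heU k) (hpos _ _ h1) (hpos _ _ h2)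
  obtain ⟨a1, a2⟩ := hθ (e i)
  obtain ⟨b1, b2⟩ := hθ (e j)
  suffices hj : j = i + 1 by rw [hj]
  rcases lt_trichotomy i j with hij | hij | hij
  · have hlt : θ (e i) < θ (e j) := hmono hij
    have hπ : θ (e j) - θ (e i) < Real.pi := by
      by_contra hc'
      rw [not_lt] at hc'
      rw [← Real.sin_sub_two_pi] at hturn
      exact hturn.not_ge (Real.sin_nonpos_of_nonpos_of_neg_pi_le (by linarith) (by linarith))
    by_contra hne
    have h1 : (i : ℕ) + 1 < j := by
      have h2 : (i : ℕ) < j := hij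
      refine lt_of_le_of_ne h2 fun h3 => hne (Fin.ext ?_)
      rw [Fin.val_add_one_of_lt (hij.trans_le (Fin.le_last j)), h3]
    have h3 : θ (e i) < θ (e ⟨i + 1, by omega⟩) := hmono (Fin.lt_def.2 (by simp))
    have h4 : θ (e ⟨i + 1, by omega⟩) < θ (e j) := hmono (Fin.lt_def.2 h1)
    exact hnb _ (Real.sin_pos_of_pos_of_lt_pi (by linarith) (by linarith))
      (Real.sin_pos_of_pos_of_lt_pi (by linarith) (by linarith))
  · rw [hij, sub_self, Real.sin_zero] at hturn
    exact absurd hturn (lt_irrefl _)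
  · have hlt : θ (e j) < θ (e i) := hmono hij
    have hπ : θ (e j) - θ (e i) < -Real.pi := by
      by_contra hc'
      rw [not_lt] at hc'
      exact hturn.not_ge (Real.sin_nonpos_of_nonpos_of_neg_pi_le (by linarith) hc')
    have hi : i = Fin.last _ := by
      by_contra hne
      have h1 := Fin.lt_last_iff_ne_last.2 hne
      have h2 : θ (e i) < θ (e (Fin.last _)) := hmono h1
      obtain ⟨c1, c2⟩ := hθ (e (Fin.last _))
      refine hnb (Fin.last _) (Real.sin_pos_of_pos_of_lt_pi (by linarith) (by linarith)) ?_
      rw [← Real.sin_add_two_pi]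
      exact Real.sin_pos_of_pos_of_lt_pi (by linarith) (by linarith)
    have hj : j = 0 := by
      by_contra hne
      have h1 := Fin.pos_iff_ne_zero.2 hne
      have h2 : θ (e 0) < θ (e j) := hmono h1
      obtain ⟨c1, c2⟩ := hθ (e 0)
      refine hnb 0 ?_ (Real.sin_pos_of_pos_of_lt_pi (by linarith) (by linarith))
      rw [← Real.sin_add_two_pi]
      exact Real.sin_pos_of_pos_of_lt_pi (by linarith) (by linarith)
    rw [hi, hj, Fin.last_add_one]

/-- The polygon of a frame is the convex hull of its vertices. -/
theorem convexHull_eq : convexHull ℝ ((fun e => G.pos (G.src e)) '' (U : Set E)) =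
    {q | ∀ e ∈ U, 0 ≤ G.side e q} := by
  refine subset_antisymm (convexHull_min ?_ ?_) ?_
  · rintro _ ⟨e', he', rfl⟩ e he
    exact hU.side_nonneg e he e' he'
  · intro q hq q' hq' a b ha hb hab e he
    have h1 : G.side e (a • q + b • q') = a * G.side e q + b * G.side e q' := by
      have : a = 1 - b := by linarith
      subst this
      simp only [side, planeDet, Prod.fst_sub, Prod.snd_sub, Prod.fst_add, Prod.snd_add,
        Prod.smul_fst, Prod.smul_snd, smul_eq_mul]
      ring
    rw [h1]
    exact add_nonneg (mul_nonneg ha (hq e he)) (mul_nonneg hb (hq' e he))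
  · intro q hq
    by_contra hn
    have hfin : ((fun e => G.pos (G.src e)) '' (U : Set E)).Finite := U.finite_toSet.image _
    obtain ⟨u, s, h1, h2⟩ := geometric_hahn_banach_point_closed (convex_convexHull ℝ _)
      (hfin.isClosed_convexHull ℝ) hn
    -- A separating functional is smallest on the polygon at some vertex, and the point `q` lies in
    -- the cone of the corner there, where the functional is not smaller.
    obtain ⟨e', he', hmin⟩ := U.exists_min_image (fun e => u (G.pos (G.src e))) hU.nonempty
    obtain ⟨e, he, hprev⟩ := hU.exists_prev he'
    obtain ⟨e₂, he₂, hnext⟩ := hU.exists_next e' he'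
    have ht := hU.turn he he' hprev.symm
    have k1 : u (G.pos (G.src e')) ≤ u (G.pos (G.src e)) := hmin e he
    have k2 : u (G.pos (G.src e')) ≤ u (G.pos (G.src e₂)) := hmin e₂ he₂
    have h3 : 0 ≤ u (G.vec e') := by rw [vec, map_sub, ← hnext]; linarith
    have h4 : u (G.vec e) ≤ 0 := by rw [vec, map_sub, hprev]; linarith
    have p1 := hq e he
    have p2 := hq e' he'
    have h5 := planeDet_smul_eq (G.vec e) (G.vec e') (q - G.pos (G.src e'))
    have h6 : G.side e q = planeDet (G.vec e) (q - G.pos (G.src e')) := by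
      have := G.side_sub_side e (G.pos (G.src e')) q
      rw [← hprev, side_tgt, sub_zero] at this
      rw [this, hprev]
    have h7 : planeDet (q - G.pos (G.src e')) (G.vec e') = -G.side e' q := planeDet_swap _ _
    rw [← h6, h7] at h5
    have h8 := congrArg u h5
    simp only [map_smul, map_add, smul_eq_mul, map_sub] at h8
    have h9 : u (G.pos (G.src e')) ∈ Set.Ioi s :=
      h2 _ (subset_convexHull ℝ _ ⟨e', he', rfl⟩)
    have h10 : u q < s := h1
    have h11 : planeDet (G.vec e) (G.vec e') * (u q - u (G.pos (G.src e'))) < 0 :=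
      mul_neg_of_pos_of_neg ht (by linarith [Set.mem_Ioi.1 h9])
    have h12 := mul_nonneg p1 h3
    have h13 := mul_nonneg p2 (neg_nonneg.2 h4)
    linarith

end IsFrame

end PlaneGraph

end

/-! ### Tilings as subdivisions of polygons -/

noncomputable section

open scoped Classical

namespace PlaneGraph

variable {V E : Type*} {G : PlaneGraph V E} {𝒟 : Finset (Finset E)}

theorem subset_closed_polygon {U : Finset E} : G.inner U ⊆ interior {q | ∀ e ∈ U, 0 ≤ G.side e q} :=
  interior_maximal (fun _ hq e he => (hq e he).le) (G.isOpen_inner U)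

variable [Finite V]

/-- The pieces of a tiling cover the polygon of the boundary. -/
theorem IsTiling.iUnion_polygon (h : G.IsTiling 𝒟) :
    {q | ∀ e ∈ G.boundary 𝒟, 0 ≤ G.side e q} = ⋃ U ∈ 𝒟, {q | ∀ e ∈ U, 0 ≤ G.side e q} := by
  have hclosed : ∀ U : Finset E, IsClosed {q | ∀ e ∈ U, 0 ≤ G.side e q} := by
    intro U
    have : {q | ∀ e ∈ U, 0 ≤ G.side e q} = ⋂ e ∈ U, {q | 0 ≤ G.side e q} := by ext; simp
    rw [this]
    exact isClosed_biInter fun e _ => isClosed_le continuous_const (G.continuous_side e)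
  refine subset_antisymm (fun q hq => ?_) (Set.iUnion₂_subset fun U hU q hq e he =>
    h.side_boundary_nonneg hU ((h.frames U hU).mem_closure_inner _ hq) he)
  -- The union is closed, so it suffices to find its points near `q`. At a generic inner point of
  -- the boundary polygon the winding number is one, and some piece must contribute it.
  have hcl : IsClosed (⋃ U ∈ 𝒟, {q | ∀ e ∈ U, 0 ≤ G.side e q}) :=
    𝒟.finite_toSet.isClosed_biUnion fun U _ => hclosed U
  rw [← hcl.closure_eq, mem_closure_iff]
  intro O hO hqO
  obtain ⟨q₁, h1, h2⟩ := mem_closure_iff.1 (h.boundary.mem_closure_inner _ hq) O hO hqO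
  obtain ⟨q₂, ⟨h3, h4⟩, h5, h6⟩ := G.exists_generic_point (edgesOf 𝒟)
    (hO.inter (G.isOpen_inner _)) ⟨q₁, h1, h2⟩
  obtain ⟨u, -, hu⟩ := G.exists_generic_dir h6 isOpen_univ ⟨0, trivial⟩
  have hs := h.sum_inner h5 hu
  rw [if_pos h4] at hs
  obtain ⟨U, hU, hne⟩ := Finset.exists_ne_zero_of_sum_ne_zero (by rw [hs]; exact one_ne_zero)
  have : q₂ ∈ G.inner U := by
    by_contra hc
    exact hne (if_neg hc)
  exact ⟨q₂, h3, Set.mem_biUnion hU fun e he => (this e he).le⟩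

theorem IsTiling.disjoint_interior (h : G.IsTiling 𝒟) {U U' : Finset E} (hU : U ∈ 𝒟) (hU' : U' ∈ 𝒟)
    (hne : U ≠ U') : Disjoint (interior {q | ∀ e ∈ U, 0 ≤ G.side e q})
      (interior {q | ∀ e ∈ U', 0 ≤ G.side e q}) := by
  rw [Set.disjoint_iff_inter_eq_empty, ← Set.not_nonempty_iff_eq_empty]
  intro hnon
  obtain ⟨q, ⟨h1, h2⟩, h3, -⟩ := G.exists_generic_point (edgesOf 𝒟)
    (isOpen_interior.inter isOpen_interior) hnon
  refine hne (h.eq_of_mem_inner hU hU' (q := q) (fun e he => ?_) fun e he => ?_)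
  · exact (interior_subset h1 e he).lt_of_ne (h3 e (mem_edgesOf.2 ⟨U, hU, he⟩)).symm
  · exact (interior_subset h2 e he).lt_of_ne (h3 e (mem_edgesOf.2 ⟨U', hU', he⟩)).symm

end PlaneGraph

namespace TwoMorse

variable {m : ℕ} {M : Type*} [TopologicalSpace M] [ChartedSpace (EuclideanSpace ℝ (Fin m)) M]
  [IsManifold (𝓡 m) ∞ M] {T : TwoMorse m M}

/-! ### The plane graph of a system -/

/-- The critical points have different first coordinates, and no three are on a line. -/
structure InGeneralPosition (T : TwoMorse m M) : Prop where
  fst_ne : ∀ p q, p ≠ q → (T.pos p).1 ≠ (T.pos q).1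
  not_collinear : ∀ a b c, a ≠ b → a ≠ c → b ≠ c →
    planeDet (T.pos b - T.pos a) (T.pos c - T.pos a) ≠ 0

/-- The plane graph of the critical edges. -/
def planeGraph (h : T.InGeneralPosition) : PlaneGraph T.CriticalPoint T.OrientedEdge where
  pos := T.pos
  src := OrientedEdge.src
  tgt := OrientedEdge.tgt
  rev := OrientedEdge.rev
  rev_rev := OrientedEdge.rev_rev
  src_rev _ := rfl
  src_ne_tgt e he := by
    obtain ⟨c, hc, h⟩ := e.pos_tgt_sub
    rw [he, sub_self] at h
    have h1 := e.norm_dir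
    rcases smul_eq_zero.1 h.symm with h | h
    · exact hc.ne' h
    · rw [h] at h1; simp at h1
  fst_ne := h.fst_ne
  not_collinear := h.not_collinear

variable (h : T.InGeneralPosition)

theorem exists_vec_eq (e : T.OrientedEdge) : ∃ c : ℝ, 0 < c ∧ (planeGraph h).vec e = c • e.dir :=
  e.pos_tgt_sub

/-- The angle of the direction of an edge. -/
def OrientedEdge.angle (e : T.OrientedEdge) : ℝ := Complex.arg ⟨e.dir.1, e.dir.2⟩

theorem OrientedEdge.dir_eq (e : T.OrientedEdge) :
    e.dir = (Real.cos e.angle, Real.sin e.angle) := by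
  have h1 : ‖(⟨e.dir.1, e.dir.2⟩ : ℂ)‖ = 1 := by
    rw [← sq_eq_sq₀ (norm_nonneg _) zero_le_one, one_pow, ← e.norm_dir, Complex.sq_norm,
      Complex.normSq_apply]
    ring
  have h2 : (⟨e.dir.1, e.dir.2⟩ : ℂ) ≠ 0 := norm_ne_zero_iff.1 (by rw [h1]; exact one_ne_zero)
  rw [OrientedEdge.angle, Complex.cos_arg h2, Complex.sin_arg, h1]
  simp

theorem Frame.isFrame (f : T.Frame) : (planeGraph h).IsFrame f.edges := by
  obtain ⟨N, e, θ, h1, h2, h3, h4, h5⟩ := f.cyclic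
  choose c hc hvec using exists_vec_eq h
  have := PlaneGraph.isFrame_of_cyclic (G := planeGraph h) (e := e) h1 h2 (fun i => hc (e i))
    (fun i => by rw [hvec, h3]) h4
  convert this
  ext a
  simp [h5]

theorem exists_frame {U : Finset T.OrientedEdge} (hU : (planeGraph h).IsFrame U) :
    ∃ f : T.Frame, f.edges = U := by
  choose c hc hvec using exists_vec_eq h
  obtain ⟨N, e, h1, h2, h3⟩ := hU.exists_cyclic (θ := OrientedEdge.angle) hc
    (fun e => by rw [hvec, ← e.dir_eq]) fun e => Complex.arg_mem_Ioc _
  refine ⟨⟨U, N, e, _, h1, ?_, fun i => (e i).dir_eq, h2, h3⟩, rfl⟩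
  have h4 := Complex.arg_mem_Ioc ⟨(e (Fin.last _)).dir.1, (e (Fin.last _)).dir.2⟩
  have h5 := Complex.arg_mem_Ioc ⟨(e 0).dir.1, (e 0).dir.2⟩
  have h6 := h4.2
  have h7 := h5.1
  simp only [Function.comp_apply, OrientedEdge.angle]
  linarith

theorem Frame.polygon_eq (f : T.Frame) :
    f.polygon = {q | ∀ e ∈ f.edges, 0 ≤ (planeGraph h).side e q} :=
  (f.isFrame h).convexHull_eq

/-- The family of the edge sets. -/
def pieces {k : ℕ} (fs : Fin k → T.Frame) : Finset (Finset T.OrientedEdge) :=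
  Finset.univ.image fun i => (fs i).edges

theorem mem_pieces {k : ℕ} {fs : Fin k → T.Frame} {U : Finset T.OrientedEdge} :
    U ∈ pieces fs ↔ ∃ i, (fs i).edges = U := by simp [pieces]

theorem Frame.edges_injective : Function.Injective (Frame.edges : T.Frame → _) :=
  fun _ _ h => Frame.ext h

theorem card_pieces {k : ℕ} {fs : Fin k → T.Frame} (hfs : Function.Injective fs) :
    (pieces fs).card = k := by
  have := Finset.card_image_of_injective Finset.univ (Frame.edges_injective.comp hfs)
  rwa [Finset.card_univ, Fintype.card_fin] at this

theorem mem_edgesOf_pieces {k : ℕ} {fs : Fin k → T.Frame} {e : T.OrientedEdge} :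
    e ∈ PlaneGraph.edgesOf (pieces fs) ↔ ∃ i, e ∈ (fs i).edges := by
  rw [PlaneGraph.mem_edgesOf]
  constructor
  · rintro ⟨U, hU, he⟩
    obtain ⟨i, rfl⟩ := mem_pieces.1 hU
    exact ⟨i, he⟩
  · rintro ⟨i, hi⟩
    exact ⟨_, mem_pieces.2 ⟨i, rfl⟩, hi⟩

theorem mem_boundary_pieces {k : ℕ} {fs : Fin k → T.Frame} {e : T.OrientedEdge} :
    e ∈ (planeGraph h).boundary (pieces fs) ↔
      (∃ i, e ∈ (fs i).edges) ∧ ∀ j, e.rev ∉ (fs j).edges := by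
  rw [PlaneGraph.mem_boundary, mem_edgesOf_pieces, mem_edgesOf_pieces, not_exists]
  rfl

/-- Frames have nonempty interior and two frames with a common edge overlap next to it, so disjoint
interiors give distinct pieces without shared oriented edges. Conversely, covering and disjointness
follow from the winding numbers. -/
theorem isSubdivision_iff [Finite T.CriticalPoint] {k : ℕ} {f : T.Frame} {fs : Fin k → T.Frame} :
    IsSubdivision f fs ↔ Function.Injective fs ∧ (planeGraph h).IsTiling (pieces fs) ∧
      (planeGraph h).boundary (pieces fs) = f.edges := by
  constructor
  · intro hs
    have hb : (planeGraph h).boundary (pieces fs) = f.edges := by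
      ext e
      rw [mem_boundary_pieces, hs.edges]
    have hov : ∀ i j, ((planeGraph h).inner (fs i).edges ∩
        (planeGraph h).inner (fs j).edges).Nonempty → i = j := by
      rintro i j ⟨q, h1, h2⟩
      by_contra hne
      have h3 := hs.disjoint i j hne
      rw [Frame.polygon_eq h, Frame.polygon_eq h] at h3
      exact Set.disjoint_left.1 h3 (PlaneGraph.subset_closed_polygon h1)
        (PlaneGraph.subset_closed_polygon h2)
    refine ⟨fun i j hij => hov i j ?_, ⟨?_, ?_, hb ▸ f.isFrame h⟩, hb⟩
    · rw [hij, Set.inter_self]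
      exact ((fs j).isFrame h).inner_nonempty
    · intro U hU
      obtain ⟨i, rfl⟩ := mem_pieces.1 hU
      exact (fs i).isFrame h
    · intro U hU U' hU' e he he'
      obtain ⟨i, rfl⟩ := mem_pieces.1 hU
      obtain ⟨j, rfl⟩ := mem_pieces.1 hU'
      rw [hov i j (PlaneGraph.exists_mem_inner_of_parallel ((fs i).isFrame h) ((fs j).isFrame h)
        he he' rfl rfl)]
  · rintro ⟨hfs, ht, hb⟩
    refine ⟨?_, fun i j hij => ?_, fun e => ?_⟩
    · rw [Frame.polygon_eq h, ← hb, ht.iUnion_polygon]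
      ext q
      simp only [Set.mem_iUnion, Frame.polygon_eq h, Set.mem_ofPred_eq, mem_pieces, exists_prop]
      constructor
      · rintro ⟨_, ⟨i, rfl⟩, hq⟩
        exact ⟨i, hq⟩
      · rintro ⟨i, hq⟩
        exact ⟨_, ⟨i, rfl⟩, hq⟩
    · rw [Frame.polygon_eq h, Frame.polygon_eq h]
      exact ht.disjoint_interior (mem_pieces.2 ⟨i, rfl⟩) (mem_pieces.2 ⟨j, rfl⟩)
        fun hc => hij (hfs (Frame.edges_injective hc))
    · rw [← hb, mem_boundary_pieces]

/-- A quarter turn takes the normal of an edge to its direction. -/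
theorem exists_isDualWeb_iff {k : ℕ} {fs : Fin k → T.Frame} (hfs : Function.Injective fs) :
    (∃ x, IsDualWeb fs x) ↔ ∃ x, (planeGraph h).IsWeb (pieces fs) x := by
  have hinj := Frame.edges_injective.comp hfs
  constructor
  · rintro ⟨x, hx⟩
    refine ⟨fun U => if hU : ∃ i, (fs i).edges = U then
      (-(x hU.choose).2, (x hU.choose).1) else 0, ?_⟩
    have hval : ∀ i, (if hU : ∃ j, (fs j).edges = (fs i).edges then
        (-(x hU.choose).2, (x hU.choose).1) else (0 : ℝ × ℝ)) = (-(x i).2, (x i).1) := by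
      intro i
      have hU : ∃ j, (fs j).edges = (fs i).edges := ⟨i, rfl⟩
      rw [dif_pos hU, hinj hU.choose_spec]
    intro U hU U' hU' e he he'
    obtain ⟨i, rfl⟩ := mem_pieces.1 hU
    obtain ⟨j, rfl⟩ := mem_pieces.1 hU'
    obtain ⟨t, ht, hxt⟩ := hx i j e he he'
    obtain ⟨c, hc, hvec⟩ := exists_vec_eq h e
    refine ⟨t / c, div_pos ht hc, ?_⟩
    simp only [hval]
    rw [hvec, smul_smul, div_mul_cancel₀ _ hc.ne']
    have h1 := congrArg Prod.fst hxt
    have h2 := congrArg Prod.snd hxt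
    simp only [Prod.fst_sub, Prod.snd_sub, Prod.smul_fst, Prod.smul_snd, smul_eq_mul] at h1 h2
    refine Prod.ext ?_ ?_ <;>
      simp only [Prod.fst_sub, Prod.snd_sub, Prod.smul_fst, Prod.smul_snd, smul_eq_mul] <;> linarith
  · rintro ⟨x, hx⟩
    refine ⟨fun i => ((x (fs i).edges).2, -(x (fs i).edges).1), fun i j e he he' => ?_⟩
    obtain ⟨t, ht, hxt⟩ := hx _ (mem_pieces.2 ⟨i, rfl⟩) _ (mem_pieces.2 ⟨j, rfl⟩) e he he'
    obtain ⟨c, hc, hvec⟩ := exists_vec_eq h e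
    refine ⟨t * c, mul_pos ht hc, ?_⟩
    rw [hvec, smul_smul] at hxt
    have h1 := congrArg Prod.fst hxt
    have h2 := congrArg Prod.snd hxt
    simp only [Prod.fst_sub, Prod.snd_sub, Prod.smul_fst, Prod.smul_snd, smul_eq_mul] at h1 h2
    refine Prod.ext ?_ ?_ <;>
      simp only [Prod.fst_sub, Prod.snd_sub, Prod.smul_fst, Prod.smul_snd, smul_eq_mul] <;> linarith

/-- A carrier determines the edge up to reversal, and `halfInternal` contains one orientation of
each internal edge. -/
theorem two_mul_internalEdgeCount [T2Space M] {k : ℕ} (fs : Fin k → T.Frame) :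
    2 * internalEdgeCount fs = ((planeGraph h).internal (pieces fs)).card := by
  rw [← PlaneGraph.card_halfInternal, internalEdgeCount]
  congr 1
  have hinj : Set.InjOn OrientedEdge.carrier
      ((planeGraph h).halfInternal (pieces fs) : Set T.OrientedEdge) := by
    intro e he e' he' hc
    rcases OrientedEdge.eq_or_eq_rev_of_carrier hc with h1 | h1
    · exact h1.symm
    · subst h1
      exact absurd he' (PlaneGraph.rev_notMem_halfInternal he)
  rw [← Finset.card_image_of_injOn hinj, ← Set.ncard_coe_finset]
  congr 1
  ext c
  simp only [Set.mem_ofPred_eq, Finset.coe_image, Set.mem_image, Finset.mem_coe]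
  constructor
  · rintro ⟨i, j, e, he, he', rfl⟩
    have hi : e ∈ (planeGraph h).internal (pieces fs) :=
      PlaneGraph.mem_internal.2 ⟨mem_edgesOf_pieces.2 ⟨i, he⟩, mem_edgesOf_pieces.2 ⟨j, he'⟩⟩
    by_cases hh : e ∈ (planeGraph h).halfInternal (pieces fs)
    · exact ⟨e, hh, rfl⟩
    · exact ⟨e.rev, PlaneGraph.rev_mem_halfInternal hi hh, rfl⟩
  · rintro ⟨e, he, rfl⟩
    obtain ⟨h1, h2⟩ := PlaneGraph.mem_internal.1 (PlaneGraph.halfInternal_subset he)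
    obtain ⟨i, hi⟩ := mem_edgesOf_pieces.1 h1
    obtain ⟨j, hj⟩ := mem_edgesOf_pieces.1 h2
    exact ⟨i, j, e, hi, hj, rfl⟩

/-- The decompositions of a frame in terms of the plane graph. -/
theorem isWebDecomposition_iff [T2Space M] [Finite T.CriticalPoint] {k : ℕ} {f : T.Frame}
    {fs : Fin k → T.Frame} : IsWebDecomposition f fs ↔ Function.Injective fs ∧
      (planeGraph h).IsDec (pieces fs) ∧ (planeGraph h).boundary (pieces fs) = f.edges := by
  have hcount := two_mul_internalEdgeCount h fs
  have hcodim : Function.Injective fs → (expectedCodim fs = 1 ↔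
      ((planeGraph h).internal (pieces fs)).card + 6 = 4 * (pieces fs).card) := by
    intro hfs
    rw [card_pieces hfs, expectedCodim]
    omega
  constructor
  · rintro ⟨h1, h2, h3⟩
    obtain ⟨hfs, ht, hb⟩ := (isSubdivision_iff h).1 h1
    exact ⟨hfs, ⟨ht, (exists_isDualWeb_iff h hfs).1 h2, (hcodim hfs).1 h3⟩, hb⟩
  · rintro ⟨hfs, ⟨ht, hw, hc⟩, hb⟩
    exact ⟨(isSubdivision_iff h).2 ⟨hfs, ht, hb⟩, (exists_isDualWeb_iff h hfs).2 hw,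
      (hcodim hfs).2 hc⟩

end TwoMorse

end

noncomputable section

open scoped Classical

/-! ### Counting characters in half-planes -/

/-- Counts the vectors `y` up to the half-plane to the left of `x`, starting from the downward
direction. -/
def IsCounted (x y : ℝ × ℝ) : Prop :=
  if x.1 < 0 then 0 < y.1 ∧ 0 ≤ planeDet x y else 0 < y.1 ∨ 0 ≤ planeDet x y

theorem inCone_iff {x y z : ℝ × ℝ} (h : 0 < planeDet x y) :
    InCone y (-x) z ↔ 0 ≤ planeDet x z ∧ 0 ≤ planeDet y z := by
  constructor
  · rintro ⟨s, t, hs, ht, rfl⟩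
    have e1 : planeDet x (s • y + t • -x) = s * planeDet x y := by
      simp only [planeDet, Prod.fst_add, Prod.snd_add, Prod.smul_fst, Prod.smul_snd, smul_eq_mul,
        Prod.fst_neg, Prod.snd_neg]; ring
    have e2 : planeDet y (s • y + t • -x) = t * planeDet x y := by
      simp only [planeDet, Prod.fst_add, Prod.snd_add, Prod.smul_fst, Prod.smul_snd, smul_eq_mul,
        Prod.fst_neg, Prod.snd_neg]; ring
    rw [e1, e2]
    exact ⟨mul_nonneg hs h.le, mul_nonneg ht h.le⟩
  · rintro ⟨h1, h2⟩
    refine ⟨planeDet x z / planeDet x y, planeDet y z / planeDet x y, div_nonneg h1 h.le,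
      div_nonneg h2 h.le, ?_⟩
    refine Prod.ext ?_ ?_ <;>
      simp only [Prod.fst_add, Prod.snd_add, Prod.smul_fst, Prod.smul_snd, smul_eq_mul,
        Prod.fst_neg, Prod.snd_neg, mul_neg] <;>
      rw [div_mul_eq_mul_div, div_mul_eq_mul_div, ← sub_eq_add_neg, ← sub_div, eq_div_iff h.ne'] <;>
      simp only [planeDet] <;> ring

theorem pos_of_det {A B D a b l : ℝ} (h : 0 < D) (key : D * l = A * a - B * b)
    (hAB : A = 0 → B ≠ 0) (hb : b < 0) (ha : 0 < a) (hA : 0 ≤ A) (hB : 0 ≤ B) : 0 < l := by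
  refine pos_of_mul_pos_right (a := D) ?_ h.le
  rw [key]
  rcases hA.eq_or_lt with h0 | h0
  · have hB' := hB.lt_of_ne (hAB h0.symm).symm
    nlinarith [mul_pos hB' (neg_pos.2 hb), mul_nonneg hA ha.le]
  · nlinarith [mul_nonneg hB (neg_pos.2 hb).le, mul_pos h0 ha]

/-- The counted vectors have angles from the downward vertical up to the ray opposite to the
direction. Turning the direction from `x` to `y` sweeps the vectors on the left side; when the
direction passes the upward vertical the count falls from everything to nothing, which the last term
repairs. -/
theorem isCounted_sub {x y z : ℝ × ℝ} (h : 0 < planeDet x y) (hx : x.1 ≠ 0) (hy : y.1 ≠ 0)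
    (hz : z ≠ 0) : (if 0 ≤ planeDet y z ∧ planeDet x z < 0 then (1 : ℤ) else 0) =
      (if IsCounted y z then 1 else 0) - (if IsCounted x z then 1 else 0) +
        if 0 < x.1 ∧ y.1 < 0 then 1 else 0 := by
  have key : planeDet x y * z.1 = planeDet x z * y.1 - planeDet y z * x.1 := by
    simp only [planeDet]; ring
  have key2 : planeDet x y * z.2 = planeDet x z * y.2 - planeDet y z * x.2 := by
    simp only [planeDet]; ring
  have hAB : planeDet x z = 0 → planeDet y z ≠ 0 := by
    intro h1 h2
    rw [h1, h2, zero_mul, zero_mul, sub_zero] at key key2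
    exact hz (Prod.ext ((mul_eq_zero.1 key).resolve_left h.ne')
      ((mul_eq_zero.1 key2).resolve_left h.ne'))
  have hpos := pos_of_det h key hAB
  clear key2 hAB hz
  have hlt : planeDet x z < 0 ↔ ¬0 ≤ planeDet x z := not_le.symm
  simp only [IsCounted, hlt]
  rcases lt_or_gt_of_ne hx with hb | hb <;> rcases lt_or_gt_of_ne hy with ha | ha <;>
    by_cases hA : 0 ≤ planeDet x z <;> by_cases hB : 0 ≤ planeDet y z <;>
    by_cases hl : 0 < z.1 <;> simp [hb, ha, hA, hB, hl, hb.not_gt, ha.not_gt]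
  all_goals
    try rw [not_lt] at hl
    try rw [not_le] at hA
    try rw [not_le] at hB
    first
    | exact absurd (hpos hb ha hA hB) hl.not_gt
    | nlinarith [mul_pos h hl, mul_nonneg hA (neg_pos.2 ha).le, mul_nonneg hA ha.le]
    | nlinarith

namespace TwoMorse

variable {m : ℕ} {M : Type*} [TopologicalSpace M] [ChartedSpace (EuclideanSpace ℝ (Fin m)) M]
  [IsManifold (𝓡 m) ∞ M] {T : TwoMorse m M}

/-- The number of counted characters. -/
def weightCount (p : T.CriticalPoint) (d : ℝ × ℝ) : ℤ :=
  ∑ i, if IsCounted d (T.weight p i) then 1 else 0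

/-- A normal character contributes `-1` if it is weakly left of the leaving edge and strictly right
of the arriving one, and nothing otherwise. The excluded characters on the rays of the edges do not
satisfy this condition, so the sum may run over all characters and is a difference of counts for the
two edges. -/
theorem corner_eq {e e' : T.OrientedEdge} (h : e.tgt = e'.src) (ht : 0 < planeDet e.dir e'.dir)
    (h1 : e.dir.1 ≠ 0) (h2 : e'.dir.1 ≠ 0) :
    ((((normalWeights e e').filter
        fun i => InCone e'.dir (-e.dir) (T.weight e'.src i)).card : ℤ) -
      (((normalWeights e e').filter
        fun i => 0 ≤ planeDet e'.dir (T.weight e'.src i)).card : ℤ)) =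
      weightCount e.tgt e.dir - weightCount e'.src e'.dir -
        if 0 < e.dir.1 ∧ e'.dir.1 < 0 then (m : ℤ) else 0 := by
  have hm : (if 0 < e.dir.1 ∧ e'.dir.1 < 0 then (m : ℤ) else 0) =
      ∑ _i : Fin m, if 0 < e.dir.1 ∧ e'.dir.1 < 0 then (1 : ℤ) else 0 := by
    rw [Finset.sum_const, Finset.card_univ, Fintype.card_fin]
    split_ifs <;> simp
  rw [normalWeights, Finset.filter_filter, Finset.filter_filter, Finset.card_filter,
    Finset.card_filter, weightCount, weightCount, hm, h]
  push_cast
  rw [← Finset.sum_sub_distrib, ← Finset.sum_sub_distrib, ← Finset.sum_sub_distrib]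
  refine Finset.sum_congr rfl fun i _ => ?_
  set z := T.weight e'.src i with hz
  have h3 := isCounted_sub ht h1 h2 (T.weight_ne_zero e'.src i)
  rw [← hz] at h3
  have h4 := inCone_iff (z := z) ht
  have h5 : OnRay (-e.dir) z → 0 ≤ planeDet e.dir z := by
    rintro ⟨t, -, hzt⟩
    exact le_of_eq (by
      rw [hzt]
      simp only [planeDet, Prod.smul_fst, Prod.smul_snd, smul_eq_mul, Prod.fst_neg,
        Prod.snd_neg]; ring)
  have h6 : OnRay e'.dir z → 0 ≤ planeDet e.dir z := by
    rintro ⟨t, ht', hzt⟩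
    have : planeDet e.dir (t • e'.dir) = t * planeDet e.dir e'.dir := by
      simp only [planeDet, Prod.smul_fst, Prod.smul_snd, smul_eq_mul]; ring
    rw [hzt, this]
    exact (mul_pos ht' ht).le
  have h7 : (if (¬OnRay (-e.dir) z ∧ ¬OnRay e'.dir z) ∧ InCone e'.dir (-e.dir) z then (1 : ℤ)
      else 0) - (if (¬OnRay (-e.dir) z ∧ ¬OnRay e'.dir z) ∧ 0 ≤ planeDet e'.dir z then 1 else 0) =
      -if 0 ≤ planeDet e'.dir z ∧ planeDet e.dir z < 0 then (1 : ℤ) else 0 := by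
    rw [h4]
    by_cases hA : planeDet e.dir z < 0
    · have a1 : ¬OnRay (-e.dir) z := fun hc => (h5 hc).not_gt hA
      have a2 : ¬OnRay e'.dir z := fun hc => (h6 hc).not_gt hA
      simp [a1, a2, hA, hA.not_ge]
    · simp [hA, not_lt.1 hA]
  rw [h7, h3]
  ring

/-- The contribution of an edge to the expected dimension. -/
def OrientedEdge.index (e : T.OrientedEdge) : ℤ := weightCount e.tgt e.dir - weightCount e.src e.dir

section

variable (h : T.InGeneralPosition)
include h

theorem dir_fst_ne (e : T.OrientedEdge) : e.dir.1 ≠ 0 := by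
  obtain ⟨c, hc, hv⟩ := exists_vec_eq h e
  have := PlaneGraph.vec_fst_ne (G := planeGraph h) e
  rw [hv, Prod.smul_fst, smul_eq_mul] at this
  exact right_ne_zero_of_mul this

/-- Regrouping the corner terms by edges leaves the indices. Exactly one corner, the rightmost,
turns through the upward vertical, and its correction cancels the `m` in `m - 2`. -/
theorem Frame.expectedDim_eq (f : T.Frame) : f.expectedDim = ∑ e ∈ f.edges, e.index - 2 := by
  have hU := f.isFrame h
  obtain ⟨σ, hσ⟩ := hU.exists_perm
  have hσ' : ∀ e : f.edges, (σ e).1.src = e.1.tgt := hσ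
  choose c hc hv using exists_vec_eq h
  have hfst : ∀ e, 0 < ((planeGraph h).vec e).1 ↔ 0 < e.dir.1 := fun e => by
    rw [hv, Prod.smul_fst, smul_eq_mul, mul_pos_iff_of_pos_left (hc e)]
  have hfst' : ∀ e, ((planeGraph h).vec e).1 < 0 ↔ e.dir.1 < 0 := fun e => by
    rw [hv, Prod.smul_fst, smul_eq_mul, mul_neg_iff]
    simp [hc e, (hc e).not_gt]
  have hcorner : ∀ e : f.edges, (∑ e' ∈ f.edges with e.1.tgt = e'.src,
      ((((normalWeights e.1 e').filter
        fun i => InCone e'.dir (-e.1.dir) (T.weight e'.src i)).card : ℤ) -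
      (((normalWeights e.1 e').filter
        fun i => 0 ≤ planeDet e'.dir (T.weight e'.src i)).card : ℤ))) =
      weightCount e.1.tgt e.1.dir - weightCount (σ e).1.src (σ e).1.dir -
        if 0 < e.1.dir.1 ∧ (σ e).1.dir.1 < 0 then (m : ℤ) else 0 := by
    intro e
    have h1 : f.edges.filter (fun e' => e.1.tgt = e'.src) = {(σ e).1} := by
      ext e'
      rw [Finset.mem_filter, Finset.mem_singleton]
      constructor
      · rintro ⟨h1, h2⟩
        exact hU.src_inj e' h1 _ (σ e).2 (h2.symm.trans (hσ' e).symm)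
      · rintro rfl
        exact ⟨(σ e).2, (hσ' e).symm⟩
    have ht := hU.turn e.2 (σ e).2 (hσ e)
    rw [hv, hv (σ e).1, planeDet_smul_left, planeDet_swap, planeDet_smul_left, planeDet_swap] at ht
    have ht' : 0 < planeDet e.1.dir (σ e).1.dir := by
      have h2 : 0 < c e.1 * (c (σ e).1 * planeDet e.1.dir (σ e).1.dir) := by linarith
      exact pos_of_mul_pos_right (pos_of_mul_pos_right h2 (hc _).le) (hc _).le
    have h3 : ∀ (s : Finset T.OrientedEdge) (g : T.OrientedEdge → ℤ), s = {(σ e).1} →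
        ∑ e' ∈ s, g e' = g (σ e).1 := by
      rintro s g rfl
      exact Finset.sum_singleton _ _
    refine (h3 _ _ ?_).trans (corner_eq (hσ' e).symm ht' (dir_fst_ne h _) (dir_fst_ne h _))
    rw [← h1]
  have hone : ∑ e : f.edges, (if 0 < e.1.dir.1 ∧ (σ e).1.dir.1 < 0 then (m : ℤ) else 0) = m := by
    obtain ⟨e', he', hmax⟩ := f.edges.exists_max_image (fun e => (T.pos e.src).1) hU.nonempty
    set e₀ := σ.symm ⟨e', he'⟩ with he₀
    have hσe : (σ e₀).1 = e' := by rw [he₀, Equiv.apply_symm_apply]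
    have htgt : e₀.1.tgt = e'.src := by rw [← hσ', hσe]
    have hp1 : 0 < e₀.1.dir.1 := by
      rw [← hfst]
      refine lt_of_le_of_ne ?_ (PlaneGraph.vec_fst_ne (G := planeGraph h) _).symm
      have := hmax e₀.1 e₀.2
      rw [← htgt] at this
      exact sub_nonneg.2 this
    have hp2 : (σ e₀).1.dir.1 < 0 := by
      rw [← hfst']
      refine lt_of_le_of_ne ?_ (PlaneGraph.vec_fst_ne (G := planeGraph h) _)
      have := hmax (σ (σ e₀)).1 (σ (σ e₀)).2
      rw [hσ', ← hσe] at this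
      exact sub_nonpos.2 this
    rw [Finset.sum_eq_single e₀, if_pos ⟨hp1, hp2⟩]
    · intro e _ hne
      refine if_neg fun ⟨h1, h2⟩ => hne ?_
      have k1 := hU.fst_le_of_turn e.2 (σ e).2 (hσ e) (σ e₀).2 ((hfst _).2 h1) ((hfst' _).2 h2)
      have k2 := hU.fst_le_of_turn e₀.2 (σ e₀).2 (hσ e₀) (σ e).2 ((hfst _).2 hp1)
        ((hfst' _).2 hp2)
      have k3 : (σ e).1.src = (σ e₀).1.src := by
        by_contra hc
        exact h.fst_ne _ _ hc (le_antisymm k2 k1)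
      exact σ.injective (Subtype.ext (hU.src_inj _ (σ e).2 _ (σ e₀).2 k3))
    · intro hc
      exact absurd (Finset.mem_univ _) hc
  have hsum : ∑ e : f.edges, weightCount (σ e).1.src (σ e).1.dir =
      ∑ e : f.edges, weightCount e.1.src e.1.dir :=
    Equiv.sum_comp σ fun e : f.edges => weightCount e.1.src e.1.dir
  rw [Frame.expectedDim, ← Finset.sum_coe_sort, Finset.sum_congr rfl fun e _ => hcorner e,
    Finset.sum_sub_distrib, Finset.sum_sub_distrib, hone, hsum,
    ← Finset.sum_coe_sort f.edges OrientedEdge.index]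
  simp only [OrientedEdge.index, Finset.sum_sub_distrib]
  ring

omit h in
theorem card_onRay_src [T2Space M] (e : T.OrientedEdge) :
    ∑ i, (if OnRay e.dir (T.weight e.src i) then (1 : ℤ) else 0) = 1 := by
  obtain ⟨i, hi⟩ := e.exists_weight_onRay
  rw [Finset.sum_eq_single i, if_pos hi]
  · exact fun j _ hne => if_neg fun hj => hne (weight_onRay_unique T _ e.norm_dir hj hi)
  · exact fun hc => absurd (Finset.mem_univ _) hc

/-- Such a character would lead to a further critical point on the line of the edge, and three
critical points would be collinear. -/
theorem not_onRay_tgt [CompactSpace M] [T2Space M] (e : T.OrientedEdge) (i : Fin m) :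
    ¬OnRay e.dir (T.weight e.tgt i) := by
  intro hi
  obtain ⟨q, c, hc, hq⟩ := exists_criticalPoint_of_weight T e.tgt e.norm_dir hi
  obtain ⟨c', hc', he⟩ := e.pos_tgt_sub
  have hd : e.dir ≠ 0 := fun h0 => dir_fst_ne h e (by rw [h0]; rfl)
  have h1 : T.pos q - T.pos e.src = (c + c') • e.dir := by
    rw [add_smul, ← hq, ← he]; abel
  refine h.not_collinear e.src e.tgt q ?_ ?_ ?_ ?_
  · intro hst
    rw [hst, sub_self] at he
    exact (smul_ne_zero hc'.ne' hd) he.symm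
  · intro hsq
    rw [hsq, sub_self] at h1
    exact (smul_ne_zero (add_pos hc hc').ne' hd) h1.symm
  · intro htq
    rw [htq, sub_self] at hq
    exact (smul_ne_zero hc.ne' hd) hq.symm
  · rw [he, h1]
    simp only [planeDet, Prod.smul_fst, Prod.smul_snd, smul_eq_mul]
    ring

/-- For a direction to the right, the counts for it and for its opposite differ by the characters
weakly to its left minus those on its ray. The former are equally many at the two ends of the edge;
on the ray there is one at the source and none at the target. -/
theorem index_add_index_rev [CompactSpace M] [T2Space M] (e : T.OrientedEdge) :
    e.index + e.rev.index = 1 := by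
  have key : ∀ e : T.OrientedEdge, 0 < e.dir.1 → e.index + e.rev.index = 1 := by
    intro e he
    have hdiff : ∀ p : T.CriticalPoint, weightCount p e.dir - weightCount p (-e.dir) =
        ((Finset.univ.filter fun i => 0 ≤ planeDet e.dir (T.weight p i)).card : ℤ) -
        ∑ i, if OnRay e.dir (T.weight p i) then (1 : ℤ) else 0 := by
      intro p
      rw [Finset.card_filter, weightCount, weightCount]
      push_cast
      rw [← Finset.sum_sub_distrib, ← Finset.sum_sub_distrib]
      refine Finset.sum_congr rfl fun i _ => ?_
      set z := T.weight p i with hz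
      have hneg : planeDet (-e.dir) z = -planeDet e.dir z := by
        simp only [planeDet, Prod.fst_neg, Prod.snd_neg]; ring
      have hray : OnRay e.dir z ↔ planeDet e.dir z = 0 ∧ 0 < z.1 := by
        constructor
        · rintro ⟨t, ht, hzt⟩
          rw [hzt]
          exact ⟨by simp only [planeDet, Prod.smul_fst, Prod.smul_snd, smul_eq_mul]; ring,
            mul_pos ht he⟩
        · rintro ⟨h0, h1⟩
          refine ⟨z.1 / e.dir.1, div_pos h1 he, Prod.ext ?_ ?_⟩
          · simp [div_mul_cancel₀ _ he.ne']
          · simp only [Prod.smul_snd, smul_eq_mul]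
            rw [div_mul_eq_mul_div, eq_div_iff he.ne']
            simp only [planeDet] at h0
            linarith
      have hn1 : (-e.dir).1 < 0 := by simpa using he
      rw [hray, IsCounted, if_neg he.not_gt, IsCounted, if_pos hn1, hneg]
      rcases lt_trichotomy (planeDet e.dir z) 0 with h1 | h1 | h1 <;> by_cases h2 : 0 < z.1
      · simp [h2, h1.not_ge, h1.le, h1.ne]
      · simp [h2, h1.not_ge, h1.le, h1.ne]
      · simp [h1, h2]
      · simp [h1, h2]
      · simp [h2, h1.not_ge, h1.le, h1.ne']
      · simp [h2, h1.not_ge, h1.le, h1.ne']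
    have h1 := hdiff e.tgt
    have h2 := hdiff e.src
    rw [card_onRay_src, e.card_weight_eq fun x => 0 ≤ x] at h2
    have h3 : ∑ i, (if OnRay e.dir (T.weight e.tgt i) then (1 : ℤ) else 0) = 0 :=
      Finset.sum_eq_zero fun i _ => if_neg (not_onRay_tgt h e i)
    rw [h3] at h1
    simp only [OrientedEdge.index, OrientedEdge.rev]
    linarith
  rcases lt_or_gt_of_ne (dir_fst_ne h e) with h1 | h1
  · have := key e.rev (by simpa [OrientedEdge.rev] using h1)
    rw [OrientedEdge.rev_rev] at this
    linarith
  · exact key e h1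

end

end TwoMorse

end

noncomputable section

open scoped Classical

/-! ### Multilinear operations on a graded free module -/

section GradedFree

variable {R ι N : Type*} [CommRing R] [AddCommGroup N] [Module R N]

/-- Homogeneous elements are combinations of basis elements of the same degree. The axioms can thus
be tested on frames. -/
theorem multilinearMap_eq_zero_of_single {n : ℕ} (Φ : MultilinearMap R (fun _ : Fin n => ι →₀ R) N)
    {s : Fin n → Set ι} {x : Fin n → ι →₀ R} (hx : ∀ i, x i ∈ Finsupp.supported R R (s i))
    (h : ∀ fs : Fin n → ι, (∀ i, fs i ∈ s i) → Φ (fun i => Finsupp.single (fs i) 1) = 0) :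
    Φ x = 0 := by
  have hxe : x = fun i => ∑ f ∈ (x i).support, x i f • Finsupp.single f (1 : R) := by
    funext i
    conv_lhs => rw [← Finsupp.sum_single (x i)]
    simp [Finsupp.sum]
  rw [hxe, MultilinearMap.map_sum_finset]
  refine Finset.sum_eq_zero fun r hr => ?_
  rw [Φ.map_smul_univ, h, smul_zero]
  exact fun i => (Finsupp.mem_supported R _).1 (hx i) (Fintype.mem_piFinset.1 hr i)

/-- The composite of two operations as a multilinear map. -/
def nestedBracketMap (l : ∀ k : ℕ, MultilinearMap R (fun _ : Fin k => N) N) {n : ℕ}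
    (S : Finset (Fin n)) : MultilinearMap R (fun _ : Fin n => N) N :=
  (MultilinearMap.curryFinFinset R N N (rfl : S.card = _) (rfl : Sᶜ.card = _)).symm
    ((l (Sᶜ.card + 1)).curryLeft.compMultilinearMap (l S.card))

theorem nestedBracketMap_apply (l : ∀ k : ℕ, MultilinearMap R (fun _ : Fin k => N) N) {n : ℕ}
    (S : Finset (Fin n)) (x : Fin n → N) : nestedBracketMap l S x = nestedBracket l x S := rfl

theorem isInternal_supported (deg : ι → ℤ) :
    DirectSum.IsInternal fun d => Finsupp.supported R R {f | deg f = d} := by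
  rw [DirectSum.isInternal_submodule_iff_iSupIndep_and_iSup_eq_top]
  constructor
  · intro d
    have h1 : (⨆ (j) (_ : j ≠ d), Finsupp.supported R R {f | deg f = j}) ≤
        Finsupp.supported R R {f | deg f ≠ d} :=
      iSup₂_le fun j hj => Finsupp.supported_mono fun f (hf : deg f = j) => by
        change deg f ≠ d
        rwa [hf]
    refine Disjoint.mono_right h1 (Finsupp.disjoint_supported_supported ?_)
    exact Set.disjoint_left.2 fun f hf hf' => hf' hf
  · rw [← Finsupp.supported_iUnion, ← Finsupp.supported_univ]
    congr 1
    exact Set.eq_univ_of_forall fun f => Set.mem_iUnion.2 ⟨deg f, rfl⟩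

end GradedFree

theorem negOnePow_sum {E : Type*} (g : E → ℤ) (s : Finset E) :
    (∑ e ∈ s, g e).negOnePow = (((s.filter fun e => Odd (g e)).card : ℕ) : ℤ).negOnePow := by
  induction s using Finset.induction_on with
  | empty => simp
  | insert a s ha ih =>
    rw [Finset.sum_insert ha, Int.negOnePow_add, ih, Finset.filter_insert]
    split_ifs with h
    · rw [Finset.card_insert_of_notMem (by simp [ha]), Nat.cast_succ, Int.negOnePow_add,
        Int.negOnePow_odd _ h, Int.negOnePow_one, mul_comm]
    · rw [Int.negOnePow_even _ (Int.not_odd_iff_even.1 h), one_mul]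

/-! ### General position -/

namespace PlaneGraph

open MvPolynomial

/-- The determinant of three points. -/
def trianglePoly {n : ℕ} (t : Fin n × Fin n × Fin n) : MvPolynomial (Fin n × Fin 2) ℤ :=
  (X (t.2.1, 0) - X (t.1, 0)) * (X (t.2.2, 1) - X (t.1, 1)) -
    (X (t.2.1, 1) - X (t.1, 1)) * (X (t.2.2, 0) - X (t.1, 0))

theorem trianglePoly_ne_zero {n : ℕ} {t : Fin n × Fin n × Fin n} (h1 : t.1 ≠ t.2.1)
    (h2 : t.1 ≠ t.2.2) (h3 : t.2.1 ≠ t.2.2) : trianglePoly t ≠ 0 := by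
  intro h
  -- At the points `(i, i²)` of the parabola the determinant is of Vandermonde type.
  have h4 := congrArg (MvPolynomial.eval fun ij : Fin n × Fin 2 =>
    ![((ij.1 : ℕ) : ℤ), ((ij.1 : ℕ) : ℤ) ^ 2] ij.2) h
  simp only [trianglePoly, map_sub, map_mul, eval_X, map_zero, Matrix.cons_val_zero,
    Matrix.cons_val_one] at h4
  have hne : ∀ {i j : Fin n}, i ≠ j → ((j : ℕ) : ℤ) - ((i : ℕ) : ℤ) ≠ 0 := fun hij hc =>
    hij (Fin.ext (by omega))
  refine mul_ne_zero (mul_ne_zero (hne h1) (hne h2)) (hne h3) ?_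
  linear_combination h4

/-- The polynomial which defines general position. -/
def genericPoly (n : ℕ) : MvPolynomial (Fin n × Fin 2) ℤ :=
  (∏ p ∈ Finset.univ.filter fun p : Fin n × Fin n => p.1 ≠ p.2, (X (p.1, 0) - X (p.2, 0))) *
  (∏ t ∈ Finset.univ.filter fun t : Fin n × Fin n × Fin n =>
    t.1 ≠ t.2.1 ∧ t.1 ≠ t.2.2 ∧ t.2.1 ≠ t.2.2, trianglePoly t) *
  ∏ S : Finset (Gluing n), rankPoly S

theorem genericPoly_ne_zero (n : ℕ) : genericPoly n ≠ 0 := by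
  refine mul_ne_zero (mul_ne_zero ?_ ?_) ?_
  · refine Finset.prod_ne_zero_iff.2 fun p hp h => (Finset.mem_filter.1 hp).2 ?_
    exact (Prod.ext_iff.1 (X_injective (sub_eq_zero.1 h))).1
  · refine Finset.prod_ne_zero_iff.2 fun t ht => ?_
    obtain ⟨-, h1, h2, h3⟩ := Finset.mem_filter.1 ht
    exact trianglePoly_ne_zero h1 h2 h3
  · exact Finset.prod_ne_zero_iff.2 fun S _ => rankPoly_ne_zero S

theorem aeval_rankPoly_ne_zero {n : ℕ} {g : Fin n × Fin 2 → ℝ} (h : aeval g (genericPoly n) ≠ 0)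
    (S : Finset (Gluing n)) : aeval g (rankPoly S) ≠ 0 := by
  intro h0
  refine h ?_
  rw [genericPoly, map_mul, map_prod (aeval g) rankPoly,
    Finset.prod_eq_zero (Finset.mem_univ S) h0, mul_zero]

end PlaneGraph

namespace TwoMorse

variable {m : ℕ} {M : Type*} [TopologicalSpace M] [ChartedSpace (EuclideanSpace ℝ (Fin m)) M]
  [IsManifold (𝓡 m) ∞ M] {T : TwoMorse m M}

section

variable {n : ℕ} {label : Fin n ≃ T.CriticalPoint}
  (hP : MvPolynomial.aeval (TwoMorse.coords label) (PlaneGraph.genericPoly n) ≠ 0)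
include hP

theorem inGeneralPosition_of_genericPoly : T.InGeneralPosition := by
  rw [PlaneGraph.genericPoly, map_mul, map_mul, map_prod, map_prod] at hP
  have h1 := Finset.prod_ne_zero_iff.1 (left_ne_zero_of_mul (left_ne_zero_of_mul hP))
  have h2 := Finset.prod_ne_zero_iff.1 (right_ne_zero_of_mul (left_ne_zero_of_mul hP))
  constructor
  · intro p q hpq h
    refine h1 (label.symm p, label.symm q)
      (Finset.mem_filter.2 ⟨Finset.mem_univ _, fun hc => hpq (label.symm.injective hc)⟩) ?_
    simp [TwoMorse.coords, h]
  · intro a b c hab hac hbc h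
    refine h2 (label.symm a, label.symm b, label.symm c)
      (Finset.mem_filter.2 ⟨Finset.mem_univ _, fun hc => hab (label.symm.injective hc),
        fun hc => hac (label.symm.injective hc), fun hc => hbc (label.symm.injective hc)⟩) ?_
    rw [← h]
    simp [TwoMorse.coords, PlaneGraph.trianglePoly, planeDet]

theorem generic_of_genericPoly (h : T.InGeneralPosition) : (planeGraph h).Generic := by
  have := Finite.of_equiv _ label
  exact fun 𝒟 x ht hx τ hτ hτ' heq =>
    ht.stress_eq_zero_of_generic label
      (fun S => PlaneGraph.aeval_rankPoly_ne_zero (g := (planeGraph h).coord label) hP S)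
      hx hτ hτ' heq

end

variable (h : T.InGeneralPosition)
include h

/-- Modulo two the sum of the indices is the number of odd edges. This identifies the signs of the
grading with those of the exterior algebra. -/
theorem negOnePow_expectedDim (f : T.Frame) : f.expectedDim.negOnePow =
    ((PlaneGraph.oddList (fun e : T.OrientedEdge => Odd e.index) f.edges).length : ℤ).negOnePow := by
  rw [f.expectedDim_eq h, Int.negOnePow_sub, negOnePow_sum, PlaneGraph.oddList,
    Finset.length_toList]
  simp only [Int.negOnePow_even 2 even_two, mul_one]
  congr!

theorem odd_index_rev [CompactSpace M] [T2Space M] (e : T.OrientedEdge) :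
    Odd e.rev.index ↔ ¬Odd e.index := by
  have := index_add_index_rev h e
  rw [Int.odd_iff, Int.odd_iff]
  omega

/-- The operations have degree one. -/
theorem IsWebDecomposition.expectedDim_eq [CompactSpace M] [T2Space M] [Finite T.CriticalPoint]
    {k : ℕ} {f : T.Frame} {fs : Fin k → T.Frame} (hf : IsWebDecomposition f fs) :
    f.expectedDim = ∑ i, (fs i).expectedDim + 1 := by
  obtain ⟨hfs, hd, hb⟩ := (isWebDecomposition_iff h).1 hf
  have hd' := hd.tiling.unique
  have h1 : ∑ i, ∑ e ∈ (fs i).edges, e.index =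
      ∑ e ∈ PlaneGraph.edgesOf (pieces fs), e.index := by
    rw [PlaneGraph.edgesOf, Finset.sum_biUnion, pieces, Finset.sum_image]
    · rfl
    · exact fun i _ j _ hij => hfs (Frame.edges_injective hij)
    · intro U hU U' hU' hne
      exact Finset.disjoint_left.2 fun e he he' => hne (hd' U hU U' hU' e he he')
  have h2 : ∑ e ∈ PlaneGraph.edgesOf (pieces fs), e.index =
      ∑ e ∈ (planeGraph h).internal (pieces fs), e.index + ∑ e ∈ f.edges, e.index := by
    rw [← hb]
    exact (Finset.sum_filter_add_sum_filter_not _ _ _).symm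
  have h3 : ∑ e ∈ (planeGraph h).internal (pieces fs), e.rev.index =
      ∑ e ∈ (planeGraph h).internal (pieces fs), e.index :=
    Finset.sum_bij (fun e _ => e.rev) (fun e he => PlaneGraph.rev_mem_internal he)
      (fun _ _ _ _ h' => (planeGraph h).rev_injective h')
      (fun e he => ⟨_, PlaneGraph.rev_mem_internal he, e.rev_rev⟩) fun e _ => rfl
  -- Both orientations of an internal edge occur, so the internal indices have sum `s`, and the
  -- degrees differ by `2k - s - 2`.
  have h4 : ∑ e ∈ (planeGraph h).internal (pieces fs), (e.index + e.rev.index) =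
      ((planeGraph h).internal (pieces fs)).card := by
    rw [Finset.sum_congr rfl fun e _ => index_add_index_rev h e]
    simp
  rw [Finset.sum_add_distrib, h3] at h4
  have h5 := hd.codim
  rw [card_pieces hfs] at h5
  rw [f.expectedDim_eq h, Finset.sum_congr rfl fun i _ => (fs i).expectedDim_eq h,
    Finset.sum_sub_distrib, h1, h2]
  simp only [Finset.sum_const, Finset.card_univ, Fintype.card_fin, nsmul_eq_mul]
  omega

end TwoMorse

end

noncomputable section

open scoped Classical

namespace TwoMorse

variable {m : ℕ} {M : Type*} [TopologicalSpace M] [ChartedSpace (EuclideanSpace ℝ (Fin m)) M]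
  [IsManifold (𝓡 m) ∞ M] {T : TwoMorse m M}

/-! ### The operations on frames -/

section

variable {R : Type*} [CommRing R] {ε : ∀ k : ℕ, (Fin k → T.Frame) → ℤˣ} {k : ℕ}

theorem bracket_single {f : T.Frame} {fs : Fin k → T.Frame} (hf : IsWebDecomposition f fs) :
    T.bracket R ε k (fun i => Finsupp.single (fs i) 1) = ε k fs • Finsupp.single f 1 := by
  rw [bracket, multilinearOfBasis_single, finsum_eq_single _ f, if_pos hf]
  exact fun g hg => if_neg fun hg' => hg (hg'.unique hf)

theorem bracket_single_eq_zero {fs : Fin k → T.Frame} (h : ∀ f, ¬IsWebDecomposition f fs) :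
    T.bracket R ε k (fun i => Finsupp.single (fs i) 1) = 0 := by
  rw [bracket, multilinearOfBasis_single]
  exact (finsum_congr fun f => if_neg (h f)).trans finsum_zero

theorem cons_single (f : T.Frame) (gs : Fin k → T.Frame) :
    (Fin.cons (Finsupp.single f (1 : R)) fun b => Finsupp.single (gs b) 1 :
      Fin (k + 1) → T.FrameSpace R) =
    fun i => Finsupp.single ((Fin.cons f gs : Fin (k + 1) → T.Frame) i) 1 := by
  funext i
  refine Fin.cases ?_ (fun j => ?_) i <;> simp

variable {n : ℕ} {fs : Fin n → T.Frame} {S : Finset (Fin n)}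

theorem nestedBracket_single {f g : T.Frame}
    (hf : IsWebDecomposition f fun a => fs (S.orderEmbOfFin rfl a))
    (hg : IsWebDecomposition g
      (Fin.cons f fun b => fs (Sᶜ.orderEmbOfFin rfl b) : Fin (Sᶜ.card + 1) → T.Frame)) :
    nestedBracket (T.bracket R ε) (fun i => Finsupp.single (fs i) 1) S =
      (ε _ (fun a => fs (S.orderEmbOfFin rfl a)) *
        ε (Sᶜ.card + 1) (Fin.cons f fun b => fs (Sᶜ.orderEmbOfFin rfl b))) •
          Finsupp.single g 1 := by
  rw [nestedBracket, bracket_single hf, Units.smul_def, ← Int.cast_smul_eq_zsmul R,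
    MultilinearMap.cons_smul, cons_single, bracket_single hg, Int.cast_smul_eq_zsmul R,
    ← Units.smul_def, mul_smul]

theorem nestedBracket_single_eq_zero
    (h : ∀ f g : T.Frame, IsWebDecomposition f (fun a => fs (S.orderEmbOfFin rfl a)) →
      ¬IsWebDecomposition g
        (Fin.cons f fun b => fs (Sᶜ.orderEmbOfFin rfl b) : Fin (Sᶜ.card + 1) → T.Frame)) :
    nestedBracket (T.bracket R ε) (fun i => Finsupp.single (fs i) 1) S = 0 := by
  rw [nestedBracket]
  by_cases hf : ∃ f, IsWebDecomposition f fun a => fs (S.orderEmbOfFin rfl a)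
  · obtain ⟨f, hf⟩ := hf
    rw [bracket_single hf, Units.smul_def, ← Int.cast_smul_eq_zsmul R,
      MultilinearMap.cons_smul, cons_single, bracket_single_eq_zero fun g => h f g hf, smul_zero]
  · rw [bracket_single_eq_zero (not_exists.1 hf)]
    exact MultilinearMap.map_coord_zero _ 0 rfl

end

/-! ### Composable pairs of decompositions -/

theorem pieces_cons {k : ℕ} (f : T.Frame) (gs : Fin k → T.Frame) :
    pieces (Fin.cons f gs : Fin (k + 1) → T.Frame) = insert f.edges (pieces gs) := by
  ext U
  simp only [mem_pieces, Finset.mem_insert, Fin.exists_fin_succ, Fin.cons_zero, Fin.cons_succ]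
  exact or_congr_left eq_comm

theorem pieces_comp_perm {k : ℕ} (fs : Fin k → T.Frame) (σ : Equiv.Perm (Fin k)) :
    pieces (fs ∘ σ) = pieces fs := by
  ext U
  rw [mem_pieces, mem_pieces]
  exact ⟨fun ⟨i, hi⟩ => ⟨σ i, hi⟩, fun ⟨i, hi⟩ => ⟨σ.symm i, by simpa using hi⟩⟩

theorem exists_orderEmbOfFin_iff {n : ℕ} {S : Finset (Fin n)} {p : Fin n → Prop} :
    (∃ a, p (S.orderEmbOfFin rfl a)) ↔ ∃ i ∈ S, p i := by
  constructor
  · rintro ⟨a, ha⟩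
    exact ⟨_, S.orderEmbOfFin_mem rfl a, ha⟩
  · rintro ⟨i, hi, hp⟩
    have : i ∈ Set.range (S.orderEmbOfFin rfl) := by rwa [S.range_orderEmbOfFin rfl]
    obtain ⟨a, rfl⟩ := this
    exact ⟨a, hp⟩

theorem pieces_orderEmbOfFin {n : ℕ} (fs : Fin n → T.Frame) (S : Finset (Fin n)) :
    pieces (fun a => fs (S.orderEmbOfFin rfl a)) = S.image fun i => (fs i).edges := by
  ext U
  rw [mem_pieces, exists_orderEmbOfFin_iff (p := fun i => (fs i).edges = U), Finset.mem_image]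

theorem injOn_of_orderEmbOfFin {n : ℕ} {fs : Fin n → T.Frame} {S : Finset (Fin n)}
    (h : Function.Injective fun a => fs (S.orderEmbOfFin rfl a)) {i j : Fin n} (hi : i ∈ S)
    (hj : j ∈ S) (hij : fs i = fs j) : i = j := by
  have hr : ∀ i ∈ S, i ∈ Set.range (S.orderEmbOfFin rfl) := fun i hi => by
    rwa [S.range_orderEmbOfFin rfl]
  obtain ⟨a, rfl⟩ := hr i hi
  obtain ⟨b, rfl⟩ := hr j hj
  rw [h hij]

section

variable {n : ℕ} {fs : Fin n → T.Frame} {S : Finset (Fin n)}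

theorem pieces_eq_union (fs : Fin n → T.Frame) (S : Finset (Fin n)) : pieces fs =
    (S.image fun i => (fs i).edges) ∪ Sᶜ.image fun i => (fs i).edges := by
  rw [← Finset.image_union, Finset.union_compl]
  rfl

theorem pieces_sdiff (hfs : Function.Injective fs) :
    pieces fs \ (S.image fun i => (fs i).edges) = Sᶜ.image fun i => (fs i).edges := by
  rw [pieces_eq_union fs S, Finset.union_sdiff_cancel_left]
  refine Finset.disjoint_left.2 fun U hU hU' => ?_
  obtain ⟨i, hi, rfl⟩ := Finset.mem_image.1 hU
  obtain ⟨j, hj, hij⟩ := Finset.mem_image.1 hU'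
  rw [hfs (Frame.edges_injective hij)] at hj
  exact Finset.mem_compl.1 hj hi

variable [T2Space M] [Finite T.CriticalPoint] (h : T.InGeneralPosition)

/-- Besides translating the definitions, it has to be seen that no frame occurs both in `S` and
outside: it would lie inside the glued polygon and would be disjoint from it. -/
theorem isGood_of_isWebDecomposition {f g : T.Frame}
    (hf : IsWebDecomposition f fun a => fs (S.orderEmbOfFin rfl a))
    (hg : IsWebDecomposition g
      (Fin.cons f fun b => fs (Sᶜ.orderEmbOfFin rfl b) : Fin (Sᶜ.card + 1) → T.Frame)) :
    Function.Injective fs ∧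
      (planeGraph h).IsGood (pieces fs) (S.image fun i => (fs i).edges) := by
  obtain ⟨f1, f2, f3⟩ := (isWebDecomposition_iff h).1 hf
  obtain ⟨g1, g2, g3⟩ := (isWebDecomposition_iff h).1 hg
  rw [pieces_orderEmbOfFin] at f2 f3
  rw [pieces_cons, pieces_orderEmbOfFin] at g2 g3
  rw [Fin.cons_injective_iff] at g1
  have hfT : f.edges ∉ Sᶜ.image fun i => (fs i).edges := by
    intro hc
    obtain ⟨i, hi, he⟩ := Finset.mem_image.1 hc
    exact g1.1 ((exists_orderEmbOfFin_iff (p := fun i => fs i = f)).2 ⟨i, hi, Frame.edges_injective he⟩)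
  have hmixed : ∀ i ∈ S, ∀ j ∈ Sᶜ, fs i ≠ fs j := by
    intro i hi j hj hij
    have hjT : (fs j).edges ∈ Sᶜ.image fun i => (fs i).edges := Finset.mem_image_of_mem _ hj
    have hiS : (fs i).edges ∈ S.image fun i => (fs i).edges :=
      Finset.mem_image_of_mem (fun i => (fs i).edges) hi
    obtain ⟨q, h1, h2, h3⟩ := (planeGraph h).exists_generic_point
      (PlaneGraph.edgesOf (S.image fun i => (fs i).edges)) ((planeGraph h).isOpen_inner _)
      ((fs i).isFrame h).inner_nonempty
    have h4 := f2.tiling.inner_subset hiS h2 h3 h1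
    rw [f3] at h4
    rw [hij] at h1
    refine hfT ?_
    rw [g2.tiling.eq_of_mem_inner (Finset.mem_insert_self _ _) (Finset.mem_insert_of_mem hjT) h4 h1]
    exact hjT
  have hfs : Function.Injective fs := by
    intro i j hij
    by_cases hi : i ∈ S <;> by_cases hj : j ∈ S
    · exact injOn_of_orderEmbOfFin f1 hi hj hij
    · exact absurd hij (hmixed i hi j (Finset.mem_compl.2 hj))
    · exact absurd hij.symm (hmixed j hj i (Finset.mem_compl.2 hi))
    · exact injOn_of_orderEmbOfFin g1.2 (Finset.mem_compl.2 hi) (Finset.mem_compl.2 hj) hij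
  refine ⟨hfs, ?_, f2, ?_, ?_⟩
  · rw [pieces_eq_union fs S]
    exact Finset.subset_union_left
  · rw [PlaneGraph.coarse, pieces_sdiff hfs, f3]
    exact g2
  · rw [pieces_sdiff hfs, f3]
    exact hfT

theorem exists_isWebDecomposition_of_isGood (hfs : Function.Injective fs)
    (hS : (planeGraph h).IsGood (pieces fs) (S.image fun i => (fs i).edges)) {g : T.Frame}
    (hg : g.edges = (planeGraph h).boundary (pieces fs)) :
    ∃ f : T.Frame, f.edges = (planeGraph h).boundary (S.image fun i => (fs i).edges) ∧
      IsWebDecomposition f (fun a => fs (S.orderEmbOfFin rfl a)) ∧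
      IsWebDecomposition g
        (Fin.cons f fun b => fs (Sᶜ.orderEmbOfFin rfl b) : Fin (Sᶜ.card + 1) → T.Frame) := by
  obtain ⟨f, hf⟩ := exists_frame h hS.fine.tiling.boundary
  have h1 := hS.coarse
  have h2 := hS.notMem
  have h3 := hS.isNested.boundary_coarse
  rw [PlaneGraph.coarse, pieces_sdiff hfs, ← hf] at h1 h3
  rw [pieces_sdiff hfs, ← hf] at h2
  refine ⟨f, hf, (isWebDecomposition_iff h).2 ⟨?_, ?_, ?_⟩,
    (isWebDecomposition_iff h).2 ⟨?_, ?_, ?_⟩⟩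
  · exact hfs.comp (S.orderEmbOfFin rfl).injective
  · rw [pieces_orderEmbOfFin]
    exact hS.fine
  · rw [pieces_orderEmbOfFin, hf]
  · rw [Fin.cons_injective_iff]
    refine ⟨fun hc => h2 ?_, hfs.comp (Sᶜ.orderEmbOfFin rfl).injective⟩
    obtain ⟨i, hi, he⟩ := exists_orderEmbOfFin_iff (p := fun i => fs i = f).1 hc
    exact Finset.mem_image.2 ⟨i, hi, congrArg _ he⟩
  · rw [pieces_cons, pieces_orderEmbOfFin]
    exact h1
  · rw [pieces_cons, pieces_orderEmbOfFin, h3, hg]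

end

/-! ### The relations -/

/-- The sign of a decomposition. -/
def decompositionSign (h : T.InGeneralPosition) (k : ℕ) (fs : Fin k → T.Frame) : ℤˣ :=
  PlaneGraph.tilingSign (fun e : T.OrientedEdge => Odd e.index) (planeGraph h)
    (List.ofFn fun i => (fs i).edges)

variable [T2Space M] [CompactSpace M] [Finite T.CriticalPoint] (h : T.InGeneralPosition)
  (hG : (planeGraph h).Generic) (R : Type*) [CommRing R]

include hG

theorem bracket_comp_perm {k : ℕ} {fs : Fin k → T.Frame} {d : Fin k → ℤ}
    (hd : ∀ i, (fs i).expectedDim = d i) (σ : Equiv.Perm (Fin k)) :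
    T.bracket R (decompositionSign h) k (fun i => Finsupp.single (fs (σ i)) 1) =
      koszulSign d σ •
        T.bracket R (decompositionSign h) k (fun i => Finsupp.single (fs i) 1) := by
  have hiff : ∀ f, IsWebDecomposition f (fs ∘ σ) ↔ IsWebDecomposition f fs := by
    intro f
    rw [isWebDecomposition_iff h, isWebDecomposition_iff h, pieces_comp_perm,
      Function.Injective.of_comp_iff' _ σ.bijective]
  by_cases hf : ∃ f, IsWebDecomposition f fs
  · obtain ⟨f, hf⟩ := hf
    obtain ⟨h1, h2, h3⟩ := (isWebDecomposition_iff h).1 hf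
    rw [bracket_single hf]
    refine (bracket_single ((hiff f).2 hf)).trans ?_
    rw [smul_smul]
    congr 1
    exact PlaneGraph.tilingSign_perm (odd_index_rev h)
      (fun i => by rw [← hd i]; exact negOnePow_expectedDim h _) hG
      (Frame.edges_injective.comp h1) h2 σ
  · rw [not_exists] at hf
    rw [bracket_single_eq_zero hf, smul_zero]
    exact bracket_single_eq_zero fun f => (hiff f).not.2 (hf f)

/-- If one subset contributes, exactly one other does, by `exists_partner`. Both composites give the
frame bounding all pieces, and `tilingSign_cancel` makes the coefficients opposite. -/
theorem sum_nestedBracket {n : ℕ} {fs : Fin n → T.Frame} {d : Fin n → ℤ}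
    (hd : ∀ i, (fs i).expectedDim = d i) :
    ∑ S : Finset (Fin n) with S.Nonempty, unshuffleSign d S •
      nestedBracket (T.bracket R (decompositionSign h)) (fun i => Finsupp.single (fs i) 1) S =
        0 := by
  by_cases hex : Function.Injective fs ∧
    ∃ S : Finset (Fin n), (planeGraph h).IsGood (pieces fs) (S.image fun i => (fs i).edges)
  · obtain ⟨hfs, I, hI⟩ := hex
    obtain ⟨S', hS', hne, -, huniq, -⟩ := hI.exists_partner hG
    obtain ⟨I', -, hI'⟩ := Finset.subset_image_iff.1 hS'.subset
    subst hI'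
    have hinj := Finset.image_injective (Frame.edges_injective.comp hfs)
    have hne' : I' ≠ I := fun hc => hne (by rw [hc])
    obtain ⟨g, hg⟩ := exists_frame h hI.isNested.isTiling.boundary
    have hnonempty : ∀ S : Finset (Fin n),
        (planeGraph h).IsGood (pieces fs) (S.image fun i => (fs i).edges) → S.Nonempty := by
      intro S hS
      have := hS.fine.two_le_card
      exact Finset.image_nonempty.1 (Finset.card_pos.1 (two_pos.trans_le this))
    have hval : ∀ S : Finset (Fin n),
        (planeGraph h).IsGood (pieces fs) (S.image fun i => (fs i).edges) →
        unshuffleSign d S • nestedBracket (T.bracket R (decompositionSign h))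
          (fun i => Finsupp.single (fs i) 1) S =
        (unshuffleSign d S * (PlaneGraph.tilingSign (fun e : T.OrientedEdge => Odd e.index)
          (planeGraph h) (List.ofFn fun a => (fs (S.orderEmbOfFin rfl a)).edges) *
          PlaneGraph.tilingSign (fun e : T.OrientedEdge => Odd e.index)
          (planeGraph h) ((planeGraph h).boundary (S.image fun i => (fs i).edges) ::
            List.ofFn fun a => (fs (Sᶜ.orderEmbOfFin rfl a)).edges))) •
          Finsupp.single g (1 : R) := by
      intro S hS
      obtain ⟨f, f1, f2, f3⟩ := exists_isWebDecomposition_of_isGood h hfs hS hg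
      rw [nestedBracket_single f2 f3, smul_smul, ← f1]
      congr 3
      rw [decompositionSign, List.ofFn_succ]
      simp
    rw [Finset.sum_eq_add I I' hne'.symm, hval I hI, hval I' hS']
    · have hcancel := PlaneGraph.tilingSign_cancel (odd_index_rev h) (d := d)
        (fun i => by rw [← hd i]; exact negOnePow_expectedDim h _) hG
        (Frame.edges_injective.comp hfs) hI hS' hne'
      simp only [Function.comp_apply] at hcancel
      rw [← neg_add_cancel ((unshuffleSign d I' * _) • Finsupp.single g (1 : R)), ← Units.neg_smul]
      exact congrArg (· + _) (congrArg (· • Finsupp.single g (1 : R)) hcancel)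
    · intro S _ hS
      rw [nestedBracket_single_eq_zero, smul_zero]
      intro f g hf hg
      have hgood := (isGood_of_isWebDecomposition h hf hg).2
      rcases huniq _ hgood with hc | hc
      · exact hS.1 (hinj hc)
      · exact hS.2 (hinj hc)
    · exact fun hc => absurd (Finset.mem_filter.2 ⟨Finset.mem_univ _, hnonempty I hI⟩) hc
    · exact fun hc => absurd (Finset.mem_filter.2 ⟨Finset.mem_univ _, hnonempty I' hS'⟩) hc
  · refine Finset.sum_eq_zero fun S _ => ?_
    rw [nestedBracket_single_eq_zero, smul_zero]
    intro f g hf hg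
    have hgood := isGood_of_isWebDecomposition h hf hg
    exact hex ⟨hgood.1, S, hgood.2⟩

/-- The frames of a system in general position form an L-infinity algebra. -/
theorem isLInfinityAlgebra_bracket :
    IsLInfinityAlgebra (T.grading R) (T.bracket R (decompositionSign h)) where
  internal := isInternal_supported Frame.expectedDim
  flat := by
    ext1 x
    have hx : x = fun i => Finsupp.single ((Fin.elim0 : Fin 0 → T.Frame) i) 1 :=
      Subsingleton.elim _ _
    rw [hx, bracket_single_eq_zero, zero_apply]
    intro f hf
    obtain ⟨-, h2, -⟩ := (isWebDecomposition_iff h).1 hf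
    have := h2.two_le_card
    simp [pieces] at this
  degree := by
    intro k x d hx
    -- Membership in a graded part becomes the vanishing of a multilinear map to the quotient, which
    -- can be tested on frames.
    rw [← Submodule.Quotient.mk_eq_zero]
    refine multilinearMap_eq_zero_of_single
      ((T.grading R (∑ i, d i + 1)).mkQ.compMultilinearMap
        (T.bracket R (decompositionSign h) k)) hx fun fs hfs => ?_
    rw [LinearMap.compMultilinearMap_apply, Submodule.mkQ_apply, Submodule.Quotient.mk_eq_zero]
    by_cases hf : ∃ f, IsWebDecomposition f fs
    · obtain ⟨f, hf⟩ := hf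
      rw [bracket_single hf, Units.smul_def]
      refine zsmul_mem (Finsupp.single_mem_supported R _ ?_) _
      change f.expectedDim = _
      rw [hf.expectedDim_eq h, Finset.sum_congr rfl fun i _ => hfs i]
    · rw [bracket_single_eq_zero (not_exists.1 hf)]
      exact zero_mem _
  symmetric := by
    intro k σ x d hx
    have := multilinearMap_eq_zero_of_single
      (MultilinearMap.domDomCongr σ (T.bracket R (decompositionSign h) k) -
        ((koszulSign d σ : ℤ) : R) • T.bracket R (decompositionSign h) k) hx
      fun fs hfs => ?_
    · rw [sub_apply, smul_apply, Int.cast_smul_eq_zsmul, ← Units.smul_def, sub_eq_zero] at this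
      exact this
    · rw [sub_apply, smul_apply, Int.cast_smul_eq_zsmul, ← Units.smul_def, sub_eq_zero]
      exact bracket_comp_perm h hG R hfs σ
  relation := by
    intro n x d hx
    have := multilinearMap_eq_zero_of_single (∑ S : Finset (Fin n) with S.Nonempty,
      ((unshuffleSign d S : ℤ) : R) • nestedBracketMap (T.bracket R (decompositionSign h)) S) hx
      fun fs hfs => ?_
    · rw [← this, sum_apply]
      refine Finset.sum_congr rfl fun S _ => ?_
      rw [smul_apply, Int.cast_smul_eq_zsmul, ← Units.smul_def,
        nestedBracketMap_apply]
    · rw [← sum_nestedBracket h hG R hfs, sum_apply]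
      refine Finset.sum_congr rfl fun S _ => ?_
      rw [smul_apply, Int.cast_smul_eq_zsmul, ← Units.smul_def,
        nestedBracketMap_apply]

end TwoMorse

end

/-- General position of `A` means that its coordinates are not a zero of a certain nonzero integer
polynomial, which depends only on the number `n` of critical points. -/
theorem lemma5p12 (n : ℕ) :
    ∃ P : MvPolynomial (Fin n × Fin 2) ℤ, P ≠ 0 ∧
      ∀ (m : ℕ) (M : Type*) [TopologicalSpace M] [T2Space M] [CompactSpace M]
        [ChartedSpace (EuclideanSpace ℝ (Fin m)) M] [IsManifold (𝓡 m) ∞ M]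
        (T : TwoMorse m M) (label : Fin n ≃ T.CriticalPoint),
        MvPolynomial.aeval (TwoMorse.coords label) P ≠ 0 →
        ∃ ε : ∀ k : ℕ, (Fin k → T.Frame) → ℤˣ,
          ∀ (R : Type*) [CommRing R],
            IsLInfinityAlgebra (T.grading R) (T.bracket R ε) := by
  refine ⟨PlaneGraph.genericPoly n, PlaneGraph.genericPoly_ne_zero n, ?_⟩
  intro m M _ _ _ _ _ T label hP
  have := Finite.of_equiv _ label
  have h := TwoMorse.inGeneralPosition_of_genericPoly hP
  exact ⟨TwoMorse.decompositionSign h, fun R _ =>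
    TwoMorse.isLInfinityAlgebra_bracket h (TwoMorse.generic_of_genericPoly hP h) R⟩
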